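/- **Setting.** Let $\alpha\in(-\pi/2,0)$ (western boundary), $s=\sin\alpha<0$, $c=\cos\alpha$, $\Omega=\{(x_1,x_2,x_3)\in\mathbb R^3:\ x_3>x_1\tan\alpha\}$, and let $x=cx_1+sx_3$, $y=x_2$, $z=-sx_1+cx_3$ be the local coordinates, so that $\Omega=\{z>0\}$. For $\omega\in\mathbb R$ and $\beta,\nu_h,\nu_3>0$ put $\nu_{\rm eff}=\nu_hs^2+\nu_3c^2$ and consider, with $\Delta_h=\partial_1^2+\partial_2^2$, $$i\omega\Delta\psi+\beta\partial_1\psi-(\nu_h\Delta_h+\nu_3\partial_3^2)\Delta_h\psi=S\quad\text{in }\Omega.\tag{QG}$$ Hats denote the Fourier transform in the tangential variables $(x,y)$, with dual variable $\xi=(\xi_x,\xi_y)$, $\partial_x\leftrightarrow i\xi_x$. For a space $X$ of functions of $z\in(0,\infty)$, $\sigma\ge0$, the space $H^\sigma(\mathbb R^2,X)$ (and $L^2=H^0$) is understood through the Fourier transform: $\|u\|_{H^\sigma(\mathbb R^2,X)}^2=\int_{\mathbb R^2}(1+|\xi|^2)^\sigma\|\hat u(\xi,\cdot)\|_X^2\,d\xi$.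 $C_0(0,\infty)$ (resp. $C^1_0(0,\infty)$) consists of the bounded continuous functions on $(0,\infty)$ tending to $0$ at $+\infty$ (resp. $C^1$ functions which are such together with their derivative), with the sup norm (resp. $C^1$ norm). For almost every $\xi$ the characteristic equation $$i\omega(\mu^2-|\xi|^2)+\beta(ci\xi_x+s\mu)-\big(\nu_h((ci\xi_x+s\mu)^2-\xi_y^2)+\nu_3(is\xi_x-c\mu)^2\big)\big((ci\xi_x+s\mu)^2-\xi_y^2\big)=0$$ has, with multiplicity, two roots $\mu_1^+,\mu_2^+$ with positive and two roots $\mu_1^-,\mu_2^-$ with negative real part, ordered by $\Re\mu_1^\pm\le\Re\mu_2^\pm$ (ties broken by imaginary part). Let $\mathcal M$ be the set of roots and define $$\widehat G(\xi,z)=\sum_{j=1,2}C_j^{\pm}e^{-\mu_j^\pm z}\ \ (\pm z>0),\qquad C_j^\pm=\mp\frac1{\nu_{\rm eff}s^2}\prod_{\mu\in\mathcal M\setminus\{\mu_j^\pm\}}\frac1{\mu-\mu_j^\pm},\qquad \widehat{\psi}_S(\xi,z)=\int_0^\infty\widehat G(\xi,z-z')\widehat S(\xi,z')\,dz',$$ and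 $\psi_S=G*S$ is the inverse tangential Fourier transform of $\widehat\psi_S$. **Proposition 3.3.** 1. For every $K>0$ there are $\kappa,C>0$, depending only on $\alpha$ and $K$, such that the following holds for all $\omega\in\mathbb R$, $\beta,\nu_h,\nu_3,R>0$ with $|\omega|\le\kappa\beta^{3/4}\nu_{\rm eff}^{1/4}$ and * either $|\omega|\le K\beta^{2/3}\nu_{\rm eff}^{1/3}$, $R|\omega|\le\kappa\beta$ and $R\le\kappa(\beta/\nu_{\rm eff})^{1/3}$, * or $\beta^{2/3}\nu_{\rm eff}^{1/3}\le\kappa|\omega|$ and $R|\omega|^4\le\kappa\beta^3\nu_{\rm eff}$, and all $S\in L^2(\mathbb R^2,L^1(0,\infty))$ such that $\widehat S(\xi,z)=0$ for a.e. $|\xi|\ge R$, $z>0$. (a) For a.e. $\xi$ the integral defining $\widehat\psi_S(\xi,z)$ converges absolutely for all $z\ge0$ and is continuous in $z\in[0,\infty)$; $\psi_S\in L^2(\mathbb R^2,C_0(0,\infty))$; $\psi_S$ solves (QG) in the sense of distributions in $\Omega$; and for every $\sigma\ge0$ $$\|\psi_S\|_{H^\sigma(\mathbb R^2,L^\infty(0,\infty))}\le\frac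 C\beta\|S\|_{H^\sigma(\mathbb R^2,L^1(0,\infty))}.$$ (b) If $\psi\in L^2(\mathbb R^2,C^1_0(0,\infty))$ is any distributional solution of (QG) in $\Omega$ with $\widehat\psi(\xi,z)=0$ for $|\xi|\ge R$, then there are $c_1,c_2\in L^2(\mathbb R^2)$ such that for a.e. $\xi$ and all $z>0$ $$\widehat\psi(\xi,z)=\widehat\psi_S(\xi,z)+\sum_{j=1,2}c_j(\xi)e^{-\mu_j^+z}.$$ 2. Let $\beta=\varepsilon^{-a}$, $\omega=\varepsilon^{-b}$, $\nu_h=\varepsilon^d$, $\nu_3=\varepsilon^e$ with $0<a<1$, $e\ge d\ge0$, $b\le(2a-d)/3$ (H0). Let $R>0$ and $S\in L^2(\mathbb R^2,L^1(0,\infty))$, independent of $\varepsilon$, with $\widehat S(\xi,z)=0$ for a.e. $|\xi|\ge R$, $z>0$. For every $\varepsilon>0$ there is a Sverdrup solution $\overline\psi_S\in L^2(\mathbb R^2,C_0(0,\infty))$, i.e. $\beta\partial_1\overline\psi_S=S$ in the sense of distributions in $\Omega$ and $\lim_{z\to+\infty}\overline\psi_S=0$, and for any choice of these solutions, for every $\sigma\ge0$,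 $$\lim_{\varepsilon\to0^+}\big\|\beta(\psi_S-\overline\psi_S)\big\|_{H^\sigma(\mathbb R^2,L^\infty(0,\infty))}=0.$$ -/

import Mathlib

open MeasureTheory Filter Set Topology
open scoped ENNReal

namespace QG3D

noncomputable section

/-- Physical space, with the global Cartesian coordinates `(x₁, x₂, x₃) = (p 0, p 1, p 2)`. -/
abbrev E3 := EuclideanSpace ℝ (Fin 3)

/-- The tangential frequency plane, `ξ = (ξ_x, ξ_y) = (ξ 0, ξ 1)`. -/
abbrev Freq := EuclideanSpace ℝ (Fin 2)

/-- The parameters: slope angle `α`, forcing frequency `ω`, Rossby parameter `β`, and the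
horizontal and vertical viscosities. -/
structure Params where
  α : ℝ
  ω : ℝ
  β : ℝ
  νh : ℝ
  ν3 : ℝ

/-- The viscosity in the direction normal to the boundary, `ν_h sin² α + ν₃ cos² α`. -/
def Params.νeff (P : Params) : ℝ := P.νh * Real.sin P.α ^ 2 + P.ν3 * Real.cos P.α ^ 2

/-! ### Geometry -/

/-- The half-space above the tilted bottom, `x₃ > x₁ tan α`. -/
def domain (α : ℝ) : Set E3 := {p | Real.tan α * p 0 < p 2}

/-- Local coordinate along `e_x = cos α e₁ + sin α e₃`. -/
def locX (α : ℝ) (p : E3) : ℝ := Real.cos α * p 0 + Real.sin α * p 2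

/-- Local coordinate along `e_y = e₂`. -/
def locY (p : E3) : ℝ := p 1

/-- Local coordinate along the inner normal `e_z = - sin α e₁ + cos α e₃`. -/
def locZ (α : ℝ) (p : E3) : ℝ := -Real.sin α * p 0 + Real.cos α * p 2

/-- For `cos α > 0` the domain is the half-space `z > 0` in local coordinates. -/
theorem mem_domain_iff {α : ℝ} (h : 0 < Real.cos α) (p : E3) :
    p ∈ domain α ↔ 0 < locZ α p := by
  have e : locZ α p = Real.cos α * (p 2 - Real.tan α * p 0) := by
    rw [Real.tan_eq_sin_div_cos, locZ]
    field_simp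
    ring
  rw [e, mul_pos_iff_of_pos_left h, sub_pos]
  rfl

/-! ### Distributional solutions -/

/-- The partial derivative in the `i`-th global Cartesian direction. -/
def pd (i : Fin 3) (φ : E3 → ℂ) : E3 → ℂ :=
  fun p => fderiv ℝ φ p (EuclideanSpace.single i 1)

/-- `Δ_h = ∂₁² + ∂₂²`. -/
def lapH (φ : E3 → ℂ) : E3 → ℂ := fun p => pd 0 (pd 0 φ) p + pd 1 (pd 1 φ) p

/-- `Δ = ∂₁² + ∂₂² + ∂₃²`. -/
def lap (φ : E3 → ℂ) : E3 → ℂ := fun p => lapH φ p + pd 2 (pd 2 φ) p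

/-- The formal transpose of `iωΔ + β∂₁ - (ν_h Δ_h + ν₃ ∂₃²) Δ_h`: only the sign of the
first-order term changes. -/
def qgTranspose (P : Params) (φ : E3 → ℂ) : E3 → ℂ := fun p =>
  Complex.I * P.ω * lap φ p - P.β * pd 0 φ p
    - (P.νh * lapH (lapH φ) p + P.ν3 * pd 2 (pd 2 (lapH φ)) p)

/-- Smooth compactly supported test functions on `Ω`. -/
def IsTest (Ω : Set E3) (φ : E3 → ℂ) : Prop :=
  ContDiff ℝ (⊤ : ℕ∞) φ ∧ HasCompactSupport φ ∧ tsupport φ ⊆ Ω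

/-- `iωΔψ + β∂₁ψ - (ν_h Δ_h + ν₃ ∂₃²) Δ_h ψ = S` in the sense of distributions in the domain. -/
def SolvesQG (P : Params) (ψ S : E3 → ℂ) : Prop :=
  LocallyIntegrableOn ψ (domain P.α) ∧ LocallyIntegrableOn S (domain P.α) ∧
    ∀ φ : E3 → ℂ, IsTest (domain P.α) φ →
      ∫ p in domain P.α, ψ p * qgTranspose P φ p = ∫ p in domain P.α, S p * φ p

/-- The Sverdrup equation `β∂₁ψ = S` in the sense of distributions in the domain. -/
def SolvesSverdrup (P : Params) (ψ S : E3 → ℂ) : Prop :=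
  LocallyIntegrableOn ψ (domain P.α) ∧ LocallyIntegrableOn S (domain P.α) ∧
    ∀ φ : E3 → ℂ, IsTest (domain P.α) φ →
      ∫ p in domain P.α, ψ p * (-(P.β : ℂ) * pd 0 φ p) = ∫ p in domain P.α, S p * φ p

/-! ### Tangential Fourier transform and function spaces -/

/-- Inverse Fourier transform in the tangential variables `(x, y)` of `u = u(ξ, z)`, as a function
on physical space. The direct transform is `∫ exp(-i(x ξ_x + y ξ_y)) (...) dx dy`. -/
def tangInv (α : ℝ) (u : Freq → ℝ → ℂ) (p : E3) : ℂ :=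
  (1 / (2 * Real.pi : ℂ) ^ 2) *
    ∫ ξ : Freq, Complex.exp (Complex.I * (locX α p * ξ 0 + locY p * ξ 1 : ℝ)) * u ξ (locZ α p)

/-- `uhat` is the tangential Fourier transform of `u` (for transforms that are integrable in `ξ` on
almost every slice `z = const`, which is automatic for the band-limited functions below). -/
def IsTangFourier (α : ℝ) (u : E3 → ℂ) (uhat : Freq → ℝ → ℂ) : Prop :=
  (∀ᵐ z ∂(volume.restrict (Ioi (0 : ℝ))), Integrable (fun ξ : Freq => uhat ξ z)) ∧
    ∀ᵐ p ∂(volume.restrict (domain α)), u p = tangInv α uhat p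

/-- The norm of `H^σ(ℝ²; L^q(0,∞))`, the tangential variables being measured on the Fourier side:
`( ∫ (1 + |ξ|²)^σ ‖u(ξ, ·)‖²_{L^q(0,∞)} dξ )^(1/2)`, as a function of the transform `u`. -/
def tangNorm (σ : ℝ) (q : ℝ≥0∞) (u : Freq → ℝ → ℂ) : ℝ≥0∞ :=
  (∫⁻ ξ : Freq, ENNReal.ofReal ((1 + ‖ξ‖ ^ 2) ^ σ) *
    eLpNorm (u ξ) q (volume.restrict (Ioi (0 : ℝ))) ^ 2) ^ (1 / 2 : ℝ)

/-- Joint measurability in `(ξ, z)`, `z > 0`. -/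
def TangMeas (u : Freq → ℝ → ℂ) : Prop :=
  AEStronglyMeasurable (Function.uncurry u)
    ((volume : Measure Freq).prod (volume.restrict (Ioi (0 : ℝ))))

/-- `L²(ℝ²; L¹(0,∞))`, in terms of the tangential Fourier transform. -/
def MemL2L1 (u : Freq → ℝ → ℂ) : Prop := TangMeas u ∧ tangNorm 0 1 u < ∞

/-- `L²(ℝ²; C₀(0,∞))`, in terms of the tangential Fourier transform: bounded continuous functions
of `z > 0` that tend to `0` as `z → +∞`. -/
def MemL2C0 (u : Freq → ℝ → ℂ) : Prop :=
  TangMeas u ∧ tangNorm 0 ∞ u < ∞ ∧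
    ∀ᵐ ξ : Freq, ContinuousOn (u ξ) (Ioi 0) ∧ Tendsto (u ξ) atTop (𝓝 0)

/-- `L²(ℝ²; C¹₀(0,∞))`: moreover the `z`-derivative is of the same kind. -/
def MemL2C10 (u : Freq → ℝ → ℂ) : Prop :=
  MemL2C0 u ∧ tangNorm 0 ∞ (fun ξ => deriv (u ξ)) < ∞ ∧
    ∀ᵐ ξ : Freq, ContDiffOn ℝ 1 (u ξ) (Ioi 0) ∧ Tendsto (deriv (u ξ)) atTop (𝓝 0)

/-- Vanishing at the tangential frequencies `|ξ| ≥ R`, almost everywhere. -/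
def BandLimited (R : ℝ) (u : Freq → ℝ → ℂ) : Prop :=
  ∀ᵐ ξ : Freq, R ≤ ‖ξ‖ → ∀ᵐ z ∂(volume.restrict (Ioi (0 : ℝ))), u ξ z = 0

/-! ### Characteristic roots and the Green function -/

open Polynomial in
/-- The characteristic polynomial: the symbol of the equation on `exp(i(x ξ_x + y ξ_y) - μ z)`. -/
def charPoly (P : Params) (ξ : Freq) : ℂ[X] :=
  let c : ℂ := Real.cos P.α
  let s : ℂ := Real.sin P.α
  let k1 : ℂ[X] := C (c * Complex.I * ξ 0) + C s * X
  let k3 : ℂ[X] := C (Complex.I * s * ξ 0) - C c * X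
  C (Complex.I * P.ω) * (X ^ 2 - C ((‖ξ‖ ^ 2 : ℝ) : ℂ)) + C (P.β : ℂ) * k1
    - (C (P.νh : ℂ) * (k1 ^ 2 - C ((ξ 1 : ℂ) ^ 2)) + C (P.ν3 : ℂ) * k3 ^ 2) *
      (k1 ^ 2 - C ((ξ 1 : ℂ) ^ 2))

theorem eval_charPoly (P : Params) (ξ : Freq) (μ : ℂ) :
    (charPoly P ξ).eval μ =
      Complex.I * P.ω * (μ ^ 2 - (‖ξ‖ ^ 2 : ℝ))
        + P.β * (Real.cos P.α * Complex.I * ξ 0 + Real.sin P.α * μ)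
        - (P.νh * ((Real.cos P.α * Complex.I * ξ 0 + Real.sin P.α * μ) ^ 2 - (ξ 1 : ℂ) ^ 2)
            + P.ν3 * (Complex.I * Real.sin P.α * ξ 0 - Real.cos P.α * μ) ^ 2)
          * ((Real.cos P.α * Complex.I * ξ 0 + Real.sin P.α * μ) ^ 2 - (ξ 1 : ℂ) ^ 2) := by
  simp only [charPoly, Polynomial.eval_add, Polynomial.eval_sub, Polynomial.eval_mul,
    Polynomial.eval_pow, Polynomial.eval_C, Polynomial.eval_X]

/-- A multiset of complex numbers listed by increasing real part, ties being broken by the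
imaginary part. -/
def sortByRe (m : Multiset ℂ) : List ℂ :=
  ((m.map fun μ => toLex (μ.re, μ.im)).sort (· ≤ ·)).map
    fun q => (⟨(ofLex q).1, (ofLex q).2⟩ : ℂ)

/-- The roots `μ₁⁺, μ₂⁺` with positive real part (indices `0, 1`), with `Re μ₁⁺ ≤ Re μ₂⁺`.
The value `0` is used if there are too few of them, which for `sin α ≠ 0` and positive viscosities
only concerns frequencies with `ξ_y = 0`. -/
def rootPos (P : Params) (ξ : Freq) (j : Fin 2) : ℂ :=
  (sortByRe ((charPoly P ξ).roots.filter fun μ => 0 < μ.re)).getD j 0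

/-- The roots `μ₁⁻, μ₂⁻` with negative real part, with `Re μ₁⁻ ≤ Re μ₂⁻`. -/
def rootNeg (P : Params) (ξ : Freq) (j : Fin 2) : ℂ :=
  (sortByRe ((charPoly P ξ).roots.filter fun μ => μ.re < 0)).getD j 0

/-- `(ν_eff s²)⁻¹ ∏ (μ - μ_j)⁻¹`, the product being over the characteristic roots `μ ≠ μ_j`. -/
def greenCoeff (P : Params) (ξ : Freq) (μj : ℂ) : ℂ :=
  1 / ((P.νeff : ℂ) * (Real.sin P.α : ℂ) ^ 2) *
    ∏ μ ∈ (charPoly P ξ).roots.toFinset.erase μj, 1 / (μ - μj)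

/-- The tangential Fourier transform of the Green function, with
`C_j^± = ∓ (ν_eff s²)⁻¹ ∏ (μ - μ_j^±)⁻¹`. -/
def greenHat (P : Params) (ξ : Freq) (z : ℝ) : ℂ :=
  if 0 < z then
    ∑ j : Fin 2, -greenCoeff P ξ (rootPos P ξ j) * Complex.exp (-rootPos P ξ j * z)
  else
    ∑ j : Fin 2, greenCoeff P ξ (rootNeg P ξ j) * Complex.exp (-rootNeg P ξ j * z)

/-- The tangential Fourier transform of `ψ_S = G * S`. -/
def psiHat (P : Params) (Shat : Freq → ℝ → ℂ) (ξ : Freq) (z : ℝ) : ℂ :=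
  ∫ z' in Ioi (0 : ℝ), greenHat P ξ (z - z') * Shat ξ z'

/-! ### Parameter regimes -/

/-- The regimes considered, `κ` quantifying each `≪` and `K` the symbol `≲`:
`|ω| ≪ β^(3/4) ν_eff^(1/4)`, and either `|ω| ≲ β^(2/3) ν_eff^(1/3)` with
`R ≪ β / |ω|` and `R ≪ (β / ν_eff)^(1/3)`, or `|ω| ≫ β^(2/3) ν_eff^(1/3)` with
`R ≪ β³ ν_eff / |ω|⁴`. -/
def Regime (K κ : ℝ) (P : Params) (R : ℝ) : Prop :=
  |P.ω| ≤ κ * (P.β ^ (3 / 4 : ℝ) * P.νeff ^ (1 / 4 : ℝ)) ∧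
    ((|P.ω| ≤ K * (P.β ^ (2 / 3 : ℝ) * P.νeff ^ (1 / 3 : ℝ)) ∧
        R * |P.ω| ≤ κ * P.β ∧ R ≤ κ * (P.β / P.νeff) ^ (1 / 3 : ℝ)) ∨
      (P.β ^ (2 / 3 : ℝ) * P.νeff ^ (1 / 3 : ℝ) ≤ κ * |P.ω| ∧
        R * |P.ω| ^ 4 ≤ κ * (P.β ^ 3 * P.νeff)))

/-- The power laws `β = ε^(-a)`, `ω = ε^(-b)`, `ν_h = ε^d`, `ν₃ = ε^e`. -/
def powerParams (α a b d e ε : ℝ) : Params where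
  α := α
  ω := ε ^ (-b)
  β := ε ^ (-a)
  νh := ε ^ d
  ν3 := ε ^ e

/-- A Sverdrup solution: `β∂₁ψ = S` in the domain and `ψ → 0` as `z → +∞`, with `ψ` in
`L²(ℝ²; C₀(0,∞))`; `ψhat` is its tangential Fourier transform. -/
def IsSverdrup (P : Params) (S : E3 → ℂ) (ψ : E3 → ℂ) (ψhat : Freq → ℝ → ℂ) : Prop :=
  IsTangFourier P.α ψ ψhat ∧ MemL2C0 ψhat ∧ SolvesSverdrup P ψ S

end

end QG3D

/-!
After a tangential Fourier transform, the equation becomes at each frequency `ξ` the ordinary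
differential equation `p_ξ(-∂_z) u = v` on `(0, ∞)`, where `p_ξ` is the characteristic polynomial,
of degree `4`, and the Green function is the fundamental solution of `p_ξ(-∂_z)` made of
exponentials that are bounded on each side. With simple roots `μⱼ`, its coefficients are `± 1 /
p_ξ'(μⱼ)`, so everything rests on a precise description of the roots for `|ξ| ≤ R`.

*Roots.* Let `L = (β / ν_eff)^(1/3)`. In units where `L` is the unit of frequency and `β = ν_eff =
1`, the roots at `ξ = 0` are `0` and the roots of `σ² m³ - i w m + σ`, where `σ = -sin α` and `w`
is the normalized forcing frequency. This cubic has two roots in the right and one in the left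
half-plane, at distance at least `c (1 + |w|)⁻⁴` of the imaginary axis (`cubic_abs_re_ge`,
`exists_cubic_roots`), and its derivative at them is bounded below *uniformly in `w`*
(`cubic_deriv_ge`). Both regimes imply `R / L ≪ (1 + |w|)⁻⁴` (`exists_scale_le_of_regime`), so
that for `|ξ| ≤ R` the four roots of `p_ξ` stay in disjoint discs around these nodes, with errors
`O(R / L)` (`normalized_roots`, `exists_isRootFamily`). The small root is close to the root `-i
ξ_x cot α` of the Sverdrup operator and may touch the imaginary axis, but for `ξ_y ≠ 0` the
viscous dissipation pushes it into the left half-plane (`re_small_root_neg`). The uniform lower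
bound `|p_ξ'(μⱼ)| ≥ c β` gives `|Ĝ| ≤ C / β`, hence the estimate of `ψ_S` in all the norms.

*Equation.* Partial fractions show that the Green kernel is a fundamental solution
(`integral_greenKernel_mul_diffOp`). Parseval's formula (`exists_parseval`) transfers the weak
equations at the frequencies to the distributional equation in the domain (`weak_equation_of_ae`);
the converse (`ae_weak_equation`) uses tangential translates of a product test function and the
injectivity of the Fourier transform on `L¹`.

*Uniqueness.* The difference of two solutions is, at almost every frequency, a bounded continuous
weak solution of a homogeneous equation. Mollified, it is a combination of the exponentials
`exp(-μⱼ z)`, in which the ones growing at infinity do not occur (`shiftPairing_eq_sum_exp`,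
`exists_two_exp_of_weak_solution`). The coefficients are recovered from two values of `z`, which
makes them square integrable in `ξ` (`IsRootFamily.exists_modes`).

*Sverdrup limit.* The Sverdrup equation has the same structure with a single, imaginary root, so
that its decaying solution exists and is unique. When `L → ∞` with `w` bounded, the boundary layer
modes of `β Ĝ` concentrate at `z = 0`, while the amplitude and the root of the slow mode converge
to those of the Sverdrup kernel (`IsRootFamily.norm_kernel_sub_le`). The convolutions with the
fixed source then converge uniformly in `z` at each frequency, and dominated convergence concludes
(`tendsto_tangNorm_sub_sverdrup`).
-/

namespace QG3D

noncomputable section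

/-! ### The characteristic cubic at zero tangential frequency -/

section Cubic

variable {σ w : ℝ} {m : ℂ}

theorem cubic_norm_sq_le (hσ : 0 < σ) (hσ1 : σ ≤ 1)
    (h : (σ : ℂ) ^ 2 * m ^ 3 - Complex.I * w * m + σ = 0) :
    ‖m‖ ^ 2 ≤ (1 + |w|) / σ ^ 2 := by
  by_contra! hlt
  have hW : 0 ≤ |w| := abs_nonneg w
  rw [div_lt_iff₀ (by positivity)] at hlt
  have e : (σ : ℂ) ^ 2 * m ^ 3 = Complex.I * w * m - σ := by linear_combination h
  have e1 : σ ^ 2 * ‖m‖ ^ 3 ≤ |w| * ‖m‖ + σ := by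
    have := congrArg norm e
    rw [norm_mul, norm_pow, norm_pow, Complex.norm_real, Real.norm_eq_abs, abs_of_pos hσ] at this
    rw [this]
    refine (norm_sub_le _ _).trans ?_
    simp [abs_of_pos hσ]
  have ht : 1 ≤ ‖m‖ := by
    by_contra! hm
    have : ‖m‖ ^ 2 * σ ^ 2 ≤ 1 * 1 := by
      gcongr
      · nlinarith [norm_nonneg m]
      · nlinarith
    linarith
  nlinarith [norm_nonneg m]

theorem cubic_norm_ge (hσ : 0 < σ) (hσ1 : σ ≤ 1)
    (h : (σ : ℂ) ^ 2 * m ^ 3 - Complex.I * w * m + σ = 0) :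
    σ / (2 * (1 + |w|)) ≤ ‖m‖ := by
  by_contra! hlt
  have hW : 0 ≤ |w| := abs_nonneg w
  rw [lt_div_iff₀ (by positivity)] at hlt
  have e : (σ : ℂ) = Complex.I * w * m - (σ : ℂ) ^ 2 * m ^ 3 := by linear_combination h
  have e1 : σ ≤ |w| * ‖m‖ + σ ^ 2 * ‖m‖ ^ 3 := by
    have := congrArg norm e
    rw [Complex.norm_real, Real.norm_eq_abs, abs_of_pos hσ] at this
    refine this.le.trans ((norm_sub_le _ _).trans ?_)
    simp
  have h0 := norm_nonneg m
  have ht : ‖m‖ ≤ 1 := by nlinarith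
  have h3 : ‖m‖ ^ 3 ≤ ‖m‖ := by
    calc ‖m‖ ^ 3 = ‖m‖ * ‖m‖ ^ 2 := by ring
      _ ≤ ‖m‖ * 1 := by gcongr; nlinarith
      _ = ‖m‖ := by ring
  have h4 : σ ^ 2 * ‖m‖ ^ 3 ≤ 1 * ‖m‖ := by
    gcongr
    nlinarith
  nlinarith

/-- Real and imaginary parts of the cubic combine into a relation that does not involve `w`. -/
theorem cubic_re_im (h : (σ : ℂ) ^ 2 * m ^ 3 - Complex.I * w * m + σ = 0) (hσ : 0 < σ) :
    σ * (m.re ^ 4 - m.im ^ 4) = -m.re := by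
  have hr := congrArg Complex.re h
  have hi := congrArg Complex.im h
  simp [pow_succ] at hr hi
  have : σ * (σ * (m.re ^ 4 - m.im ^ 4) + m.re) = 0 := by linear_combination m.re * hr + m.im * hi
  have := (mul_eq_zero.mp this).resolve_left hσ.ne'
  linarith

theorem cubic_re_ne_zero (h : (σ : ℂ) ^ 2 * m ^ 3 - Complex.I * w * m + σ = 0) (hσ : 0 < σ) :
    m.re ≠ 0 := by
  intro h0
  have h1 := cubic_re_im h hσ
  rw [h0] at h1
  have h2 : m.im = 0 := by
    have : m.im ^ 4 = 0 := by
      have : σ * m.im ^ 4 = 0 := by linear_combination -h1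
      exact (mul_eq_zero.mp this).resolve_left hσ.ne'
    exact pow_eq_zero_iff (by norm_num) |>.mp this
  have : m = 0 := Complex.ext h0 h2
  rw [this] at h
  simp at h
  exact hσ.ne' h

/-- The roots of the cubic stay away from the imaginary axis. If `|Re m| ≤ |m| / 2`, then
`|Im m|` exceeds `|Re m|` by a factor, and `cubic_re_im` gives `|Re m| ≥ σ |m|⁴ / 2`. -/
theorem cubic_abs_re_ge (hσ : 0 < σ) (hσ1 : σ ≤ 1)
    (h : (σ : ℂ) ^ 2 * m ^ 3 - Complex.I * w * m + σ = 0) :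
    σ ^ 5 / (32 * (1 + |w|) ^ 4) ≤ |m.re| := by
  have hW : 0 ≤ |w| := abs_nonneg w
  have hge := cubic_norm_ge hσ hσ1 h
  set t := ‖m‖ with ht
  have ht2 : t ^ 2 = m.re ^ 2 + m.im ^ 2 := by
    rw [ht, ← Complex.normSq_eq_norm_sq, Complex.normSq_apply]; ring
  have hx2 : |m.re| ^ 2 = m.re ^ 2 := sq_abs _
  have ht4 : (σ / (2 * (1 + |w|))) ^ 4 ≤ t ^ 4 := by gcongr
  have e4 : (σ / (2 * (1 + |w|))) ^ 4 = σ ^ 4 / (16 * (1 + |w|) ^ 4) := by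
    rw [div_pow]; ring_nf
  rcases le_or_gt |m.re| (t / 2) with hx | hx
  · have h1 := cubic_re_im h hσ
    have h3 : m.re ^ 2 ≤ t ^ 2 / 4 := by rw [← hx2]; nlinarith [abs_nonneg m.re]
    have h4 : σ * t ^ 4 / 2 ≤ m.re := by
      have : m.re = σ * (t ^ 2 * (m.im ^ 2 - m.re ^ 2)) := by rw [ht2]; linarith
      rw [this]
      have : t ^ 2 * (t ^ 2 / 2) ≤ t ^ 2 * (m.im ^ 2 - m.re ^ 2) := by
        gcongr; linarith
      nlinarith
    calc σ ^ 5 / (32 * (1 + |w|) ^ 4) = σ * (σ ^ 4 / (16 * (1 + |w|) ^ 4)) / 2 := by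
          field_simp; ring
      _ ≤ σ * t ^ 4 / 2 := by rw [← e4]; gcongr
      _ ≤ m.re := h4
      _ ≤ |m.re| := le_abs_self _
  · refine le_trans ?_ hx.le
    refine le_trans ?_ (div_le_div_of_nonneg_right hge (by norm_num))
    rw [div_div]
    have h5 : σ ^ 5 ≤ σ := by
      calc σ ^ 5 = σ * σ ^ 4 := by ring
        _ ≤ σ * 1 := by gcongr; exact pow_le_one₀ hσ.le hσ1
        _ = σ := by ring
    have h6 : (1 + |w|) ≤ (1 + |w|) ^ 4 := le_self_pow₀ (by linarith) (by norm_num)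
    calc σ ^ 5 / (32 * (1 + |w|) ^ 4) ≤ σ / (32 * (1 + |w|)) := by gcongr
      _ ≤ σ / (2 * (1 + |w|) * 2) := by
          apply div_le_div_of_nonneg_left hσ.le (by positivity) (by linarith)

/-- The derivative `2σ²m³ - σ` of `X (σ²X³ - iwX + σ)` at a nonzero root is bounded below
uniformly in `w`: if `2σ²m³` were close to `σ`, then `iwm` would be close to `3σ/2`, and the cubes
of these two relations contradict each other, as `(iw)³` is imaginary. -/
theorem cubic_deriv_ge (hσ : 0 < σ)
    (h : (σ : ℂ) ^ 2 * m ^ 3 - Complex.I * w * m + σ = 0) :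
    σ / 4 ≤ ‖2 * (σ : ℂ) ^ 2 * m ^ 3 - σ‖ := by
  by_contra! hlt
  have hσc : (σ : ℂ) ≠ 0 := by exact_mod_cast hσ.ne'
  obtain ⟨θ, hθ⟩ : ∃ θ : ℂ, 2 * (σ : ℂ) ^ 2 * m ^ 3 - σ = σ * θ :=
    ⟨(2 * (σ : ℂ) ^ 2 * m ^ 3 - σ) / σ, by field_simp⟩
  have hθn : ‖θ‖ < 1 / 4 := by
    rw [hθ, norm_mul, Complex.norm_real, Real.norm_eq_abs, abs_of_pos hσ] at hlt
    nlinarith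
  have e1 : 2 * (Complex.I * w * m) = σ * (3 + θ) := by linear_combination (-2) * h + hθ
  have e2 : (3 + θ) ^ 3 * (σ : ℂ) ^ 4 = -(4 * w ^ 3 : ℝ) * Complex.I * (1 + θ) := by
    have h3 : (2 * (Complex.I * w * m)) ^ 3 = (σ * (3 + θ)) ^ 3 := by rw [e1]
    have hI : Complex.I ^ 3 = -Complex.I := by rw [pow_succ, Complex.I_sq]; ring
    rw [mul_pow, mul_pow, mul_pow, hI] at h3
    apply mul_left_cancel₀ hσc
    push_cast
    linear_combination (-(σ : ℂ) ^ 2) * h3 - 4 * Complex.I * w ^ 3 * hθ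
  have e3 : ((3 + θ) ^ 3 * (starRingEnd ℂ) (1 + θ)).re = 0 := by
    have h4 : (3 + θ) ^ 3 * (starRingEnd ℂ) (1 + θ) * ((σ ^ 4 : ℝ) : ℂ)
        = ((-(4 * w ^ 3) * Complex.normSq (1 + θ) : ℝ) : ℂ) * Complex.I := by
      rw [Complex.ofReal_mul, ← Complex.mul_conj]
      push_cast at e2 ⊢
      linear_combination (1 + (starRingEnd ℂ) θ) * e2 + (3 + θ) ^ 3 * (σ : ℂ) ^ 4 *
        ((map_add (starRingEnd ℂ) 1 θ).trans (by rw [map_one])) + 4 * w ^ 3 * (1 + θ) * Complex.I *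
        ((map_add (starRingEnd ℂ) 1 θ).trans (by rw [map_one]))
    have h5 := congrArg Complex.re h4
    rw [Complex.re_mul_ofReal, Complex.re_ofReal_mul] at h5
    simp only [Complex.I_re, mul_zero] at h5
    exact (mul_eq_zero.mp h5).resolve_right (by positivity)
  set E : ℂ := 27 * (starRingEnd ℂ) θ
    + (27 * θ + 9 * θ ^ 2 + θ ^ 3) * (1 + (starRingEnd ℂ) θ) with hE
  have e4 : (3 + θ) ^ 3 * (starRingEnd ℂ) (1 + θ) = 27 + E := by
    rw [map_add, map_one, hE]; ring
  have hEn : ‖E‖ < 27 := by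
    have hc : ‖(starRingEnd ℂ) θ‖ = ‖θ‖ := Complex.norm_conj θ
    have h1 : ‖E‖ ≤ 27 * ‖θ‖ + (27 * ‖θ‖ + 9 * ‖θ‖ ^ 2 + ‖θ‖ ^ 3) * (1 + ‖θ‖) := by
      rw [hE]
      refine (norm_add_le _ _).trans ?_
      rw [norm_mul, norm_mul, hc]
      have h2 : ‖(27 : ℂ)‖ = 27 := by simp
      rw [h2]
      gcongr
      · refine (norm_add₃_le).trans ?_
        simp
      · refine (norm_add_le _ _).trans ?_
        rw [hc]; simp
    have h0 := norm_nonneg θ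
    have h2 : ‖θ‖ ^ 2 ≤ 1 / 16 := by nlinarith
    have h3 : ‖θ‖ ^ 3 ≤ 1 / 64 := by nlinarith
    have h4 : (27 * ‖θ‖ + 9 * ‖θ‖ ^ 2 + ‖θ‖ ^ 3) * (1 + ‖θ‖) ≤ 8 * (5 / 4) := by
      apply mul_le_mul <;> nlinarith
    linarith
  rw [e4] at e3
  have h6 := Complex.abs_re_le_norm E
  have h7 := neg_abs_le E.re
  simp at e3
  linarith

/-- The lower bound of `cubic_deriv_ge` with the weight `(1 + ‖m‖)³`, which matches the growth in
`m` of the perturbation created by the tangential frequency. -/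
theorem cubic_deriv_ge_weight (hσ : 0 < σ) (hσ1 : σ ≤ 1)
    (h : (σ : ℂ) ^ 2 * m ^ 3 - Complex.I * w * m + σ = 0) :
    σ ^ 2 / 32 * (1 + ‖m‖) ^ 3 ≤ ‖2 * (σ : ℂ) ^ 2 * m ^ 3 - σ‖ := by
  have h1 := cubic_deriv_ge hσ h
  set D := ‖2 * (σ : ℂ) ^ 2 * m ^ 3 - σ‖
  have h2 : 2 * σ ^ 2 * ‖m‖ ^ 3 ≤ D + σ := by
    have : 2 * (σ : ℂ) ^ 2 * m ^ 3 = (2 * (σ : ℂ) ^ 2 * m ^ 3 - σ) + σ := by ring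
    have h3 := congrArg norm this
    rw [norm_mul, norm_mul, norm_pow, norm_pow, Complex.norm_real, Real.norm_eq_abs,
      abs_of_pos hσ] at h3
    have h4 := norm_add_le (2 * (σ : ℂ) ^ 2 * m ^ 3 - σ) (σ : ℂ)
    rw [Complex.norm_real, Real.norm_eq_abs, abs_of_pos hσ] at h4
    simp only [Complex.norm_ofNat] at h3
    linarith
  have h0 := norm_nonneg m
  have h5 : (1 + ‖m‖) ^ 3 ≤ 4 * (1 + ‖m‖ ^ 3) := by
    nlinarith [mul_nonneg (by linarith : 0 ≤ 1 + ‖m‖) (sq_nonneg (‖m‖ - 1))]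
  have h6 : σ ^ 2 ≤ σ := by nlinarith
  have h7 : σ ^ 2 / 32 * (1 + ‖m‖) ^ 3 ≤ σ ^ 2 / 32 * (4 * (1 + ‖m‖ ^ 3)) := by gcongr
  nlinarith

/-- The cubic has two roots in the right and one in the left half-plane. The sum of the roots is
zero, so that they are not all on the same side. By `cubic_re_im`, roots in the left half-plane
satisfy `|Im n| < |Re n|`; two such roots would have a product of positive real part, while the
third root would have positive real part, and the product of the three could not be `-1/σ`. -/
theorem exists_cubic_roots (hσ : 0 < σ) (w : ℝ) : ∃ n₁ n₂ n₃ : ℂ,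
    (∀ X : ℂ, (σ : ℂ) ^ 2 * X ^ 3 - Complex.I * w * X + σ
      = (σ : ℂ) ^ 2 * ((X - n₁) * (X - n₂) * (X - n₃))) ∧
    n₁ + n₂ + n₃ = 0 ∧ (σ : ℂ) ^ 2 * (n₁ * n₂ * n₃) = -σ ∧
    0 < n₁.re ∧ 0 < n₂.re ∧ n₃.re < 0 := by
  have hσc : (σ : ℂ) ≠ 0 := by exact_mod_cast hσ.ne'
  obtain ⟨a, b, c, habc⟩ : ∃ a b c : ℂ, ∀ X : ℂ, (σ : ℂ) ^ 2 * X ^ 3 - Complex.I * w * X + σ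
      = (σ : ℂ) ^ 2 * ((X - a) * (X - b) * (X - c)) := by
    open Polynomial in
    set p : ℂ[X] := C ((σ : ℂ) ^ 2) * X ^ 3 - C (Complex.I * w) * X + C (σ : ℂ) with hp
    have hdeg : p.natDegree = 3 := by
      rw [hp]; compute_degree!; exact hσ.ne'
    have hlead : p.leadingCoeff = (σ : ℂ) ^ 2 := by
      rw [Polynomial.leadingCoeff, hdeg, hp]; compute_degree!
    have hs := IsAlgClosed.splits p
    have hcard : p.roots.card = 3 := by rw [← hdeg]; exact hs.natDegree_eq_card_roots.symm
    obtain ⟨a, b, c, habc⟩ := Multiset.card_eq_three.mp hcard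
    refine ⟨a, b, c, fun X => ?_⟩
    have h1 := hs.eq_prod_roots
    rw [habc, hlead] at h1
    have h2 := congrArg (Polynomial.eval X) h1
    rw [hp] at h2
    simp at h2
    linear_combination h2
  have hsq : (σ : ℂ) ^ 2 ≠ 0 := pow_ne_zero _ hσc
  have hprod : a * b * c = -(1 / σ : ℝ) := by
    have := habc 0
    have h2 : (σ : ℂ) * (σ * (a * b * c) + 1) = 0 := by linear_combination this
    have h3 := (mul_eq_zero.mp h2).resolve_left hσc
    push_cast
    field_simp
    linear_combination h3
  have hprod' : (σ : ℂ) ^ 2 * (a * b * c) = -σ := by linear_combination habc 0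
  have hsum : a + b + c = 0 := by
    have h1 := habc 1
    have h2 := habc (-1)
    have h3 : (σ : ℂ) ^ 2 * (2 * (a + b + c)) = 0 := by
      have h4 := habc 0
      linear_combination h1 + h2 - 2 * h4
    have := (mul_eq_zero.mp h3).resolve_left hsq
    linear_combination this / 2
  have hroot : ∀ n, (n = a ∨ n = b ∨ n = c) →
      (σ : ℂ) ^ 2 * n ^ 3 - Complex.I * w * n + σ = 0 := by
    intro n hn
    rw [habc n]
    rcases hn with rfl | rfl | rfl <;> ring
  -- Two roots cannot both lie in the left half-plane.
  have key : ∀ a b c : ℂ, a + b + c = 0 → a * b * c = -(1 / σ : ℝ) →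
      σ * (a.re ^ 4 - a.im ^ 4) = -a.re → σ * (b.re ^ 4 - b.im ^ 4) = -b.re →
      a.re < 0 → b.re < 0 → False := by
    intro a b c hs hp ha hb hra hrb
    have h1 : ∀ n : ℂ, σ * (n.re ^ 4 - n.im ^ 4) = -n.re → n.re < 0 → n.im ^ 2 < n.re ^ 2 := by
      intro n hn hneg
      by_contra! hle
      have : (n.re ^ 2) ^ 2 ≤ (n.im ^ 2) ^ 2 := by gcongr
      nlinarith
    have hab : a.im * b.im < a.re * b.re := by
      have h2 := h1 a ha hra
      have h3 := h1 b hb hrb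
      have h4 := sq_lt_sq.mp h2
      have h5 := sq_lt_sq.mp h3
      calc a.im * b.im ≤ |a.im * b.im| := le_abs_self _
        _ = |a.im| * |b.im| := abs_mul _ _
        _ < |a.re| * |b.re| := by
          apply mul_lt_mul'' h4 h5 (abs_nonneg _) (abs_nonneg _)
        _ = a.re * b.re := by rw [← abs_mul, abs_of_pos (mul_pos_of_neg_of_neg hra hrb)]
    have hc : 0 < c.re := by
      have := congrArg Complex.re hs
      simp at this
      linarith
    have hr := congrArg Complex.re hp
    have hi := congrArg Complex.im hp
    simp only [Complex.mul_re, Complex.mul_im, Complex.neg_re, Complex.neg_im, Complex.ofReal_re,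
      Complex.ofReal_im, neg_zero] at hr hi
    set Pr := a.re * b.re - a.im * b.im
    set Pi := a.re * b.im + a.im * b.re
    have hPr : 0 < Pr := by simp only [Pr]; linarith
    have h2 : c.re * (Pr ^ 2 + Pi ^ 2) = -(Pr * (1 / σ)) := by
      linear_combination Pr * hr + Pi * hi
    have h3 : 0 < c.re * (Pr ^ 2 + Pi ^ 2) := by positivity
    have h4 : 0 < Pr * (1 / σ) := by positivity
    linarith
  have hra := cubic_re_ne_zero (hroot a (by simp)) hσ
  have hrb := cubic_re_ne_zero (hroot b (by simp)) hσ
  have hrc := cubic_re_ne_zero (hroot c (by simp)) hσ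
  have ha := cubic_re_im (hroot a (by simp)) hσ
  have hb := cubic_re_im (hroot b (by simp)) hσ
  have hc := cubic_re_im (hroot c (by simp)) hσ
  have hs := congrArg Complex.re hsum
  simp only [Complex.add_re, Complex.zero_re] at hs
  have kab := key a b c hsum hprod ha hb
  have kac := key a c b (by linear_combination hsum) (by linear_combination hprod) ha hc
  have kbc := key b c a (by linear_combination hsum) (by linear_combination hprod) hb hc
  rcases lt_or_gt_of_ne hra with h1 | h1 <;> rcases lt_or_gt_of_ne hrb with h2 | h2 <;>
    rcases lt_or_gt_of_ne hrc with h3 | h3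
  · exact (kab h1 h2).elim
  · exact (kab h1 h2).elim
  · exact (kac h1 h3).elim
  · exact ⟨b, c, a, fun X => by rw [habc X]; ring, by linear_combination hsum,
      by linear_combination hprod', h2, h3, h1⟩
  · exact (kbc h2 h3).elim
  · exact ⟨a, c, b, fun X => by rw [habc X]; ring, by linear_combination hsum,
      by linear_combination hprod', h1, h3, h2⟩
  · exact ⟨a, b, c, habc, hsum, hprod', h1, h2, h3⟩
  · linarith

end Cubic

/-! ### Perturbation of the roots of a quartic polynomial -/

section Quartic

open Polynomial

variable {n m : Fin 4 → ℂ} {δ : Fin 4 → ℝ}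

/-- A quartic polynomial over `ℂ` splits, with the roots listed along `Fin 4`. -/
theorem exists_factorization {p : ℂ[X]} (hp : p.natDegree = 4) :
    ∃ m : Fin 4 → ℂ, p = C p.leadingCoeff * ∏ j, (X - C (m j)) := by
  have hs := IsAlgClosed.splits p
  obtain ⟨l, hl⟩ : ∃ l : List ℂ, (l : Multiset ℂ) = p.roots := Quot.exists_rep p.roots
  have hl4 : l.length = 4 := by
    rw [← hp, hs.natDegree_eq_card_roots, ← hl, Multiset.coe_card]
  refine ⟨fun j => l.get (j.cast hl4.symm), ?_⟩
  conv_lhs => rw [hs.eq_prod_roots]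
  congr 1
  rw [← hl, Multiset.map_coe, Multiset.prod_coe, ← List.prod_ofFn]
  congr 1
  apply List.ext_get
  · simp [hl4]
  · intro i h1 h2
    simp only [List.get_eq_getElem, List.getElem_map, List.getElem_ofFn, Fin.cast_mk]

/-- If a quartic is small at four well separated points, then it has exactly one root near each of
them: `|p(nⱼ)|` is `|a|` times the product of the distances from `nⱼ` to the roots. -/
theorem exists_roots_near {p : ℂ[X]} (hp : p.natDegree = 4)
    (hδ : ∀ j, 0 < δ j) (hsep : ∀ j k, j ≠ k → 3 * δ j ≤ ‖n j - n k‖)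
    (hval : ∀ j, ‖p.eval (n j)‖ ≤ ‖p.leadingCoeff‖ * δ j ^ 4) :
    ∃ m : Fin 4 → ℂ, p = C p.leadingCoeff * ∏ j, (X - C (m j)) ∧ ∀ j, ‖m j - n j‖ ≤ δ j := by
  obtain ⟨m, hm⟩ := exists_factorization hp
  have ha : 0 < ‖p.leadingCoeff‖ := by
    rw [norm_pos_iff, Ne, Polynomial.leadingCoeff_eq_zero]
    rintro rfl
    simp at hp
  have h1 : ∀ j, ∃ k, ‖m k - n j‖ ≤ δ j := by
    intro j
    by_contra! hlt
    have h2 := hval j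
    rw [congrArg (eval (n j)) hm] at h2
    simp only [eval_mul, eval_C, eval_prod, eval_sub, eval_X, norm_mul, norm_prod] at h2
    have h4 : δ j ^ 4 < ∏ k, ‖n j - m k‖ := by
      have : δ j ^ 4 = ∏ _k : Fin 4, δ j := by simp
      rw [this]
      apply Finset.prod_lt_prod_of_nonempty (fun _ _ => hδ j)
      · intro k _
        rw [norm_sub_rev]; exact hlt k
      · exact Finset.univ_nonempty
    have h5 := le_of_mul_le_mul_left h2 ha
    linarith
  choose τ hτ using h1
  have hinj : Function.Injective τ := by
    intro j k hjk
    by_contra hne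
    have h2 := hsep j k hne
    have h3 := hsep k j (Ne.symm hne)
    have h4 := hτ j
    have h5 := hτ k
    rw [← hjk] at h5
    have h6 : ‖n j - n k‖ ≤ δ j + δ k := by
      calc ‖n j - n k‖ = ‖(m (τ j) - n k) - (m (τ j) - n j)‖ := by congr 1; ring
        _ ≤ ‖m (τ j) - n k‖ + ‖m (τ j) - n j‖ := norm_sub_le _ _
        _ ≤ _ := by linarith
    rw [norm_sub_rev] at h3
    linarith [hδ j, hδ k]
  let e : Fin 4 ≃ Fin 4 := Equiv.ofBijective τ (Finite.injective_iff_bijective.mp hinj)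
  refine ⟨fun j => m (τ j), ?_, hτ⟩
  conv_lhs => rw [hm]
  congr 1
  exact (Equiv.prod_comp e (fun k => X - C (m k))).symm

theorem norm_sub_root_ge (hsep : ∀ j k, j ≠ k → 3 * δ j ≤ ‖n j - n k‖)
    (hm : ∀ j, ‖m j - n j‖ ≤ δ j) {j k : Fin 4} (hjk : j ≠ k) :
    2 / 3 * ‖n j - n k‖ ≤ ‖n j - m k‖ := by
  have h1 := hsep k j hjk.symm
  rw [norm_sub_rev] at h1
  have h2 : ‖n j - n k‖ ≤ ‖n j - m k‖ + ‖m k - n k‖ := by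
    calc ‖n j - n k‖ = ‖(n j - m k) + (m k - n k)‖ := by congr 1; ring
      _ ≤ _ := norm_add_le _ _
  linarith [hm k]

theorem norm_root_sub_root_ge (hsep : ∀ j k, j ≠ k → 3 * δ j ≤ ‖n j - n k‖)
    (hm : ∀ j, ‖m j - n j‖ ≤ δ j) {j k : Fin 4} (hjk : j ≠ k) :
    1 / 3 * ‖n j - n k‖ ≤ ‖m j - m k‖ := by
  have h1 := norm_sub_root_ge hsep hm hjk
  have h3 := hsep j k hjk
  have h2 : ‖n j - m k‖ ≤ ‖m j - m k‖ + ‖m j - n j‖ := by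
    calc ‖n j - m k‖ = ‖(m j - m k) - (m j - n j)‖ := by congr 1; ring
      _ ≤ _ := norm_sub_le _ _
  linarith [hm j]

/-- The distance from `nⱼ` to its root is controlled linearly by `|p(nⱼ)|`. -/
theorem norm_root_sub_le {a : ℂ} {p : ℂ[X]} (hp : p = C a * ∏ j, (X - C (m j)))
    (hsep : ∀ j k, j ≠ k → 3 * δ j ≤ ‖n j - n k‖) (hm : ∀ j, ‖m j - n j‖ ≤ δ j) (j : Fin 4) :
    8 / 27 * (‖a‖ * ∏ k ∈ Finset.univ.erase j, ‖n j - n k‖) * ‖m j - n j‖ ≤ ‖p.eval (n j)‖ := by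
  rw [hp]
  simp only [eval_mul, eval_C, eval_prod, eval_sub, eval_X, norm_mul, norm_prod]
  rw [← Finset.mul_prod_erase Finset.univ _ (Finset.mem_univ j), norm_sub_rev (n j) (m j)]
  have h1 : 8 / 27 * ∏ k ∈ Finset.univ.erase j, ‖n j - n k‖
      ≤ ∏ k ∈ Finset.univ.erase j, ‖n j - m k‖ := by
    have : (8 / 27 : ℝ) = ∏ _k ∈ (Finset.univ.erase j : Finset (Fin 4)), (2 / 3 : ℝ) := by
      rw [Finset.prod_const, Finset.card_erase_of_mem (Finset.mem_univ j)]
      simp; norm_num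
    rw [this, ← Finset.prod_mul_distrib]
    apply Finset.prod_le_prod
    · intros; positivity
    · intro k hk
      exact norm_sub_root_ge hsep hm (Finset.ne_of_mem_erase hk).symm
  calc _ = ‖a‖ * (‖m j - n j‖ * (8 / 27 * ∏ k ∈ Finset.univ.erase j, ‖n j - n k‖)) := by ring
    _ ≤ _ := by gcongr

theorem prod_norm_root_sub_ge (hsep : ∀ j k, j ≠ k → 3 * δ j ≤ ‖n j - n k‖)
    (hm : ∀ j, ‖m j - n j‖ ≤ δ j) (j : Fin 4) :
    1 / 27 * ∏ k ∈ Finset.univ.erase j, ‖n j - n k‖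
      ≤ ∏ k ∈ Finset.univ.erase j, ‖m j - m k‖ := by
  have : (1 / 27 : ℝ) = ∏ _k ∈ (Finset.univ.erase j : Finset (Fin 4)), (1 / 3 : ℝ) := by
    rw [Finset.prod_const, Finset.card_erase_of_mem (Finset.mem_univ j)]
    simp; norm_num
  rw [this, ← Finset.prod_mul_distrib]
  apply Finset.prod_le_prod
  · intros; positivity
  · intro k hk
    exact norm_root_sub_root_ge hsep hm (Finset.ne_of_mem_erase hk).symm

end Quartic

/-! ### The characteristic polynomial at low tangential frequency -/

section CharPoly

open Polynomial

theorem natDegree_charPoly_le (P : Params) (ξ : Freq) : (charPoly P ξ).natDegree ≤ 4 := by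
  unfold charPoly
  dsimp only
  compute_degree

theorem coeff_charPoly (P : Params) (ξ : Freq) :
    (charPoly P ξ).coeff 4 = -((P.νeff : ℂ) * (Real.sin P.α : ℂ) ^ 2) := by
  unfold charPoly
  dsimp only
  compute_degree!
  left
  simp [Params.νeff]

theorem norm_sq_freq (ξ : Freq) : ‖ξ‖ ^ 2 = ξ 0 ^ 2 + ξ 1 ^ 2 := by
  rw [EuclideanSpace.norm_sq_eq]
  simp

theorem abs_freq_le (ξ : Freq) (i : Fin 2) : |ξ i| ≤ ‖ξ‖ := by
  simpa using PiLp.norm_apply_le ξ i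

set_option maxHeartbeats 1000000 in
/-- Distance from the characteristic polynomial to its value `iωX² + sX - s²X⁴` at `ξ = 0`, for
`β = ν_eff = 1`. -/
theorem norm_eval_charPoly_sub_le {P : Params} (hβ : P.β = 1) (hν : P.νeff = 1) {N r : ℝ}
    (hh : 0 ≤ P.νh) (h3 : 0 ≤ P.ν3) (hN : P.νh + P.ν3 ≤ N) (hr : r ≤ 1)
    (hωr : |P.ω| * r ≤ 1) {ξ : Freq} (hξ : ‖ξ‖ ≤ r) (m : ℂ) :
    ‖(charPoly P ξ).eval m - (Complex.I * P.ω * m ^ 2 + Real.sin P.α * m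
      - (Real.sin P.α : ℂ) ^ 2 * m ^ 4)‖ ≤ (4 + 6 * N) * r * (1 + ‖m‖) ^ 3 := by
  have hr0 : 0 ≤ r := (norm_nonneg ξ).trans hξ
  have hsc := Real.sin_sq_add_cos_sq P.α
  have hs1 := Real.abs_sin_le_one P.α
  have hc1 := Real.abs_cos_le_one P.α
  set s := Real.sin P.α with hs
  set c := Real.cos P.α with hc
  set t := ‖m‖ with ht
  have ht0 : 0 ≤ t := norm_nonneg m
  have hnorm := norm_sq_freq ξ
  have h0 := (abs_freq_le ξ 0).trans hξ
  have hξ2 : ‖ξ‖ ^ 2 ≤ r ^ 2 := by gcongr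
  have hr2 : r ^ 2 ≤ r := by nlinarith
  have hscc : (s : ℂ) ^ 2 + (c : ℂ) ^ 2 = 1 := by exact_mod_cast hsc
  have hνc : (P.νh : ℂ) * (s : ℂ) ^ 2 + P.ν3 * (c : ℂ) ^ 2 = 1 := by
    have : P.νh * s ^ 2 + P.ν3 * c ^ 2 = 1 := hν
    exact_mod_cast this
  have hsq : s ^ 2 ≤ 1 := by nlinarith [sq_nonneg c]
  have hcq : c ^ 2 ≤ 1 := by nlinarith [sq_nonneg s]
  have hscle : |c| * |s| ≤ 1 := by nlinarith [abs_nonneg c, abs_nonneg s]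
  obtain ⟨e₁, he₁⟩ : ∃ e : ℂ, e = 2 * c * s * Complex.I * ξ 0 * m
      + ((-(c ^ 2 * ξ 0 ^ 2 + ξ 1 ^ 2) : ℝ) : ℂ) := ⟨_, rfl⟩
  obtain ⟨e₃, he₃⟩ : ∃ e : ℂ, e = -2 * c * s * Complex.I * ξ 0 * m
      + ((-(s ^ 2 * ξ 0 ^ 2) : ℝ) : ℂ) := ⟨_, rfl⟩
  have hlin : |c| * |s| * |ξ 0| * t ≤ r * t := by
    have : |c| * |s| * |ξ 0| ≤ 1 * r := by gcongr
    rw [one_mul] at this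
    gcongr
  have hlin2 : ‖(2 * c * s * Complex.I * ξ 0 * m : ℂ)‖ ≤ 2 * (r * t) := by
    simp only [norm_mul, Complex.norm_I, Complex.norm_real, Real.norm_eq_abs, Complex.norm_ofNat]
    calc 2 * |c| * |s| * 1 * |ξ 0| * ‖m‖ = 2 * (|c| * |s| * |ξ 0| * t) := by rw [ht]; ring
      _ ≤ _ := by gcongr
  have hn₁ : ‖e₁‖ ≤ 2 * r * (1 + t) := by
    rw [he₁]
    refine (norm_add_le _ _).trans ?_
    rw [Complex.norm_real, Real.norm_eq_abs, abs_neg, abs_of_nonneg (by positivity)]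
    have : c ^ 2 * ξ 0 ^ 2 ≤ 1 * ξ 0 ^ 2 := by gcongr
    nlinarith
  have hn₃ : ‖e₃‖ ≤ 2 * r * (1 + t) := by
    rw [he₃]
    refine (norm_add_le _ _).trans ?_
    rw [Complex.norm_real, Real.norm_eq_abs, abs_neg, abs_of_nonneg (by positivity)]
    have : s ^ 2 * ξ 0 ^ 2 ≤ 1 * ξ 0 ^ 2 := by gcongr
    have h4 : ‖(-2 * c * s * Complex.I * ξ 0 * m : ℂ)‖ ≤ 2 * (r * t) := by
      rw [show (-2 * c * s * Complex.I * ξ 0 * m : ℂ) = -(2 * c * s * Complex.I * ξ 0 * m) by ring,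
        norm_neg]
      exact hlin2
    nlinarith [sq_nonneg (ξ 1)]
  obtain ⟨E, hE⟩ : ∃ E : ℂ, E = P.νh * e₁ + P.ν3 * e₃ := ⟨_, rfl⟩
  have hN0 : 0 ≤ N := by linarith
  have hnE : ‖E‖ ≤ N * (2 * r * (1 + t)) := by
    rw [hE]
    refine (norm_add_le _ _).trans ?_
    simp only [norm_mul, Complex.norm_real, Real.norm_eq_abs, abs_of_nonneg hh, abs_of_nonneg h3]
    calc P.νh * ‖e₁‖ + P.ν3 * ‖e₃‖
        ≤ P.νh * (2 * r * (1 + t)) + P.ν3 * (2 * r * (1 + t)) := by gcongr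
      _ = (P.νh + P.ν3) * (2 * r * (1 + t)) := by ring
      _ ≤ _ := by gcongr
  have hmain : (charPoly P ξ).eval m - (Complex.I * P.ω * m ^ 2 + s * m - (s : ℂ) ^ 2 * m ^ 4)
      = -(Complex.I * P.ω * ((‖ξ‖ ^ 2 : ℝ) : ℂ)) + c * Complex.I * ξ 0
        - (m ^ 2 * e₁ + E * (s : ℂ) ^ 2 * m ^ 2 + E * e₁) := by
    rw [eval_charPoly, hβ, ← hs, ← hc]
    have hA : ((c : ℂ) * Complex.I * ξ 0 + s * m) ^ 2 - (ξ 1 : ℂ) ^ 2 = (s : ℂ) ^ 2 * m ^ 2 + e₁ := by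
      rw [he₁]
      push_cast
      linear_combination (c : ℂ) ^ 2 * (ξ 0 : ℂ) ^ 2 * Complex.I_sq
    have hB : (Complex.I * s * ξ 0 - c * m) ^ 2 = (c : ℂ) ^ 2 * m ^ 2 + e₃ := by
      rw [he₃]
      push_cast
      linear_combination (s : ℂ) ^ 2 * (ξ 0 : ℂ) ^ 2 * Complex.I_sq
    rw [hA, hB, hE]
    push_cast
    linear_combination (-((s : ℂ) ^ 2 * m ^ 4) - m ^ 2 * e₁) * hνc
  rw [hmain]
  have b1 : ‖-(Complex.I * P.ω * ((‖ξ‖ ^ 2 : ℝ) : ℂ))‖ ≤ r := by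
    rw [norm_neg]
    simp only [norm_mul, Complex.norm_I, Complex.norm_real, Real.norm_eq_abs, one_mul]
    rw [abs_of_nonneg (sq_nonneg ‖ξ‖)]
    calc |P.ω| * ‖ξ‖ ^ 2 ≤ |P.ω| * r ^ 2 := by gcongr
      _ = (|P.ω| * r) * r := by ring
      _ ≤ 1 * r := by gcongr
      _ = r := one_mul r
  have b2 : ‖(c * Complex.I * ξ 0 : ℂ)‖ ≤ r := by
    simp only [norm_mul, Complex.norm_I, Complex.norm_real, Real.norm_eq_abs, mul_one]
    calc |c| * |ξ 0| ≤ 1 * r := by gcongr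
      _ = r := one_mul r
  have b3 : ‖m ^ 2 * e₁ + E * (s : ℂ) ^ 2 * m ^ 2 + E * e₁‖
      ≤ t ^ 2 * (2 * r * (1 + t)) + N * (2 * r * (1 + t)) * 1 * t ^ 2
        + N * (2 * r * (1 + t)) * (2 * r * (1 + t)) := by
    refine norm_add₃_le.trans ?_
    simp only [norm_mul, norm_pow, Complex.norm_real, Real.norm_eq_abs, sq_abs]
    gcongr
  refine (norm_sub_le _ _).trans ?_
  refine (add_le_add ((norm_add_le _ _).trans (add_le_add b1 b2)) b3).trans ?_
  have c1 : (1 : ℝ) ≤ (1 + t) ^ 3 := one_le_pow₀ (by linarith)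
  have c2 : t ^ 2 * (1 + t) ≤ (1 + t) ^ 3 := by
    have : (1 + t) ^ 3 - t ^ 2 * (1 + t) = (1 + t) * (1 + 2 * t) := by ring
    have : 0 ≤ (1 + t) * (1 + 2 * t) := by positivity
    linarith
  have c3 : (1 + t) * (1 + t) ≤ (1 + t) ^ 3 := by
    have : (1 + t) ^ 3 - (1 + t) * (1 + t) = (1 + t) ^ 2 * t := by ring
    have : 0 ≤ (1 + t) ^ 2 * t := by positivity
    linarith
  calc r + r + (t ^ 2 * (2 * r * (1 + t)) + N * (2 * r * (1 + t)) * 1 * t ^ 2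
        + N * (2 * r * (1 + t)) * (2 * r * (1 + t)))
      = 2 * r * 1 + 2 * r * (t ^ 2 * (1 + t)) + 2 * N * r * (t ^ 2 * (1 + t))
        + 4 * N * (r * r) * ((1 + t) * (1 + t)) := by ring
    _ ≤ 2 * r * (1 + t) ^ 3 + 2 * r * (1 + t) ^ 3 + 2 * N * r * (1 + t) ^ 3
        + 4 * N * (1 * r) * (1 + t) ^ 3 := by
      have d0 : 2 * r * 1 ≤ 2 * r * (1 + t) ^ 3 := mul_le_mul_of_nonneg_left c1 (by positivity)
      have d1 : 2 * r * (t ^ 2 * (1 + t)) ≤ 2 * r * (1 + t) ^ 3 :=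
        mul_le_mul_of_nonneg_left c2 (by positivity)
      have d2 : 2 * N * r * (t ^ 2 * (1 + t)) ≤ 2 * N * r * (1 + t) ^ 3 :=
        mul_le_mul_of_nonneg_left c2 (by positivity)
      have d3 : 4 * N * (r * r) * ((1 + t) * (1 + t)) ≤ 4 * N * (1 * r) * (1 + t) ^ 3 :=
        mul_le_mul (by gcongr) c3 (by positivity) (by positivity)
      linarith
    _ = (4 + 6 * N) * r * (1 + t) ^ 3 := by ring

end CharPoly

/-! ### The small root -/

section CharPoly

open Polynomial

/-- Bounds on the first-order symbols of `∂₁`, `∂₃` and on the two second-order factors of the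
quartic part of the symbol, for arguments of size at most `ρ`. -/
theorem norm_symbol_factors_le {P : Params} {N ρ : ℝ} (hh : 0 ≤ P.νh) (h3 : 0 ≤ P.ν3)
    (hN : P.νh + P.ν3 ≤ N) {ξ : Freq} (hξ : ‖ξ‖ ≤ ρ) {m : ℂ} (hm : ‖m‖ ≤ ρ) :
    ‖(Real.cos P.α * Complex.I * ξ 0 + Real.sin P.α * m : ℂ)‖ ≤ 2 * ρ ∧
    ‖(Complex.I * Real.sin P.α * ξ 0 - Real.cos P.α * m : ℂ)‖ ≤ 2 * ρ ∧
    ‖((Real.cos P.α * Complex.I * ξ 0 + Real.sin P.α * m) ^ 2 - (ξ 1 : ℂ) ^ 2 : ℂ)‖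
      ≤ 5 * ρ ^ 2 ∧
    ‖(P.νh * ((Real.cos P.α * Complex.I * ξ 0 + Real.sin P.α * m) ^ 2 - (ξ 1 : ℂ) ^ 2)
      + P.ν3 * (Complex.I * Real.sin P.α * ξ 0 - Real.cos P.α * m) ^ 2 : ℂ)‖
      ≤ N * (5 * ρ ^ 2) := by
  have hρ : 0 ≤ ρ := (norm_nonneg m).trans hm
  have hs1 := Real.abs_sin_le_one P.α
  have hc1 := Real.abs_cos_le_one P.α
  have h0 := (abs_freq_le ξ 0).trans hξ
  have h1 := (abs_freq_le ξ 1).trans hξ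
  have k1 : ‖(Real.cos P.α * Complex.I * ξ 0 + Real.sin P.α * m : ℂ)‖ ≤ 2 * ρ := by
    refine (norm_add_le _ _).trans ?_
    simp only [norm_mul, Complex.norm_I, Complex.norm_real, Real.norm_eq_abs, mul_one]
    calc |Real.cos P.α| * |ξ 0| + |Real.sin P.α| * ‖m‖ ≤ 1 * ρ + 1 * ρ := by gcongr
      _ = 2 * ρ := by ring
  have k3 : ‖(Complex.I * Real.sin P.α * ξ 0 - Real.cos P.α * m : ℂ)‖ ≤ 2 * ρ := by
    refine (norm_sub_le _ _).trans ?_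
    simp only [norm_mul, Complex.norm_I, Complex.norm_real, Real.norm_eq_abs, one_mul]
    calc |Real.sin P.α| * |ξ 0| + |Real.cos P.α| * ‖m‖ ≤ 1 * ρ + 1 * ρ := by gcongr
      _ = 2 * ρ := by ring
  have kB : ‖((Real.cos P.α * Complex.I * ξ 0 + Real.sin P.α * m) ^ 2 - (ξ 1 : ℂ) ^ 2 : ℂ)‖
      ≤ 5 * ρ ^ 2 := by
    refine (norm_sub_le _ _).trans ?_
    rw [norm_pow, norm_pow, Complex.norm_real, Real.norm_eq_abs]
    calc _ ≤ (2 * ρ) ^ 2 + ρ ^ 2 := by gcongr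
      _ = 5 * ρ ^ 2 := by ring
  refine ⟨k1, k3, kB, ?_⟩
  refine (norm_add_le _ _).trans ?_
  rw [norm_mul, norm_mul, norm_pow, Complex.norm_real, Real.norm_eq_abs, Complex.norm_real,
    Real.norm_eq_abs, abs_of_nonneg hh, abs_of_nonneg h3]
  calc _ ≤ P.νh * (5 * ρ ^ 2) + P.ν3 * (2 * ρ) ^ 2 := by gcongr
    _ ≤ P.νh * (5 * ρ ^ 2) + P.ν3 * (5 * ρ ^ 2) := by gcongr; nlinarith
    _ = (P.νh + P.ν3) * (5 * ρ ^ 2) := by ring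
    _ ≤ N * (5 * ρ ^ 2) := by gcongr

/-- On the imaginary axis, the real part of the symbol is minus the viscous dissipation. -/
theorem re_eval_charPoly_I_neg {P : Params} (hh : 0 < P.νh) (h3 : 0 ≤ P.ν3) {ξ : Freq}
    (hξ : ξ 1 ≠ 0) (y : ℝ) : ((charPoly P ξ).eval (y * Complex.I)).re < 0 := by
  have e : (charPoly P ξ).eval (y * Complex.I) =
      ((-(P.ω * (y ^ 2 + ‖ξ‖ ^ 2)) + P.β * (Real.cos P.α * ξ 0 + Real.sin P.α * y) : ℝ) : ℂ)
        * Complex.I +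
      ((-((P.νh * ((Real.cos P.α * ξ 0 + Real.sin P.α * y) ^ 2 + ξ 1 ^ 2)
          + P.ν3 * (Real.sin P.α * ξ 0 - Real.cos P.α * y) ^ 2)
          * ((Real.cos P.α * ξ 0 + Real.sin P.α * y) ^ 2 + ξ 1 ^ 2)) : ℝ) : ℂ) := by
    have h1 : (Real.cos P.α * Complex.I * ξ 0 + Real.sin P.α * (y * Complex.I) : ℂ) ^ 2
        = -((Real.cos P.α * ξ 0 + Real.sin P.α * y) ^ 2) := by
      linear_combination (Real.cos P.α * ξ 0 + Real.sin P.α * y : ℂ) ^ 2 * Complex.I_sq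
    have h2 : (Complex.I * Real.sin P.α * ξ 0 - Real.cos P.α * (y * Complex.I) : ℂ) ^ 2
        = -((Real.sin P.α * ξ 0 - Real.cos P.α * y) ^ 2) := by
      linear_combination (Real.sin P.α * ξ 0 - Real.cos P.α * y : ℂ) ^ 2 * Complex.I_sq
    rw [eval_charPoly, h1, h2]
    push_cast
    linear_combination Complex.I * P.ω * (y : ℂ) ^ 2 * Complex.I_sq
  rw [e, Complex.add_re, Complex.re_ofReal_mul, Complex.I_re, mul_zero, zero_add,
    Complex.ofReal_re, neg_lt_zero]
  have : 0 < ξ 1 ^ 2 := by positivity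
  positivity

/-- A small root of the characteristic polynomial has negative real part if `sin α < 0`. Comparing
the values at `m` and at `i Im m`, one gets
`0 = p(m) = p(i Im m) + β sin α Re m + (small multiple of Re m)`, where `Re p(i Im m) < 0`. The
restriction `ξ_y ≠ 0` is what makes the dissipation, hence this last inequality, strict. -/
theorem re_small_root_neg {P : Params} (hβ : P.β = 1) (hh : 0 < P.νh) (h3 : 0 ≤ P.ν3)
    {N ρ : ℝ} (hN : P.νh + P.ν3 ≤ N) {ξ : Freq} (hξ : ‖ξ‖ ≤ ρ)
    (hξ1 : ξ 1 ≠ 0) {m : ℂ} (hm : ‖m‖ ≤ ρ) (hroot : (charPoly P ξ).eval m = 0)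
    (hsmall : 2 * ρ * |P.ω| + 40 * N * ρ ^ 3 ≤ -Real.sin P.α / 2) : m.re < 0 := by
  have hneg := re_eval_charPoly_I_neg hh h3 hξ1 m.im
  have hm' : ‖(m.im * Complex.I : ℂ)‖ ≤ ρ := by
    rw [norm_mul, Complex.norm_I, mul_one, Complex.norm_real, Real.norm_eq_abs]
    exact (Complex.abs_im_le_norm m).trans hm
  have hρ : 0 ≤ ρ := (norm_nonneg m).trans hm
  have hN0 : 0 ≤ N := by linarith
  obtain ⟨a1, a2, a3, a4⟩ := norm_symbol_factors_le hh.le h3 hN hξ hm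
  obtain ⟨b1, b2, b3, b4⟩ := norm_symbol_factors_le hh.le h3 hN hξ hm'
  have hs1 := Real.abs_sin_le_one P.α
  have hc1 := Real.abs_cos_le_one P.α
  have e1 := eval_charPoly P ξ m
  have e2 := eval_charPoly P ξ (m.im * Complex.I)
  have hmm : m = m.re + m.im * Complex.I := (Complex.re_add_im m).symm
  set m' : ℂ := m.im * Complex.I with hm'def
  set x := m.re with hx
  set k : ℂ := Real.cos P.α * Complex.I * ξ 0 + Real.sin P.α * m with hk
  set k' : ℂ := Real.cos P.α * Complex.I * ξ 0 + Real.sin P.α * m' with hk'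
  set l : ℂ := Complex.I * Real.sin P.α * ξ 0 - Real.cos P.α * m with hl
  set l' : ℂ := Complex.I * Real.sin P.α * ξ 0 - Real.cos P.α * m' with hl'
  have kk : k - k' = Real.sin P.α * x := by
    rw [hk, hk']; linear_combination (Real.sin P.α : ℂ) * hmm
  have ll : l - l' = -(Real.cos P.α * x) := by
    rw [hl, hl']; linear_combination (-Real.cos P.α : ℂ) * hmm
  have xn : ‖(x : ℂ)‖ = |x| := by simp
  have q1 : ‖k ^ 2 - k' ^ 2‖ ≤ 4 * ρ * |x| := by
    rw [show k ^ 2 - k' ^ 2 = (k - k') * (k + k') by ring, kk, norm_mul, norm_mul,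
      Complex.norm_real, Real.norm_eq_abs, xn]
    calc |Real.sin P.α| * |x| * ‖k + k'‖ ≤ 1 * |x| * (2 * ρ + 2 * ρ) := by
          gcongr
          exact (norm_add_le _ _).trans (add_le_add a1 b1)
      _ = 4 * ρ * |x| := by ring
  have q3 : ‖l ^ 2 - l' ^ 2‖ ≤ 4 * ρ * |x| := by
    rw [show l ^ 2 - l' ^ 2 = (l - l') * (l + l') by ring, ll, norm_mul, norm_neg, norm_mul,
      Complex.norm_real, Real.norm_eq_abs, xn]
    calc |Real.cos P.α| * |x| * ‖l + l'‖ ≤ 1 * |x| * (2 * ρ + 2 * ρ) := by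
          gcongr
          exact (norm_add_le _ _).trans (add_le_add a2 b2)
      _ = 4 * ρ * |x| := by ring
  set rest : ℂ := Complex.I * P.ω * (x * (m + m'))
    - ((P.νh * (k ^ 2 - k' ^ 2) + P.ν3 * (l ^ 2 - l' ^ 2)) * (k ^ 2 - (ξ 1 : ℂ) ^ 2)
      + (P.νh * (k' ^ 2 - (ξ 1 : ℂ) ^ 2) + P.ν3 * l' ^ 2) * (k ^ 2 - k' ^ 2)) with hrest
  have hdiff : (0 : ℂ) = (charPoly P ξ).eval m' + (Real.sin P.α * x : ℝ) + rest := by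
    rw [← hroot, e1, e2, hβ, hrest]
    rw [Complex.ofReal_mul, Complex.ofReal_one]
    linear_combination kk + (Complex.I * P.ω * (m + m')) * hmm
  have hrn : ‖rest‖ ≤ (-Real.sin P.α / 2) * |x| := by
    refine le_trans ?_ (mul_le_mul_of_nonneg_right hsmall (abs_nonneg x))
    rw [hrest]
    refine (norm_sub_le _ _).trans ?_
    have r1 : ‖Complex.I * P.ω * (x * (m + m'))‖ ≤ 2 * ρ * |P.ω| * |x| := by
      simp only [norm_mul, Complex.norm_I, Complex.norm_real, Real.norm_eq_abs, one_mul]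
      calc |P.ω| * (|x| * ‖m + m'‖) ≤ |P.ω| * (|x| * (ρ + ρ)) := by
            gcongr
            exact (norm_add_le _ _).trans (add_le_add hm hm')
        _ = _ := by ring
    have r2 : ‖P.νh * (k ^ 2 - k' ^ 2) + P.ν3 * (l ^ 2 - l' ^ 2)‖ ≤ N * (4 * ρ * |x|) := by
      refine (norm_add_le _ _).trans ?_
      rw [norm_mul, norm_mul, Complex.norm_real, Real.norm_eq_abs, Complex.norm_real,
        Real.norm_eq_abs, abs_of_nonneg hh.le, abs_of_nonneg h3]
      calc _ ≤ P.νh * (4 * ρ * |x|) + P.ν3 * (4 * ρ * |x|) := by gcongr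
        _ = (P.νh + P.ν3) * (4 * ρ * |x|) := by ring
        _ ≤ _ := by gcongr
    have r3 : ‖(P.νh * (k ^ 2 - k' ^ 2) + P.ν3 * (l ^ 2 - l' ^ 2)) * (k ^ 2 - (ξ 1 : ℂ) ^ 2)
      + (P.νh * (k' ^ 2 - (ξ 1 : ℂ) ^ 2) + P.ν3 * l' ^ 2) * (k ^ 2 - k' ^ 2)‖
        ≤ N * (4 * ρ * |x|) * (5 * ρ ^ 2) + N * (5 * ρ ^ 2) * (4 * ρ * |x|) := by
      refine (norm_add_le _ _).trans ?_
      rw [norm_mul, norm_mul]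
      gcongr
    refine (add_le_add r1 r3).trans (le_of_eq ?_)
    ring
  have hre := congrArg Complex.re hdiff
  rw [Complex.zero_re, Complex.add_re, Complex.add_re, Complex.ofReal_re] at hre
  have h7 := (Complex.abs_re_le_norm rest).trans hrn
  have h8 := abs_le.mp h7
  by_contra! hx0
  rw [abs_of_nonneg hx0] at h8
  nlinarith [h8.2]

/-- The small root is close to the root `-i ξ_x cot α` of the Sverdrup operator. -/
theorem norm_small_root_sub_le {P : Params} (hβ : P.β = 1) (hh : 0 ≤ P.νh) (h3 : 0 ≤ P.ν3)
    {N ρ : ℝ} (hN : P.νh + P.ν3 ≤ N) {ξ : Freq} (hξ : ‖ξ‖ ≤ ρ) {m : ℂ} (hm : ‖m‖ ≤ ρ)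
    (hroot : (charPoly P ξ).eval m = 0) :
    ‖(Real.cos P.α * Complex.I * ξ 0 + Real.sin P.α * m : ℂ)‖
      ≤ 2 * |P.ω| * ρ ^ 2 + 25 * N * ρ ^ 4 := by
  obtain ⟨-, -, a3, a4⟩ := norm_symbol_factors_le hh h3 hN hξ hm
  have hN0 : 0 ≤ N := by linarith
  rw [eval_charPoly, hβ] at hroot
  have e : (Real.cos P.α * Complex.I * ξ 0 + Real.sin P.α * m : ℂ)
      = (P.νh * ((Real.cos P.α * Complex.I * ξ 0 + Real.sin P.α * m) ^ 2 - (ξ 1 : ℂ) ^ 2)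
            + P.ν3 * (Complex.I * Real.sin P.α * ξ 0 - Real.cos P.α * m) ^ 2)
          * ((Real.cos P.α * Complex.I * ξ 0 + Real.sin P.α * m) ^ 2 - (ξ 1 : ℂ) ^ 2)
        - Complex.I * P.ω * (m ^ 2 - (‖ξ‖ ^ 2 : ℝ)) := by
    push_cast at hroot ⊢
    linear_combination hroot
  rw [e]
  refine (norm_sub_le _ _).trans ?_
  have h1 : ‖Complex.I * P.ω * (m ^ 2 - (‖ξ‖ ^ 2 : ℝ))‖ ≤ |P.ω| * (ρ ^ 2 + ρ ^ 2) := by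
    rw [norm_mul, norm_mul, Complex.norm_I, one_mul, Complex.norm_real, Real.norm_eq_abs]
    gcongr
    refine (norm_sub_le _ _).trans ?_
    rw [norm_pow, Complex.norm_real, Real.norm_eq_abs, abs_of_nonneg (sq_nonneg _)]
    gcongr
  rw [norm_mul]
  calc _ ≤ N * (5 * ρ ^ 2) * (5 * ρ ^ 2) + |P.ω| * (ρ ^ 2 + ρ ^ 2) := by gcongr
    _ = _ := by ring

end CharPoly

/-! ### Localization of the characteristic roots in normalized units -/

section CharPoly

open Polynomial

/-- The product of three factors is Lipschitz on bounded sets. -/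
theorem norm_triple_prod_sub_le {a b : Fin 3 → ℂ} {d M : ℝ}
    (hab : ∀ i, ‖a i - b i‖ ≤ d) (ha : ∀ i, ‖a i‖ ≤ M) (hb : ∀ i, ‖b i‖ ≤ M) :
    ‖a 0 * a 1 * a 2 - b 0 * b 1 * b 2‖ ≤ 3 * d * M ^ 2 := by
  have hM : 0 ≤ M := (norm_nonneg _).trans (ha 0)
  have hd : 0 ≤ d := (norm_nonneg _).trans (hab 0)
  have e : a 0 * a 1 * a 2 - b 0 * b 1 * b 2 =
      (a 0 - b 0) * a 1 * a 2 + b 0 * (a 1 - b 1) * a 2 + b 0 * b 1 * (a 2 - b 2) := by ring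
  rw [e]
  refine norm_add₃_le.trans ?_
  simp only [norm_mul]
  calc _ ≤ d * M * M + M * d * M + M * M * d := by
        gcongr
        all_goals first | exact hab _ | exact ha _ | exact hb _
    _ = _ := by ring

/-- The roots `0, n₁, n₂, n₃` of the characteristic polynomial at `ξ = 0` for `β = ν_eff = 1`,
with bounds that are uniform in the forcing frequency. -/
theorem exists_nodes {σ : ℝ} (hσ : 0 < σ) (hσ1 : σ ≤ 1) (w : ℝ) : ∃ n : Fin 4 → ℂ,
    n 0 = 0 ∧
    (∀ j, Complex.I * w * n j ^ 2 - σ * n j - (σ : ℂ) ^ 2 * n j ^ 4 = 0) ∧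
    (∀ j, ‖n j‖ ≤ √(1 + |w|) / σ) ∧
    (∀ j, σ ^ 2 / 32 * (1 + ‖n j‖) ^ 3
      ≤ σ ^ 2 * ∏ k ∈ Finset.univ.erase j, ‖n j - n k‖) ∧
    (σ : ℂ) ^ 2 * (n 1 * n 2 * n 3) = -σ ∧
    σ ^ 5 / 32 / (1 + |w|) ^ 4 ≤ (n 1).re ∧ σ ^ 5 / 32 / (1 + |w|) ^ 4 ≤ (n 2).re ∧
    (n 3).re ≤ -(σ ^ 5 / 32 / (1 + |w|) ^ 4) := by
  have hσc : (σ : ℂ) ≠ 0 := by exact_mod_cast hσ.ne'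
  obtain ⟨n₁, n₂, n₃, hX, hsum, hprod, h1, h2, h3⟩ := exists_cubic_roots hσ w
  have r1 : (σ : ℂ) ^ 2 * n₁ ^ 3 - Complex.I * w * n₁ + σ = 0 := by rw [hX]; ring
  have r2 : (σ : ℂ) ^ 2 * n₂ ^ 3 - Complex.I * w * n₂ + σ = 0 := by rw [hX]; ring
  have r3 : (σ : ℂ) ^ 2 * n₃ ^ 3 - Complex.I * w * n₃ + σ = 0 := by rw [hX]; ring
  have hW : 0 ≤ 1 + |w| := by positivity
  have hle : ∀ m : ℂ, (σ : ℂ) ^ 2 * m ^ 3 - Complex.I * w * m + σ = 0 →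
      ‖m‖ ≤ √(1 + |w|) / σ := by
    intro m hm
    have := cubic_norm_sq_le hσ hσ1 hm
    rw [← Real.sqrt_sq hσ.le, ← Real.sqrt_div hW]
    exact Real.le_sqrt_of_sq_le this
  have hre : ∀ m : ℂ, (σ : ℂ) ^ 2 * m ^ 3 - Complex.I * w * m + σ = 0 →
      σ ^ 5 / 32 / (1 + |w|) ^ 4 ≤ |m.re| := by
    intro m hm
    rw [div_div]
    exact cubic_abs_re_ge hσ hσ1 hm
  have habs2 : ‖(σ : ℂ) ^ 2‖ = σ ^ 2 := by simp
  have hder : ∀ a b c : ℂ, (σ : ℂ) ^ 2 * a ^ 3 - Complex.I * w * a + σ = 0 → a + b + c = 0 →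
      (σ : ℂ) ^ 2 * (a * b * c) = -σ →
      σ ^ 2 / 32 * (1 + ‖a‖) ^ 3 ≤ σ ^ 2 * (‖a‖ * (‖a - b‖ * ‖a - c‖)) := by
    intro a b c ha hs hp
    have h4 := cubic_deriv_ge_weight hσ hσ1 ha
    have e : 2 * (σ : ℂ) ^ 2 * a ^ 3 - σ = (σ : ℂ) ^ 2 * (a * ((a - b) * (a - c))) := by
      linear_combination -hp + (σ : ℂ) ^ 2 * a ^ 2 * hs
    rw [e, norm_mul, norm_mul, norm_mul, habs2] at h4
    exact h4
  refine ⟨![0, n₁, n₂, n₃], rfl, ?_, ?_, ?_, hprod, ?_, ?_, ?_⟩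
  · intro j
    fin_cases j
    · simp
    · change Complex.I * w * n₁ ^ 2 - σ * n₁ - (σ : ℂ) ^ 2 * n₁ ^ 4 = 0
      linear_combination -n₁ * r1
    · change Complex.I * w * n₂ ^ 2 - σ * n₂ - (σ : ℂ) ^ 2 * n₂ ^ 4 = 0
      linear_combination -n₂ * r2
    · change Complex.I * w * n₃ ^ 2 - σ * n₃ - (σ : ℂ) ^ 2 * n₃ ^ 4 = 0
      linear_combination -n₃ * r3
  · intro j
    fin_cases j
    · change ‖(0 : ℂ)‖ ≤ _
      rw [norm_zero]; positivity
    · exact hle _ r1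
    · exact hle _ r2
    · exact hle _ r3
  · have E0 : (Finset.univ.erase 0 : Finset (Fin 4)) = {1, 2, 3} := by decide
    have E1 : (Finset.univ.erase 1 : Finset (Fin 4)) = {0, 2, 3} := by decide
    have E2 : (Finset.univ.erase 2 : Finset (Fin 4)) = {0, 1, 3} := by decide
    have E3 : (Finset.univ.erase 3 : Finset (Fin 4)) = {0, 1, 2} := by decide
    rw [Fin.forall_fin_succ, Fin.forall_fin_succ, Fin.forall_fin_succ, Fin.forall_fin_succ]
    refine ⟨?_, ?_, ?_, ?_, fun i => i.elim0⟩
    · rw [E0, Finset.prod_insert (by decide), Finset.prod_insert (by decide),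
        Finset.prod_singleton]
      change σ ^ 2 / 32 * (1 + ‖(0 : ℂ)‖) ^ 3 ≤ σ ^ 2 * (‖0 - n₁‖ * (‖0 - n₂‖ * ‖0 - n₃‖))
      have := congrArg norm hprod
      rw [norm_mul, norm_mul, norm_mul, habs2, norm_neg, Complex.norm_real, Real.norm_eq_abs,
        abs_of_pos hσ] at this
      rw [zero_sub, zero_sub, zero_sub, norm_neg, norm_neg, norm_neg, ← mul_assoc ‖n₁‖, this]
      rw [norm_zero]
      nlinarith
    · change σ ^ 2 / 32 * (1 + ‖n₁‖) ^ 3 ≤ σ ^ 2 * ∏ k ∈ Finset.univ.erase (1 : Fin 4), _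
      rw [E1, Finset.prod_insert (by decide), Finset.prod_insert (by decide),
        Finset.prod_singleton]
      change _ ≤ σ ^ 2 * (‖n₁ - 0‖ * (‖n₁ - n₂‖ * ‖n₁ - n₃‖))
      rw [sub_zero]
      exact hder _ _ _ r1 hsum hprod
    · change σ ^ 2 / 32 * (1 + ‖n₂‖) ^ 3 ≤ σ ^ 2 * ∏ k ∈ Finset.univ.erase (2 : Fin 4), _
      rw [E2, Finset.prod_insert (by decide), Finset.prod_insert (by decide),
        Finset.prod_singleton]
      change _ ≤ σ ^ 2 * (‖n₂ - 0‖ * (‖n₂ - n₁‖ * ‖n₂ - n₃‖))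
      rw [sub_zero]
      exact hder _ _ _ r2 (by linear_combination hsum) (by linear_combination hprod)
    · change σ ^ 2 / 32 * (1 + ‖n₃‖) ^ 3 ≤ σ ^ 2 * ∏ k ∈ Finset.univ.erase (3 : Fin 4), _
      rw [E3, Finset.prod_insert (by decide), Finset.prod_insert (by decide),
        Finset.prod_singleton]
      change _ ≤ σ ^ 2 * (‖n₃ - 0‖ * (‖n₃ - n₁‖ * ‖n₃ - n₂‖))
      rw [sub_zero]
      exact hder _ _ _ r3 (by linear_combination hsum) (by linear_combination hprod)
  · have := hre _ r1
    rwa [abs_of_pos h1] at this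
  · have := hre _ r2
    rwa [abs_of_pos h2] at this
  · have := hre _ r3
    rw [abs_of_neg h3] at this
    change n₃.re ≤ _
    linarith

/-- Separation of the nodes, from the lower bound on the derivative and the upper bound on the
nodes themselves. -/
theorem nodes_separated {σ W : ℝ} (hσ : 0 < σ) (hW : 1 ≤ W) {n : Fin 4 → ℂ}
    (hn : ∀ j, ‖n j‖ ≤ √W / σ)
    (hd : ∀ j, σ ^ 2 / 32 * (1 + ‖n j‖) ^ 3 ≤ σ ^ 2 * ∏ k ∈ Finset.univ.erase j, ‖n j - n k‖)
    {j k : Fin 4} (hjk : j ≠ k) :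
    3 * (σ ^ 2 / 32 * (1 + ‖n j‖) ^ 3 / (12 * W)) ≤ ‖n j - n k‖ := by
  have hk : k ∈ (Finset.univ.erase j : Finset (Fin 4)) :=
    Finset.mem_erase.mpr ⟨hjk.symm, Finset.mem_univ _⟩
  have h1 := hd j
  rw [← Finset.mul_prod_erase _ _ hk] at h1
  have hcard : ((Finset.univ.erase j).erase k).card = 2 := by
    rw [Finset.card_erase_of_mem hk, Finset.card_erase_of_mem (Finset.mem_univ _)]
    simp
  have h2 : ∏ l ∈ (Finset.univ.erase j).erase k, ‖n j - n l‖ ≤ (2 * (√W / σ)) ^ 2 := by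
    have : (2 * (√W / σ)) ^ 2 = ∏ _l ∈ (Finset.univ.erase j).erase k, (2 * (√W / σ)) := by
      rw [Finset.prod_const, hcard]
    rw [this]
    apply Finset.prod_le_prod (fun _ _ => norm_nonneg _)
    intro l _
    refine (norm_sub_le _ _).trans ?_
    linarith [hn j, hn l]
  have h3 : (2 * (√W / σ)) ^ 2 = 4 * W / σ ^ 2 := by
    rw [mul_pow, div_pow, Real.sq_sqrt (by linarith)]; ring
  rw [h3] at h2
  have h4 : σ ^ 2 / 32 * (1 + ‖n j‖) ^ 3 ≤ 4 * W * ‖n j - n k‖ := by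
    calc _ ≤ _ := h1
      _ ≤ σ ^ 2 * (‖n j - n k‖ * (4 * W / σ ^ 2)) := by gcongr
      _ = _ := by field_simp
  have hW0 : 0 < W := by linarith
  calc 3 * (σ ^ 2 / 32 * (1 + ‖n j‖) ^ 3 / (12 * W))
      = (σ ^ 2 / 32 * (1 + ‖n j‖) ^ 3) / (4 * W) := by field_simp; norm_num
    _ ≤ _ := by rw [div_le_iff₀ (by positivity)]; linarith

set_option maxHeartbeats 1000000 in
/-- Localization of the characteristic roots for `β = ν_eff = 1` at tangential frequencies
`|ξ| ≤ r ≪ (1 + |ω|)⁻⁴`. The discs of radius `δⱼ` around `nⱼ` do not depend on `ξ`. -/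
theorem normalized_roots {α : ℝ} (hα : α ∈ Ioo (-(Real.pi / 2)) 0) :
    ∃ κ C c : ℝ, 0 < κ ∧ 0 < C ∧ 0 < c ∧ ∀ P : Params, P.α = α → P.β = 1 → 0 < P.νh → 0 < P.ν3 →
      P.νeff = 1 → ∀ r : ℝ, 0 < r → r * (1 + |P.ω|) ^ 4 ≤ κ →
      ∃ (n : Fin 4 → ℂ) (δ : Fin 4 → ℝ), (∀ j, 0 < δ j) ∧
        (∀ j k, j ≠ k → 3 * δ j ≤ ‖n j - n k‖) ∧
        ∀ ξ : Freq, ‖ξ‖ ≤ r → ∃ m : Fin 4 → ℂ,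
          charPoly P ξ = Polynomial.C (-(Real.sin α : ℂ) ^ 2) * ∏ j, (X - Polynomial.C (m j)) ∧
          (∀ j, ‖m j - n j‖ ≤ δ j) ∧
          (∀ j, c ≤ ∏ k ∈ Finset.univ.erase j, ‖m j - m k‖) ∧
          c / (1 + |P.ω|) ^ 4 ≤ (m 1).re ∧ c / (1 + |P.ω|) ^ 4 ≤ (m 2).re ∧
          (m 3).re ≤ -(c / (1 + |P.ω|) ^ 4) ∧
          (ξ 1 ≠ 0 → (m 0).re < 0) ∧
          ‖(Real.cos α * Complex.I * ξ 0 + Real.sin α * m 0 : ℂ)‖ ≤ C * (1 + |P.ω|) * r ^ 2 ∧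
          ‖-(Real.sin α : ℂ) ^ 2 * ((m 0 - m 1) * (m 0 - m 2) * (m 0 - m 3)) - Real.sin α‖
            ≤ C * (1 + |P.ω|) * r := by
  have hs : Real.sin α < 0 := Real.sin_neg_of_neg_of_neg_pi_lt hα.2 (by linarith [hα.1, Real.pi_pos])
  have hc : 0 < Real.cos α := Real.cos_pos_of_mem_Ioo ⟨hα.1, by linarith [hα.2, Real.pi_pos]⟩
  obtain ⟨σ, hσdef⟩ : ∃ σ, σ = -Real.sin α := ⟨_, rfl⟩
  have hσ : 0 < σ := by linarith
  have hσ1 : σ ≤ 1 := by linarith [Real.neg_one_le_sin α]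
  have hsσ : (Real.sin α : ℂ) = -σ := by rw [hσdef]; simp
  obtain ⟨N, hN⟩ : ∃ x : ℝ, x = 1 / Real.sin α ^ 2 + 1 / Real.cos α ^ 2 := ⟨_, rfl⟩
  have hs2 : 0 < Real.sin α ^ 2 := by
    have := hs.ne
    positivity
  have hc2 : 0 < Real.cos α ^ 2 := by positivity
  have hN0 : 0 < N := by rw [hN]; positivity
  obtain ⟨Cp, hCp⟩ : ∃ x : ℝ, x = 4 + 6 * N := ⟨_, rfl⟩
  have hCp0 : 0 < Cp := by rw [hCp]; positivity
  obtain ⟨c0, hc0⟩ : ∃ x : ℝ, x = σ ^ 2 / 32 := ⟨_, rfl⟩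
  have hc00 : 0 < c0 := by rw [hc0]; positivity
  obtain ⟨C2, hC2⟩ : ∃ x : ℝ, x = 27 / 8 * (Cp / c0) + 1 := ⟨_, rfl⟩
  have hC20 : 0 < C2 := by rw [hC2]; positivity
  obtain ⟨c3, hc3⟩ : ∃ x : ℝ, x = σ ^ 5 / 32 := ⟨_, rfl⟩
  have hc30 : 0 < c3 := by rw [hc3]; positivity
  obtain ⟨κ, hκ⟩ : ∃ x : ℝ, x = min (min 1 (σ ^ 2 * c0 ^ 4 / (12 ^ 4 * Cp)))
    (min (c3 / (2 * C2)) (σ / (2 * (2 * C2 + 40 * N * C2 ^ 3)))) := ⟨_, rfl⟩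
  have hκ0 : 0 < κ := by rw [hκ]; positivity
  have hκ1 : κ ≤ 1 := hκ.le.trans <| (min_le_left _ _).trans (min_le_left _ _)
  have hκ2 : κ ≤ σ ^ 2 * c0 ^ 4 / (12 ^ 4 * Cp) := hκ.le.trans <| (min_le_left _ _).trans (min_le_right _ _)
  have hκ3 : κ ≤ c3 / (2 * C2) := hκ.le.trans <| (min_le_right _ _).trans (min_le_left _ _)
  have hκ4 : κ ≤ σ / (2 * (2 * C2 + 40 * N * C2 ^ 3)) :=
    hκ.le.trans <| (min_le_right _ _).trans (min_le_right _ _)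
  -- The four constraints on `κ` are used, in this order, for `r ≤ 1`, for the smallness of `p(nⱼ)`
  -- required by `exists_roots_near`, for the perturbation of the real parts, and for the sign of
  -- the real part of the small root.
  refine ⟨κ, (2 * C2 ^ 2 + 25 * N * C2 ^ 4) + 3 * (2 * C2) * (1 / σ + 2 * C2) ^ 2,
    min (c0 / (27 * σ ^ 2)) (c3 / 2), hκ0, by positivity, by positivity, ?_⟩
  intro P hPα hβ hνh hν3 hν r hr hrW
  obtain ⟨W, hWdef⟩ : ∃ W, W = 1 + |P.ω| := ⟨_, rfl⟩
  have hW : 1 ≤ W := by rw [hWdef]; linarith [abs_nonneg P.ω]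
  have hWpos : 0 < W := by linarith
  have hωW : |P.ω| ≤ W := by rw [hWdef]; linarith
  rw [← hWdef] at hrW
  have hW4 : W ≤ W ^ 4 := le_self_pow₀ hW (by norm_num)
  have hrWκ : r * W ≤ κ := (mul_le_mul_of_nonneg_left hW4 hr.le).trans hrW
  have hrκ : r ≤ κ := by nlinarith
  have hr1 : r ≤ 1 := hrκ.trans hκ1
  have hωr : |P.ω| * r ≤ 1 := by nlinarith
  -- The normalization `ν_h s² + ν₃ c² = 1` bounds both viscosities in terms of the slope.
  have hNν : P.νh + P.ν3 ≤ N := by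
    have h1 : P.νh * Real.sin α ^ 2 + P.ν3 * Real.cos α ^ 2 = 1 := by rw [← hPα]; exact hν
    have h2 : P.νh ≤ 1 / Real.sin α ^ 2 := by
      rw [le_div_iff₀ hs2]; nlinarith
    have h3 : P.ν3 ≤ 1 / Real.cos α ^ 2 := by
      rw [le_div_iff₀ hc2]; nlinarith
    linarith
  obtain ⟨n, n0, nroot, nle, nder, nprod, re1, re2, re3⟩ := exists_nodes hσ hσ1 P.ω
  rw [← hWdef] at nle re1 re2 re3
  set δ : Fin 4 → ℝ := fun j => c0 * (1 + ‖n j‖) ^ 3 / (12 * W) with hδ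
  rw [← hc3] at re1 re2 re3
  rw [← hc0] at nder
  have hT : ∀ j, 1 ≤ (1 + ‖n j‖) ^ 3 := fun j =>
    one_le_pow₀ (by linarith [norm_nonneg (n j)])
  have hδ0 : ∀ j, 0 < δ j := fun j => by
    have := hT j
    simp only [hδ]; positivity
  have hsep : ∀ j k, j ≠ k → 3 * δ j ≤ ‖n j - n k‖ := fun j k hjk =>
    by simpa only [hδ, hc0] using nodes_separated hσ hW nle (by rw [← hc0]; exact nder) hjk
  refine ⟨n, δ, hδ0, hsep, ?_⟩
  intro ξ hξ
  have hlead4 : (charPoly P ξ).coeff 4 = -(Real.sin α : ℂ) ^ 2 := by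
    rw [coeff_charPoly, hν, hPα]; simp
  have hsin0 : -(Real.sin α : ℂ) ^ 2 ≠ 0 := by
    rw [neg_ne_zero]; exact pow_ne_zero _ (by exact_mod_cast hs.ne)
  have hdeg : (charPoly P ξ).natDegree = 4 := by
    refine le_antisymm (natDegree_charPoly_le P ξ) (le_natDegree_of_ne_zero ?_)
    rw [hlead4]; exact hsin0
  have hlead : (charPoly P ξ).leadingCoeff = -(Real.sin α : ℂ) ^ 2 := by
    rw [leadingCoeff, hdeg, hlead4]
  have hleadn : ‖(charPoly P ξ).leadingCoeff‖ = σ ^ 2 := by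
    rw [hlead, norm_neg, norm_pow, Complex.norm_real, Real.norm_eq_abs, sq_abs, hσdef]; ring
  -- The nodes are the roots at `ξ = 0`, so that `p(nⱼ)` is of order `r`.
  have hpert : ∀ j, ‖(charPoly P ξ).eval (n j)‖ ≤ Cp * r * (1 + ‖n j‖) ^ 3 := by
    intro j
    have h1 := norm_eval_charPoly_sub_le hβ hν hνh.le hν3.le hNν hr1 hωr hξ (n j)
    have h2 : Complex.I * P.ω * n j ^ 2 + Real.sin P.α * n j
      - (Real.sin P.α : ℂ) ^ 2 * n j ^ 4 = 0 := by
      rw [hPα, hsσ, ← nroot j]; ring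
    rwa [h2, sub_zero, ← hCp] at h1
  have hval : ∀ j, ‖(charPoly P ξ).eval (n j)‖
      ≤ ‖(charPoly P ξ).leadingCoeff‖ * δ j ^ 4 := by
    intro j
    refine (hpert j).trans ?_
    rw [hleadn]
    have h1 : r ≤ σ ^ 2 * c0 ^ 4 / (12 ^ 4 * Cp) / W ^ 4 := by
      rw [le_div_iff₀ (by positivity)]; exact hrW.trans hκ2
    calc Cp * r * (1 + ‖n j‖) ^ 3
        ≤ Cp * (σ ^ 2 * c0 ^ 4 / (12 ^ 4 * Cp) / W ^ 4) * ((1 + ‖n j‖) ^ 3) ^ 4 := by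
          have h5 : (1 + ‖n j‖) ^ 3 ≤ ((1 + ‖n j‖) ^ 3) ^ 4 :=
            le_self_pow₀ (hT j) (by norm_num)
          gcongr
      _ = σ ^ 2 * δ j ^ 4 := by
          simp only [hδ]; field_simp
  obtain ⟨m, hm, hmδ⟩ := exists_roots_near hdeg hδ0 hsep hval
  rw [hlead] at hm
  have hroot : (charPoly P ξ).eval (m 0) = 0 := by
    rw [hm, eval_mul, eval_prod, Finset.prod_eq_zero (Finset.mem_univ 0), mul_zero]
    simp
  -- The roots are at distance `O(r)` of the nodes, with a constant that does not depend on `ω`: the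
  -- weight `(1 + ‖nⱼ‖)³` occurs both in the perturbation and in the derivative.
  have hclose : ∀ j, ‖m j - n j‖ ≤ C2 * r := by
    intro j
    have h1 := (norm_root_sub_le hm hsep hmδ j).trans (hpert j)
    rw [← hlead, hleadn] at h1
    have h2 : 8 / 27 * (c0 * (1 + ‖n j‖) ^ 3) * ‖m j - n j‖ ≤ Cp * r * (1 + ‖n j‖) ^ 3 := by
      refine le_trans ?_ h1
      have := nder j
      gcongr
    have h3 : c0 * ‖m j - n j‖ ≤ 27 / 8 * Cp * r := by
      have hTp : 0 < (1 + ‖n j‖) ^ 3 := by linarith [hT j]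
      have : (c0 * ‖m j - n j‖) * (1 + ‖n j‖) ^ 3 ≤ (27 / 8 * Cp * r) * (1 + ‖n j‖) ^ 3 := by
        linarith
      exact le_of_mul_le_mul_right this hTp
    calc ‖m j - n j‖ ≤ (27 / 8 * Cp * r) / c0 := by rw [le_div_iff₀ hc00]; linarith
      _ = 27 / 8 * (Cp / c0) * r := by ring
      _ ≤ C2 * r := by rw [hC2]; nlinarith
  have hm0 : ‖m 0‖ ≤ C2 * r := by
    have := hclose 0
    rwa [n0, sub_zero] at this
  have hC21 : 1 ≤ C2 := by rw [hC2]; linarith [show 0 < 27 / 8 * (Cp / c0) by positivity]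
  have hξ' : ‖ξ‖ ≤ C2 * r := by nlinarith
  have hcre : C2 * r ≤ c3 / W ^ 4 / 2 := by
    rw [div_div, le_div_iff₀ (by positivity)]
    have h1 : r * W ^ 4 ≤ c3 / (2 * C2) := hrW.trans hκ3
    rw [le_div_iff₀ (by positivity)] at h1
    linarith
  have hmin1 : min (c0 / (27 * σ ^ 2)) (c3 / 2) / W ^ 4 ≤ c3 / W ^ 4 / 2 := by
    rw [div_right_comm c3]
    gcongr
    exact min_le_right _ _
  have hrediff : ∀ j, |(m j).re - (n j).re| ≤ c3 / W ^ 4 / 2 := by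
    intro j
    rw [← Complex.sub_re]
    exact (Complex.abs_re_le_norm _).trans ((hclose j).trans hcre)
  refine ⟨m, hm, hmδ, ?_, ?_, ?_, ?_, ?_, ?_, ?_⟩
  · intro j
    refine le_trans ?_ (prod_norm_root_sub_ge hsep hmδ j)
    refine (min_le_left _ _).trans ?_
    have h1 : c0 * (1 + ‖n j‖) ^ 3 ≤ σ ^ 2 * ∏ k ∈ Finset.univ.erase j, ‖n j - n k‖ := nder j
    rw [div_le_iff₀ (by positivity)]
    have h2 : c0 * 1 ≤ c0 * (1 + ‖n j‖) ^ 3 := by gcongr; exact hT j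
    rw [mul_one] at h2
    exact (h2.trans h1).trans (le_of_eq (by ring))
  · rw [← hWdef]
    linarith [abs_le.mp (hrediff 1)]
  · rw [← hWdef]
    linarith [abs_le.mp (hrediff 2)]
  · rw [← hWdef]
    linarith [abs_le.mp (hrediff 3)]
  · intro hξ1
    refine re_small_root_neg hβ hνh hν3.le hNν hξ' hξ1 hm0 hroot ?_
    rw [hPα, ← hσdef]
    have h1 : r * W ≤ σ / (2 * (2 * C2 + 40 * N * C2 ^ 3)) := hrWκ.trans hκ4
    rw [le_div_iff₀ (by positivity)] at h1
    have h2 : r ^ 3 ≤ r * W := by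
      calc r ^ 3 = r * r ^ 2 := by ring
        _ ≤ r * W := by gcongr; nlinarith
    have h3 : 2 * (C2 * r) * |P.ω| ≤ 2 * C2 * (r * W) := by
      calc 2 * (C2 * r) * |P.ω| ≤ 2 * (C2 * r) * W := by gcongr
        _ = _ := by ring
    have h4 : 40 * N * (C2 * r) ^ 3 ≤ 40 * N * C2 ^ 3 * (r * W) := by
      calc 40 * N * (C2 * r) ^ 3 = 40 * N * C2 ^ 3 * r ^ 3 := by ring
        _ ≤ _ := by gcongr
    linarith
  · rw [← hWdef, ← hPα]
    refine (norm_small_root_sub_le hβ hνh.le hν3.le hNν hξ' hm0 hroot).trans ?_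
    have h2 : r ^ 4 ≤ W * r ^ 2 := by
      calc r ^ 4 = r ^ 2 * r ^ 2 := by ring
        _ ≤ W * r ^ 2 := by gcongr; nlinarith
    have h3 : 2 * |P.ω| * (C2 * r) ^ 2 ≤ 2 * C2 ^ 2 * (W * r ^ 2) := by
      calc 2 * |P.ω| * (C2 * r) ^ 2 ≤ 2 * W * (C2 * r) ^ 2 := by gcongr
        _ = _ := by ring
    have h4 : 25 * N * (C2 * r) ^ 4 ≤ 25 * N * C2 ^ 4 * (W * r ^ 2) := by
      calc 25 * N * (C2 * r) ^ 4 = 25 * N * C2 ^ 4 * r ^ 4 := by ring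
        _ ≤ _ := by gcongr
    have h5 : 0 ≤ 3 * (2 * C2) * (1 / σ + 2 * C2) ^ 2 * (W * r ^ 2) := by positivity
    linarith
  · rw [← hWdef]
    have hsqW : 1 ≤ √W := Real.one_le_sqrt.mpr hW
    have h1 := norm_triple_prod_sub_le (a := fun i => m 0 - m i.succ) (b := fun i => -n i.succ)
      (d := 2 * (C2 * r)) (M := (1 / σ + 2 * C2) * √W) (fun i => ?_) (fun i => ?_) (fun i => ?_)
    · have h2 : -(Real.sin α : ℂ) ^ 2 * ((m 0 - m 1) * (m 0 - m 2) * (m 0 - m 3)) - Real.sin α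
          = -(Real.sin α : ℂ) ^ 2 * ((m 0 - m 1) * (m 0 - m 2) * (m 0 - m 3)
            - (-n 1) * (-n 2) * (-n 3)) := by
        rw [hsσ]; linear_combination nprod
      rw [h2, norm_mul, ← hlead, hleadn]
      have h3 : ((1 / σ + 2 * C2) * √W) ^ 2 = (1 / σ + 2 * C2) ^ 2 * W := by
        rw [mul_pow, Real.sq_sqrt hWpos.le]
      rw [h3] at h1
      calc σ ^ 2 * _ ≤ 1 * (3 * (2 * (C2 * r)) * ((1 / σ + 2 * C2) ^ 2 * W)) := by
            gcongr
            · exact pow_le_one₀ hσ.le hσ1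
            · exact h1
        _ = 3 * (2 * C2) * (1 / σ + 2 * C2) ^ 2 * (W * r) := by ring
        _ ≤ _ := by
            have h5 : 0 ≤ (2 * C2 ^ 2 + 25 * N * C2 ^ 4) * (W * r) := by positivity
            linarith
    · calc ‖(m 0 - m i.succ) - -n i.succ‖ = ‖m 0 - (m i.succ - n i.succ)‖ := by congr 1; ring
        _ ≤ _ := norm_sub_le _ _
        _ ≤ _ := by linarith [hclose i.succ]
    · have h6 : ‖m i.succ‖ ≤ √W / σ + C2 * r := by
        calc ‖m i.succ‖ = ‖n i.succ + (m i.succ - n i.succ)‖ := by congr 1; ring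
          _ ≤ _ := norm_add_le _ _
          _ ≤ _ := by linarith [hclose i.succ, nle i.succ]
      refine (norm_sub_le _ _).trans ?_
      have h7 : C2 * r ≤ C2 * √W := by gcongr; linarith
      calc _ ≤ C2 * √W + (√W / σ + C2 * √W) := by linarith
        _ = _ := by ring
    · rw [norm_neg]
      refine (nle i.succ).trans ?_
      have : 0 ≤ 2 * C2 * √W := by positivity
      calc √W / σ ≤ √W / σ + 2 * C2 * √W := by linarith
        _ = _ := by ring

end CharPoly

/-! ### Families of characteristic roots -/

section CharPoly

open Polynomial

/-- Roots confined to fixed disjoint discs depend continuously on a parameter: a cluster value of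
`μ j` at `x₀` is a root of `p x₀` in the closed disc `j`, which contains no other root than
`μ j x₀`. -/
theorem continuousOn_root {X : Type*} [TopologicalSpace X] {S : Set X} {p : X → ℂ[X]} {a : ℂ}
    (ha : a ≠ 0) {μ : Fin 4 → X → ℂ} {n : Fin 4 → ℂ} {δ : Fin 4 → ℝ} (hδ : ∀ j, 0 < δ j)
    (hsep : ∀ j k, j ≠ k → 3 * δ j ≤ ‖n j - n k‖)
    (hp : ∀ x ∈ S, p x = Polynomial.C a * ∏ j, (Polynomial.X - Polynomial.C (μ j x)))
    (hμ : ∀ x ∈ S, ∀ j, ‖μ j x - n j‖ ≤ δ j)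
    (hcont : Continuous fun q : X × ℂ => (p q.1).eval q.2) (j : Fin 4) :
    ContinuousOn (μ j) S := by
  intro x₀ hx₀
  refine (isCompact_closedBall (n j) (δ j)).tendsto_nhds_of_unique_mapClusterPt ?_ ?_
  · filter_upwards [self_mem_nhdsWithin] with x hx
    rw [Metric.mem_closedBall, dist_eq_norm]
    exact hμ x hx j
  · intro y hy hcl
    rw [mapClusterPt_iff_ultrafilter] at hcl
    obtain ⟨U, hU, hUy⟩ := hcl
    have h1 : Tendsto (fun x => (p x).eval (μ j x)) U (𝓝 ((p x₀).eval y)) := by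
      have h2 : Tendsto (fun x => (x, μ j x)) U (𝓝 (x₀, y)) :=
        (tendsto_id'.mpr (hU.trans nhdsWithin_le_nhds)).prodMk_nhds hUy
      exact (hcont.tendsto (x₀, y)).comp h2
    have h3 : (fun x => (p x).eval (μ j x)) =ᶠ[U] fun _ => (0 : ℂ) := by
      have : S ∈ (U : Filter X) := hU self_mem_nhdsWithin
      filter_upwards [this] with x hx
      rw [hp x hx, eval_mul, eval_prod, Finset.prod_eq_zero (Finset.mem_univ j), mul_zero]
      simp
    have h4 : (p x₀).eval y = 0 := tendsto_nhds_unique (h1.congr' h3) tendsto_const_nhds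
    rw [hp x₀ hx₀, eval_mul, eval_C, eval_prod] at h4
    obtain ⟨k, -, hk⟩ := Finset.prod_eq_zero_iff.mp ((mul_eq_zero.mp h4).resolve_left ha)
    rw [eval_sub, eval_X, eval_C, sub_eq_zero] at hk
    by_cases hjk : j = k
    · rw [hjk]; exact hk
    · exfalso
      have h5 := hsep j k hjk
      have h6 := hsep k j (Ne.symm hjk)
      rw [norm_sub_rev] at h6
      have h7 := hμ x₀ hx₀ k
      rw [← hk] at h7
      rw [Metric.mem_closedBall, dist_eq_norm] at hy
      have h8 : ‖n j - n k‖ ≤ ‖y - n k‖ + ‖y - n j‖ := by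
        calc ‖n j - n k‖ = ‖(y - n k) - (y - n j)‖ := by congr 1; ring
          _ ≤ _ := norm_sub_le _ _
      linarith [hδ j, hδ k]

theorem continuous_eval_charPoly (P : Params) :
    Continuous fun q : Freq × ℂ => (charPoly P q.1).eval q.2 := by
  simp only [eval_charPoly]
  fun_prop

/-- The inverse length scale `(β / ν_eff)^(1/3)` of the boundary layers. -/
def layerScale (P : Params) : ℝ := (P.β / P.νeff) ^ (1 / 3 : ℝ)

/-- The parameters in units in which `β = ν_eff = 1`. -/
def normalizedParams (P : Params) : Params where
  α := P.α
  ω := P.ω * layerScale P / P.β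
  β := 1
  νh := P.νh / P.νeff
  ν3 := P.ν3 / P.νeff

variable {P : Params}

theorem νeff_pos (hh : 0 < P.νh) (h3 : 0 < P.ν3) : 0 < P.νeff := by
  unfold Params.νeff
  have h := Real.sin_sq_add_cos_sq P.α
  rcases eq_or_lt_of_le (sq_nonneg (Real.sin P.α)) with h1 | h1
  · rw [← h1] at h ⊢
    have : Real.cos P.α ^ 2 = 1 := by linarith
    rw [this]; linarith
  · positivity

theorem layerScale_pos (hβ : 0 < P.β) (hν : 0 < P.νeff) : 0 < layerScale P := by
  unfold layerScale; positivity

theorem layerScale_pow_three (hβ : 0 < P.β) (hν : 0 < P.νeff) :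
    P.νeff * layerScale P ^ 3 = P.β := by
  have : layerScale P ^ 3 = P.β / P.νeff := by
    rw [layerScale, ← Real.rpow_natCast, ← Real.rpow_mul (by positivity)]
    norm_num
  rw [this]; field_simp

/-- With the layer scale `L` as the unit of frequencies and roots, `β` and `ν_eff` become `1`. -/
theorem charPoly_eq_normalized (hβ : 0 < P.β) (hν : 0 < P.νeff) (ξ : Freq) :
    charPoly P ξ = Polynomial.C ((P.β * layerScale P : ℝ) : ℂ) *
      (charPoly (normalizedParams P) ((layerScale P)⁻¹ • ξ)).comp
        (Polynomial.C (((layerScale P)⁻¹ : ℝ) : ℂ) * X) := by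
  have hL := layerScale_pos hβ hν
  have h3 := layerScale_pow_three hβ hν
  set L := layerScale P with hLdef
  apply Polynomial.funext
  intro m
  have hLc : (L : ℂ) ≠ 0 := by exact_mod_cast hL.ne'
  have hβc : (P.β : ℂ) ≠ 0 := by exact_mod_cast hβ.ne'
  have hνc : (P.νeff : ℂ) ≠ 0 := by exact_mod_cast hν.ne'
  have h3c : (P.β : ℂ) = (P.νeff : ℂ) * (L : ℂ) ^ 3 := by exact_mod_cast h3.symm
  rw [eval_mul, eval_C, eval_comp, eval_mul, eval_C, eval_X, eval_charPoly, eval_charPoly]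
  have e1 : ((L⁻¹ • ξ : Freq) 0 : ℝ) = L⁻¹ * ξ 0 := rfl
  have e2 : ((L⁻¹ • ξ : Freq) 1 : ℝ) = L⁻¹ * ξ 1 := rfl
  have e3 : ‖(L⁻¹ • ξ : Freq)‖ ^ 2 = (L⁻¹) ^ 2 * ‖ξ‖ ^ 2 := by
    rw [norm_smul, mul_pow, Real.norm_eq_abs, sq_abs]
  rw [e1, e2, e3]
  simp only [normalizedParams, ← hLdef, Complex.ofReal_mul, Complex.ofReal_inv,
    Complex.ofReal_div, Complex.ofReal_pow, Complex.ofReal_one]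
  generalize (Real.cos P.α : ℂ) = c
  generalize (Real.sin P.α : ℂ) = s
  rw [h3c] at hβc ⊢
  field_simp

theorem νeff_normalized (hν : 0 < P.νeff) : (normalizedParams P).νeff = 1 := by
  have e : (normalizedParams P).νeff = P.νeff / P.νeff := by
    change P.νh / P.νeff * Real.sin P.α ^ 2 + P.ν3 / P.νeff * Real.cos P.α ^ 2 = _
    nth_rewrite 3 [Params.νeff]
    ring
  rw [e, div_self hν.ne']

/-- The normalized forcing frequency `|ω| β^(-2/3) ν_eff^(-1/3)`, plus one. -/
def freqWeight (P : Params) : ℝ := 1 + |P.ω| * layerScale P / P.β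

/-- A measurable labelling `μ₀, …, μ₃` of the characteristic roots at the frequencies `|ξ| ≤ R`.
The root `μ₀` is the one that is close to the root `-iξ_x cot α` of the Sverdrup operator, the
other ones have real parts at least of the order of the boundary layer scale. The lower bound
`deriv_ge` on the derivative of the characteristic polynomial at its roots is what controls the
coefficients of the Green function, and `deriv_zero_near` identifies this derivative at `μ₀`. -/
structure IsRootFamily (P : Params) (R c C : ℝ) (μ : Fin 4 → Freq → ℂ) : Prop where
  measurable : ∀ j, Measurable (μ j)
  bounded : ∃ M, ∀ ξ : Freq, ‖ξ‖ ≤ R → ∀ j, ‖μ j ξ‖ ≤ M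
  separated : ∃ g, 0 < g ∧ ∀ ξ : Freq, ‖ξ‖ ≤ R → ∀ j k, j ≠ k → g ≤ ‖μ j ξ - μ k ξ‖
  factor : ∀ ξ : Freq, ‖ξ‖ ≤ R → charPoly P ξ =
    Polynomial.C (-((P.νeff : ℂ) * (Real.sin P.α : ℂ) ^ 2)) * ∏ j, (X - Polynomial.C (μ j ξ))
  deriv_ge : ∀ ξ : Freq, ‖ξ‖ ≤ R → ∀ j,
    c * P.β ≤ P.νeff * Real.sin P.α ^ 2 * ∏ k ∈ Finset.univ.erase j, ‖μ j ξ - μ k ξ‖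
  re_one : ∀ ξ : Freq, ‖ξ‖ ≤ R → c * layerScale P / freqWeight P ^ 4 ≤ (μ 1 ξ).re
  re_two : ∀ ξ : Freq, ‖ξ‖ ≤ R → c * layerScale P / freqWeight P ^ 4 ≤ (μ 2 ξ).re
  re_three : ∀ ξ : Freq, ‖ξ‖ ≤ R → (μ 3 ξ).re ≤ -(c * layerScale P / freqWeight P ^ 4)
  re_zero : ∀ ξ : Freq, ‖ξ‖ ≤ R → ξ 1 ≠ 0 → (μ 0 ξ).re < 0
  zero_near : ∀ ξ : Freq, ‖ξ‖ ≤ R →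
    ‖(Real.cos P.α * Complex.I * ξ 0 + Real.sin P.α * μ 0 ξ : ℂ)‖
      ≤ C * freqWeight P * R ^ 2 / layerScale P
  deriv_zero_near : ∀ ξ : Freq, ‖ξ‖ ≤ R →
    ‖-((P.νeff : ℂ) * (Real.sin P.α : ℂ) ^ 2) *
        ((μ 0 ξ - μ 1 ξ) * (μ 0 ξ - μ 2 ξ) * (μ 0 ξ - μ 3 ξ)) - P.β * Real.sin P.α‖
      ≤ P.β * (C * freqWeight P * (R / layerScale P))

/-- Root families exist, with constants that only depend on the slope, as soon as `R / L ≪ (1 +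
|ω| L / β)⁻⁴`, where `L` is the layer scale. The labelling is measurable since each root is
confined to a disc that does not depend on `ξ`. -/
theorem exists_isRootFamily {α : ℝ} (hα : α ∈ Ioo (-(Real.pi / 2)) 0) :
    ∃ κ C c : ℝ, 0 < κ ∧ 0 < C ∧ 0 < c ∧ ∀ P : Params, P.α = α → 0 < P.β → 0 < P.νh → 0 < P.ν3 →
      ∀ R : ℝ, 0 < R → R / layerScale P * freqWeight P ^ 4 ≤ κ →
        ∃ μ : Fin 4 → Freq → ℂ, IsRootFamily P R c C μ := by
  have hs : Real.sin α < 0 :=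
    Real.sin_neg_of_neg_of_neg_pi_lt hα.2 (by linarith [hα.1, Real.pi_pos])
  have hs2 : 0 < Real.sin α ^ 2 := by
    have := hs.ne
    positivity
  obtain ⟨κ, C, c, hκ, hC, hc, h⟩ := normalized_roots hα
  refine ⟨κ, C, min c (c * Real.sin α ^ 2), hκ, hC, by positivity, ?_⟩
  intro P hPα hβ hνh hν3 R hR hreg
  have hν := νeff_pos hνh hν3
  have hL := layerScale_pos hβ hν
  have hL3 := layerScale_pow_three hβ hν
  have hscale := charPoly_eq_normalized hβ hν
  have hW : 1 + |(normalizedParams P).ω| = freqWeight P := by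
    simp only [normalizedParams, freqWeight]
    rw [abs_div, abs_mul, abs_of_pos hL, abs_of_pos hβ]
  have hW0 : 0 < freqWeight P := by
    rw [← hW]; positivity
  obtain ⟨n, δ, hδ, hsep, hm⟩ := h (normalizedParams P) hPα rfl (div_pos hνh hν)
    (div_pos hν3 hν) (νeff_normalized hν) (R / layerScale P) (by positivity) (by rw [hW]; exact hreg)
  rw [hW] at hm
  set L := layerScale P with hLdef
  have hξ : ∀ ξ : Freq, ‖ξ‖ ≤ R → ‖(L⁻¹ • ξ : Freq)‖ ≤ R / L := by
    intro ξ h1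
    rw [norm_smul, Real.norm_eq_abs, abs_of_pos (by positivity), div_eq_inv_mul]
    gcongr
  choose! m hm1 hm2 hm3 hm4 hm5 hm6 hm7 hm8 hm9 using fun ξ (h1 : ‖ξ‖ ≤ R) => hm _ (hξ ξ h1)
  have hLc : (L : ℂ) ≠ 0 := by exact_mod_cast hL.ne'
  have hL3c : (P.νeff : ℂ) * (L : ℂ) ^ 3 = P.β := by exact_mod_cast hL3
  let μ : Fin 4 → Freq → ℂ := fun j ξ => if ‖ξ‖ ≤ R then L * m ξ j else 0
  have hμ : ∀ ξ : Freq, ‖ξ‖ ≤ R → ∀ j, μ j ξ = L * m ξ j := fun ξ h1 j => if_pos h1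
  have hfac : ∀ ξ : Freq, ‖ξ‖ ≤ R → charPoly P ξ =
      Polynomial.C (-((P.νeff : ℂ) * (Real.sin P.α : ℂ) ^ 2)) *
        ∏ j, (X - Polynomial.C (μ j ξ)) := by
    intro ξ h1
    apply Polynomial.funext
    intro z
    rw [hscale, hm1 ξ h1]
    simp only [eval_mul, eval_comp, eval_C, eval_X, eval_sub, hμ ξ h1,
      Fin.prod_univ_four]
    rw [hPα, Complex.ofReal_mul, ← hL3c, Complex.ofReal_inv]
    field_simp
  have hlead : -((P.νeff : ℂ) * (Real.sin P.α : ℂ) ^ 2) ≠ 0 := by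
    rw [neg_ne_zero, hPα]
    exact mul_ne_zero (by exact_mod_cast hν.ne') (pow_ne_zero _ (by exact_mod_cast hs.ne))
  have hdist : ∀ ξ : Freq, ‖ξ‖ ≤ R → ∀ j k, ‖μ j ξ - μ k ξ‖ = L * ‖m ξ j - m ξ k‖ := by
    intro ξ h1 j k
    rw [hμ ξ h1, hμ ξ h1, ← mul_sub, norm_mul, Complex.norm_real, Real.norm_eq_abs, abs_of_pos hL]
  have hball : ∀ ξ ∈ Metric.closedBall (0 : Freq) R, ‖ξ‖ ≤ R := fun ξ h1 => by
    simpa using h1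
  have hLδ : ∀ ξ : Freq, ‖ξ‖ ≤ R → ∀ j, ‖μ j ξ - L * n j‖ ≤ L * δ j := by
    intro ξ h1 j
    rw [hμ ξ h1, ← mul_sub, norm_mul, Complex.norm_real, Real.norm_eq_abs, abs_of_pos hL]
    have := hm2 ξ h1 j
    gcongr
  have hLsep : ∀ j k, j ≠ k → 3 * (L * δ j) ≤ ‖L * n j - L * n k‖ := by
    intro j k hjk
    rw [← mul_sub, norm_mul, Complex.norm_real, Real.norm_eq_abs, abs_of_pos hL]
    nlinarith [hsep j k hjk]
  have hre : ∀ z : ℂ, ((L : ℂ) * z).re = L * z.re := fun z => Complex.re_ofReal_mul L z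
  have hrate : min c (c * Real.sin α ^ 2) * L / freqWeight P ^ 4
      ≤ L * (c / freqWeight P ^ 4) := by
    have : min c (c * Real.sin α ^ 2) ≤ c := min_le_left _ _
    calc _ ≤ c * L / freqWeight P ^ 4 := by gcongr
      _ = _ := by ring
  refine ⟨μ, ?_, ?_, ?_, hfac, ?_, ?_, ?_, ?_, ?_, ?_, ?_⟩
  · intro j
    have hcont := continuousOn_root (S := Metric.closedBall (0 : Freq) R) hlead
      (fun j => mul_pos hL (hδ j)) hLsep (fun x hx => hfac x (hball x hx))
      (fun x hx => hLδ x (hball x hx)) (continuous_eval_charPoly P) j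
    have : μ j = (Metric.closedBall (0 : Freq) R).indicator (μ j) := by
      funext ξ
      by_cases h1 : ‖ξ‖ ≤ R
      · rw [indicator_of_mem (by simpa using h1)]
      · rw [indicator_of_notMem (by simpa using h1)]
        exact if_neg h1
    rw [this]
    classical
    rw [← piecewise_eq_indicator]
    exact hcont.measurable_piecewise continuousOn_const Metric.isClosed_closedBall.measurableSet
  · refine ⟨∑ j, (‖(L : ℂ) * n j‖ + L * δ j), fun ξ h1 j => ?_⟩
    have h2 : ‖μ j ξ‖ ≤ ‖(L : ℂ) * n j‖ + L * δ j := by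
      calc ‖μ j ξ‖ = ‖L * n j + (μ j ξ - L * n j)‖ := by congr 1; ring
        _ ≤ _ := norm_add_le _ _
        _ ≤ _ := by linarith [hLδ ξ h1 j]
    refine h2.trans ?_
    exact Finset.single_le_sum (f := fun j => ‖(L : ℂ) * n j‖ + L * δ j)
      (fun k _ => by have := hδ k; positivity) (Finset.mem_univ j)
  · obtain ⟨g, hg, hgle⟩ : ∃ g, 0 < g ∧ ∀ j, g ≤ L * δ j := by
      refine ⟨Finset.univ.inf' Finset.univ_nonempty (fun j => L * δ j), ?_, fun j => ?_⟩
      · rw [Finset.lt_inf'_iff]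
        exact fun j _ => mul_pos hL (hδ j)
      · exact Finset.inf'_le _ (Finset.mem_univ j)
    refine ⟨g, hg, fun ξ h1 j k hjk => ?_⟩
    have h2 := norm_root_sub_root_ge hLsep (hLδ ξ h1) hjk
    linarith [hgle j, hLsep j k hjk]
  · intro ξ h1 j
    simp only [hdist ξ h1]
    rw [Finset.prod_mul_distrib, Finset.prod_const, Finset.card_erase_of_mem (Finset.mem_univ j)]
    simp only [Finset.card_univ, Fintype.card_fin]
    have h2 := hm3 ξ h1 j
    rw [hPα]
    calc min c (c * Real.sin α ^ 2) * P.β ≤ c * Real.sin α ^ 2 * P.β := by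
          gcongr; exact min_le_right _ _
      _ = P.β * Real.sin α ^ 2 * c := by ring
      _ ≤ P.β * Real.sin α ^ 2 * ∏ k ∈ Finset.univ.erase j, ‖m ξ j - m ξ k‖ := by gcongr
      _ = _ := by rw [← hL3]; ring
  · intro ξ h1
    rw [hμ ξ h1, hre]
    exact hrate.trans (mul_le_mul_of_nonneg_left (hm4 ξ h1) hL.le)
  · intro ξ h1
    rw [hμ ξ h1, hre]
    exact hrate.trans (mul_le_mul_of_nonneg_left (hm5 ξ h1) hL.le)
  · intro ξ h1
    rw [hμ ξ h1, hre]
    have := mul_le_mul_of_nonneg_left (hm6 ξ h1) hL.le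
    rw [← hLdef]
    linarith
  · intro ξ h1 h2
    rw [hμ ξ h1, hre]
    have h3 : (L⁻¹ • ξ : Freq) 1 ≠ 0 := mul_ne_zero (by positivity) h2
    exact mul_neg_of_pos_of_neg hL (hm7 ξ h1 h3)
  · intro ξ h1
    have h2 := hm8 ξ h1
    have e1 : ((L⁻¹ • ξ : Freq) 0 : ℝ) = L⁻¹ * ξ 0 := rfl
    have e2 : (Real.cos P.α * Complex.I * ξ 0 + Real.sin P.α * μ 0 ξ : ℂ) = L *
        (Real.cos α * Complex.I * ((L⁻¹ • ξ : Freq) 0 : ℝ) + Real.sin α * m ξ 0) := by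
      rw [e1, hμ ξ h1, hPα, Complex.ofReal_mul, Complex.ofReal_inv]
      field_simp
    rw [e2, norm_mul, Complex.norm_real, Real.norm_eq_abs, abs_of_pos hL]
    calc _ ≤ L * (C * freqWeight P * (R / L) ^ 2) := by gcongr
      _ = C * freqWeight P * R ^ 2 / L := by field_simp
  · intro ξ h1
    have h2 := hm9 ξ h1
    have e2 : -((P.νeff : ℂ) * (Real.sin P.α : ℂ) ^ 2) *
        ((μ 0 ξ - μ 1 ξ) * (μ 0 ξ - μ 2 ξ) * (μ 0 ξ - μ 3 ξ)) - P.β * Real.sin P.α =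
        P.β * (-(Real.sin α : ℂ) ^ 2 * ((m ξ 0 - m ξ 1) * (m ξ 0 - m ξ 2) * (m ξ 0 - m ξ 3))
          - Real.sin α) := by
      simp only [hμ ξ h1]
      rw [hPα, ← hL3c]
      ring
    rw [e2, norm_mul, Complex.norm_real, Real.norm_eq_abs, abs_of_pos hβ]
    gcongr

end CharPoly

/-! ### Constant-coefficient operators on test functions of one variable -/

section OneVariable

open Polynomial

/-- Smooth compactly supported functions of the normal variable. -/
def testFun : Submodule ℂ (ℝ → ℂ) where
  carrier := {θ | ContDiff ℝ (⊤ : ℕ∞) θ ∧ HasCompactSupport θ}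
  add_mem' h₁ h₂ := ⟨h₁.1.add h₂.1, h₁.2.add h₂.2⟩
  zero_mem' := ⟨contDiff_const, HasCompactSupport.zero⟩
  smul_mem' a _ h := ⟨h.1.const_smul a, h.2.smul_left (f := fun _ => a)⟩

theorem testFun_differentiable (θ : testFun) : Differentiable ℝ (θ : ℝ → ℂ) :=
  θ.2.1.differentiable (by simp)

theorem testFun_continuous (θ : testFun) : Continuous (θ : ℝ → ℂ) := θ.2.1.continuous

theorem testFun_integrable (θ : testFun) : Integrable (θ : ℝ → ℂ) :=
  (testFun_continuous θ).integrable_of_hasCompactSupport θ.2.2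

/-- Differentiation of test functions. -/
def testDeriv : testFun →ₗ[ℂ] testFun where
  toFun θ := ⟨deriv θ, (contDiff_infty_iff_deriv.mp θ.2.1).2, θ.2.2.deriv⟩
  map_add' θ η := by
    ext z
    exact deriv_add (testFun_differentiable θ z) (testFun_differentiable η z)
  map_smul' a θ := by
    ext z
    exact deriv_const_smul a (testFun_differentiable θ z)

/-- The differential operator `p(∂)`; its transpose is `p(-∂)`. -/
def diffOp (p : ℂ[X]) : testFun →ₗ[ℂ] testFun := aeval testDeriv p

theorem hasDerivAt_testFun (θ : testFun) (z : ℝ) :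
    HasDerivAt (θ : ℝ → ℂ) ((testDeriv θ : ℝ → ℂ) z) z :=
  (testFun_differentiable θ z).hasDerivAt

theorem diffOp_mul (p q : ℂ[X]) (θ : testFun) : diffOp (p * q) θ = diffOp p (diffOp q θ) := by
  simp [diffOp]

theorem diffOp_X_sub_C_apply (μ : ℂ) (θ : testFun) (z : ℝ) :
    (diffOp (X - Polynomial.C μ) θ : ℝ → ℂ) z = (testDeriv θ : ℝ → ℂ) z - μ * (θ : ℝ → ℂ) z := by
  simp [diffOp]

/-- Test functions that vanish below `a`; this class is stable under differential operators. -/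
def VanishBelow (a : ℝ) (θ : ℝ → ℂ) : Prop := ∀ z < a, θ z = 0

theorem VanishBelow.testDeriv {a : ℝ} {θ : testFun} (h : VanishBelow a θ) :
    VanishBelow a (testDeriv θ : testFun) := by
  intro z hz
  have : (θ : ℝ → ℂ) =ᶠ[𝓝 z] fun _ => 0 := by
    filter_upwards [Iio_mem_nhds hz] with y hy using h y hy
  have h2 := this.deriv_eq
  rw [deriv_const] at h2
  exact h2

theorem VanishBelow.diffOp {a : ℝ} {θ : testFun} (h : VanishBelow a θ) (p : ℂ[X]) :
    VanishBelow a (diffOp p θ : testFun) := by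
  induction p using Polynomial.induction_on' with
  | add p q hp hq =>
    intro z hz
    have : QG3D.diffOp (p + q) θ = QG3D.diffOp p θ + QG3D.diffOp q θ := by
      simp [QG3D.diffOp]
    rw [this]
    change (QG3D.diffOp p θ : ℝ → ℂ) z + (QG3D.diffOp q θ : ℝ → ℂ) z = 0
    rw [hp z hz, hq z hz, add_zero]
  | monomial n c =>
    intro z hz
    have h1 : ∀ n : ℕ, VanishBelow a ((QG3D.testDeriv ^ n) θ : testFun) := by
      intro n
      induction n with
      | zero => simpa using h
      | succ n ih => rw [pow_succ']; exact ih.testDeriv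
    have : QG3D.diffOp (monomial n c) θ = c • (QG3D.testDeriv ^ n) θ := by
      simp [QG3D.diffOp, aeval_monomial]
    rw [this]
    change c • ((QG3D.testDeriv ^ n) θ : ℝ → ℂ) z = 0
    rw [h1 n z hz, smul_zero]

/-- Translation of a test function. -/
def testShift (q : ℝ) : testFun →ₗ[ℂ] testFun where
  toFun θ := ⟨fun z => (θ : ℝ → ℂ) (z - q), θ.2.1.comp (contDiff_id.sub contDiff_const),
    θ.2.2.comp_homeomorph (Homeomorph.subRight q)⟩
  map_add' _ _ := rfl
  map_smul' _ _ := rfl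

theorem testShift_apply (q : ℝ) (θ : testFun) (z : ℝ) :
    (testShift q θ : ℝ → ℂ) z = (θ : ℝ → ℂ) (z - q) := rfl

theorem diffOp_testShift (p : ℂ[X]) (q : ℝ) (θ : testFun) :
    diffOp p (testShift q θ) = testShift q (diffOp p θ) := by
  have h1 : testDeriv * testShift q = testShift q * testDeriv := by
    ext θ z
    change deriv (fun z => (θ : ℝ → ℂ) (z - q)) z = deriv (θ : ℝ → ℂ) (z - q)
    rw [deriv_comp_sub_const]
  have h2 : Commute (aeval testDeriv p) (testShift q) := by
    induction p using Polynomial.induction_on' with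
    | add p r hp hr => rw [map_add]; exact hp.add_left hr
    | monomial n c =>
      rw [aeval_monomial]
      have h3 : Commute (algebraMap ℂ (testFun →ₗ[ℂ] testFun) c) (testShift q) :=
        Algebra.commutes c _
      exact h3.mul_left (Commute.pow_left h1 n)
  exact LinearMap.congr_fun h2 θ

theorem hasDerivAt_exp_mul_testFun (μ : ℂ) (θ : testFun) (a z : ℝ) : HasDerivAt
    (fun z : ℝ => Complex.exp (-μ * ((z - a : ℝ) : ℂ)) * (θ : ℝ → ℂ) z)
    (Complex.exp (-μ * ((z - a : ℝ) : ℂ)) * (diffOp (X - Polynomial.C μ) θ : ℝ → ℂ) z) z := by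
  have h1 : HasDerivAt (fun z : ℝ => -μ * ((z - a : ℝ) : ℂ)) (-μ) z := by
    have := ((hasDerivAt_id z).sub_const a).ofReal_comp.const_mul (-μ)
    simpa using this
  refine (h1.cexp.mul (hasDerivAt_testFun θ z)).congr_deriv ?_
  rw [diffOp_X_sub_C_apply]
  ring

theorem integrable_exp_mul_testFun (b μ : ℂ) (θ : testFun) (a : ℝ) : Integrable
    (fun z : ℝ => b * (Complex.exp (-μ * ((z - a : ℝ) : ℂ)) * (θ : ℝ → ℂ) z)) := by
  apply Continuous.integrable_of_hasCompactSupport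
  · exact continuous_const.mul (Continuous.mul (by fun_prop) (testFun_continuous _))
  · exact θ.2.2.mul_left.mul_left

theorem tendsto_exp_mul_testFun (μ : ℂ) (θ : testFun) (a : ℝ) : Tendsto
    (fun z : ℝ => Complex.exp (-μ * ((z - a : ℝ) : ℂ)) * (θ : ℝ → ℂ) z) (cocompact ℝ) (𝓝 0) :=
  HasCompactSupport.is_zero_at_infty θ.2.2.mul_left

/-- On `(a, ∞)`, the function `exp(-μ (z - a))` solves `-(∂ + μ) e = 0` up to a boundary term. -/
theorem integral_exp_mul_diffOp_Ioi (μ : ℂ) (θ : testFun) (a : ℝ) :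
    ∫ z in Ioi a, Complex.exp (-μ * ((z - a : ℝ) : ℂ)) * (diffOp (X - Polynomial.C μ) θ : ℝ → ℂ) z
      = -(θ : ℝ → ℂ) a := by
  have hint := integrable_exp_mul_testFun 1 μ (diffOp (X - Polynomial.C μ) θ) a
  simp only [one_mul] at hint
  rw [integral_Ioi_of_hasDerivAt_of_tendsto' (fun z _ => hasDerivAt_exp_mul_testFun μ θ a z)
    hint.integrableOn ((tendsto_exp_mul_testFun μ θ a).mono_left atTop_le_cocompact)]
  simp

theorem integral_exp_mul_diffOp_Iic (μ : ℂ) (θ : testFun) (a : ℝ) :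
    ∫ z in Iic a, Complex.exp (-μ * ((z - a : ℝ) : ℂ)) * (diffOp (X - Polynomial.C μ) θ : ℝ → ℂ) z
      = (θ : ℝ → ℂ) a := by
  have hint := integrable_exp_mul_testFun 1 μ (diffOp (X - Polynomial.C μ) θ) a
  simp only [one_mul] at hint
  rw [integral_Iic_of_hasDerivAt_of_tendsto' (fun z _ => hasDerivAt_exp_mul_testFun μ θ a z)
    hint.integrableOn ((tendsto_exp_mul_testFun μ θ a).mono_left atBot_le_cocompact)]
  simp

/-! ### Green kernels -/

variable {ι : Type*} [Fintype ι] [DecidableEq ι]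

/-- The value `p'(μⱼ)` for `p = a ∏ (X - μₖ)`. -/
def rootDeriv (a : ℂ) (μ : ι → ℂ) (j : ι) : ℂ := a * ∏ k ∈ Finset.univ.erase j, (μ j - μ k)

/-- The Green kernel of `p(-∂)`, `p = a ∏ (X - μₖ)`, which is made of the exponentials `exp(-μⱼ t)`
with `j ∈ J` for `t > 0` and of the other ones for `t ≤ 0`. -/
def greenKernel (a : ℂ) (μ : ι → ℂ) (J : Finset ι) (t : ℝ) : ℂ :=
  if 0 < t then ∑ j ∈ J, -(rootDeriv a μ j)⁻¹ * Complex.exp (-μ j * t)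
  else ∑ j ∈ Jᶜ, (rootDeriv a μ j)⁻¹ * Complex.exp (-μ j * t)

/-- The cofactor `p / (X - μⱼ)`. -/
def cofactor (a : ℂ) (μ : ι → ℂ) (j : ι) : ℂ[X] :=
  Polynomial.C a * ∏ k ∈ Finset.univ.erase j, (X - Polynomial.C (μ k))

theorem X_sub_C_mul_cofactor (a : ℂ) (μ : ι → ℂ) (j : ι) :
    (X - Polynomial.C (μ j)) * cofactor a μ j
      = Polynomial.C a * ∏ k, (X - Polynomial.C (μ k)) := by
  rw [cofactor, mul_left_comm, Finset.mul_prod_erase Finset.univ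
    (fun k => X - Polynomial.C (μ k)) (Finset.mem_univ j)]

/-- Partial fractions: `∑ⱼ p / ((X - μⱼ) p'(μⱼ)) = 1`. -/
theorem sum_cofactor [Nonempty ι] {a : ℂ} (ha : a ≠ 0) {μ : ι → ℂ} (hμ : Function.Injective μ) :
    ∑ j, Polynomial.C (rootDeriv a μ j)⁻¹ * cofactor a μ j = 1 := by
  rw [← Lagrange.sum_basis (s := (Finset.univ : Finset ι)) (v := μ) hμ.injOn Finset.univ_nonempty]
  refine Finset.sum_congr rfl fun j _ => ?_
  rw [Lagrange.basis, cofactor, rootDeriv]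
  simp only [Lagrange.basisDivisor]
  rw [Finset.prod_mul_distrib, ← mul_assoc, ← map_mul, ← map_prod]
  congr 2
  rw [mul_inv, mul_right_comm, inv_mul_cancel₀ ha, one_mul, ← Finset.prod_inv_distrib]

/-- The partial fraction identity, applied to a test function. -/
theorem sum_diffOp_cofactor [Nonempty ι] {a : ℂ} (ha : a ≠ 0) {μ : ι → ℂ}
    (hμ : Function.Injective μ) (θ : testFun) (z : ℝ) :
    ∑ j, (rootDeriv a μ j)⁻¹ * (diffOp (cofactor a μ j) θ : ℝ → ℂ) z = (θ : ℝ → ℂ) z := by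
  have h1 : diffOp (∑ j, Polynomial.C (rootDeriv a μ j)⁻¹ * cofactor a μ j) θ = θ := by
    rw [sum_cofactor ha hμ]; simp [diffOp]
  have h2 : diffOp (∑ j, Polynomial.C (rootDeriv a μ j)⁻¹ * cofactor a μ j) θ
      = ∑ j, (rootDeriv a μ j)⁻¹ • diffOp (cofactor a μ j) θ := by
    simp only [diffOp, map_sum, map_mul, LinearMap.sum_apply]
    refine Finset.sum_congr rfl fun j _ => ?_
    rw [aeval_C]; rfl
  rw [h2] at h1
  have h3 := congrArg (fun η : testFun => (η : ℝ → ℂ) z) h1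
  simpa using h3

/-- The Green kernel is a fundamental solution. Whatever the choice of `J`, each exponential
contributes its boundary term `diffOp (cofactor j) θ z' / p'(μⱼ)`, and these terms sum up to `θ
z'` by partial fractions. -/
theorem integral_greenKernel_mul_diffOp [Nonempty ι] {a : ℂ} (ha : a ≠ 0) {μ : ι → ℂ}
    (hμ : Function.Injective μ) (J : Finset ι) (θ : testFun) (z' : ℝ) :
    ∫ z, greenKernel a μ J (z - z') *
      (diffOp (Polynomial.C a * ∏ k, (X - Polynomial.C (μ k))) θ : ℝ → ℂ) z = (θ : ℝ → ℂ) z' := by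
  set p := Polynomial.C a * ∏ k, (X - Polynomial.C (μ k)) with hp
  -- `p(∂)` is divisible by the factor `∂ - μⱼ` that integrates against `exp(-μⱼ z)`.
  have hfac : ∀ j, diffOp p θ = diffOp (X - Polynomial.C (μ j)) (diffOp (cofactor a μ j) θ) := by
    intro j
    rw [← diffOp_mul, X_sub_C_mul_cofactor]
  have hint : ∀ (b : ℂ) (j : ι), Integrable (fun z : ℝ => b *
      (Complex.exp (-μ j * ((z - z' : ℝ) : ℂ)) * (diffOp p θ : ℝ → ℂ) z)) := fun b j =>
    integrable_exp_mul_testFun b (μ j) (diffOp p θ) z'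
  have hI : ∫ z in Ioi z', greenKernel a μ J (z - z') * (diffOp p θ : ℝ → ℂ) z
      = ∑ j ∈ J, (rootDeriv a μ j)⁻¹ * (diffOp (cofactor a μ j) θ : ℝ → ℂ) z' := by
    have : ∀ z ∈ Ioi z', greenKernel a μ J (z - z') * (diffOp p θ : ℝ → ℂ) z
        = ∑ j ∈ J, -(rootDeriv a μ j)⁻¹ * (Complex.exp (-μ j * ((z - z' : ℝ) : ℂ)) *
          (diffOp p θ : ℝ → ℂ) z) := by
      intro z hz
      rw [greenKernel, if_pos (sub_pos.mpr hz), Finset.sum_mul]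
      exact Finset.sum_congr rfl fun j _ => by ring
    rw [setIntegral_congr_fun measurableSet_Ioi this,
      integral_finsetSum _ fun j _ => (hint _ j).integrableOn]
    refine Finset.sum_congr rfl fun j _ => ?_
    rw [integral_const_mul, hfac j, integral_exp_mul_diffOp_Ioi]
    ring
  have hII : ∫ z in Iic z', greenKernel a μ J (z - z') * (diffOp p θ : ℝ → ℂ) z
      = ∑ j ∈ Jᶜ, (rootDeriv a μ j)⁻¹ * (diffOp (cofactor a μ j) θ : ℝ → ℂ) z' := by
    have : ∀ z ∈ Iic z', greenKernel a μ J (z - z') * (diffOp p θ : ℝ → ℂ) z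
        = ∑ j ∈ Jᶜ, (rootDeriv a μ j)⁻¹ * (Complex.exp (-μ j * ((z - z' : ℝ) : ℂ)) *
          (diffOp p θ : ℝ → ℂ) z) := by
      intro z hz
      rw [greenKernel, if_neg (by simpa using hz), Finset.sum_mul]
      exact Finset.sum_congr rfl fun j _ => by ring
    rw [setIntegral_congr_fun measurableSet_Iic this,
      integral_finsetSum _ fun j _ => (hint _ j).integrableOn]
    refine Finset.sum_congr rfl fun j _ => ?_
    rw [integral_const_mul, hfac j, integral_exp_mul_diffOp_Iic]
  have hwhole : Integrable (fun z => greenKernel a μ J (z - z') * (diffOp p θ : ℝ → ℂ) z) := by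
    rw [← integrableOn_univ, ← Iic_union_Ioi (a := z')]
    refine IntegrableOn.union ?_ ?_
    · refine IntegrableOn.congr_fun (f := fun z => ∑ j ∈ Jᶜ, (rootDeriv a μ j)⁻¹ *
        (Complex.exp (-μ j * ((z - z' : ℝ) : ℂ)) * (diffOp p θ : ℝ → ℂ) z)) ?_ ?_
        measurableSet_Iic
      · exact (integrable_finsetSum _ fun j _ => hint _ j).integrableOn
      · intro z hz
        dsimp only
        rw [greenKernel, if_neg (by simpa using hz), Finset.sum_mul]
        exact Finset.sum_congr rfl fun j _ => by ring
    · refine IntegrableOn.congr_fun (f := fun z => ∑ j ∈ J, -(rootDeriv a μ j)⁻¹ *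
        (Complex.exp (-μ j * ((z - z' : ℝ) : ℂ)) * (diffOp p θ : ℝ → ℂ) z)) ?_ ?_
        measurableSet_Ioi
      · exact (integrable_finsetSum _ fun j _ => hint _ j).integrableOn
      · intro z hz
        dsimp only
        rw [greenKernel, if_pos (sub_pos.mpr hz), Finset.sum_mul]
        exact Finset.sum_congr rfl fun j _ => by ring
  rw [← setIntegral_univ, ← Iic_union_Ioi (a := z'),
    setIntegral_union (Iic_disjoint_Ioi le_rfl) measurableSet_Ioi hwhole.integrableOn
      hwhole.integrableOn, hI, hII, add_comm, Finset.sum_add_sum_compl]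
  exact sum_diffOp_cofactor ha hμ θ z'

end OneVariable

/-! ### Convolutions with Green kernels on the half-line -/

section Kernel

open Polynomial

variable {ι : Type*} [Fintype ι] [DecidableEq ι] {a : ℂ} {μ : ι → ℂ} {J : Finset ι}

theorem norm_exp_neg_mul_le_one {m : ℂ} {t : ℝ} (h : 0 ≤ m.re * t) :
    ‖Complex.exp (-m * t)‖ ≤ 1 := by
  rw [Complex.norm_exp, Real.exp_le_one_iff, neg_mul, Complex.neg_re, Complex.re_mul_ofReal]
  linarith

theorem norm_greenKernel_le (hJ : ∀ j ∈ J, 0 ≤ (μ j).re) (hJ' : ∀ j ∉ J, (μ j).re ≤ 0) (t : ℝ) :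
    ‖greenKernel a μ J t‖ ≤ ∑ j, ‖rootDeriv a μ j‖⁻¹ := by
  rw [greenKernel]
  split_ifs with ht
  · refine (norm_sum_le _ _).trans ((Finset.sum_le_sum fun j hj => ?_).trans
      (Finset.sum_le_sum_of_subset_of_nonneg (Finset.subset_univ J)
        fun j _ _ => inv_nonneg.mpr (norm_nonneg _)))
    rw [norm_mul, norm_neg, norm_inv]
    exact mul_le_of_le_one_right (inv_nonneg.mpr (norm_nonneg _))
      (norm_exp_neg_mul_le_one (mul_nonneg (hJ j hj) ht.le))
  · refine (norm_sum_le _ _).trans ((Finset.sum_le_sum fun j hj => ?_).trans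
      (Finset.sum_le_sum_of_subset_of_nonneg (Finset.subset_univ Jᶜ)
        fun j _ _ => inv_nonneg.mpr (norm_nonneg _)))
    rw [norm_mul, norm_inv]
    exact mul_le_of_le_one_right (inv_nonneg.mpr (norm_nonneg _))
      (norm_exp_neg_mul_le_one (mul_nonneg_of_nonpos_of_nonpos
        (hJ' j (Finset.mem_compl.mp hj)) (not_lt.mp ht)))

theorem measurable_greenKernel : Measurable (greenKernel a μ J) := by
  unfold greenKernel
  refine Measurable.ite (measurableSet_lt measurable_const measurable_id) ?_ ?_
  · fun_prop
  · fun_prop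

theorem continuousAt_greenKernel {t : ℝ} (ht : t ≠ 0) : ContinuousAt (greenKernel a μ J) t := by
  rcases lt_or_gt_of_ne ht with h | h
  · have h1 : ContinuousAt (fun t : ℝ => ∑ j ∈ Jᶜ, (rootDeriv a μ j)⁻¹ * Complex.exp (-μ j * t)) t := by
      fun_prop
    refine h1.congr ?_
    filter_upwards [Iio_mem_nhds h] with y hy
    rw [greenKernel, if_neg (not_lt.mpr (le_of_lt hy))]
  · have h1 : ContinuousAt (fun t : ℝ => ∑ j ∈ J, -(rootDeriv a μ j)⁻¹ * Complex.exp (-μ j * t)) t := by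
      fun_prop
    refine h1.congr ?_
    filter_upwards [Ioi_mem_nhds h] with y hy
    rw [greenKernel, if_pos (mem_Ioi.mp hy)]

theorem tendsto_exp_neg_mul_atTop {m : ℂ} (h : 0 < m.re) :
    Tendsto (fun t : ℝ => Complex.exp (-m * t)) atTop (𝓝 0) := by
  rw [tendsto_zero_iff_norm_tendsto_zero]
  have : ∀ t : ℝ, ‖Complex.exp (-m * t)‖ = Real.exp (-(m.re * t)) := by
    intro t
    rw [Complex.norm_exp, neg_mul, Complex.neg_re, Complex.re_mul_ofReal]
  simp only [this]
  exact Real.tendsto_exp_neg_atTop_nhds_zero.comp (tendsto_id.const_mul_atTop h)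

theorem tendsto_greenKernel (hJ : ∀ j ∈ J, 0 < (μ j).re) :
    Tendsto (greenKernel a μ J) atTop (𝓝 0) := by
  have h1 : Tendsto (fun t : ℝ => ∑ j ∈ J, -(rootDeriv a μ j)⁻¹ * Complex.exp (-μ j * t)) atTop
      (𝓝 (∑ j ∈ J, -(rootDeriv a μ j)⁻¹ * 0)) :=
    tendsto_finsetSum _ fun j hj => (tendsto_exp_neg_mul_atTop (hJ j hj)).const_mul _
  simp only [mul_zero, Finset.sum_const_zero] at h1
  refine h1.congr' ?_
  filter_upwards [Ioi_mem_atTop 0] with t ht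
  rw [greenKernel, if_pos (mem_Ioi.mp ht)]

/-- Convolution of a kernel with a source on the half-line. -/
def kernelConv (K S : ℝ → ℂ) (z : ℝ) : ℂ := ∫ z' in Ioi (0 : ℝ), K (z - z') * S z'

variable {K S : ℝ → ℂ} {B : ℝ}

theorem integrableOn_kernelConv (hK : Measurable K) (hB : ∀ t, ‖K t‖ ≤ B)
    (hS : IntegrableOn S (Ioi 0)) (z : ℝ) :
    IntegrableOn (fun z' => K (z - z') * S z') (Ioi 0) :=
  hS.bdd_mul (hK.comp (measurable_const.sub measurable_id)).aestronglyMeasurable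
    (Eventually.of_forall fun z' => hB (z - z'))

theorem norm_kernelConv_le (hB : ∀ t, ‖K t‖ ≤ B)
    (hS : IntegrableOn S (Ioi 0)) (z : ℝ) :
    ‖kernelConv K S z‖ ≤ B * ∫ z' in Ioi (0 : ℝ), ‖S z'‖ := by
  rw [← integral_const_mul]
  refine norm_integral_le_of_norm_le (hS.norm.const_mul B) (Eventually.of_forall fun z' => ?_)
  rw [norm_mul]
  exact mul_le_mul_of_nonneg_right (hB _) (norm_nonneg _)

theorem continuous_kernelConv (hK : Measurable K) (hB : ∀ t, ‖K t‖ ≤ B)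
    (hKc : ∀ t ≠ 0, ContinuousAt K t) (hS : IntegrableOn S (Ioi 0)) :
    Continuous (kernelConv K S) := by
  rw [continuous_iff_continuousAt]
  intro z
  refine continuousAt_of_dominated (bound := fun z' => B * ‖S z'‖) ?_ ?_ (hS.norm.const_mul B) ?_
  · exact Eventually.of_forall fun z => (integrableOn_kernelConv hK hB hS z).aestronglyMeasurable
  · refine Eventually.of_forall fun z => Eventually.of_forall fun z' => ?_
    rw [norm_mul]
    exact mul_le_mul_of_nonneg_right (hB _) (norm_nonneg _)
  · have : ∀ᵐ z' ∂(volume.restrict (Ioi (0 : ℝ))), z' ≠ z :=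
      ae_restrict_of_ae (Measure.ae_ne volume z)
    filter_upwards [this] with z' hz'
    have h1 : ContinuousAt (fun y : ℝ => K (y - z')) z :=
      ContinuousAt.comp (f := fun y : ℝ => y - z') (hKc (z - z') (sub_ne_zero.mpr hz'.symm))
        (by fun_prop)
    exact h1.mul continuousAt_const

theorem tendsto_kernelConv (hK : Measurable K) (hB : ∀ t, ‖K t‖ ≤ B)
    (hK0 : Tendsto K atTop (𝓝 0)) (hS : IntegrableOn S (Ioi 0)) :
    Tendsto (kernelConv K S) atTop (𝓝 0) := by
  have h0 : (0 : ℂ) = ∫ z' in Ioi (0 : ℝ), (0 : ℂ) := by simp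
  rw [h0]
  refine tendsto_integral_filter_of_dominated_convergence (fun z' => B * ‖S z'‖) ?_ ?_
    (hS.norm.const_mul B) ?_
  · exact Eventually.of_forall fun z => (integrableOn_kernelConv hK hB hS z).aestronglyMeasurable
  · refine Eventually.of_forall fun z => Eventually.of_forall fun z' => ?_
    rw [norm_mul]
    exact mul_le_mul_of_nonneg_right (hB _) (norm_nonneg _)
  · refine Eventually.of_forall fun z' => ?_
    have := (hK0.comp (tendsto_atTop_add_const_right atTop (-z') tendsto_id)).mul_const (S z')
    simpa [sub_eq_add_neg, Function.comp_def] using this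

/-- The convolution of the Green kernel with `S` solves `p(-∂) u = S` weakly. -/
theorem integral_kernelConv_mul_diffOp [Nonempty ι] (ha : a ≠ 0) (hμ : Function.Injective μ)
    (hJ : ∀ j ∈ J, 0 ≤ (μ j).re) (hJ' : ∀ j ∉ J, (μ j).re ≤ 0)
    (hS : IntegrableOn S (Ioi 0)) {θ : testFun} (hθ : VanishBelow 0 θ) :
    ∫ z in Ioi (0 : ℝ), kernelConv (greenKernel a μ J) S z *
      (diffOp (Polynomial.C a * ∏ k, (X - Polynomial.C (μ k))) θ : ℝ → ℂ) z
      = ∫ z in Ioi (0 : ℝ), S z * (θ : ℝ → ℂ) z := by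
  set p := Polynomial.C a * ∏ k, (X - Polynomial.C (μ k)) with hp
  have hK : Measurable (greenKernel a μ J) := measurable_greenKernel
  have hB := norm_greenKernel_le (a := a) hJ hJ'
  have hD := (testFun_integrable (diffOp p θ)).integrableOn (s := Ioi 0)
  have hprod : Integrable (fun q : ℝ × ℝ => greenKernel a μ J (q.1 - q.2) *
      (S q.2 * (diffOp p θ : ℝ → ℂ) q.1))
      ((volume.restrict (Ioi 0)).prod (volume.restrict (Ioi 0))) := by
    refine Integrable.bdd_mul (c := ∑ j, ‖rootDeriv a μ j‖⁻¹) ?_ ?_ ?_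
    · have := Integrable.mul_prod hD hS
      refine this.congr (Eventually.of_forall fun q => ?_)
      exact mul_comm _ _
    · exact (hK.comp (measurable_fst.sub measurable_snd)).aestronglyMeasurable
    · exact Eventually.of_forall fun q => hB _
  calc ∫ z in Ioi (0 : ℝ), kernelConv (greenKernel a μ J) S z * (diffOp p θ : ℝ → ℂ) z
      = ∫ z in Ioi (0 : ℝ), ∫ z' in Ioi (0 : ℝ), greenKernel a μ J (z - z') *
          (S z' * (diffOp p θ : ℝ → ℂ) z) := by
        refine setIntegral_congr_fun measurableSet_Ioi fun z _ => ?_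
        simp only [kernelConv]
        rw [← integral_mul_const]
        refine integral_congr_ae (Eventually.of_forall fun z' => ?_)
        dsimp only
        ring
    _ = ∫ z' in Ioi (0 : ℝ), ∫ z in Ioi (0 : ℝ), greenKernel a μ J (z - z') *
          (S z' * (diffOp p θ : ℝ → ℂ) z) := integral_integral_swap hprod
    _ = ∫ z' in Ioi (0 : ℝ), S z' * (θ : ℝ → ℂ) z' := by
        refine setIntegral_congr_fun measurableSet_Ioi fun z' _ => ?_
        have h1 : ∀ z, greenKernel a μ J (z - z') * (S z' * (diffOp p θ : ℝ → ℂ) z)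
            = S z' * (greenKernel a μ J (z - z') * (diffOp p θ : ℝ → ℂ) z) := fun z => by ring
        simp only [h1]
        rw [integral_const_mul]
        congr 1
        rw [← integral_greenKernel_mul_diffOp ha hμ J θ z', ← hp]
        refine setIntegral_eq_integral_of_ae_compl_eq_zero ?_
        have h2 : ∀ᵐ z : ℝ, z ≠ 0 := Measure.ae_ne volume 0
        filter_upwards [h2] with z hz hz'
        rw [(hθ.diffOp p) z (lt_of_le_of_ne (not_lt.mp hz') hz), mul_zero]

/-! ### Bounded weak solutions on the half-line -/

/-- The pairing of a function on the half-line with a translated test function. -/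
def shiftPairing (v : ℝ → ℂ) (θ : testFun) (q : ℝ) : ℂ :=
  ∫ z in Ioi (0 : ℝ), v z * (θ : ℝ → ℂ) (z - q)

theorem integrableOn_shiftPairing {v : ℝ → ℂ} {M : ℝ}
    (hv : AEStronglyMeasurable v (volume.restrict (Ioi 0))) (hM : ∀ z, 0 < z → ‖v z‖ ≤ M)
    (θ : testFun) (q : ℝ) : IntegrableOn (fun z => v z * (θ : ℝ → ℂ) (z - q)) (Ioi 0) := by
  refine Integrable.bdd_mul (c := M) ?_ hv ?_
  · exact (testFun_integrable (testShift q θ)).integrableOn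
  · filter_upwards [ae_restrict_mem measurableSet_Ioi] with z hz using hM z hz

theorem norm_shiftPairing_le {v : ℝ → ℂ} {M : ℝ} (hM : ∀ z, 0 < z → ‖v z‖ ≤ M)
    (θ : testFun) (q : ℝ) : ‖shiftPairing v θ q‖ ≤ M * ∫ z, ‖(θ : ℝ → ℂ) z‖ := by
  have hM0 : 0 ≤ M := (norm_nonneg _).trans (hM 1 one_pos)
  have hi := (testFun_integrable (testShift q θ)).norm
  calc ‖shiftPairing v θ q‖ ≤ ∫ z in Ioi (0 : ℝ), M * ‖(testShift q θ : ℝ → ℂ) z‖ := by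
        refine norm_integral_le_of_norm_le (hi.integrableOn.const_mul M) ?_
        filter_upwards [ae_restrict_mem measurableSet_Ioi] with z hz
        rw [norm_mul]
        exact mul_le_mul_of_nonneg_right (hM z hz) (norm_nonneg _)
    _ = M * ∫ z in Ioi (0 : ℝ), ‖(testShift q θ : ℝ → ℂ) z‖ := integral_const_mul _ _
    _ ≤ M * ∫ z, ‖(testShift q θ : ℝ → ℂ) z‖ := by
        exact mul_le_mul_of_nonneg_left
          (setIntegral_le_integral hi (Eventually.of_forall fun z => norm_nonneg _)) hM0
    _ = M * ∫ z, ‖(θ : ℝ → ℂ) z‖ := by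
        congr 1
        exact integral_sub_right_eq_self (fun z => ‖(θ : ℝ → ℂ) z‖) q

theorem hasDerivAt_shiftPairing {v : ℝ → ℂ} {M : ℝ}
    (hv : AEStronglyMeasurable v (volume.restrict (Ioi 0))) (hM : ∀ z, 0 < z → ‖v z‖ ≤ M)
    (θ : testFun) (q : ℝ) :
    HasDerivAt (shiftPairing v θ) (-shiftPairing v (testDeriv θ) q) q := by
  have hloc : LocallyIntegrable ((Ioi (0 : ℝ)).indicator v) volume := by
    intro x
    refine ⟨Metric.ball x 1, Metric.ball_mem_nhds x one_pos, ?_⟩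
    refine Measure.integrableOn_of_bounded (M := max M 0) (by simp) ?_ ?_
    · exact (aestronglyMeasurable_indicator_iff measurableSet_Ioi).mpr hv
    · refine Eventually.of_forall fun z => ?_
      by_cases hz : z ∈ Ioi (0 : ℝ)
      · rw [indicator_of_mem hz]; exact (hM z hz).trans (le_max_left _ _)
      · rw [indicator_of_notMem hz, norm_zero]; exact le_max_right _ _
  let g : ℝ → ℂ := fun t => (θ : ℝ → ℂ) (-t)
  have hg : ContDiff ℝ 1 g := (θ.2.1.comp contDiff_neg).of_le (by simp)
  have hgc : HasCompactSupport g := θ.2.2.comp_homeomorph (Homeomorph.neg ℝ)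
  have hconv : ∀ (f : ℝ → ℂ) (q : ℝ), (∫ t, (Ioi (0 : ℝ)).indicator v t * f (q - t))
      = ∫ z in Ioi (0 : ℝ), v z * f (q - z) := by
    intro f q
    rw [← integral_indicator measurableSet_Ioi]
    congr 1
    funext t
    by_cases ht : t ∈ Ioi (0 : ℝ)
    · rw [indicator_of_mem ht, indicator_of_mem ht]
    · rw [indicator_of_notMem ht, indicator_of_notMem ht, zero_mul]
  have h1 := hgc.hasDerivAt_convolution_right (ContinuousLinearMap.mul ℝ ℂ) hloc hg q
  have e1 : convolution ((Ioi (0 : ℝ)).indicator v) g (ContinuousLinearMap.mul ℝ ℂ) volume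
      = shiftPairing v θ := by
    funext q
    simp only [convolution_def, ContinuousLinearMap.mul_apply', shiftPairing]
    rw [hconv]
    simp [g]
  have e2 : convolution ((Ioi (0 : ℝ)).indicator v) (deriv g) (ContinuousLinearMap.mul ℝ ℂ)
      volume q = -shiftPairing v (testDeriv θ) q := by
    simp only [convolution_def, ContinuousLinearMap.mul_apply', shiftPairing]
    rw [hconv, ← integral_neg]
    refine setIntegral_congr_fun measurableSet_Ioi fun z _ => ?_
    have : deriv g (q - z) = -deriv (θ : ℝ → ℂ) (-(q - z)) := deriv_comp_neg (θ : ℝ → ℂ) (q - z)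
    rw [this, neg_sub, mul_neg]
    rfl
  rw [e1, e2] at h1
  exact h1

theorem shiftPairing_diffOp_X_sub_C {v : ℝ → ℂ} {M : ℝ}
    (hv : AEStronglyMeasurable v (volume.restrict (Ioi 0))) (hM : ∀ z, 0 < z → ‖v z‖ ≤ M)
    (m : ℂ) (θ : testFun) (q : ℝ) :
    shiftPairing v (diffOp (X - Polynomial.C m) θ) q
      = shiftPairing v (testDeriv θ) q - m * shiftPairing v θ q := by
  simp only [shiftPairing, diffOp_X_sub_C_apply]
  rw [← integral_const_mul, ← integral_sub]
  · refine setIntegral_congr_fun measurableSet_Ioi fun z _ => ?_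
    ring
  · exact integrableOn_shiftPairing hv hM _ q
  · exact (integrableOn_shiftPairing hv hM θ q).const_mul m

/-- A solution of `G' = -m G` on `(η, ∞)` is an exponential. -/
theorem eq_exp_of_hasDerivAt {G : ℝ → ℂ} {m : ℂ} {η : ℝ}
    (hG : ∀ q, η < q → HasDerivAt G (-m * G q) q) :
    ∃ b : ℂ, ∀ q, η < q → G q = b * Complex.exp (-m * q) := by
  have h1 : ∀ q, η < q → HasDerivAt (fun q : ℝ => G q * Complex.exp (m * q)) 0 q := by
    intro q hq
    have h2 : HasDerivAt (fun q : ℝ => m * (q : ℂ)) m q := by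
      have := (hasDerivAt_id q).ofReal_comp.const_mul m
      simpa using this
    refine ((hG q hq).mul h2.cexp).congr_deriv ?_
    ring
  refine ⟨G (η + 1) * Complex.exp (m * (η + 1 : ℝ)), fun q hq => ?_⟩
  have h3 : G q * Complex.exp (m * q) = G (η + 1) * Complex.exp (m * (η + 1 : ℝ)) := by
    refine isOpen_Ioi.is_const_of_deriv_eq_zero (𝕜 := ℝ) (s := Ioi η) isPreconnected_Ioi
      (f := fun q : ℝ => G q * Complex.exp (m * q)) ?_ ?_ hq (by simp : η + 1 ∈ Ioi η)
    · exact fun q hq => (h1 q hq).differentiableAt.differentiableWithinAt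
    · exact fun q hq => (h1 q hq).deriv
  rw [← h3, mul_assoc, ← Complex.exp_add]
  simp

/-- Bounded weak solutions of `p(-∂) v = 0` on the half-line, after mollification, are combinations
of the exponentials `exp(-μⱼ z)` with `Re μⱼ ≥ 0`. -/
theorem shiftPairing_eq_sum_exp [Nonempty ι] (ha : a ≠ 0) (hμ : Function.Injective μ)
    {v : ℝ → ℂ} {M : ℝ} (hv : AEStronglyMeasurable v (volume.restrict (Ioi 0)))
    (hM : ∀ z, 0 < z → ‖v z‖ ≤ M) (θ : testFun) {η : ℝ}
    (h : ∀ q : ℚ, η < q →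
      shiftPairing v (diffOp (Polynomial.C a * ∏ k, (X - Polynomial.C (μ k))) θ) q = 0) :
    ∃ b : ι → ℂ, (∀ j, (μ j).re < 0 → b j = 0) ∧
      ∀ q, η < q → shiftPairing v θ q = ∑ j, b j * Complex.exp (-μ j * q) := by
  set p := Polynomial.C a * ∏ k, (X - Polynomial.C (μ k)) with hp
  have h0 : ∀ q : ℝ, η < q → shiftPairing v (diffOp p θ) q = 0 := by
    have hc : Continuous (shiftPairing v (diffOp p θ)) := continuous_iff_continuousAt.mpr
      fun q => (hasDerivAt_shiftPairing hv hM _ q).continuousAt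
    intro q hq
    have hcl : IsClosed {q : ℝ | shiftPairing v (diffOp p θ) q = 0} :=
      isClosed_eq hc continuous_const
    have hd : Dense (range ((↑) : ℚ → ℝ)) := Rat.denseRange_cast
    have h1 : q ∈ closure (Ioi η ∩ range ((↑) : ℚ → ℝ)) :=
      hd.open_subset_closure_inter isOpen_Ioi hq
    refine hcl.closure_subset_iff.mpr ?_ h1
    rintro _ ⟨hx, r, rfl⟩
    exact h r hx
  have hex : ∀ j, ∃ b : ℂ, ∀ q, η < q →
      shiftPairing v (diffOp (cofactor a μ j) θ) q = b * Complex.exp (-μ j * q) := by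
    intro j
    refine eq_exp_of_hasDerivAt fun q hq => ?_
    refine (hasDerivAt_shiftPairing hv hM _ q).congr_deriv ?_
    have h1 := shiftPairing_diffOp_X_sub_C hv hM (μ j) (diffOp (cofactor a μ j) θ) q
    rw [← diffOp_mul, X_sub_C_mul_cofactor, ← hp, h0 q hq] at h1
    linear_combination h1
  choose b hb using hex
  refine ⟨fun j => (rootDeriv a μ j)⁻¹ * b j, ?_, ?_⟩
  · intro j hj
    dsimp only
    have hbnd : ∀ q : ℝ, η < q →
        ‖b j‖ ≤ (M * ∫ z, ‖(diffOp (cofactor a μ j) θ : ℝ → ℂ) z‖) * Real.exp ((μ j).re * q) := by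
      intro q hq
      have h1 := norm_shiftPairing_le hM (diffOp (cofactor a μ j) θ) q
      rw [hb j q hq, norm_mul, Complex.norm_exp, neg_mul, Complex.neg_re,
        Complex.re_mul_ofReal, Real.exp_neg] at h1
      have h2 := Real.exp_pos ((μ j).re * q)
      calc ‖b j‖ = ‖b j‖ * (Real.exp ((μ j).re * q))⁻¹ * Real.exp ((μ j).re * q) := by
            field_simp
        _ ≤ _ := mul_le_mul_of_nonneg_right h1 h2.le
    have hlim : Tendsto (fun q : ℝ => (M * ∫ z, ‖(diffOp (cofactor a μ j) θ : ℝ → ℂ) z‖) *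
        Real.exp ((μ j).re * q)) atTop (𝓝 ((M * ∫ z, ‖(diffOp (cofactor a μ j) θ : ℝ → ℂ) z‖) * 0)) :=
      (Real.tendsto_exp_atBot.comp (tendsto_id.const_mul_atTop_of_neg hj)).const_mul _
    rw [mul_zero] at hlim
    have h3 : ‖b j‖ ≤ 0 := ge_of_tendsto hlim (by
      filter_upwards [Ioi_mem_atTop η] with q hq using hbnd q hq)
    rw [norm_le_zero_iff.mp h3, mul_zero]
  · intro q hq
    have h1 : shiftPairing v θ q
        = ∑ j, (rootDeriv a μ j)⁻¹ * shiftPairing v (diffOp (cofactor a μ j) θ) q := by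
      simp only [shiftPairing, ← integral_const_mul]
      rw [← integral_finsetSum _ fun j _ => (integrableOn_shiftPairing hv hM _ q).const_mul _]
      refine setIntegral_congr_fun measurableSet_Ioi fun z _ => ?_
      rw [← sum_diffOp_cofactor ha hμ θ (z - q), Finset.mul_sum]
      exact Finset.sum_congr rfl fun j _ => by ring
    rw [h1]
    refine Finset.sum_congr rfl fun j _ => ?_
    rw [hb j q hq, mul_assoc]

end Kernel

/-! ### Continuous weak solutions on the half-line -/

section Mollify

open Polynomial

/-- A bump function at the origin supported in the ball of radius `1 / (n + 1)`. -/
def bump (n : ℕ) : ContDiffBump (0 : ℝ) where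
  rIn := 1 / (2 * (n + 1))
  rOut := 1 / (n + 1)
  rIn_pos := by positivity
  rIn_lt_rOut := by
    rw [div_lt_div_iff_of_pos_left one_pos (by positivity) (by positivity)]
    linarith [show (0 : ℝ) < n + 1 by positivity]

/-- The normalized bump as a complex test function. -/
def mollifier (n : ℕ) : testFun :=
  ⟨fun z => (((bump n).normed volume z : ℝ) : ℂ),
    Complex.ofRealCLM.contDiff.comp (bump n).contDiff_normed,
    (bump n).hasCompactSupport_normed.comp_left (g := fun x : ℝ => (x : ℂ)) Complex.ofReal_zero⟩

theorem mollifier_apply (n : ℕ) (z : ℝ) :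
    (mollifier n : ℝ → ℂ) z = (((bump n).normed volume z : ℝ) : ℂ) := rfl

theorem tendsto_inv_nat_add_one : Tendsto (fun n : ℕ => (1 : ℝ) / (n + 1)) atTop (𝓝 0) :=
  tendsto_one_div_add_atTop_nhds_zero_nat

theorem vanishBelow_testShift_mollifier {n : ℕ} {q : ℝ} (hq : 1 / ((n : ℝ) + 1) < q) :
    VanishBelow 0 (testShift q (mollifier n) : testFun) := by
  intro z hz
  rw [testShift_apply, mollifier_apply]
  have : z - q ∉ Function.support ((bump n).normed volume) := by
    rw [(bump n).support_normed_eq, Metric.mem_ball, dist_zero_right, Real.norm_eq_abs, not_lt]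
    refine le_trans ?_ (neg_le_abs _)
    change 1 / ((n : ℝ) + 1) ≤ _
    linarith
  rw [Function.notMem_support.mp this, Complex.ofReal_zero]

/-- The mollifications of a continuous function on the half-line converge pointwise. -/
theorem tendsto_shiftPairing_mollifier {v : ℝ → ℂ}
    (hv : ContinuousOn v (Ioi 0)) {q : ℝ} (hq : 0 < q) :
    Tendsto (fun n => shiftPairing v (mollifier n) q) atTop (𝓝 (v q)) := by
  have hm : AEStronglyMeasurable ((Ioi (0 : ℝ)).indicator v) volume :=
    (aestronglyMeasurable_indicator_iff measurableSet_Ioi).mpr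
      (hv.aestronglyMeasurable measurableSet_Ioi)
  have hc : ContinuousAt ((Ioi (0 : ℝ)).indicator v) q := by
    refine (hv.continuousAt (Ioi_mem_nhds hq)).congr ?_
    filter_upwards [Ioi_mem_nhds hq] with z hz
    rw [indicator_of_mem hz]
  have h1 := ContDiffBump.convolution_tendsto_right (μ := (volume : Measure ℝ)) (φ := bump)
    (l := atTop) (g := fun _ : ℕ => (Ioi (0 : ℝ)).indicator v) (k := fun _ => q) (x₀ := q)
    (z₀ := v q) tendsto_inv_nat_add_one (Eventually.of_forall fun _ => hm) ?_ tendsto_const_nhds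
  · refine h1.congr fun n => ?_
    rw [convolution_def, shiftPairing, ← integral_indicator measurableSet_Ioi,
      ← integral_sub_left_eq_self _ volume q]
    refine integral_congr_ae (Eventually.of_forall fun t => ?_)
    simp only [ContinuousLinearMap.lsmul_apply]
    by_cases ht : t ∈ Ioi (0 : ℝ)
    · rw [sub_sub_cancel, indicator_of_mem ht, indicator_of_mem ht, mollifier_apply,
        Complex.real_smul, mul_comm, ← neg_sub t q, ContDiffBump.normed_neg]
    · rw [sub_sub_cancel, indicator_of_notMem ht, indicator_of_notMem ht, smul_zero]
  · have h2 : Tendsto ((Ioi (0 : ℝ)).indicator v) (𝓝 q) (𝓝 (v q)) := by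
      have := hc.tendsto
      rwa [indicator_of_mem (mem_Ioi.mpr hq)] at this
    exact h2.comp tendsto_snd

/-- Mollification preserves the decay at infinity. -/
theorem tendsto_shiftPairing_atTop {v : ℝ → ℂ} {M : ℝ}
    (hv : AEStronglyMeasurable v (volume.restrict (Ioi 0))) (hM : ∀ z, 0 < z → ‖v z‖ ≤ M)
    (h0 : Tendsto v atTop (𝓝 0)) (θ : testFun) :
    Tendsto (shiftPairing v θ) atTop (𝓝 0) := by
  have hM0 : 0 ≤ M := (norm_nonneg _).trans (hM 1 one_pos)
  have e : ∀ q, shiftPairing v θ q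
      = ∫ t, (Ioi (0 : ℝ)).indicator v (t + q) * (θ : ℝ → ℂ) t := by
    intro q
    rw [shiftPairing, ← integral_indicator measurableSet_Ioi, ← integral_add_right_eq_self _ q]
    refine integral_congr_ae (Eventually.of_forall fun t => ?_)
    by_cases ht : t + q ∈ Ioi (0 : ℝ)
    · simp only [indicator_of_mem ht, add_sub_cancel_right]
    · simp only [indicator_of_notMem ht, zero_mul]
  have hm : AEStronglyMeasurable ((Ioi (0 : ℝ)).indicator v) volume :=
    (aestronglyMeasurable_indicator_iff measurableSet_Ioi).mpr hv
  have h2 : Tendsto (fun q => ∫ t, (Ioi (0 : ℝ)).indicator v (t + q) * (θ : ℝ → ℂ) t) atTop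
      (𝓝 (∫ _t : ℝ, (0 : ℂ))) := by
    refine tendsto_integral_filter_of_dominated_convergence (fun t => M * ‖(θ : ℝ → ℂ) t‖) ?_ ?_
      ((testFun_integrable θ).norm.const_mul M) ?_
    · refine Eventually.of_forall fun q => ?_
      exact (hm.comp_quasiMeasurePreserving
        (measurePreserving_add_right volume q).quasiMeasurePreserving).mul
        (testFun_continuous θ).aestronglyMeasurable
    · refine Eventually.of_forall fun q => Eventually.of_forall fun t => ?_
      rw [norm_mul]
      refine mul_le_mul_of_nonneg_right ?_ (norm_nonneg _)
      by_cases ht : t + q ∈ Ioi (0 : ℝ)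
      · rw [indicator_of_mem ht]; exact hM _ ht
      · rw [indicator_of_notMem ht, norm_zero]; exact hM0
    · refine Eventually.of_forall fun t => ?_
      have h3 : Tendsto (fun q : ℝ => t + q) atTop atTop :=
        tendsto_atTop_add_const_left _ t tendsto_id
      have h4 : Tendsto ((Ioi (0 : ℝ)).indicator v) atTop (𝓝 0) := by
        refine h0.congr' ?_
        filter_upwards [Ioi_mem_atTop 0] with z hz
        rw [indicator_of_mem hz]
      simpa using (h4.comp h3).mul_const ((θ : ℝ → ℂ) t)
  rw [integral_zero] at h2
  exact h2.congr fun q => (e q).symm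

/-- A first-order equation without decaying solutions has no nonzero weak solution that tends to
zero at infinity. -/
theorem eq_zero_of_weak_solution {a m : ℂ} (ha : a ≠ 0) (hm : m.re ≤ 0) {v : ℝ → ℂ} {M : ℝ}
    (hv : ContinuousOn v (Ioi 0)) (hM : ∀ z, 0 < z → ‖v z‖ ≤ M) (h0 : Tendsto v atTop (𝓝 0))
    (h : ∀ (n : ℕ) (q : ℚ), 1 / ((n : ℝ) + 1) < q → shiftPairing v
      (diffOp (Polynomial.C a * (X - Polynomial.C m)) (mollifier n)) q = 0) :
    ∀ z, 0 < z → v z = 0 := by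
  have hvm := hv.aestronglyMeasurable (μ := volume) measurableSet_Ioi
  have h1 : ∀ (n : ℕ) (q : ℝ), 1 / ((n : ℝ) + 1) < q → shiftPairing v (mollifier n) q = 0 := by
    intro n
    obtain ⟨b, -, hb⟩ := shiftPairing_eq_sum_exp (ι := Unit) ha (μ := fun _ => m)
      (Function.injective_of_subsingleton _) hvm hM (mollifier n) (η := 1 / ((n : ℝ) + 1))
      (by simpa using h n)
    simp only [Finset.univ_unique, Finset.sum_singleton] at hb
    have hlim := tendsto_shiftPairing_atTop hvm hM h0 (mollifier n)
    have hb0 : ‖b default‖ ≤ 0 := by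
      refine ge_of_tendsto (tendsto_zero_iff_norm_tendsto_zero.mp hlim) ?_
      filter_upwards [Ioi_mem_atTop (1 / ((n : ℝ) + 1)), Ioi_mem_atTop 0] with q hq hq0
      rw [hb q hq, norm_mul]
      refine le_mul_of_one_le_right (norm_nonneg _) ?_
      rw [Complex.norm_exp, Real.one_le_exp_iff, neg_mul, Complex.neg_re, Complex.re_mul_ofReal]
      have : m.re * q ≤ 0 := mul_nonpos_of_nonpos_of_nonneg hm (le_of_lt hq0)
      linarith
    intro q hq
    rw [hb q hq, norm_le_zero_iff.mp hb0, zero_mul]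
  intro z hz
  refine tendsto_nhds_unique (tendsto_shiftPairing_mollifier hv hz) ?_
  refine (tendsto_const_nhds (x := (0 : ℂ))).congr' ?_
  filter_upwards [tendsto_inv_nat_add_one.eventually (gt_mem_nhds hz)] with n hn
  exact (h1 n z hn).symm

theorem norm_exp_sub_one_ge {u : ℂ} (hu : ‖u‖ ≤ 1 / 2) : ‖u‖ / 2 ≤ ‖Complex.exp u - 1‖ := by
  have h1 := Complex.norm_exp_sub_one_sub_id_le (x := u) (by linarith)
  have h2 : ‖u‖ ≤ ‖Complex.exp u - 1‖ + ‖Complex.exp u - 1 - u‖ := by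
    calc ‖u‖ = ‖(Complex.exp u - 1) - (Complex.exp u - 1 - u)‖ := by congr 1; ring
      _ ≤ _ := norm_sub_le _ _
  nlinarith [norm_nonneg u]

theorem exp_shift_sub_ne_zero {m₁ m₂ : ℂ} (hne : m₁ ≠ m₂) {h : ℝ} (h0 : 0 < h)
    (hh : ‖m₁ - m₂‖ * h ≤ 1 / 2) :
    Complex.exp (-m₁ * h) - Complex.exp (-m₂ * h) ≠ 0 := by
  have hu : ‖(-(m₁ - m₂) * h : ℂ)‖ = ‖m₁ - m₂‖ * h := by
    rw [norm_mul, norm_neg, Complex.norm_real, Real.norm_eq_abs, abs_of_pos h0]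
  have h1 := norm_exp_sub_one_ge (hu.le.trans hh)
  have h2 : Complex.exp (-m₁ * h) - Complex.exp (-m₂ * h)
      = Complex.exp (-m₂ * h) * (Complex.exp (-(m₁ - m₂) * h) - 1) := by
    rw [mul_sub, ← Complex.exp_add, mul_one]
    congr 2
    ring
  rw [h2]
  refine mul_ne_zero (Complex.exp_ne_zero _) (norm_pos_iff.mp (lt_of_lt_of_le ?_ h1))
  rw [hu]
  have : 0 < ‖m₁ - m₂‖ := norm_pos_iff.mpr (sub_ne_zero.mpr hne)
  positivity

/-- The coefficient of `exp(-m₁ z)` in a combination of two exponentials, from the values at `1`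
and `1 + h`. -/
theorem coeff_of_two_exp {f : ℝ → ℂ} {c₁ c₂ m₁ m₂ : ℂ} {h : ℝ}
    (h1 : f 1 = c₁ * Complex.exp (-m₁ * (1 : ℝ)) + c₂ * Complex.exp (-m₂ * (1 : ℝ)))
    (h2 : f (1 + h) = c₁ * Complex.exp (-m₁ * (1 + h : ℝ)) + c₂ * Complex.exp (-m₂ * (1 + h : ℝ)))
    (hne : Complex.exp (-m₁ * h) - Complex.exp (-m₂ * h) ≠ 0) :
    c₁ = (f (1 + h) - Complex.exp (-m₂ * h) * f 1) * Complex.exp m₁ *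
      (Complex.exp (-m₁ * h) - Complex.exp (-m₂ * h))⁻¹ := by
  have e : ∀ m : ℂ, Complex.exp (-m * (1 + h : ℝ)) = Complex.exp (-m) * Complex.exp (-m * h) := by
    intro m
    rw [← Complex.exp_add]
    congr 1
    push_cast
    ring
  rw [h1, h2, e, e]
  simp only [Complex.ofReal_one, mul_one]
  have e2 : Complex.exp (-m₁) * Complex.exp m₁ = 1 := by rw [← Complex.exp_add]; simp
  rw [eq_mul_inv_iff_mul_eq₀ hne]
  linear_combination (-(c₁ * (Complex.exp (-m₁ * h) - Complex.exp (-m₂ * h)))) * e2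

/-- Bounded continuous weak solutions of a fourth-order equation with two decaying exponentials. -/
theorem exists_two_exp_of_weak_solution {a : ℂ} (ha : a ≠ 0) {μ : Fin 4 → ℂ}
    (hμ : Function.Injective μ) (hμ0 : (μ 0).re < 0) (hμ3 : (μ 3).re < 0) {v : ℝ → ℂ} {M : ℝ}
    (hv : ContinuousOn v (Ioi 0)) (hM : ∀ z, 0 < z → ‖v z‖ ≤ M)
    (h : ∀ (n : ℕ) (q : ℚ), 1 / ((n : ℝ) + 1) < q → shiftPairing v
      (diffOp (Polynomial.C a * ∏ k, (X - Polynomial.C (μ k))) (mollifier n)) q = 0) :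
    ∃ c₁ c₂ : ℂ, ∀ z : ℝ, 0 < z →
      v z = c₁ * Complex.exp (-μ 1 * z) + c₂ * Complex.exp (-μ 2 * z) := by
  have hvm := hv.aestronglyMeasurable (μ := volume) measurableSet_Ioi
  have hex : ∀ n : ℕ, ∃ b : ℂ × ℂ, ∀ q : ℝ, 1 / ((n : ℝ) + 1) < q →
      shiftPairing v (mollifier n) q
        = b.1 * Complex.exp (-μ 1 * q) + b.2 * Complex.exp (-μ 2 * q) := by
    intro n
    obtain ⟨b, hb0, hb⟩ := shiftPairing_eq_sum_exp ha hμ hvm hM (mollifier n)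
      (η := 1 / ((n : ℝ) + 1)) (h n)
    refine ⟨(b 1, b 2), fun q hq => ?_⟩
    rw [hb q hq, Fin.sum_univ_four, hb0 0 hμ0, hb0 3 hμ3]
    ring
  -- The coefficients of the two modes are recovered from the values at `1` and `1 + s`, which is
  -- why they converge when the mollification parameter tends to `0`.
  choose b hb using hex
  have hne12 : μ 1 ≠ μ 2 := fun h => absurd (hμ h) (by decide)
  have hd : 0 < ‖μ 1 - μ 2‖ := norm_pos_iff.mpr (sub_ne_zero.mpr hne12)
  obtain ⟨s, hs, hsle⟩ : ∃ s : ℝ, 0 < s ∧ ‖μ 1 - μ 2‖ * s ≤ 1 / 2 :=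
    ⟨1 / (2 * ‖μ 1 - μ 2‖), by positivity, le_of_eq (by field_simp)⟩
  have hlim : ∀ q : ℝ, 0 < q → Tendsto (fun n => shiftPairing v (mollifier n) q) atTop (𝓝 (v q)) :=
    fun q hq => tendsto_shiftPairing_mollifier hv hq
  have hev : ∀ q : ℝ, 0 < q → ∀ᶠ n : ℕ in atTop, 1 / ((n : ℝ) + 1) < q := fun q hq =>
    tendsto_inv_nat_add_one.eventually (gt_mem_nhds hq)
  have hne := exp_shift_sub_ne_zero hne12 hs hsle
  have hne' := exp_shift_sub_ne_zero hne12.symm hs (by rw [norm_sub_rev]; exact hsle)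
  have key1 : ∃ c, Tendsto (fun n => (b n).1) atTop (𝓝 c) := by
    refine ⟨_, Tendsto.congr' ?_ ((((hlim (1 + s) (by linarith)).sub
      ((hlim 1 one_pos).const_mul (Complex.exp (-μ 2 * s)))).mul_const
        (Complex.exp (μ 1))).mul_const
        (Complex.exp (-μ 1 * s) - Complex.exp (-μ 2 * s))⁻¹)⟩
    filter_upwards [hev 1 one_pos, hev (1 + s) (by linarith)] with n hn1 hn2
    exact (coeff_of_two_exp (hb n 1 hn1) (hb n (1 + s) hn2) hne).symm
  have key2 : ∃ c, Tendsto (fun n => (b n).2) atTop (𝓝 c) := by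
    refine ⟨_, Tendsto.congr' ?_ ((((hlim (1 + s) (by linarith)).sub
      ((hlim 1 one_pos).const_mul (Complex.exp (-μ 1 * s)))).mul_const
        (Complex.exp (μ 2))).mul_const
        (Complex.exp (-μ 2 * s) - Complex.exp (-μ 1 * s))⁻¹)⟩
    filter_upwards [hev 1 one_pos, hev (1 + s) (by linarith)] with n hn1 hn2
    exact (coeff_of_two_exp ((hb n 1 hn1).trans (add_comm _ _))
      ((hb n (1 + s) hn2).trans (add_comm _ _)) hne').symm
  obtain ⟨c₁, hc₁⟩ := key1
  obtain ⟨c₂, hc₂⟩ := key2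
  refine ⟨c₁, c₂, fun z hz => tendsto_nhds_unique (hlim z hz) ?_⟩
  refine ((hc₁.mul_const (Complex.exp (-μ 1 * z))).add
    (hc₂.mul_const (Complex.exp (-μ 2 * z)))).congr' ?_
  filter_upwards [hev z hz] with n hn using (hb n z hn).symm

end Mollify

/-! ### Test functions in local coordinates and their tangential transform -/

section PartialFourier

open Polynomial

/-- Smooth compactly supported functions of the tangential and the normal variables. -/
def stripTest : Submodule ℂ (Freq × ℝ → ℂ) where
  carrier := {g | ContDiff ℝ (⊤ : ℕ∞) g ∧ HasCompactSupport g}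
  add_mem' h₁ h₂ := ⟨h₁.1.add h₂.1, h₁.2.add h₂.2⟩
  zero_mem' := ⟨contDiff_const, HasCompactSupport.zero⟩
  smul_mem' a _ h := ⟨h.1.const_smul a, h.2.smul_left (f := fun _ => a)⟩

theorem stripTest_differentiable (g : stripTest) : Differentiable ℝ (g : Freq × ℝ → ℂ) :=
  g.2.1.differentiable (by simp)

theorem stripTest_continuous (g : stripTest) : Continuous (g : Freq × ℝ → ℂ) := g.2.1.continuous

/-- The derivative in a fixed direction. -/
def dirDeriv (v : Freq × ℝ) : stripTest →ₗ[ℂ] stripTest where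
  toFun g := ⟨fun p => fderiv ℝ (g : Freq × ℝ → ℂ) p v,
    (g.2.1.fderiv_right (m := (⊤ : ℕ∞)) (by simp)).clm_apply contDiff_const,
    g.2.2.fderiv_apply (𝕜 := ℝ) v⟩
  map_add' g h := by
    ext p
    change fderiv ℝ ((g : Freq × ℝ → ℂ) + (h : Freq × ℝ → ℂ)) p v = _
    rw [fderiv_add (stripTest_differentiable g p) (stripTest_differentiable h p)]
    rfl
  map_smul' a g := by
    ext p
    change fderiv ℝ (a • (g : Freq × ℝ → ℂ)) p v = _
    rw [fderiv_const_smul (stripTest_differentiable g p)]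
    rfl

theorem dirDeriv_apply (v : Freq × ℝ) (g : stripTest) (p : Freq × ℝ) :
    (dirDeriv v g : Freq × ℝ → ℂ) p = fderiv ℝ (g : Freq × ℝ → ℂ) p v := rfl

theorem dirDeriv_add (v w : Freq × ℝ) : dirDeriv (v + w) = dirDeriv v + dirDeriv w := by
  ext g p
  exact map_add (fderiv ℝ (g : Freq × ℝ → ℂ) p) v w

theorem dirDeriv_smul (a : ℝ) (v : Freq × ℝ) : dirDeriv (a • v) = (a : ℂ) • dirDeriv v := by
  ext g p
  change fderiv ℝ (g : Freq × ℝ → ℂ) p (a • v) = (a : ℂ) * fderiv ℝ (g : Freq × ℝ → ℂ) p v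
  rw [map_smul, Complex.real_smul]

/-- The character `x ↦ exp(i x · ξ)`. -/
def planeWave (ξ x : Freq) : ℂ := Complex.exp (Complex.I * (x 0 * ξ 0 + x 1 * ξ 1 : ℝ))

theorem norm_planeWave (ξ x : Freq) : ‖planeWave ξ x‖ = 1 := by
  rw [planeWave, mul_comm, Complex.norm_exp_ofReal_mul_I]

theorem continuous_planeWave : Continuous (fun q : Freq × Freq => planeWave q.1 q.2) := by
  unfold planeWave
  fun_prop

theorem differentiable_planeWave (ξ : Freq) : Differentiable ℝ (planeWave ξ) := by
  have : planeWave ξ = fun x : Freq => Complex.exp (Complex.I * (x 0 * ξ 0 + x 1 * ξ 1 : ℝ)) := rfl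
  rw [this]
  have h : Differentiable ℝ fun x : Freq => (x 0 * ξ 0 + x 1 * ξ 1 : ℝ) := by fun_prop
  exact ((Complex.ofRealCLM.differentiable.comp h).const_mul _).cexp

theorem fderiv_planeWave (ξ x v : Freq) :
    fderiv ℝ (planeWave ξ) x v = Complex.I * (v 0 * ξ 0 + v 1 * ξ 1 : ℝ) * planeWave ξ x := by
  have h0 : HasDerivAt (fun t : ℝ => planeWave ξ (x + t • v))
      (Complex.I * (v 0 * ξ 0 + v 1 * ξ 1 : ℝ) * planeWave ξ x) 0 := by
    have e : (fun t : ℝ => planeWave ξ (x + t • v)) = fun t : ℝ =>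
        Complex.exp (Complex.I * (((x 0 * ξ 0 + x 1 * ξ 1) + t * (v 0 * ξ 0 + v 1 * ξ 1) : ℝ) : ℂ)) := by
      funext t
      rw [planeWave]
      congr 3
      simp only [PiLp.add_apply, PiLp.smul_apply, smul_eq_mul]
      ring
    rw [e]
    have h1 : HasDerivAt (fun t : ℝ => (x 0 * ξ 0 + x 1 * ξ 1) + t * (v 0 * ξ 0 + v 1 * ξ 1))
        (v 0 * ξ 0 + v 1 * ξ 1) 0 := by
      simpa using ((hasDerivAt_id (0 : ℝ)).mul_const (v 0 * ξ 0 + v 1 * ξ 1)).const_add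
        (x 0 * ξ 0 + x 1 * ξ 1)
    refine (h1.ofReal_comp.const_mul Complex.I).cexp.congr_deriv ?_
    rw [planeWave]
    simp only [zero_mul, add_zero]
    ring
  have h1 : HasFDerivAt (planeWave ξ) (fderiv ℝ (planeWave ξ) x) (x + (0 : ℝ) • v) := by
    rw [zero_smul, add_zero]
    exact (differentiable_planeWave ξ x).hasFDerivAt
  have h3 : HasDerivAt (fun t : ℝ => x + t • v) v 0 := by
    simpa using ((hasDerivAt_id (0 : ℝ)).smul_const v).const_add x
  have h4 := HasFDerivAt.comp_hasDerivAt (f := fun t : ℝ => x + t • v) (0 : ℝ) h1 h3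
  exact HasDerivAt.unique h4 h0

/-- The Fourier transform, with the sign `+`, in the tangential variables. -/
def sliceTransform (ξ : Freq) (g : Freq × ℝ → ℂ) (z : ℝ) : ℂ :=
  ∫ x : Freq, planeWave ξ x * g (x, z)

theorem slice_hasCompactSupport (g : stripTest) (z : ℝ) :
    HasCompactSupport fun x : Freq => (g : Freq × ℝ → ℂ) (x, z) := by
  refine HasCompactSupport.intro' (K := Prod.fst '' tsupport (g : Freq × ℝ → ℂ))
    (g.2.2.isCompact.image continuous_fst) (g.2.2.isCompact.image continuous_fst).isClosed ?_
  intro x hx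
  by_contra h
  exact hx ⟨(x, z), subset_tsupport _ h, rfl⟩

theorem slice_continuous (g : stripTest) (z : ℝ) :
    Continuous fun x : Freq => (g : Freq × ℝ → ℂ) (x, z) :=
  (stripTest_continuous g).comp (by fun_prop)

theorem slice_integrable (g : stripTest) (z : ℝ) :
    Integrable fun x : Freq => (g : Freq × ℝ → ℂ) (x, z) :=
  (slice_continuous g z).integrable_of_hasCompactSupport (slice_hasCompactSupport g z)

theorem slice_mul_integrable (g : stripTest) (ξ : Freq) (z : ℝ) :
    Integrable fun x : Freq => planeWave ξ x * (g : Freq × ℝ → ℂ) (x, z) := by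
  refine (slice_integrable g z).bdd_mul (c := 1) ?_ ?_
  · exact (differentiable_planeWave ξ).continuous.aestronglyMeasurable
  · exact Eventually.of_forall fun x => (norm_planeWave ξ x).le

/-- An integrable function of the tangential variable that dominates all slices. -/
theorem exists_slice_bound (g : stripTest) : ∃ b : Freq → ℝ, Integrable b ∧
    ∀ x z, ‖(g : Freq × ℝ → ℂ) (x, z)‖ ≤ b x := by
  obtain ⟨M, hM⟩ := g.2.2.exists_bound_of_continuous (stripTest_continuous g)
  set K := Prod.fst '' tsupport (g : Freq × ℝ → ℂ)
  have hK : IsCompact K := g.2.2.isCompact.image continuous_fst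
  refine ⟨K.indicator fun _ => M, ?_, fun x z => ?_⟩
  · rw [integrable_indicator_iff hK.measurableSet]
    exact integrableOn_const hK.measure_ne_top
  · by_cases hx : x ∈ K
    · rw [indicator_of_mem hx]
      exact hM _
    · rw [indicator_of_notMem hx, norm_le_zero_iff]
      by_contra h
      exact hx ⟨(x, z), subset_tsupport _ h, rfl⟩

theorem hasDerivAt_sliceTransform (ξ : Freq) (g : stripTest) (z : ℝ) :
    HasDerivAt (sliceTransform ξ g) (sliceTransform ξ (dirDeriv (0, 1) g) z) z := by
  obtain ⟨b, hb, hgb⟩ := exists_slice_bound (dirDeriv (0, 1) g)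
  refine (hasDerivAt_integral_of_dominated_loc_of_deriv_le
    (F := fun z x => planeWave ξ x * (g : Freq × ℝ → ℂ) (x, z))
    (F' := fun z x => planeWave ξ x * (dirDeriv (0, 1) g : Freq × ℝ → ℂ) (x, z))
    (bound := b) (s := univ) univ_mem ?_ ?_ ?_ ?_ hb ?_).2
  · exact Eventually.of_forall fun z => (slice_mul_integrable g ξ z).aestronglyMeasurable
  · exact slice_mul_integrable g ξ z
  · exact (slice_mul_integrable _ ξ z).aestronglyMeasurable
  · refine Eventually.of_forall fun x z _ => ?_
    rw [norm_mul, norm_planeWave, one_mul]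
    exact hgb x z
  · refine Eventually.of_forall fun x z _ => ?_
    have h1 : HasDerivAt (fun z : ℝ => ((x, z) : Freq × ℝ)) (0, 1) z :=
      (hasDerivAt_const z x).prodMk (hasDerivAt_id z)
    exact (((stripTest_differentiable g (x, z)).hasFDerivAt).comp_hasDerivAt z h1).const_mul _

theorem contDiff_sliceTransform (ξ : Freq) (n : ℕ) (g : stripTest) :
    ContDiff ℝ n (sliceTransform ξ g) := by
  induction n generalizing g with
  | zero =>
    rw [Nat.cast_zero, contDiff_zero, continuous_iff_continuousAt]
    exact fun z => (hasDerivAt_sliceTransform ξ g z).continuousAt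
  | succ n ih =>
    rw [Nat.cast_add, Nat.cast_one, contDiff_succ_iff_deriv]
    refine ⟨fun z => (hasDerivAt_sliceTransform ξ g z).differentiableAt, by simp, ?_⟩
    have : deriv (sliceTransform ξ g) = sliceTransform ξ (dirDeriv (0, 1) g) :=
      funext fun z => (hasDerivAt_sliceTransform ξ g z).deriv
    rw [this]
    exact ih _

/-- The tangential transform as a map between spaces of test functions. -/
def tangTransform (ξ : Freq) : stripTest →ₗ[ℂ] testFun where
  toFun g := ⟨sliceTransform ξ g, contDiff_infty.mpr fun n => contDiff_sliceTransform ξ n g, by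
    refine HasCompactSupport.intro' (K := Prod.snd '' tsupport (g : Freq × ℝ → ℂ))
      (g.2.2.isCompact.image continuous_snd) (g.2.2.isCompact.image continuous_snd).isClosed ?_
    intro z hz
    have : ∀ x : Freq, (g : Freq × ℝ → ℂ) (x, z) = 0 := by
      intro x
      by_contra h
      exact hz ⟨(x, z), subset_tsupport _ h, rfl⟩
    simp [sliceTransform, this]⟩
  map_add' g h := by
    ext z
    change ∫ x : Freq, planeWave ξ x * ((g : Freq × ℝ → ℂ) (x, z) + (h : Freq × ℝ → ℂ) (x, z)) = _
    simp only [mul_add]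
    exact integral_add (slice_mul_integrable g ξ z) (slice_mul_integrable h ξ z)
  map_smul' a g := by
    ext z
    change ∫ x : Freq, planeWave ξ x * (a * (g : Freq × ℝ → ℂ) (x, z)) = _
    simp only [mul_left_comm _ a]
    exact integral_const_mul _ _

theorem tangTransform_apply (ξ : Freq) (g : stripTest) (z : ℝ) :
    (tangTransform ξ g : ℝ → ℂ) z = ∫ x : Freq, planeWave ξ x * (g : Freq × ℝ → ℂ) (x, z) := rfl

theorem tangTransform_dirDeriv_normal (ξ : Freq) (g : stripTest) :
    tangTransform ξ (dirDeriv (0, 1) g) = diffOp X (tangTransform ξ g) := by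
  ext z
  rw [diffOp, aeval_X]
  exact (hasDerivAt_sliceTransform ξ g z).deriv.symm

/-- Tangential derivatives become multiplications, by integration by parts. -/
theorem tangTransform_dirDeriv_tangent (ξ v : Freq) (g : stripTest) :
    tangTransform ξ (dirDeriv (v, 0) g)
      = diffOp (Polynomial.C (-(Complex.I * (v 0 * ξ 0 + v 1 * ξ 1 : ℝ)))) (tangTransform ξ g) := by
  ext z
  have e : (diffOp (Polynomial.C (-(Complex.I * (v 0 * ξ 0 + v 1 * ξ 1 : ℝ)))) (tangTransform ξ g) : ℝ → ℂ) z
      = -(Complex.I * (v 0 * ξ 0 + v 1 * ξ 1 : ℝ)) * (tangTransform ξ g : ℝ → ℂ) z := by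
    rw [diffOp, aeval_C]
    rfl
  rw [e, tangTransform_apply, tangTransform_apply]
  have hd : Differentiable ℝ fun x : Freq => (g : Freq × ℝ → ℂ) (x, z) :=
    (stripTest_differentiable g).comp (by fun_prop)
  have hfd : ∀ x, fderiv ℝ (fun x : Freq => (g : Freq × ℝ → ℂ) (x, z)) x v
      = (dirDeriv (v, 0) g : Freq × ℝ → ℂ) (x, z) := by
    intro x
    have h1 : HasFDerivAt (fun x : Freq => ((x, z) : Freq × ℝ))
      (ContinuousLinearMap.inl ℝ Freq ℝ) x := hasFDerivAt_prodMk_left x z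
    have h2 := (stripTest_differentiable g (x, z)).hasFDerivAt.comp x h1
    have h3 : fderiv ℝ (fun x : Freq => (g : Freq × ℝ → ℂ) (x, z)) x = _ := h2.fderiv
    rw [h3]
    rfl
  have hpw : ∀ x, fderiv ℝ (planeWave ξ) x v * (g : Freq × ℝ → ℂ) (x, z)
      = (Complex.I * (v 0 * ξ 0 + v 1 * ξ 1 : ℝ)) * (planeWave ξ x * (g : Freq × ℝ → ℂ) (x, z)) := by
    intro x
    rw [fderiv_planeWave]
    ring
  have h := integral_mul_fderiv_eq_neg_fderiv_mul_of_integrable (μ := (volume : Measure Freq))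
    (v := v) (f := planeWave ξ) (g := fun x : Freq => (g : Freq × ℝ → ℂ) (x, z)) ?_ ?_ ?_
    (fun x _ => differentiable_planeWave ξ x) (fun x _ => hd x)
  · simp only [hfd, hpw] at h
    rw [h, integral_const_mul, neg_mul]
  · simp only [hpw]
    exact (slice_mul_integrable g ξ z).const_mul _
  · simp only [hfd]
    exact slice_mul_integrable _ ξ z
  · exact slice_mul_integrable g ξ z

end PartialFourier

/-! ### The rotated chart and the symbols of the operators -/

section Chart

open Polynomial

/-- The inverse of the rotation to local coordinates, `((x, y), z) ↦ (x₁, x₂, x₃)`. -/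
def normalChart (α : ℝ) : (Freq × ℝ) ≃L[ℝ] E3 :=
  LinearEquiv.toContinuousLinearEquiv
    { toFun := fun q => !₂[Real.cos α * q.1 0 - Real.sin α * q.2, q.1 1,
        Real.sin α * q.1 0 + Real.cos α * q.2]
      invFun := fun p => (!₂[locX α p, locY p], locZ α p)
      map_add' := fun q r => by
        ext i; fin_cases i <;> simp <;> ring
      map_smul' := fun a q => by
        ext i; fin_cases i <;> simp <;> ring
      left_inv := fun q => by
        have h := Real.sin_sq_add_cos_sq α
        refine Prod.ext ?_ ?_
        · ext i
          fin_cases i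
          · simp [locX]; linear_combination (q.1 0) * h
          · simp [locY]
        · simp [locZ]; linear_combination q.2 * h
      right_inv := fun p => by
        have h := Real.sin_sq_add_cos_sq α
        ext i
        fin_cases i
        · simp [locX, locZ]; linear_combination (p 0) * h
        · simp [locY]
        · simp [locX, locZ]; linear_combination (p 2) * h }

variable {α : ℝ}

theorem normalChart_symm_apply (p : E3) :
    (normalChart α).symm p = (!₂[locX α p, locY p], locZ α p) := rfl

theorem locX_normalChart (q : Freq × ℝ) : locX α (normalChart α q) = q.1 0 :=
  congrArg (fun r : Freq × ℝ => r.1 0) ((normalChart α).symm_apply_apply q)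

theorem locY_normalChart (q : Freq × ℝ) : locY (normalChart α q) = q.1 1 := rfl

theorem locZ_normalChart (q : Freq × ℝ) : locZ α (normalChart α q) = q.2 :=
  congrArg (fun r : Freq × ℝ => r.2) ((normalChart α).symm_apply_apply q)

theorem normalChart_mem_domain (hα : 0 < Real.cos α) (q : Freq × ℝ) :
    normalChart α q ∈ domain α ↔ 0 < q.2 := by
  rw [mem_domain_iff hα, locZ_normalChart]

/-- The test functions on the domain. -/
def bodyTest (α : ℝ) : Submodule ℂ (E3 → ℂ) where
  carrier := {φ | IsTest (domain α) φ}
  add_mem' h₁ h₂ := ⟨h₁.1.add h₂.1, h₁.2.1.add h₂.2.1,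
    (tsupport_add _ _).trans (union_subset h₁.2.2 h₂.2.2)⟩
  zero_mem' := ⟨contDiff_const, HasCompactSupport.zero, by simp [tsupport]⟩
  smul_mem' a _ h := ⟨h.1.const_smul a, h.2.1.smul_left (f := fun _ => a),
    (closure_mono (Function.support_const_smul_subset a _)).trans h.2.2⟩

theorem bodyTest_differentiable (φ : bodyTest α) : Differentiable ℝ (φ : E3 → ℂ) :=
  φ.2.1.differentiable (by simp)

/-- Partial derivatives of test functions. -/
def bodyDeriv (i : Fin 3) : bodyTest α →ₗ[ℂ] bodyTest α where
  toFun φ := ⟨pd i φ,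
    (φ.2.1.fderiv_right (m := (⊤ : ℕ∞)) (by simp)).clm_apply contDiff_const,
    φ.2.2.1.fderiv_apply (𝕜 := ℝ) _, (tsupport_fderiv_apply_subset ℝ _).trans φ.2.2.2⟩
  map_add' φ η := by
    ext p
    change fderiv ℝ ((φ : E3 → ℂ) + (η : E3 → ℂ)) p _ = _
    rw [fderiv_add (bodyTest_differentiable φ p) (bodyTest_differentiable η p)]
    rfl
  map_smul' a φ := by
    ext p
    change fderiv ℝ (a • (φ : E3 → ℂ)) p _ = _
    rw [fderiv_const_smul (bodyTest_differentiable φ p)]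
    rfl

/-- Test functions in local coordinates. -/
def pullback : bodyTest α →ₗ[ℂ] stripTest where
  toFun φ := ⟨fun q => (φ : E3 → ℂ) (normalChart α q),
    φ.2.1.comp (normalChart α).contDiff,
    φ.2.2.1.comp_homeomorph (normalChart α).toHomeomorph⟩
  map_add' _ _ := rfl
  map_smul' _ _ := rfl

theorem pullback_apply (φ : bodyTest α) (q : Freq × ℝ) :
    (pullback φ : Freq × ℝ → ℂ) q = (φ : E3 → ℂ) (normalChart α q) := rfl

theorem pullback_bodyDeriv (i : Fin 3) (φ : bodyTest α) :
    pullback (bodyDeriv i φ)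
      = dirDeriv ((normalChart α).symm (EuclideanSpace.single i 1)) (pullback φ) := by
  ext q
  rw [dirDeriv_apply, pullback_apply]
  change fderiv ℝ (φ : E3 → ℂ) (normalChart α q) _ = _
  have h := (bodyTest_differentiable φ (normalChart α q)).hasFDerivAt.comp q
    (normalChart α).hasFDerivAt
  have h2 : fderiv ℝ (pullback φ : Freq × ℝ → ℂ) q = _ := h.fderiv
  rw [h2]
  simp

/-- The tangential transform of a test function on the domain. -/
def bodyTransform (α : ℝ) (ξ : Freq) : bodyTest α →ₗ[ℂ] testFun := tangTransform ξ ∘ₗ pullback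

/-- The symbol `ik · e₁` of `∂₁` on `exp(i(x ξ_x + y ξ_y) - μ z)`. -/
def symbolOne (α : ℝ) (ξ : Freq) : ℂ[X] :=
  Polynomial.C ((Real.cos α : ℂ) * Complex.I * ξ 0) + Polynomial.C (Real.sin α : ℂ) * X

/-- The symbol of `∂₃`. -/
def symbolThree (α : ℝ) (ξ : Freq) : ℂ[X] :=
  Polynomial.C (Complex.I * (Real.sin α : ℂ) * ξ 0) - Polynomial.C (Real.cos α : ℂ) * X

theorem diffOp_add (p q : ℂ[X]) (θ : testFun) : diffOp (p + q) θ = diffOp p θ + diffOp q θ := by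
  simp [diffOp]

theorem diffOp_sub (p q : ℂ[X]) (θ : testFun) : diffOp (p - q) θ = diffOp p θ - diffOp q θ := by
  simp [diffOp]

theorem diffOp_C_mul (a : ℂ) (p : ℂ[X]) (θ : testFun) :
    diffOp (Polynomial.C a * p) θ = a • diffOp p θ := by
  rw [diffOp_mul, diffOp, diffOp, aeval_C]
  rfl

theorem diffOp_C (a : ℂ) (θ : testFun) : diffOp (Polynomial.C a) θ = a • θ := by
  rw [diffOp, aeval_C]
  rfl

theorem bodyTransform_bodyDeriv (i : Fin 3) (ξ : Freq) (φ : bodyTest α) (v : Freq) (t : ℝ)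
    (h : (normalChart α).symm (EuclideanSpace.single i 1) = (v, t)) :
    bodyTransform α ξ (bodyDeriv i φ)
      = diffOp (-(Polynomial.C (Complex.I * (v 0 * ξ 0 + v 1 * ξ 1 : ℝ))
          - Polynomial.C (t : ℂ) * X)) (bodyTransform α ξ φ) := by
  have e : ((v, t) : Freq × ℝ) = (v, 0) + t • (0, 1) := by simp
  rw [bodyTransform, LinearMap.comp_apply, pullback_bodyDeriv, h, e, dirDeriv_add, dirDeriv_smul,
    LinearMap.add_apply, map_add, LinearMap.smul_apply, map_smul, tangTransform_dirDeriv_normal,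
    tangTransform_dirDeriv_tangent, neg_sub, sub_eq_neg_add, diffOp_add, diffOp_C_mul,
    Polynomial.C_neg]
  rfl

theorem bodyTransform_bodyDeriv_zero (ξ : Freq) (φ : bodyTest α) :
    bodyTransform α ξ (bodyDeriv 0 φ) = diffOp (-symbolOne α ξ) (bodyTransform α ξ φ) := by
  rw [bodyTransform_bodyDeriv 0 ξ φ !₂[Real.cos α, 0] (-Real.sin α)
    (by rw [normalChart_symm_apply]; simp [locX, locY, locZ])]
  congr 2
  rw [symbolOne]
  simp
  ring

theorem bodyTransform_bodyDeriv_one (ξ : Freq) (φ : bodyTest α) :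
    bodyTransform α ξ (bodyDeriv 1 φ)
      = diffOp (-Polynomial.C (Complex.I * ξ 1)) (bodyTransform α ξ φ) := by
  rw [bodyTransform_bodyDeriv 1 ξ φ !₂[0, 1] 0
    (by rw [normalChart_symm_apply]; simp [locX, locY, locZ])]
  congr 2
  simp

theorem bodyTransform_bodyDeriv_two (ξ : Freq) (φ : bodyTest α) :
    bodyTransform α ξ (bodyDeriv 2 φ) = diffOp (-symbolThree α ξ) (bodyTransform α ξ φ) := by
  rw [bodyTransform_bodyDeriv 2 ξ φ !₂[Real.sin α, 0] (Real.cos α)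
    (by rw [normalChart_symm_apply]; simp [locX, locY, locZ])]
  congr 2
  rw [symbolThree]
  simp
  ring

/-- The operator `A` on test functions acts as `p ξ (∂_z)` after the tangential transform. -/
def HasSymbol (A : bodyTest α →ₗ[ℂ] bodyTest α) (p : Freq → ℂ[X]) : Prop :=
  ∀ ξ φ, bodyTransform α ξ (A φ) = diffOp (p ξ) (bodyTransform α ξ φ)

theorem HasSymbol.mul {A B : bodyTest α →ₗ[ℂ] bodyTest α} {p q : Freq → ℂ[X]}
    (hA : HasSymbol A p) (hB : HasSymbol B q) : HasSymbol (A * B) fun ξ => p ξ * q ξ := by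
  intro ξ φ
  rw [Module.End.mul_apply, hA, hB, diffOp_mul]

theorem HasSymbol.add {A B : bodyTest α →ₗ[ℂ] bodyTest α} {p q : Freq → ℂ[X]}
    (hA : HasSymbol A p) (hB : HasSymbol B q) : HasSymbol (A + B) fun ξ => p ξ + q ξ := by
  intro ξ φ
  rw [LinearMap.add_apply, map_add, hA, hB, diffOp_add]

theorem HasSymbol.sub {A B : bodyTest α →ₗ[ℂ] bodyTest α} {p q : Freq → ℂ[X]}
    (hA : HasSymbol A p) (hB : HasSymbol B q) : HasSymbol (A - B) fun ξ => p ξ - q ξ := by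
  intro ξ φ
  rw [LinearMap.sub_apply, map_sub, hA, hB, diffOp_sub]

theorem HasSymbol.smul {A : bodyTest α →ₗ[ℂ] bodyTest α} {p : Freq → ℂ[X]}
    (hA : HasSymbol A p) (a : ℂ) : HasSymbol (a • A) fun ξ => Polynomial.C a * p ξ := by
  intro ξ φ
  rw [LinearMap.smul_apply, map_smul, hA, diffOp_C_mul]

/-- The operator `qgTranspose` on test functions. -/
def qgOp (P : Params) : bodyTest P.α →ₗ[ℂ] bodyTest P.α :=
  let A : bodyTest P.α →ₗ[ℂ] bodyTest P.α := bodyDeriv 0 * bodyDeriv 0 + bodyDeriv 1 * bodyDeriv 1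
  let B : bodyTest P.α →ₗ[ℂ] bodyTest P.α := bodyDeriv 2 * bodyDeriv 2
  (Complex.I * P.ω) • (A + B) - (P.β : ℂ) • bodyDeriv 0
    - ((P.νh : ℂ) • (A * A) + (P.ν3 : ℂ) • (B * A))

/-- The transpose `-β ∂₁` of the Sverdrup operator on test functions. -/
def sverdrupOp (P : Params) : bodyTest P.α →ₗ[ℂ] bodyTest P.α := -(P.β : ℂ) • bodyDeriv 0

theorem HasSymbol.congr {A : bodyTest α →ₗ[ℂ] bodyTest α} {p q : Freq → ℂ[X]}
    (hA : HasSymbol A p) (h : ∀ ξ, p ξ = q ξ) : HasSymbol A q := by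
  intro ξ φ
  rw [hA, h]

theorem hasSymbol_sverdrupOp (P : Params) :
    HasSymbol (sverdrupOp P) fun ξ => Polynomial.C (P.β : ℂ) * symbolOne P.α ξ := by
  have h0 : HasSymbol (α := P.α) (bodyDeriv 0) fun ξ => -symbolOne P.α ξ :=
    bodyTransform_bodyDeriv_zero
  refine (h0.smul _).congr fun ξ => ?_
  simp

/-- The transposed operator acts on the transforms of test functions as the characteristic
polynomial, evaluated at `∂_z`. -/
theorem hasSymbol_qgOp (P : Params) : HasSymbol (qgOp P) (charPoly P) := by
  have h0 : HasSymbol (α := P.α) (bodyDeriv 0) fun ξ => -symbolOne P.α ξ :=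
    bodyTransform_bodyDeriv_zero
  have h1 : HasSymbol (α := P.α) (bodyDeriv 1) fun ξ => -Polynomial.C (Complex.I * ξ 1) :=
    bodyTransform_bodyDeriv_one
  have h2 : HasSymbol (α := P.α) (bodyDeriv 2) fun ξ => -symbolThree P.α ξ :=
    bodyTransform_bodyDeriv_two
  have hA := (h0.mul h0).add (h1.mul h1)
  have hB := h2.mul h2
  refine ((((hA.add hB).smul (Complex.I * P.ω)).sub (h0.smul (P.β : ℂ))).sub
    (((hA.mul hA).smul (P.νh : ℂ)).add ((hB.mul hA).smul (P.ν3 : ℂ)))).congr fun ξ => ?_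
  apply Polynomial.funext
  intro m
  rw [eval_charPoly, norm_sq_freq]
  simp only [symbolOne, symbolThree, eval_add, eval_sub, eval_mul, eval_neg, eval_C, eval_X]
  push_cast
  have h : (Complex.sin P.α) ^ 2 + (Complex.cos P.α) ^ 2 = 1 := Complex.sin_sq_add_cos_sq _
  have hI : Complex.I ^ 2 = -1 := Complex.I_sq
  generalize Complex.sin P.α = s at *
  generalize Complex.cos P.α = c at *
  generalize (ξ 0 : ℂ) = x at *
  generalize (ξ 1 : ℂ) = y at *
  have e1 : (-(c * Complex.I * x + s * m) * -(c * Complex.I * x + s * m) +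
      -(Complex.I * y) * -(Complex.I * y)) = (c * Complex.I * x + s * m) ^ 2 - y ^ 2 := by
    linear_combination y ^ 2 * hI
  have e2 : -(Complex.I * s * x - c * m) * -(Complex.I * s * x - c * m)
      = (Complex.I * s * x - c * m) ^ 2 := by ring
  have e3 : (c * Complex.I * x + s * m) ^ 2 - y ^ 2 + (Complex.I * s * x - c * m) ^ 2
      = m ^ 2 - (x ^ 2 + y ^ 2) := by
    linear_combination (x ^ 2 * Complex.I ^ 2 + m ^ 2) * h + x ^ 2 * hI
  rw [e1, e2, e3]
  ring

theorem bodyTransform_apply (ξ : Freq) (φ : bodyTest α) (z : ℝ) :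
    (bodyTransform α ξ φ : ℝ → ℂ) z
      = ∫ x : Freq, planeWave ξ x * (φ : E3 → ℂ) (normalChart α (x, z)) := rfl

/-- Test functions on the domain have transforms supported in `z ≥ 0`. -/
theorem vanishBelow_bodyTransform (hα : 0 < Real.cos α) (ξ : Freq) (φ : bodyTest α) :
    VanishBelow 0 (bodyTransform α ξ φ : testFun) := by
  intro z hz
  have : ∀ x : Freq, (φ : E3 → ℂ) (normalChart α (x, z)) = 0 := by
    intro x
    by_contra h
    have := φ.2.2.2 (subset_tsupport _ h)
    rw [normalChart_mem_domain hα] at this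
    exact absurd hz (not_lt.mpr this.le)
  simp [bodyTransform_apply, this]

/-- The product of a tangential and of a normal test function. -/
def prodTest (hα : 0 < Real.cos α) (χ : Freq → ℂ) (hχ : ContDiff ℝ (⊤ : ℕ∞) χ)
    (hχc : HasCompactSupport χ) (θ : testFun) (hθ : tsupport (θ : ℝ → ℂ) ⊆ Ioi 0) : bodyTest α :=
  ⟨fun p => χ ((normalChart α).symm p).1 * (θ : ℝ → ℂ) ((normalChart α).symm p).2, by
    have hc : HasCompactSupport fun q : Freq × ℝ => χ q.1 * (θ : ℝ → ℂ) q.2 := by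
      refine HasCompactSupport.intro' (K := tsupport χ ×ˢ tsupport (θ : ℝ → ℂ))
        (hχc.isCompact.prod θ.2.2.isCompact) ((isClosed_tsupport _).prod (isClosed_tsupport _)) ?_
      intro q hq
      by_contra h
      exact hq ⟨subset_tsupport _ (left_ne_zero_of_mul h),
        subset_tsupport _ (right_ne_zero_of_mul h)⟩
    have hd : ContDiff ℝ (⊤ : ℕ∞) fun q : Freq × ℝ => χ q.1 * (θ : ℝ → ℂ) q.2 :=
      (hχ.comp contDiff_fst).mul (θ.2.1.comp contDiff_snd)
    refine ⟨hd.comp (normalChart α).symm.contDiff,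
      hc.comp_homeomorph (normalChart α).symm.toHomeomorph, ?_⟩
    have hcl : IsClosed {p : E3 | ((normalChart α).symm p).2 ∈ tsupport (θ : ℝ → ℂ)} :=
      (isClosed_tsupport _).preimage (continuous_snd.comp (normalChart α).symm.continuous)
    refine (closure_minimal ?_ hcl).trans ?_
    · intro p hp
      exact subset_tsupport _ (right_ne_zero_of_mul hp)
    · intro p hp
      rw [mem_domain_iff hα]
      exact hθ hp⟩

theorem bodyTransform_prodTest (hα : 0 < Real.cos α) (χ : Freq → ℂ) (hχ : ContDiff ℝ (⊤ : ℕ∞) χ)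
    (hχc : HasCompactSupport χ) (θ : testFun) (hθ : tsupport (θ : ℝ → ℂ) ⊆ Ioi 0) (ξ : Freq) :
    bodyTransform α ξ (prodTest hα χ hχ hχc θ hθ) = (∫ x, planeWave ξ x * χ x) • θ := by
  ext z
  rw [bodyTransform_apply]
  change ∫ x : Freq, planeWave ξ x * (χ ((normalChart α).symm (normalChart α (x, z))).1 *
    (θ : ℝ → ℂ) ((normalChart α).symm (normalChart α (x, z))).2) = _ * (θ : ℝ → ℂ) z
  simp only [ContinuousLinearEquiv.symm_apply_apply]
  simp only [← mul_assoc]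
  exact integral_mul_const _ _

end Chart

/-! ### Parseval's formula on the half-space -/

section Parseval

open Polynomial

/-- Injectivity of the Fourier transform on `L¹`, by duality with Schwartz functions. -/
theorem ae_eq_zero_of_integral_planeWave_eq_zero {F : Freq → ℂ} (hF : Integrable F)
    (h : ∀ a : Freq, ∫ ξ, planeWave ξ a * F ξ = 0) : ∀ᵐ ξ, F ξ = 0 := by
  have hfour : ∀ w : Freq,
      VectorFourier.fourierIntegral Real.fourierChar volume (innerₗ Freq).flip F w = 0 := by
    intro w
    rw [← h (-(2 * Real.pi) • w), VectorFourier.fourierIntegral]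
    refine integral_congr_ae (Eventually.of_forall fun ξ => ?_)
    dsimp only
    rw [Circle.smul_def, Real.fourierChar_apply, smul_eq_mul, planeWave]
    congr 2
    simp [PiLp.inner_apply, Fin.sum_univ_two]
    ring
  refine ae_eq_zero_of_integral_contDiff_smul_eq_zero hF.locallyIntegrable fun g hg hgc => ?_
  have hgc' : HasCompactSupport fun x => (g x : ℂ) :=
    hgc.comp_left (g := fun x : ℝ => (x : ℂ)) Complex.ofReal_zero
  set G : SchwartzMap Freq ℂ :=
    hgc'.toSchwartzMap (Complex.ofRealCLM.contDiff.comp hg) with hG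
  have hG1 : ∀ x, G x = (g x : ℂ) := fun x => rfl
  set H : SchwartzMap Freq ℂ := FourierTransformInv.fourierInv G with hH
  have hGH : FourierTransform.fourier H = G := FourierTransform.fourier_fourierInv_eq G
  have h2 := VectorFourier.integral_fourierIntegral_smul_eq_flip (L := innerₗ Freq)
    (e := Real.fourierChar) (μ := volume) (ν := volume) (f := H) (g := F)
    Real.continuous_fourierChar continuous_inner H.integrable hF
  simp only [hfour, smul_zero, integral_zero] at h2
  rw [← h2]
  refine integral_congr_ae (Eventually.of_forall fun x => ?_)
  dsimp only
  have h3 : VectorFourier.fourierIntegral Real.fourierChar volume (innerₗ Freq) H x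
      = (FourierTransform.fourier H : SchwartzMap Freq ℂ) x := by
    rw [SchwartzMap.fourier_coe]
    rfl
  rw [h3, hGH, hG1, smul_eq_mul, Complex.real_smul]

variable {α : ℝ}

/-- Lebesgue measure on the half-space `z > 0` of the chart. -/
def stripMeasure : Measure (Freq × ℝ) :=
  (volume : Measure Freq).prod (volume.restrict (Ioi (0 : ℝ)))

/-- The chart is linear, hence it maps Lebesgue measure to a multiple of Lebesgue measure. That the
multiple is `1` is not needed. -/
theorem exists_map_stripMeasure (hα : 0 < Real.cos α) : ∃ k : ℝ≥0∞, k ≠ 0 ∧ k ≠ ∞ ∧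
    Measure.map (normalChart α) stripMeasure = k • volume.restrict (domain α) := by
  have hm : MeasurableEmbedding (normalChart α) :=
    (normalChart α).toHomeomorph.measurableEmbedding
  have hvol : ((volume : Measure Freq).prod (volume : Measure ℝ)).IsAddHaarMeasure := inferInstance
  have hhaar : (Measure.map (normalChart α)
      ((volume : Measure Freq).prod (volume : Measure ℝ))).IsAddHaarMeasure :=
    (normalChart α).isAddHaarMeasure_map _
  obtain ⟨k, hk0, hk⟩ : ∃ k : NNReal, 0 < k ∧ Measure.map (normalChart α)
      ((volume : Measure Freq).prod (volume : Measure ℝ)) = k • (volume : Measure E3) :=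
    ⟨_, Measure.addHaarScalarFactor_pos_of_isAddHaarMeasure _ _,
      Measure.isAddLeftInvariant_eq_smul _ _⟩
  refine ⟨k, ENNReal.coe_ne_zero.mpr hk0.ne', ENNReal.coe_ne_top, ?_⟩
  have hdom : normalChart α ⁻¹' domain α = univ ×ˢ Ioi (0 : ℝ) := by
    ext q
    rw [mem_preimage, normalChart_mem_domain hα]
    simp
  have h1 : stripMeasure = ((volume : Measure Freq).prod (volume : Measure ℝ)).restrict
      (normalChart α ⁻¹' domain α) := by
    rw [hdom, ← Measure.prod_restrict, Measure.restrict_univ, stripMeasure]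
  rw [h1, ← hm.restrict_map, hk, Measure.restrict_smul]
  rfl

/-- The tangential transform decays in `ξ` and is compactly supported in `z`, uniformly. -/
theorem exists_tangTransform_bound (g : stripTest) : ∃ C b : ℝ, 0 ≤ C ∧ 0 < b ∧ ∀ ξ z,
    ‖(tangTransform ξ g : ℝ → ℂ) z‖ ≤ C / (1 + ‖ξ‖ ^ 2) ∧
      (b ≤ z → (tangTransform ξ g : ℝ → ℂ) z = 0) := by
  set Dx := dirDeriv (EuclideanSpace.single 0 1, 0)
  set Dy := dirDeriv (EuclideanSpace.single 1 1, 0)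
  -- The transform of `(1 - Δ_{x,y}) g` is `(1 + |ξ|²)` times the one of `g`.
  set h : stripTest := g - Dx (Dx g) - Dy (Dy g) with hh
  obtain ⟨B, hB, hgB⟩ := exists_slice_bound h
  have hsupp : BddAbove (Prod.snd '' tsupport (g : Freq × ℝ → ℂ)) :=
    (g.2.2.isCompact.image continuous_snd).bddAbove
  obtain ⟨b, hb⟩ := hsupp
  refine ⟨∫ x, B x, |b| + 1, ?_, by positivity, fun ξ z => ⟨?_, fun hz => ?_⟩⟩
  · exact integral_nonneg fun x => (norm_nonneg _).trans (hgB x 0)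
  · have h1 : (tangTransform ξ h : ℝ → ℂ) z
        = ((1 + ‖ξ‖ ^ 2 : ℝ) : ℂ) * (tangTransform ξ g : ℝ → ℂ) z := by
      have hI := Complex.I_sq
      rw [hh, map_sub, map_sub, tangTransform_dirDeriv_tangent, tangTransform_dirDeriv_tangent,
        tangTransform_dirDeriv_tangent, tangTransform_dirDeriv_tangent, diffOp_C, diffOp_C,
        diffOp_C, diffOp_C, norm_sq_freq]
      change (tangTransform ξ g : ℝ → ℂ) z - _ * (_ * (tangTransform ξ g : ℝ → ℂ) z)
        - _ * (_ * (tangTransform ξ g : ℝ → ℂ) z) = _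
      simp
      linear_combination (-(tangTransform ξ g : ℝ → ℂ) z * ((ξ 0) ^ 2 + (ξ 1) ^ 2)) * hI
    have h2 : ‖(tangTransform ξ h : ℝ → ℂ) z‖ ≤ ∫ x, B x := by
      rw [tangTransform_apply]
      refine norm_integral_le_of_norm_le hB (Eventually.of_forall fun x => ?_)
      rw [norm_mul, norm_planeWave, one_mul]
      exact hgB x z
    rw [h1, norm_mul, Complex.norm_real, Real.norm_eq_abs,
      abs_of_pos (by positivity : 0 < 1 + ‖ξ‖ ^ 2)] at h2
    rw [le_div_iff₀ (by positivity), mul_comm]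
    exact h2
  · have : ∀ x : Freq, (g : Freq × ℝ → ℂ) (x, z) = 0 := by
      intro x
      by_contra hx
      have h1 := hb ⟨(x, z), subset_tsupport _ hx, rfl⟩
      have h1' : z ≤ b := h1
      linarith [le_abs_self b]
    simp [tangTransform_apply, this]

theorem stronglyMeasurable_tangTransform (g : stripTest) :
    StronglyMeasurable fun q : Freq × ℝ => (tangTransform q.1 g : ℝ → ℂ) q.2 := by
  have hc : Continuous fun r : (Freq × ℝ) × Freq =>
      planeWave r.1.1 r.2 * (g : Freq × ℝ → ℂ) (r.2, r.1.2) :=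
    (continuous_planeWave.comp (by fun_prop : Continuous fun r : (Freq × ℝ) × Freq =>
      (r.1.1, r.2))).mul ((stripTest_continuous g).comp (by fun_prop))
  exact hc.stronglyMeasurable.integral_prod_right (ν := (volume : Measure Freq))

/-- Transforms that are integrable on almost every slice and square integrable in the frequency
with values in `L¹_loc([0, ∞))`. -/
structure SliceRegular (u : Freq → ℝ → ℂ) : Prop where
  meas : TangMeas u
  slice : ∀ᵐ z ∂(volume.restrict (Ioi (0 : ℝ))), Integrable fun ξ => u ξ z
  square : ∀ b : ℝ, ∫⁻ ξ, (∫⁻ z in Ioo 0 b, ‖u ξ z‖ₑ) ^ 2 < ∞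

theorem lintegral_decay_sq_lt_top (C : ℝ) :
    ∫⁻ ξ : Freq, ENNReal.ofReal (C / (1 + ‖ξ‖ ^ 2)) ^ 2 < ∞ := by
  have h := (integrable_rpow_neg_one_add_norm_sq (E := Freq) (μ := volume) (r := 4)
    (by simp; norm_num)).const_mul (C ^ 2)
  have h2 : Integrable fun ξ : Freq => (C / (1 + ‖ξ‖ ^ 2)) ^ 2 := by
    refine h.congr (Eventually.of_forall fun ξ => ?_)
    dsimp only
    have hp : (0 : ℝ) < 1 + ‖ξ‖ ^ 2 := by positivity
    rw [show (-(4 : ℝ) / 2) = -(2 : ℕ) by norm_num, Real.rpow_neg hp.le, Real.rpow_natCast,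
      div_pow, div_eq_mul_inv]
  have h3 := h2.hasFiniteIntegral
  rw [hasFiniteIntegral_iff_enorm] at h3
  refine lt_of_le_of_lt (lintegral_mono fun ξ => ?_) h3
  rw [enorm_pow]
  gcongr
  rw [← ofReal_norm]
  exact ENNReal.ofReal_le_ofReal (le_abs_self _)

theorem ennreal_mul_le_sq_add_sq (a b : ℝ≥0∞) : a * b ≤ a ^ 2 + b ^ 2 := by
  rcases le_total a b with h | h
  · calc a * b ≤ b * b := by gcongr
      _ = b ^ 2 := (sq b).symm
      _ ≤ _ := le_add_self
  · calc a * b ≤ a * a := by gcongr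
      _ = a ^ 2 := (sq a).symm
      _ ≤ _ := le_self_add

/-- Such transforms pair absolutely with the transforms of test functions, which are square
integrable in `ξ`. -/
theorem SliceRegular.integrable {u : Freq → ℝ → ℂ} (hu : SliceRegular u) (g : stripTest) :
    Integrable (fun q : Freq × ℝ => u q.1 q.2 * (tangTransform q.1 g : ℝ → ℂ) q.2)
      stripMeasure := by
  obtain ⟨C, b, hC, hb, hg⟩ := exists_tangTransform_bound g
  have hm : AEStronglyMeasurable
      (fun q : Freq × ℝ => u q.1 q.2 * (tangTransform q.1 g : ℝ → ℂ) q.2) stripMeasure :=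
    hu.meas.mul (stronglyMeasurable_tangTransform g).aestronglyMeasurable
  refine ⟨hm, ?_⟩
  rw [hasFiniteIntegral_iff_enorm, stripMeasure, lintegral_prod _ hm.enorm]
  calc ∫⁻ ξ, ∫⁻ z in Ioi 0, ‖u ξ z * (tangTransform ξ g : ℝ → ℂ) z‖ₑ
      ≤ ∫⁻ ξ, ((∫⁻ z in Ioo 0 b, ‖u ξ z‖ₑ) ^ 2 + ENNReal.ofReal (C / (1 + ‖ξ‖ ^ 2)) ^ 2) := by
        refine lintegral_mono fun ξ => ?_
        refine le_trans ?_ (ennreal_mul_le_sq_add_sq _ _)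
        rw [← lintegral_mul_const' _ _ ENNReal.ofReal_ne_top,
          ← lintegral_indicator measurableSet_Ioi, ← lintegral_indicator measurableSet_Ioo]
        refine lintegral_mono fun z => ?_
        by_cases h0 : z ∈ Ioi (0 : ℝ)
        · rw [indicator_of_mem h0]
          by_cases h1 : b ≤ z
          · simp [(hg ξ z).2 h1]
          · rw [indicator_of_mem (show z ∈ Ioo 0 b from ⟨h0, not_le.mp h1⟩), enorm_mul]
            gcongr
            rw [← ofReal_norm]
            exact ENNReal.ofReal_le_ofReal (hg ξ z).1
        · rw [indicator_of_notMem h0]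
          exact zero_le
    _ = (∫⁻ ξ, (∫⁻ z in Ioo 0 b, ‖u ξ z‖ₑ) ^ 2)
          + ∫⁻ ξ : Freq, ENNReal.ofReal (C / (1 + ‖ξ‖ ^ 2)) ^ 2 := by
        refine lintegral_add_right _ ?_
        fun_prop
    _ < ∞ := ENNReal.add_lt_top.mpr ⟨hu.square b, lintegral_decay_sq_lt_top C⟩

theorem tangInv_normalChart (u : Freq → ℝ → ℂ) (x : Freq) (z : ℝ) :
    tangInv α u (normalChart α (x, z))
      = (1 / (2 * Real.pi : ℂ) ^ 2) * ∫ ξ : Freq, planeWave ξ x * u ξ z := by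
  rw [tangInv, locX_normalChart, locY_normalChart, locZ_normalChart]
  rfl

theorem integrable_mul_bodyTest {ψ : E3 → ℂ} (hψ : LocallyIntegrableOn ψ (domain α))
    (φ : bodyTest α) : IntegrableOn (fun p => ψ p * (φ : E3 → ℂ) p) (domain α) := by
  have h1 : IntegrableOn ψ (tsupport (φ : E3 → ℂ)) :=
    hψ.integrableOn_compact_subset φ.2.2.2 φ.2.2.1.isCompact
  obtain ⟨M, hM⟩ := φ.2.2.1.exists_bound_of_continuous φ.2.1.continuous
  have h2 : IntegrableOn (fun p => ψ p * (φ : E3 → ℂ) p) (tsupport (φ : E3 → ℂ)) :=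
    h1.mul_bdd (c := M) φ.2.1.continuous.aestronglyMeasurable (Eventually.of_forall hM)
  refine Integrable.integrableOn ?_
  rw [← integrableOn_iff_integrable_of_support_subset (s := tsupport (φ : E3 → ℂ))]
  · exact h2
  · intro p hp
    exact subset_tsupport _ (right_ne_zero_of_mul hp)

/-- Parseval's formula in the tangential variables, obtained from Fubini's theorem. The constant
also accounts for the normalization of Lebesgue measure in the chart. -/
theorem exists_parseval (hα : 0 < Real.cos α) : ∃ k : ℂ, k ≠ 0 ∧
    ∀ (ψ : E3 → ℂ) (u : Freq → ℝ → ℂ), SliceRegular u → LocallyIntegrableOn ψ (domain α) →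
      (∀ᵐ p ∂(volume.restrict (domain α)), ψ p = tangInv α u p) → ∀ φ : bodyTest α,
        k * ∫ p in domain α, ψ p * (φ : E3 → ℂ) p
          = ∫ ξ, ∫ z in Ioi (0 : ℝ), u ξ z * (bodyTransform α ξ φ : ℝ → ℂ) z := by
  obtain ⟨k, hk0, hkt, hk⟩ := exists_map_stripMeasure hα
  have hm : MeasurableEmbedding (normalChart α) :=
    (normalChart α).toHomeomorph.measurableEmbedding
  have hπ : (2 * Real.pi : ℂ) ^ 2 ≠ 0 := by
    simp [Real.pi_ne_zero]
  refine ⟨(2 * Real.pi : ℂ) ^ 2 * (k.toReal : ℂ), mul_ne_zero hπ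
    (by exact_mod_cast (ENNReal.toReal_pos hk0 hkt).ne'), ?_⟩
  intro ψ u hu hψ hψu φ
  have hint := integrable_mul_bodyTest hψ φ
  have hint2 : Integrable (fun q => ψ (normalChart α q) * (φ : E3 → ℂ) (normalChart α q))
      stripMeasure := by
    have : Integrable (fun p => ψ p * (φ : E3 → ℂ) p)
        (Measure.map (normalChart α) stripMeasure) := by
      rw [hk]
      exact Integrable.smul_measure hint hkt
    exact (hm.integrable_map_iff).mp this
  have hae : ∀ᵐ q ∂stripMeasure, ψ (normalChart α q) = tangInv α u (normalChart α q) := by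
    refine (hm.ae_map_iff (p := fun p => ψ p = tangInv α u p)).mp ?_
    rw [hk]
    exact Measure.ae_smul_measure hψu k
  have hae2 : ∀ᵐ z ∂(volume.restrict (Ioi (0 : ℝ))), ∀ᵐ x : Freq,
      ψ (normalChart α (x, z)) = tangInv α u (normalChart α (x, z)) := by
    have h1 : ∀ᵐ q ∂((volume.restrict (Ioi (0 : ℝ))).prod (volume : Measure Freq)),
        ψ (normalChart α (q.2, q.1)) = tangInv α u (normalChart α (q.2, q.1)) := by
      have := Measure.measurePreserving_swap (μ := volume.restrict (Ioi (0 : ℝ)))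
        (ν := (volume : Measure Freq))
      exact this.quasiMeasurePreserving.ae hae
    exact Measure.ae_ae_of_ae_prod h1
  have hswap : Integrable (fun q : Freq × ℝ => u q.1 q.2 * (tangTransform q.1 (pullback φ) : ℝ → ℂ) q.2)
      stripMeasure := hu.integrable (pullback φ)
  calc (2 * Real.pi : ℂ) ^ 2 * (k.toReal : ℂ) * ∫ p in domain α, ψ p * (φ : E3 → ℂ) p
      = (2 * Real.pi : ℂ) ^ 2 * ∫ q, ψ (normalChart α q) * (φ : E3 → ℂ) (normalChart α q)
          ∂stripMeasure := by
        rw [← hm.integral_map (fun p => ψ p * (φ : E3 → ℂ) p), hk, integral_smul_measure,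
          Complex.real_smul, mul_assoc]
    _ = (2 * Real.pi : ℂ) ^ 2 * ∫ z in Ioi (0 : ℝ), ∫ x : Freq,
          ψ (normalChart α (x, z)) * (φ : E3 → ℂ) (normalChart α (x, z)) := by
        rw [stripMeasure, integral_prod_symm _ hint2]
    _ = ∫ z in Ioi (0 : ℝ), ∫ ξ : Freq, u ξ z * (bodyTransform α ξ φ : ℝ → ℂ) z := by
        rw [← integral_const_mul]
        refine integral_congr_ae ?_
        filter_upwards [hae2, hu.slice] with z hz hz'
        have hsl := slice_integrable (pullback φ) z
        calc (2 * Real.pi : ℂ) ^ 2 * ∫ x : Freq,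
              ψ (normalChart α (x, z)) * (φ : E3 → ℂ) (normalChart α (x, z))
            = ∫ x : Freq, ∫ ξ : Freq, planeWave ξ x * (u ξ z * (φ : E3 → ℂ) (normalChart α (x, z))) := by
              rw [← integral_const_mul]
              refine integral_congr_ae ?_
              filter_upwards [hz] with x hx
              rw [hx, tangInv_normalChart]
              have : ∀ ξ, planeWave ξ x * (u ξ z * (φ : E3 → ℂ) (normalChart α (x, z)))
                  = (planeWave ξ x * u ξ z) * (φ : E3 → ℂ) (normalChart α (x, z)) := fun ξ => by ring
              simp only [this]
              rw [integral_mul_const]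
              field_simp
          _ = ∫ ξ : Freq, ∫ x : Freq, planeWave ξ x * (u ξ z * (φ : E3 → ℂ) (normalChart α (x, z))) := by
              refine integral_integral_swap ?_
              refine Integrable.bdd_mul (c := 1) ?_ ?_ ?_
              · refine (hsl.mul_prod hz').congr (Eventually.of_forall fun q => ?_)
                exact mul_comm _ _
              · exact (continuous_planeWave.comp continuous_swap).aestronglyMeasurable
              · exact Eventually.of_forall fun q => (norm_planeWave q.2 q.1).le
          _ = ∫ ξ : Freq, u ξ z * (bodyTransform α ξ φ : ℝ → ℂ) z := by
              refine integral_congr_ae (Eventually.of_forall fun ξ => ?_)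
              dsimp only
              rw [bodyTransform_apply, ← integral_const_mul]
              refine integral_congr_ae (Eventually.of_forall fun x => ?_)
              dsimp only
              ring
    _ = ∫ ξ, ∫ z in Ioi (0 : ℝ), u ξ z * (bodyTransform α ξ φ : ℝ → ℂ) z :=
        (integral_integral_swap hswap).symm

end Parseval

/-! ### Reduction of the equation to the frequencies -/

section Reduction

open Polynomial

variable {α : ℝ}

/-- Bumps on the tangential plane; concentrated at the origin, they have transforms that do not
vanish at low frequencies. -/
def tangBump (n : ℕ) : ContDiffBump (0 : Freq) where
  rIn := 1 / (2 * (n + 1))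
  rOut := 1 / (n + 1)
  rIn_pos := by positivity
  rIn_lt_rOut := by
    rw [div_lt_div_iff_of_pos_left one_pos (by positivity) (by positivity)]
    linarith [show (0 : ℝ) < n + 1 by positivity]

/-- A normalized tangential bump centred at `a`. -/
def tangTest (n : ℕ) (a x : Freq) : ℂ := (((tangBump n).normed volume (x - a) : ℝ) : ℂ)

theorem contDiff_tangTest (n : ℕ) (a : Freq) : ContDiff ℝ (⊤ : ℕ∞) (tangTest n a) :=
  Complex.ofRealCLM.contDiff.comp
    ((tangBump n).contDiff_normed.comp (contDiff_id.sub contDiff_const))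

theorem hasCompactSupport_tangTest (n : ℕ) (a : Freq) : HasCompactSupport (tangTest n a) :=
  ((tangBump n).hasCompactSupport_normed.comp_left (g := fun x : ℝ => (x : ℂ))
    Complex.ofReal_zero).comp_homeomorph (Homeomorph.subRight a)

theorem planeWave_add (ξ x y : Freq) : planeWave ξ (x + y) = planeWave ξ x * planeWave ξ y := by
  rw [planeWave, planeWave, planeWave, ← Complex.exp_add]
  congr 1
  simp only [PiLp.add_apply]
  push_cast
  ring

theorem integral_planeWave_tangTest (n : ℕ) (a ξ : Freq) :
    ∫ x, planeWave ξ x * tangTest n a x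
      = planeWave ξ a * ∫ x, planeWave ξ x * tangTest n 0 x := by
  rw [← integral_add_right_eq_self _ a, ← integral_const_mul]
  refine integral_congr_ae (Eventually.of_forall fun x => ?_)
  dsimp only
  rw [planeWave_add, tangTest, tangTest, add_sub_cancel_right, sub_zero]
  ring

/-- For `|ξ|` small with respect to the inverse of the radius, the transform of the bump at `ξ` is
close to its integral `1`. -/
theorem planeWave_tangTest_ne_zero {n : ℕ} {ξ : Freq} (hξ : 2 * ‖ξ‖ < n + 1) :
    ∫ x, planeWave ξ x * tangTest n 0 x ≠ 0 := by
  have hn : (0 : ℝ) < n + 1 := by positivity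
  set ρ := fun x : Freq => (tangBump n).normed volume (x - 0) with hρ
  have hρi : Integrable ρ := by
    simp only [hρ, sub_zero]
    exact (tangBump n).integrable_normed
  have hρ1 : ∫ x, ρ x = 1 := by
    simp only [hρ, sub_zero]
    exact (tangBump n).integral_normed
  have hi : Integrable fun x => planeWave ξ x * tangTest n 0 x := by
    refine (hρi.ofReal (𝕜 := ℂ)).bdd_mul (c := 1) ?_ ?_
    · exact (differentiable_planeWave ξ).continuous.aestronglyMeasurable
    · exact Eventually.of_forall fun x => (norm_planeWave ξ x).le
  have h1 : ∫ x, tangTest n 0 x = 1 := by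
    have : ∫ x, tangTest n 0 x = ((∫ x, ρ x : ℝ) : ℂ) := integral_ofReal
    rw [this, hρ1, Complex.ofReal_one]
  have hi2 : Integrable (tangTest n 0) := hρi.ofReal (𝕜 := ℂ)
  have h2 : ‖(∫ x, planeWave ξ x * tangTest n 0 x) - 1‖ ≤ 2 * ‖ξ‖ / (n + 1) := by
    rw [← h1, ← integral_sub hi hi2]
    calc ‖∫ x, planeWave ξ x * tangTest n 0 x - tangTest n 0 x‖
        ≤ ∫ x, 2 * ‖ξ‖ / (n + 1) * ρ x := by
          refine norm_integral_le_of_norm_le (hρi.const_mul _) (Eventually.of_forall fun x => ?_)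
          have e : planeWave ξ x * tangTest n 0 x - tangTest n 0 x
              = (planeWave ξ x - 1) * tangTest n 0 x := by ring
          have hρn : ‖tangTest n 0 x‖ = ρ x := by
            rw [tangTest, Complex.norm_real, Real.norm_eq_abs,
              abs_of_nonneg ((tangBump n).nonneg_normed _)]
          rw [e, norm_mul, hρn]
          by_cases hx : ‖x‖ < 1 / (n + 1)
          · refine mul_le_mul_of_nonneg_right ?_ ((tangBump n).nonneg_normed _)
            have h3 := Real.norm_exp_I_mul_ofReal_sub_one_le (x := x 0 * ξ 0 + x 1 * ξ 1)
            rw [planeWave]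
            refine h3.trans ?_
            rw [Real.norm_eq_abs]
            have a0 := abs_freq_le x 0
            have a1 := abs_freq_le x 1
            have b0 := abs_freq_le ξ 0
            have b1 := abs_freq_le ξ 1
            calc |x 0 * ξ 0 + x 1 * ξ 1| ≤ |x 0| * |ξ 0| + |x 1| * |ξ 1| := by
                  rw [← abs_mul, ← abs_mul]; exact abs_add_le _ _
              _ ≤ ‖x‖ * ‖ξ‖ + ‖x‖ * ‖ξ‖ := by gcongr
              _ = 2 * ‖ξ‖ * ‖x‖ := by ring
              _ ≤ 2 * ‖ξ‖ * (1 / (n + 1)) := by gcongr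
              _ = 2 * ‖ξ‖ / (n + 1) := by ring
          · have : ρ x = 0 := by
              have h4 : x ∉ Function.support ((tangBump n).normed volume) := by
                rw [(tangBump n).support_normed_eq, Metric.mem_ball, dist_zero_right]
                exact hx
              simp only [hρ, sub_zero]
              exact Function.notMem_support.mp h4
            rw [this, mul_zero, mul_zero]
      _ = 2 * ‖ξ‖ / (n + 1) := by rw [integral_const_mul, hρ1, mul_one]
  intro h0
  rw [h0, zero_sub, norm_neg, norm_one, le_div_iff₀ hn] at h2
  linarith

theorem tsupport_testShift_mollifier {n : ℕ} {q : ℝ} (hq : 1 / ((n : ℝ) + 1) < q) :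
    tsupport (testShift q (mollifier n) : ℝ → ℂ) ⊆ Ioi 0 := by
  have hcl : tsupport (testShift q (mollifier n) : ℝ → ℂ) ⊆ Ici (q - 1 / ((n : ℝ) + 1)) := by
    refine closure_minimal (fun z hz => ?_) isClosed_Ici
    by_contra h
    refine hz ?_
    rw [testShift_apply, mollifier_apply]
    have : z - q ∉ Function.support ((bump n).normed volume) := by
      rw [(bump n).support_normed_eq, Metric.mem_ball, dist_zero_right, Real.norm_eq_abs, not_lt]
      refine le_trans ?_ (neg_le_abs _)
      change 1 / ((n : ℝ) + 1) ≤ _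
      rw [mem_Ici, not_le] at h
      linarith
    rw [Function.notMem_support.mp this, Complex.ofReal_zero]
  intro z hz
  have h1 : q - 1 / ((n : ℝ) + 1) ≤ z := hcl hz
  exact lt_of_lt_of_le (sub_pos.mpr hq) h1

/-- If `u` and `v` are the transforms of `ψ` and `S`, and `ψ` is a weak solution of an equation
whose transposed operator is `A`, then for almost every frequency `u ξ` is a weak solution of the
corresponding equation in `z`, for a fixed test function `θ`. Testing with `χ(x - a) θ(z)` for all
`a` shows that the Fourier transform of `χ̂ h` vanishes, where `h` is the defect of the equation
at the frequency `ξ`. -/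
theorem ae_weak_equation (hα : 0 < Real.cos α) {A : bodyTest α →ₗ[ℂ] bodyTest α}
    {p : Freq → ℂ[X]} (hA : HasSymbol A p) {ψ S : E3 → ℂ} {u v : Freq → ℝ → ℂ}
    (hu : SliceRegular u) (hv : SliceRegular v)
    (hψ : LocallyIntegrableOn ψ (domain α)) (hS : LocallyIntegrableOn S (domain α))
    (hψu : ∀ᵐ x ∂(volume.restrict (domain α)), ψ x = tangInv α u x)
    (hSv : ∀ᵐ x ∂(volume.restrict (domain α)), S x = tangInv α v x)
    (heq : ∀ φ : bodyTest α, ∫ x in domain α, ψ x * (A φ : E3 → ℂ) x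
      = ∫ x in domain α, S x * (φ : E3 → ℂ) x)
    {θ : testFun} (hθ : tsupport (θ : ℝ → ℂ) ⊆ Ioi 0) :
    ∀ᵐ ξ, ∫ z in Ioi (0 : ℝ), u ξ z * (diffOp (p ξ) θ : ℝ → ℂ) z
      = ∫ z in Ioi (0 : ℝ), v ξ z * (θ : ℝ → ℂ) z := by
  obtain ⟨k, hk, hpars⟩ := exists_parseval hα
  set h : Freq → ℂ := fun ξ => (∫ z in Ioi (0 : ℝ), u ξ z * (diffOp (p ξ) θ : ℝ → ℂ) z)
      - ∫ z in Ioi (0 : ℝ), v ξ z * (θ : ℝ → ℂ) z with hh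
  have key : ∀ n : ℕ, ∀ᵐ ξ, (∫ x, planeWave ξ x * tangTest n 0 x) * h ξ = 0 := by
    intro n
    set φ : Freq → bodyTest α := fun a => prodTest hα (tangTest n a) (contDiff_tangTest n a)
      (hasCompactSupport_tangTest n a) θ hθ with hφ
    have hUφ : ∀ a ξ, bodyTransform α ξ (φ a)
        = (planeWave ξ a * ∫ x, planeWave ξ x * tangTest n 0 x) • θ := by
      intro a ξ
      rw [hφ, bodyTransform_prodTest, integral_planeWave_tangTest]
    have hz1 : ∀ a ξ, ∫ z in Ioi (0 : ℝ), u ξ z * (bodyTransform α ξ (A (φ a)) : ℝ → ℂ) z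
        = (planeWave ξ a * ∫ x, planeWave ξ x * tangTest n 0 x) *
          ∫ z in Ioi (0 : ℝ), u ξ z * (diffOp (p ξ) θ : ℝ → ℂ) z := by
      intro a ξ
      rw [hA, hUφ, map_smul]
      refine Eq.trans ?_ (integral_const_mul _ _)
      refine integral_congr_ae (Eventually.of_forall fun z => ?_)
      exact mul_left_comm _ _ _
    have hz2 : ∀ a ξ, ∫ z in Ioi (0 : ℝ), v ξ z * (bodyTransform α ξ (φ a) : ℝ → ℂ) z
        = (planeWave ξ a * ∫ x, planeWave ξ x * tangTest n 0 x) *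
          ∫ z in Ioi (0 : ℝ), v ξ z * (θ : ℝ → ℂ) z := by
      intro a ξ
      rw [hUφ]
      refine Eq.trans ?_ (integral_const_mul _ _)
      refine integral_congr_ae (Eventually.of_forall fun z => ?_)
      exact mul_left_comm _ _ _
    have hi1 : ∀ a, Integrable fun ξ =>
        ∫ z in Ioi (0 : ℝ), u ξ z * (bodyTransform α ξ (A (φ a)) : ℝ → ℂ) z := fun a =>
      (hu.integrable (pullback (A (φ a)))).integral_prod_left
    have hi2 : ∀ a, Integrable fun ξ =>
        ∫ z in Ioi (0 : ℝ), v ξ z * (bodyTransform α ξ (φ a) : ℝ → ℂ) z := fun a =>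
      (hv.integrable (pullback (φ a))).integral_prod_left
    have hF : ∀ a ξ, (∫ z in Ioi (0 : ℝ), u ξ z * (bodyTransform α ξ (A (φ a)) : ℝ → ℂ) z)
          - ∫ z in Ioi (0 : ℝ), v ξ z * (bodyTransform α ξ (φ a) : ℝ → ℂ) z
        = planeWave ξ a * ((∫ x, planeWave ξ x * tangTest n 0 x) * h ξ) := by
      intro a ξ
      rw [hz1, hz2, hh]
      ring
    refine ae_eq_zero_of_integral_planeWave_eq_zero ?_ fun a => ?_
    · refine ((hi1 0).sub (hi2 0)).congr (Eventually.of_forall fun ξ => ?_)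
      have h0 : planeWave ξ 0 = 1 := by simp [planeWave]
      have := hF 0 ξ
      rw [h0, one_mul] at this
      exact this
    · simp only [← hF]
      rw [integral_sub (hi1 a) (hi2 a), ← hpars ψ u hu hψ hψu, ← hpars S v hv hS hSv, heq,
        sub_self]
  have key2 : ∀ᵐ ξ, ∀ n : ℕ, (∫ x, planeWave ξ x * tangTest n 0 x) * h ξ = 0 :=
    ae_all_iff.mpr key
  filter_upwards [key2] with ξ hξ
  obtain ⟨n, hn⟩ := exists_nat_gt (2 * ‖ξ‖)
  have h1 := (mul_eq_zero.mp (hξ n)).resolve_left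
    (planeWave_tangTest_ne_zero (by linarith))
  exact sub_eq_zero.mp h1

/-- Conversely, the weak equations at the frequencies imply the equation in the domain. -/
theorem weak_equation_of_ae (hα : 0 < Real.cos α) {A : bodyTest α →ₗ[ℂ] bodyTest α}
    {p : Freq → ℂ[X]} (hA : HasSymbol A p) {ψ S : E3 → ℂ} {u v : Freq → ℝ → ℂ}
    (hu : SliceRegular u) (hv : SliceRegular v)
    (hψ : LocallyIntegrableOn ψ (domain α)) (hS : LocallyIntegrableOn S (domain α))
    (hψu : ∀ᵐ x ∂(volume.restrict (domain α)), ψ x = tangInv α u x)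
    (hSv : ∀ᵐ x ∂(volume.restrict (domain α)), S x = tangInv α v x)
    (heq : ∀ᵐ ξ, ∀ θ : testFun, VanishBelow 0 θ →
      ∫ z in Ioi (0 : ℝ), u ξ z * (diffOp (p ξ) θ : ℝ → ℂ) z
        = ∫ z in Ioi (0 : ℝ), v ξ z * (θ : ℝ → ℂ) z) (φ : bodyTest α) :
    ∫ x in domain α, ψ x * (A φ : E3 → ℂ) x = ∫ x in domain α, S x * (φ : E3 → ℂ) x := by
  obtain ⟨k, hk, hpars⟩ := exists_parseval hα
  apply mul_left_cancel₀ hk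
  rw [hpars ψ u hu hψ hψu, hpars S v hv hS hSv]
  refine integral_congr_ae ?_
  filter_upwards [heq] with ξ hξ
  rw [hA]
  exact hξ _ (vanishBelow_bodyTransform hα ξ φ)

end Reduction

/-! ### Function spaces -/

section Spaces

variable {α : ℝ} {u : Freq → ℝ → ℂ}

theorem lintegral_sq_of_tangNorm {q : ℝ≥0∞} (h : tangNorm 0 q u < ∞) :
    ∫⁻ ξ, eLpNorm (u ξ) q (volume.restrict (Ioi (0 : ℝ))) ^ 2 < ∞ := by
  rw [tangNorm] at h
  have h1 := (ENNReal.rpow_lt_top_iff_of_pos (by norm_num : (0 : ℝ) < 1 / 2)).mp h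
  simpa using h1

theorem square_of_tangNorm_one (h : tangNorm 0 1 u < ∞) (b : ℝ) :
    ∫⁻ ξ, (∫⁻ z in Ioo 0 b, ‖u ξ z‖ₑ) ^ 2 < ∞ := by
  refine lt_of_le_of_lt (lintegral_mono fun ξ => ?_) (lintegral_sq_of_tangNorm h)
  rw [eLpNorm_one_eq_lintegral_enorm]
  have : ∫⁻ z in Ioo 0 b, ‖u ξ z‖ₑ ≤ ∫⁻ z in Ioi 0, ‖u ξ z‖ₑ :=
    lintegral_mono_set Ioo_subset_Ioi_self
  dsimp only
  gcongr

theorem square_of_tangNorm_top (h : tangNorm 0 ∞ u < ∞) (b : ℝ) :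
    ∫⁻ ξ, (∫⁻ z in Ioo 0 b, ‖u ξ z‖ₑ) ^ 2 < ∞ := by
  have h1 := ENNReal.mul_lt_top (ENNReal.pow_lt_top (ENNReal.ofReal_lt_top (r := b)) (n := 2))
    (lintegral_sq_of_tangNorm h)
  rw [← lintegral_const_mul' _ _ (by finiteness)] at h1
  refine lt_of_le_of_lt (lintegral_mono fun ξ => ?_) h1
  rw [← mul_pow]
  gcongr
  rw [eLpNorm_exponent_top]
  calc ∫⁻ z in Ioo 0 b, ‖u ξ z‖ₑ
      ≤ ∫⁻ z in Ioo 0 b, eLpNormEssSup (u ξ) (volume.restrict (Ioi (0 : ℝ))) := by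
        refine lintegral_mono_ae ?_
        exact ae_restrict_of_ae_restrict_of_subset Ioo_subset_Ioi_self
          (ae_le_eLpNormEssSup (f := u ξ))
    _ = ENNReal.ofReal b * eLpNormEssSup (u ξ) (volume.restrict (Ioi (0 : ℝ))) := by
        rw [lintegral_const, Measure.restrict_apply_univ, Real.volume_Ioo, sub_zero, mul_comm]

/-- Integrability over `ℝ² × (0, b)` for all `b`. -/
def StripIntegrable (u : Freq → ℝ → ℂ) : Prop := ∀ b : ℝ, Integrable (Function.uncurry u)
  ((volume : Measure Freq).prod (volume.restrict (Ioo 0 b)))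

/-- On a bounded set of frequencies, square integrability implies integrability. -/
theorem stripIntegrable_of_bandLimited (hm : TangMeas u)
    (hsq : ∀ b : ℝ, ∫⁻ ξ, (∫⁻ z in Ioo 0 b, ‖u ξ z‖ₑ) ^ 2 < ∞) {R : ℝ} (hR : BandLimited R u) :
    StripIntegrable u := by
  intro b
  have hac : ((volume : Measure Freq).prod (volume.restrict (Ioo 0 b))).AbsolutelyContinuous
      ((volume : Measure Freq).prod (volume.restrict (Ioi (0 : ℝ)))) :=
    Measure.AbsolutelyContinuous.rfl.prod
      (Measure.absolutelyContinuous_of_le (Measure.restrict_mono Ioo_subset_Ioi_self le_rfl))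
  have hm' := hm.mono_ac hac
  refine ⟨hm', ?_⟩
  rw [hasFiniteIntegral_iff_enorm, lintegral_prod _ hm'.enorm]
  have hball : volume (Metric.ball (0 : Freq) R) < ∞ := measure_ball_lt_top
  calc ∫⁻ ξ, ∫⁻ z in Ioo 0 b, ‖u ξ z‖ₑ
      ≤ ∫⁻ ξ, ((∫⁻ z in Ioo 0 b, ‖u ξ z‖ₑ) ^ 2 + (Metric.ball (0 : Freq) R).indicator 1 ξ) := by
        refine lintegral_mono_ae ?_
        filter_upwards [hR] with ξ hξ
        by_cases h : ξ ∈ Metric.ball (0 : Freq) R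
        · rw [indicator_of_mem h, Pi.one_apply]
          simpa using ennreal_mul_le_sq_add_sq (∫⁻ z in Ioo 0 b, ‖u ξ z‖ₑ) 1
        · have h1 : R ≤ ‖ξ‖ := by simpa using h
          have h2 : ∫⁻ z in Ioo 0 b, ‖u ξ z‖ₑ = ∫⁻ z in Ioo 0 b, 0 := by
            refine lintegral_congr_ae ?_
            filter_upwards [ae_restrict_of_ae_restrict_of_subset Ioo_subset_Ioi_self (hξ h1)]
              with z hz
            rw [hz, enorm_zero]
          rw [h2]
          simp
    _ = (∫⁻ ξ, (∫⁻ z in Ioo 0 b, ‖u ξ z‖ₑ) ^ 2) + volume (Metric.ball (0 : Freq) R) := by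
        rw [lintegral_add_right _ (measurable_one.indicator measurableSet_ball),
          lintegral_indicator_one measurableSet_ball]
    _ < ∞ := ENNReal.add_lt_top.mpr ⟨hsq b, hball⟩

theorem StripIntegrable.slice (hu : StripIntegrable u) :
    ∀ᵐ z ∂(volume.restrict (Ioi (0 : ℝ))), Integrable fun ξ => u ξ z := by
  have h1 : ∀ n : ℕ, ∀ᵐ z : ℝ, z ∈ Ioo (0 : ℝ) n → Integrable fun ξ => u ξ z := fun n =>
    (ae_restrict_iff' measurableSet_Ioo).mp (hu n).prod_left_ae
  rw [ae_restrict_iff' measurableSet_Ioi]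
  filter_upwards [ae_all_iff.mpr h1] with z hz hz0
  obtain ⟨n, hn⟩ := exists_nat_gt z
  exact hz n ⟨hz0, hn⟩

/-- The inverse tangential transform is locally integrable. -/
theorem StripIntegrable.locallyIntegrableOn (hα : 0 < Real.cos α) (hu : StripIntegrable u) :
    LocallyIntegrableOn (tangInv α u) (domain α) := by
  have hopen : IsOpen (domain α) := by
    have : domain α = {p | 0 < locZ α p} := by
      ext p
      exact mem_domain_iff hα p
    rw [this]
    refine isOpen_lt continuous_const ?_
    unfold locZ
    fun_prop
  rw [locallyIntegrableOn_iff hopen.isLocallyClosed]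
  intro K hKΩ hK
  obtain ⟨ρ, hρ⟩ := (hK.image (normalChart α).symm.continuous).isBounded.subset_closedBall 0
  set B : Set (Freq × ℝ) := Metric.closedBall (0 : Freq) ρ ×ˢ Ioo (0 : ℝ) (ρ + 1) with hB
  have hBm : MeasurableSet B := Metric.isClosed_closedBall.measurableSet.prod measurableSet_Ioo
  have hsub : K ⊆ normalChart α '' B := by
    intro p hp
    have h1 := hρ ⟨p, hp, rfl⟩
    rw [mem_closedBall_zero_iff, Prod.norm_def, max_le_iff] at h1
    have h2 : 0 < ((normalChart α).symm p).2 := (mem_domain_iff hα p).mp (hKΩ hp)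
    refine ⟨(normalChart α).symm p, ⟨mem_closedBall_zero_iff.mpr h1.1, h2, ?_⟩,
      (normalChart α).apply_symm_apply p⟩
    have h3 := h1.2
    rw [Real.norm_eq_abs] at h3
    linarith [le_abs_self ((normalChart α).symm p).2]
  have hm : MeasurableEmbedding (normalChart α) :=
    (normalChart α).toHomeomorph.measurableEmbedding
  obtain ⟨k, hk0, hkt, hk⟩ := exists_map_stripMeasure hα
  refine IntegrableOn.mono_set ?_ (subset_inter hsub hKΩ)
  have hgoal : Integrable (tangInv α u)
      (k • (volume.restrict (domain α)).restrict (normalChart α '' B)) := by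
    rw [← Measure.restrict_smul, ← hk, hm.restrict_map, hm.integrable_map_iff,
      (normalChart α).injective.preimage_image]
    have hrest : stripMeasure.restrict B
        = ((volume : Measure Freq).restrict (Metric.closedBall 0 ρ)).prod
          (volume.restrict (Ioo (0 : ℝ) (ρ + 1))) := by
      rw [stripMeasure, hB, ← Measure.prod_restrict, Measure.restrict_restrict measurableSet_Ioo,
        inter_eq_left.mpr Ioo_subset_Ioi_self]
    rw [hrest]
    have hfin : IsFiniteMeasure ((volume : Measure Freq).restrict (Metric.closedBall 0 ρ)) :=
      ⟨by rw [Measure.restrict_apply_univ]; exact measure_closedBall_lt_top⟩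
    have h1 := (hu (ρ + 1)).swap.comp_snd
      ((volume : Measure Freq).restrict (Metric.closedBall 0 ρ))
    have h2 := (measurePreserving_prodAssoc
      ((volume : Measure Freq).restrict (Metric.closedBall 0 ρ))
      ((volume : Measure ℝ).restrict (Ioo (0 : ℝ) (ρ + 1))) (volume : Measure Freq)).integrable_comp_of_integrable h1
    have h3 : Integrable (fun r : (Freq × ℝ) × Freq => planeWave r.2 r.1.1 * u r.2 r.1.2)
        ((((volume : Measure Freq).restrict (Metric.closedBall 0 ρ)).prod
          (volume.restrict (Ioo (0 : ℝ) (ρ + 1)))).prod (volume : Measure Freq)) := by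
      refine Integrable.bdd_mul (c := 1) h2 ?_ ?_
      · exact (continuous_planeWave.comp (by fun_prop : Continuous fun r : (Freq × ℝ) × Freq =>
          (r.2, r.1.1))).aestronglyMeasurable
      · exact Eventually.of_forall fun r => (norm_planeWave _ _).le
    refine (h3.integral_prod_left.const_mul (1 / (2 * Real.pi : ℂ) ^ 2)).congr
      (Eventually.of_forall fun q => ?_)
    exact (tangInv_normalChart u q.1 q.2).symm
  have := (integrable_smul_measure hk0 hkt).mp hgoal
  rw [Measure.restrict_restrict (hm.measurableSet_image.mpr hBm)] at this
  exact this

end Spaces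

/-! ### The Green function in terms of a labelling of the roots -/

section Labelling

open Polynomial

/-- The order in which `sortByRe` lists complex numbers. -/
def PrecedesByRe (a b : ℂ) : Prop := a.re < b.re ∨ a.re = b.re ∧ a.im ≤ b.im

theorem sortByRe_pair {a b : ℂ} (h : PrecedesByRe a b) : sortByRe {a, b} = [a, b] := by
  have hle : toLex (a.re, a.im) ≤ toLex (b.re, b.im) := Prod.Lex.toLex_le_toLex.mpr h
  have e : (({a, b} : Multiset ℂ).map fun μ => toLex (μ.re, μ.im))
      = toLex (a.re, a.im) ::ₘ {toLex (b.re, b.im)} := rfl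
  rw [sortByRe, e, Multiset.sort_cons]
  · simp
  · intro x hx
    rw [Multiset.mem_singleton] at hx
    rw [hx]
    exact hle

theorem precedesByRe_total {a b : ℂ} (h : ¬PrecedesByRe a b) : PrecedesByRe b a := by
  unfold PrecedesByRe at *
  push Not at h
  rcases lt_or_eq_of_le h.1 with h1 | h1
  · exact Or.inl h1
  · exact Or.inr ⟨h1, (h.2 h1.symm).le⟩

theorem measurableSet_precedesByRe {f g : Freq → ℂ} (hf : Measurable f) (hg : Measurable g) :
    MeasurableSet {ξ | PrecedesByRe (f ξ) (g ξ)} := by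
  have h1 := Complex.measurable_re.comp hf
  have h2 := Complex.measurable_re.comp hg
  exact (measurableSet_lt h1 h2).union ((measurableSet_eq_fun h1 h2).inter
    (measurableSet_le (Complex.measurable_im.comp hf) (Complex.measurable_im.comp hg)))

variable {P : Params} {R c C : ℝ} {μ : Fin 4 → Freq → ℂ} {ξ : Freq}

/-- The leading coefficient of the characteristic polynomial. -/
def leadCoeff (P : Params) : ℂ := -((P.νeff : ℂ) * (Real.sin P.α : ℂ) ^ 2)

theorem IsRootFamily.injective (h : IsRootFamily P R c C μ) (hξ : ‖ξ‖ ≤ R) :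
    Function.Injective fun j => μ j ξ := by
  obtain ⟨g, hg, hsep⟩ := h.separated
  intro j k hjk
  by_contra hne
  have := hsep ξ hξ j k hne
  rw [show μ j ξ = μ k ξ from hjk, sub_self, norm_zero] at this
  linarith

theorem IsRootFamily.roots_eq (h : IsRootFamily P R c C μ) (ha : leadCoeff P ≠ 0) (hξ : ‖ξ‖ ≤ R) :
    (charPoly P ξ).roots = {μ 0 ξ, μ 1 ξ, μ 2 ξ, μ 3 ξ} := by
  have hf : charPoly P ξ = Polynomial.C (leadCoeff P) * ∏ j, (X - Polynomial.C (μ j ξ)) :=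
    h.factor ξ hξ
  rw [hf, roots_C_mul _ ha, roots_prod _ _ (Finset.prod_ne_zero_iff.mpr
    fun j _ => X_sub_C_ne_zero _)]
  simp only [roots_X_sub_C]
  rfl

/-- The labelling separates the roots according to the sign of their real parts. -/
structure SignedRoots (m : Fin 4 → ℂ) : Prop where
  zero : (m 0).re < 0
  one : 0 < (m 1).re
  two : 0 < (m 2).re
  three : (m 3).re < 0

theorem IsRootFamily.signedRoots (h : IsRootFamily P R c C μ) (hc : 0 < c)
    (hL : 0 < layerScale P) (hW : 0 < freqWeight P) (hξ : ‖ξ‖ ≤ R) (h1 : ξ 1 ≠ 0) :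
    SignedRoots fun j => μ j ξ where
  zero := h.re_zero ξ hξ h1
  one := lt_of_lt_of_le (by positivity) (h.re_one ξ hξ)
  two := lt_of_lt_of_le (by positivity) (h.re_two ξ hξ)
  three := lt_of_le_of_lt (h.re_three ξ hξ) (neg_lt_zero.mpr (by positivity))

theorem IsRootFamily.filter_pos (h : IsRootFamily P R c C μ) (ha : leadCoeff P ≠ 0) (hξ : ‖ξ‖ ≤ R)
    (hs : SignedRoots fun j => μ j ξ) :
    (charPoly P ξ).roots.filter (fun μ => 0 < μ.re) = {μ 1 ξ, μ 2 ξ} := by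
  rw [h.roots_eq ha hξ]
  have h1 := hs.one
  have h2 := hs.two
  have h0' := not_lt.mpr hs.zero.le
  have h3' := not_lt.mpr hs.three.le
  simp only [Multiset.insert_eq_cons, ← Multiset.cons_zero, Multiset.filter_cons, h0', h1, h2, h3',
    if_true, if_false, zero_add, add_zero, Multiset.filter_zero, Multiset.cons_add]

theorem IsRootFamily.rootPos_of_precedes (h : IsRootFamily P R c C μ) (ha : leadCoeff P ≠ 0)
    (hξ : ‖ξ‖ ≤ R) (hs : SignedRoots fun j => μ j ξ) (hle : PrecedesByRe (μ 1 ξ) (μ 2 ξ)) :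
    rootPos P ξ 0 = μ 1 ξ ∧ rootPos P ξ 1 = μ 2 ξ := by
  simp only [rootPos, h.filter_pos ha hξ hs, sortByRe_pair hle]
  exact ⟨rfl, rfl⟩

theorem IsRootFamily.rootPos_of_not_precedes (h : IsRootFamily P R c C μ) (ha : leadCoeff P ≠ 0)
    (hξ : ‖ξ‖ ≤ R) (hs : SignedRoots fun j => μ j ξ) (hle : ¬PrecedesByRe (μ 1 ξ) (μ 2 ξ)) :
    rootPos P ξ 0 = μ 2 ξ ∧ rootPos P ξ 1 = μ 1 ξ := by
  simp only [rootPos, h.filter_pos ha hξ hs, Multiset.pair_comm (μ 1 ξ),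
    sortByRe_pair (precedesByRe_total hle)]
  exact ⟨rfl, rfl⟩

theorem IsRootFamily.rootNeg_eq (h : IsRootFamily P R c C μ) (ha : leadCoeff P ≠ 0) (hξ : ‖ξ‖ ≤ R)
    (hs : SignedRoots fun j => μ j ξ) :
    (rootNeg P ξ 0 = μ 0 ξ ∧ rootNeg P ξ 1 = μ 3 ξ) ∨
      (rootNeg P ξ 0 = μ 3 ξ ∧ rootNeg P ξ 1 = μ 0 ξ) := by
  have hf : (charPoly P ξ).roots.filter (fun μ => μ.re < 0) = {μ 0 ξ, μ 3 ξ} := by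
    rw [h.roots_eq ha hξ]
    have h0 := hs.zero
    have h3 := hs.three
    have h1 := hs.one.le
    have h2 := hs.two.le
    have h1' := not_lt.mpr h1
    have h2' := not_lt.mpr h2
    simp only [Multiset.insert_eq_cons, ← Multiset.cons_zero, Multiset.filter_cons, h0, h1', h2', h3,
      if_true, if_false, zero_add, add_zero, Multiset.filter_zero, Multiset.cons_add]
  by_cases hle : PrecedesByRe (μ 0 ξ) (μ 3 ξ)
  · left
    simp only [rootNeg, hf, sortByRe_pair hle]
    exact ⟨rfl, rfl⟩
  · right
    simp only [rootNeg, hf, Multiset.pair_comm (μ 0 ξ), sortByRe_pair (precedesByRe_total hle)]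
    exact ⟨rfl, rfl⟩

theorem IsRootFamily.greenCoeff_eq (h : IsRootFamily P R c C μ) (ha : leadCoeff P ≠ 0)
    (hξ : ‖ξ‖ ≤ R) (j : Fin 4) :
    greenCoeff P ξ (μ j ξ) = (rootDeriv (leadCoeff P) (fun j => μ j ξ) j)⁻¹ := by
  have hinj := h.injective hξ
  have hroots : (charPoly P ξ).roots.toFinset = Finset.univ.image fun j => μ j ξ := by
    rw [h.roots_eq ha hξ]
    ext m
    simp [Fin.exists_fin_succ, eq_comm]
  have hcard : (Finset.univ.erase j).card = 3 := by
    rw [Finset.card_erase_of_mem (Finset.mem_univ j)]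
    rfl
  have he : (Finset.univ.image fun j => μ j ξ).erase (μ j ξ)
      = (Finset.univ.erase j).image fun j => μ j ξ :=
    (Finset.image_erase hinj Finset.univ j).symm
  have hprod : ∏ k ∈ Finset.univ.erase j, (μ j ξ - μ k ξ)
      = -∏ k ∈ Finset.univ.erase j, (μ k ξ - μ j ξ) := by
    have : ∀ k, μ j ξ - μ k ξ = -1 * (μ k ξ - μ j ξ) := fun k => by ring
    simp only [this]
    rw [Finset.prod_mul_distrib, Finset.prod_const, hcard]
    ring
  rw [greenCoeff, hroots, he, Finset.prod_image fun a _ b _ hab => hinj hab, rootDeriv, leadCoeff,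
    hprod, neg_mul_neg, mul_inv]
  simp only [one_div, Finset.prod_inv_distrib]

/-- The Green function is symmetric in the roots on each side, so that it does not depend on their
order. -/
theorem IsRootFamily.greenHat_eq (h : IsRootFamily P R c C μ) (ha : leadCoeff P ≠ 0)
    (hξ : ‖ξ‖ ≤ R) (hs : SignedRoots fun j => μ j ξ) :
    greenHat P ξ = greenKernel (leadCoeff P) (fun j => μ j ξ) {1, 2} := by
  funext t
  have hc : ({1, 2} : Finset (Fin 4))ᶜ = {0, 3} := by decide
  rw [greenHat, greenKernel, hc, Finset.sum_pair (by decide), Finset.sum_pair (by decide),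
    Fin.sum_univ_two, Fin.sum_univ_two]
  have e := h.greenCoeff_eq ha hξ
  congr 1
  · by_cases hle : PrecedesByRe (μ 1 ξ) (μ 2 ξ)
    · obtain ⟨h1, h2⟩ := h.rootPos_of_precedes ha hξ hs hle
      rw [h1, h2, e, e]
    · obtain ⟨h1, h2⟩ := h.rootPos_of_not_precedes ha hξ hs hle
      rw [h1, h2, e, e, add_comm]
  · rcases h.rootNeg_eq ha hξ hs with ⟨h1, h2⟩ | ⟨h1, h2⟩
    · rw [h1, h2, e, e]
    · rw [h1, h2, e, e, add_comm]

/-- The frequencies with `ξ_y = 0`, where the small root may be imaginary, are negligible. -/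
theorem ae_freq_one_ne_zero : ∀ᵐ ξ : Freq, ξ 1 ≠ 0 := by
  set V : Submodule ℝ Freq := LinearMap.ker (EuclideanSpace.proj (𝕜 := ℝ) (1 : Fin 2) :
    Freq →L[ℝ] ℝ).toLinearMap with hV
  have hne : V ≠ ⊤ := by
    intro h
    have h1 : EuclideanSpace.single (1 : Fin 2) (1 : ℝ) ∈ V := h ▸ Submodule.mem_top
    rw [hV, LinearMap.mem_ker] at h1
    simp at h1
  have h0 := Measure.addHaar_submodule (volume : Measure Freq) V hne
  rw [ae_iff]
  refine measure_mono_null (fun ξ hξ => ?_) h0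
  exact not_not.mp hξ

end Labelling

/-! ### Solutions given by frequency-dependent kernels -/

section FrequencyKernel

open Polynomial

variable {α : ℝ} {u v : Freq → ℝ → ℂ} {K : Freq → ℝ → ℂ} {R B : ℝ}

theorem MemL2L1.ae_integrableOn (hv : MemL2L1 v) : ∀ᵐ ξ, IntegrableOn (v ξ) (Ioi 0) := by
  have h1 : ∀ᵐ ξ, AEStronglyMeasurable (v ξ) (volume.restrict (Ioi (0 : ℝ))) :=
    hv.1.prodMk_left
  have hm : AEMeasurable (fun ξ => eLpNorm (v ξ) 1 (volume.restrict (Ioi (0 : ℝ)))) := by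
    simp only [eLpNorm_one_eq_lintegral_enorm]
    exact hv.1.enorm.lintegral_prod_right'
  have h2 := ae_lt_top' (hm.pow_const 2) (lintegral_sq_of_tangNorm hv.2).ne
  filter_upwards [h1, h2] with ξ hξ1 hξ2
  rw [ENNReal.pow_lt_top_iff] at hξ2
  exact memLp_one_iff_integrable.mp ⟨hξ1, hξ2.resolve_right (by norm_num)⟩

theorem kernelConv_congr {k s t : ℝ → ℂ} (h : s =ᵐ[volume.restrict (Ioi (0 : ℝ))] t) :
    kernelConv k s = kernelConv k t := by
  funext z
  refine integral_congr_ae ?_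
  filter_upwards [h] with z' hz'
  rw [hz']

theorem kernelConv_zero {k s : ℝ → ℂ} (h : ∀ᵐ z ∂(volume.restrict (Ioi (0 : ℝ))), s z = 0) :
    kernelConv k s = 0 := by
  rw [kernelConv_congr (t := 0) h]
  funext z
  simp [kernelConv]

theorem ae_prod_of_ae {p : Freq → ℝ → Prop} (h : ∀ᵐ ξ, ∀ z, p ξ z) :
    ∀ᵐ q ∂((volume : Measure Freq).prod (volume.restrict (Ioi (0 : ℝ)))), p q.1 q.2 := by
  filter_upwards [Measure.quasiMeasurePreserving_fst.ae h] with q hq using hq q.2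

theorem tangMeas_kernelConv (hK : Measurable (Function.uncurry K)) (hv : TangMeas v)
    (hu : ∀ᵐ ξ, u ξ = kernelConv (K ξ) (v ξ)) : TangMeas u := by
  obtain ⟨w, hw, hvw⟩ := hv
  have hvw' : ∀ᵐ ξ, v ξ =ᵐ[volume.restrict (Ioi (0 : ℝ))] fun z => w (ξ, z) :=
    Measure.ae_ae_of_ae_prod hvw
  have hm : StronglyMeasurable fun q : Freq × ℝ =>
      ∫ z' in Ioi (0 : ℝ), K q.1 (q.2 - z') * w (q.1, z') := by
    refine StronglyMeasurable.integral_prod_right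
      (f := fun (q : Freq × ℝ) (z' : ℝ) => K q.1 (q.2 - z') * w (q.1, z')) ?_
    refine StronglyMeasurable.mul ?_ ?_
    · exact (hK.comp (by fun_prop : Measurable fun r : (Freq × ℝ) × ℝ =>
        (r.1.1, r.1.2 - r.2))).stronglyMeasurable
    · exact hw.comp_measurable (by fun_prop : Measurable fun r : (Freq × ℝ) × ℝ => (r.1.1, r.2))
  refine ⟨_, hm, ?_⟩
  have h1 : ∀ᵐ ξ, ∀ z, u ξ z = ∫ z' in Ioi (0 : ℝ), K ξ (z - z') * w (ξ, z') := by
    filter_upwards [hu, hvw'] with ξ h1 h2 z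
    rw [h1, kernelConv_congr h2]
    rfl
  exact ae_prod_of_ae h1

/-- A family of bounded kernels at the frequencies `|ξ| < R`, continuous outside of `0` and
decaying at `+∞`. -/
structure IsGoodKernel (R B : ℝ) (K : Freq → ℝ → ℂ) : Prop where
  measurable : Measurable (Function.uncurry K)
  bound : ∀ᵐ ξ, ‖ξ‖ < R → ∀ t, ‖K ξ t‖ ≤ B
  continuous : ∀ᵐ ξ, ‖ξ‖ < R → ∀ t ≠ 0, ContinuousAt (K ξ) t
  decay : ∀ᵐ ξ, ‖ξ‖ < R → Tendsto (K ξ) atTop (𝓝 0)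

theorem IsGoodKernel.measurable_apply (hK : IsGoodKernel R B K) (ξ : Freq) : Measurable (K ξ) :=
  hK.measurable.comp (measurable_const.prodMk measurable_id)

theorem IsGoodKernel.ae_integrableOn (hK : IsGoodKernel R B K) (hv : MemL2L1 v)
    (hR : BandLimited R v) :
    ∀ᵐ ξ, ∀ z, IntegrableOn (fun z' => K ξ (z - z') * v ξ z') (Ioi 0) := by
  filter_upwards [hK.bound, hv.ae_integrableOn, hR] with ξ h1 h2 h3 z
  rcases lt_or_ge ‖ξ‖ R with h | h
  · exact integrableOn_kernelConv (hK.measurable_apply ξ) (h1 h) h2 z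
  · refine (integrable_zero ℝ ℂ _).congr ?_
    filter_upwards [h3 h] with z' hz'
    rw [hz', mul_zero]
    rfl

theorem IsGoodKernel.ae_continuous (hK : IsGoodKernel R B K) (hv : MemL2L1 v)
    (hR : BandLimited R v) (hu : ∀ᵐ ξ, u ξ = kernelConv (K ξ) (v ξ)) :
    ∀ᵐ ξ, Continuous (u ξ) ∧ Tendsto (u ξ) atTop (𝓝 0) := by
  filter_upwards [hK.bound, hK.continuous, hK.decay, hv.ae_integrableOn, hR, hu]
    with ξ h1 h2 h3 h4 h5 h6
  rw [h6]
  rcases lt_or_ge ‖ξ‖ R with h | h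
  · exact ⟨continuous_kernelConv (hK.measurable_apply ξ) (h1 h) (h2 h) h4,
      tendsto_kernelConv (hK.measurable_apply ξ) (h1 h) (h3 h) h4⟩
  · rw [kernelConv_zero (h5 h)]
    exact ⟨continuous_zero, tendsto_const_nhds⟩

theorem IsGoodKernel.ae_enorm_le (hK : IsGoodKernel R B K) (hv : MemL2L1 v)
    (hR : BandLimited R v) (hu : ∀ᵐ ξ, u ξ = kernelConv (K ξ) (v ξ)) :
    ∀ᵐ ξ, ∀ z, ‖u ξ z‖ₑ ≤ ENNReal.ofReal B * eLpNorm (v ξ) 1 (volume.restrict (Ioi (0 : ℝ))) := by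
  filter_upwards [hK.bound, hv.ae_integrableOn, hR, hu] with ξ h1 h4 h5 h6 z
  rw [h6]
  rcases lt_or_ge ‖ξ‖ R with h | h
  · have hB : 0 ≤ B := (norm_nonneg _).trans (h1 h 0)
    have := norm_kernelConv_le (h1 h) h4 z
    rw [eLpNorm_one_eq_lintegral_enorm, ← ofReal_integral_norm_eq_lintegral_enorm h4,
      ← ENNReal.ofReal_mul hB, ← ofReal_norm]
    exact ENNReal.ofReal_le_ofReal this
  · rw [kernelConv_zero (h5 h)]
    simp

theorem IsGoodKernel.bandLimited (hR : BandLimited R v)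
    (hu : ∀ᵐ ξ, u ξ = kernelConv (K ξ) (v ξ)) : BandLimited R u := by
  filter_upwards [hR, hu] with ξ h5 h6 h
  rw [h6, kernelConv_zero (h5 h)]
  exact Eventually.of_forall fun z => rfl

theorem IsGoodKernel.tangNorm_le (hK : IsGoodKernel R B K) (hv : MemL2L1 v)
    (hR : BandLimited R v) (hu : ∀ᵐ ξ, u ξ = kernelConv (K ξ) (v ξ)) (σ : ℝ) :
    tangNorm σ ∞ u ≤ ENNReal.ofReal B * tangNorm σ 1 v := by
  have h1 : ∀ᵐ ξ : Freq, ENNReal.ofReal ((1 + ‖ξ‖ ^ 2) ^ σ) *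
      eLpNorm (u ξ) ∞ (volume.restrict (Ioi (0 : ℝ))) ^ 2
      ≤ ENNReal.ofReal B ^ 2 * (ENNReal.ofReal ((1 + ‖ξ‖ ^ 2) ^ σ) *
        eLpNorm (v ξ) 1 (volume.restrict (Ioi (0 : ℝ))) ^ 2) := by
    filter_upwards [hK.ae_enorm_le hv hR hu] with ξ hξ
    rw [mul_left_comm, ← mul_pow]
    gcongr
    rw [eLpNorm_exponent_top]
    exact essSup_le_of_ae_le _ (Eventually.of_forall hξ)
  rw [tangNorm, tangNorm]
  calc (∫⁻ ξ : Freq, ENNReal.ofReal ((1 + ‖ξ‖ ^ 2) ^ σ) *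
        eLpNorm (u ξ) ∞ (volume.restrict (Ioi (0 : ℝ))) ^ 2) ^ (1 / 2 : ℝ)
      ≤ (ENNReal.ofReal B ^ 2 * ∫⁻ ξ : Freq, ENNReal.ofReal ((1 + ‖ξ‖ ^ 2) ^ σ) *
        eLpNorm (v ξ) 1 (volume.restrict (Ioi (0 : ℝ))) ^ 2) ^ (1 / 2 : ℝ) := by
        rw [← lintegral_const_mul' _ _ (by finiteness)]
        exact ENNReal.rpow_le_rpow (lintegral_mono_ae h1) (by norm_num)
    _ = _ := by
        rw [ENNReal.mul_rpow_of_nonneg _ _ (by norm_num), ← ENNReal.rpow_natCast,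
          ← ENNReal.rpow_mul]
        norm_num

theorem IsGoodKernel.memL2C0 (hK : IsGoodKernel R B K) (hv : MemL2L1 v)
    (hR : BandLimited R v) (hu : ∀ᵐ ξ, u ξ = kernelConv (K ξ) (v ξ)) : MemL2C0 u := by
  refine ⟨tangMeas_kernelConv hK.measurable hv.1 hu, ?_, ?_⟩
  · exact lt_of_le_of_lt (hK.tangNorm_le hv hR hu 0)
      (ENNReal.mul_lt_top ENNReal.ofReal_lt_top hv.2)
  · filter_upwards [hK.ae_continuous hv hR hu] with ξ hξ
    exact ⟨hξ.1.continuousOn, hξ.2⟩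

theorem MemL2L1.stripIntegrable (hv : MemL2L1 v) (hR : BandLimited R v) : StripIntegrable v :=
  stripIntegrable_of_bandLimited hv.1 (square_of_tangNorm_one hv.2) hR

theorem MemL2C0.stripIntegrable (hu : MemL2C0 u) (hR : BandLimited R u) : StripIntegrable u :=
  stripIntegrable_of_bandLimited hu.1 (square_of_tangNorm_top hu.2.1) hR

theorem MemL2L1.sliceRegular (hv : MemL2L1 v) {S : E3 → ℂ} (h : IsTangFourier α S v) :
    SliceRegular v := ⟨hv.1, h.1, square_of_tangNorm_one hv.2⟩

theorem MemL2C0.sliceRegular (hu : MemL2C0 u) {ψ : E3 → ℂ} (h : IsTangFourier α ψ u) :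
    SliceRegular u := ⟨hu.1, h.1, square_of_tangNorm_top hu.2.1⟩

theorem isTangFourier_tangInv (hu : StripIntegrable u) : IsTangFourier α (tangInv α u) u :=
  ⟨hu.slice, Eventually.of_forall fun _ => rfl⟩

theorem locallyIntegrableOn_of_isTangFourier (hα : 0 < Real.cos α) (hv : MemL2L1 v)
    (hR : BandLimited R v) {S : E3 → ℂ} (h : IsTangFourier α S v) :
    LocallyIntegrableOn S (domain α) := by
  have h1 := (hv.stripIntegrable hR).locallyIntegrableOn hα
  intro p hp
  obtain ⟨t, ht, hti⟩ := h1 p hp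
  refine ⟨t ∩ domain α, inter_mem ht self_mem_nhdsWithin, ?_⟩
  refine (hti.mono_set inter_subset_left).congr_fun_ae ?_
  filter_upwards [ae_restrict_of_ae_restrict_of_subset inter_subset_right h.2] with q hq
  exact hq.symm

/-- A family of fundamental solutions provides a solution of the equation in the domain. -/
theorem IsGoodKernel.solves (hα : 0 < Real.cos α) (hK : IsGoodKernel R B K) (hv : MemL2L1 v)
    (hR : BandLimited R v) (hu : ∀ᵐ ξ, u ξ = kernelConv (K ξ) (v ξ)) {S : E3 → ℂ}
    (hS : IsTangFourier α S v) {A : bodyTest α →ₗ[ℂ] bodyTest α} {p : Freq → ℂ[X]}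
    (hA : HasSymbol A p) (hfund : ∀ᵐ ξ, ‖ξ‖ < R → ∀ s : ℝ → ℂ, IntegrableOn s (Ioi 0) →
      ∀ θ : testFun, VanishBelow 0 θ →
        ∫ z in Ioi (0 : ℝ), kernelConv (K ξ) s z * (diffOp (p ξ) θ : ℝ → ℂ) z
          = ∫ z in Ioi (0 : ℝ), s z * (θ : ℝ → ℂ) z) :
    LocallyIntegrableOn (tangInv α u) (domain α) ∧ LocallyIntegrableOn S (domain α) ∧
      ∀ φ : bodyTest α, ∫ x in domain α, tangInv α u x * (A φ : E3 → ℂ) x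
        = ∫ x in domain α, S x * (φ : E3 → ℂ) x := by
  have hC0 := hK.memL2C0 hv hR hu
  have hstrip := hC0.stripIntegrable (IsGoodKernel.bandLimited hR hu)
  have hu1 := hstrip.locallyIntegrableOn hα
  have hS1 := locallyIntegrableOn_of_isTangFourier hα hv hR hS
  refine ⟨hu1, hS1, ?_⟩
  refine weak_equation_of_ae hα hA (hC0.sliceRegular (isTangFourier_tangInv (α := α) hstrip))
    (hv.sliceRegular hS) hu1 hS1 (Eventually.of_forall fun _ => rfl) hS.2 ?_
  filter_upwards [hfund, hv.ae_integrableOn, hR, hu] with ξ h1 h2 h3 h4 θ hθ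
  rw [h4]
  rcases lt_or_ge ‖ξ‖ R with h | h
  · exact h1 h (v ξ) h2 θ hθ
  · rw [kernelConv_zero (h3 h)]
    refine integral_congr_ae ?_
    filter_upwards [h3 h] with z hz
    rw [hz]
    simp

end FrequencyKernel

/-! ### The solution given by the Green function -/

section GreenSolution

open Polynomial

variable {P : Params} {R c C : ℝ} {μ : Fin 4 → Freq → ℂ} {v : Freq → ℝ → ℂ}

/-- Both regimes lie in the domain of validity of the root localization. With `w = |ω| L / β`, the
first one gives `w ≤ K` and `R / L ≤ κ`, the second one `w ≥ 1/κ` and `w⁴ R / L ≤ κ`. -/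
theorem exists_scale_le_of_regime {K κ' : ℝ} (hK : 0 < K) (hκ' : 0 < κ') : ∃ κ : ℝ, 0 < κ ∧
    ∀ (P : Params) (R : ℝ), 0 < P.β → 0 < P.νeff → 0 < R → Regime K κ P R →
      R / layerScale P * freqWeight P ^ 4 ≤ κ' := by
  have hK4 : 1 ≤ (1 + K) ^ 4 := one_le_pow₀ (by linarith)
  refine ⟨min 1 (κ' / (16 * (1 + K) ^ 4)), lt_min one_pos (by positivity), ?_⟩
  set κ := min 1 (κ' / (16 * (1 + K) ^ 4)) with hκ
  have hκ1 : κ ≤ 1 := min_le_left _ _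
  have hκ0 : 0 < κ := lt_min one_pos (by positivity)
  have hκ2 : κ * (16 * (1 + K) ^ 4) ≤ κ' := by
    rw [← le_div_iff₀ (by positivity)]; exact min_le_right _ _
  intro P R hβ hν hR hreg
  have hL := layerScale_pos hβ hν
  have hL3 := layerScale_pow_three hβ hν
  have hscale : P.β ^ (2 / 3 : ℝ) * P.νeff ^ (1 / 3 : ℝ) = P.β / layerScale P := by
    rw [layerScale, Real.div_rpow hβ.le hν.le, eq_div_iff (by positivity)]
    have h1 : P.νeff ^ (1 / 3 : ℝ) ≠ 0 := by positivity
    have h2 : P.β ^ (2 / 3 : ℝ) * P.β ^ (1 / 3 : ℝ) = P.β := by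
      rw [← Real.rpow_add hβ]; norm_num
    field_simp
    exact h2
  rw [Regime, hscale] at hreg
  set L := layerScale P with hLdef
  set w := |P.ω| * L / P.β with hw
  have hw0 : 0 ≤ w := by positivity
  have hW : freqWeight P = 1 + w := rfl
  rw [hW]
  rcases hreg.2 with ⟨h1, -, h3⟩ | ⟨h1, h2⟩
  · have hwK : w ≤ K := by
      rw [hw, div_le_iff₀ hβ]
      calc |P.ω| * L ≤ K * (P.β / L) * L := by gcongr
        _ = K * P.β := by field_simp
    have hr : R / L ≤ κ := by
      rw [div_le_iff₀ hL]; exact h3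
    calc R / L * (1 + w) ^ 4 ≤ κ * (1 + K) ^ 4 := by gcongr
      _ ≤ κ * (16 * (1 + K) ^ 4) := by
          apply mul_le_mul_of_nonneg_left _ hκ0.le
          linarith
      _ ≤ κ' := hκ2
  · have hw1 : 1 ≤ w := by
      rw [hw, le_div_iff₀ hβ, one_mul]
      calc P.β = P.β / L * L := by field_simp
        _ ≤ κ * |P.ω| * L := by gcongr
        _ ≤ 1 * |P.ω| * L := by gcongr
        _ = |P.ω| * L := by rw [one_mul]
    have hr : R / L * w ^ 4 ≤ κ := by
      have e : R / L * w ^ 4 = R * |P.ω| ^ 4 * L ^ 3 / P.β ^ 4 := by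
        rw [hw]; field_simp
      rw [e, div_le_iff₀ (by positivity)]
      calc R * |P.ω| ^ 4 * L ^ 3 ≤ κ * (P.β ^ 3 * P.νeff) * L ^ 3 := by gcongr
        _ = κ * P.β ^ 3 * (P.νeff * L ^ 3) := by ring
        _ = κ * P.β ^ 4 := by rw [hL3]; ring
    calc R / L * (1 + w) ^ 4 ≤ R / L * (2 * w) ^ 4 := by
          gcongr; linarith
      _ = 16 * (R / L * w ^ 4) := by ring
      _ ≤ 16 * κ := by gcongr
      _ ≤ κ * (16 * (1 + K) ^ 4) := by nlinarith
      _ ≤ κ' := hκ2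

/-- The Green kernel of a labelled family of roots, `μ₁` and `μ₂` being the decaying modes. -/
def rootKernel (P : Params) (μ : Fin 4 → Freq → ℂ) (ξ : Freq) : ℝ → ℂ :=
  greenKernel (leadCoeff P) (fun j => μ j ξ) {1, 2}

theorem leadCoeff_ne_zero (hν : 0 < P.νeff) (hs : Real.sin P.α ≠ 0) : leadCoeff P ≠ 0 := by
  refine neg_ne_zero.mpr (mul_ne_zero ?_ (pow_ne_zero 2 ?_))
  · exact_mod_cast hν.ne'
  · exact_mod_cast hs

theorem norm_leadCoeff (hν : 0 < P.νeff) : ‖leadCoeff P‖ = P.νeff * Real.sin P.α ^ 2 := by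
  rw [leadCoeff, norm_neg, norm_mul, norm_pow, Complex.norm_real, Complex.norm_real,
    Real.norm_eq_abs, Real.norm_eq_abs, sq_abs, abs_of_pos hν]

theorem IsRootFamily.norm_rootDeriv_ge (h : IsRootFamily P R c C μ) (hν : 0 < P.νeff) {ξ : Freq}
    (hξ : ‖ξ‖ ≤ R) (j : Fin 4) :
    c * P.β ≤ ‖rootDeriv (leadCoeff P) (fun j => μ j ξ) j‖ := by
  rw [rootDeriv, norm_mul, norm_leadCoeff hν, norm_prod]
  exact h.deriv_ge ξ hξ j

theorem measurable_rootDeriv (hμ : ∀ j, Measurable (μ j)) (a : ℂ) (j : Fin 4) :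
    Measurable fun ξ => rootDeriv a (fun j => μ j ξ) j := by
  unfold rootDeriv
  exact (Finset.measurable_prod _ fun k _ => (hμ j).sub (hμ k)).const_mul a

theorem measurable_rootKernel (hμ : ∀ j, Measurable (μ j)) :
    Measurable (Function.uncurry (rootKernel P μ)) := by
  have h : ∀ j, Measurable fun q : Freq × ℝ =>
      (rootDeriv (leadCoeff P) (fun j => μ j q.1) j)⁻¹ * Complex.exp (-μ j q.1 * q.2) := by
    intro j
    refine ((measurable_rootDeriv hμ _ j).comp measurable_fst).inv.mul ?_
    exact Complex.measurable_exp.comp ((((hμ j).comp measurable_fst).neg).mul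
      (Complex.measurable_ofReal.comp measurable_snd))
  refine Measurable.ite (measurableSet_lt measurable_const measurable_snd) ?_ ?_
  · refine Finset.measurable_sum _ fun j _ => ?_
    convert (h j).neg using 1
    funext q
    simp
  · exact Finset.measurable_sum _ fun j _ => h j

theorem SignedRoots.nonneg {m : Fin 4 → ℂ} (hs : SignedRoots m) :
    ∀ j ∈ ({1, 2} : Finset (Fin 4)), 0 < (m j).re := by
  intro j hj
  fin_cases hj
  · exact hs.one
  · exact hs.two

theorem SignedRoots.nonpos {m : Fin 4 → ℂ} (hs : SignedRoots m) :
    ∀ j ∉ ({1, 2} : Finset (Fin 4)), (m j).re ≤ 0 := by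
  intro j hj
  fin_cases j
  · exact hs.zero.le
  · simp at hj
  · simp at hj
  · exact hs.three.le

theorem IsRootFamily.ae_signedRoots (h : IsRootFamily P R c C μ) (hc : 0 < c) (hβ : 0 < P.β)
    (hν : 0 < P.νeff) : ∀ᵐ ξ : Freq, ‖ξ‖ ≤ R → SignedRoots fun j => μ j ξ := by
  have hL := layerScale_pos hβ hν
  have hW : 0 < freqWeight P := by
    unfold freqWeight
    positivity
  filter_upwards [ae_freq_one_ne_zero] with ξ h1 hξ
  exact h.signedRoots hc hL hW hξ h1

/-- Each of the four exponentials is bounded by `1`, and its coefficient by `(c β)⁻¹`. -/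
theorem IsRootFamily.isGoodKernel (h : IsRootFamily P R c C μ) (hc : 0 < c) (hβ : 0 < P.β)
    (hν : 0 < P.νeff) : IsGoodKernel R (4 / c / P.β) (rootKernel P μ) where
  measurable := measurable_rootKernel h.measurable
  bound := by
    filter_upwards [h.ae_signedRoots hc hβ hν] with ξ hs hξ t
    have hs := hs hξ.le
    refine (norm_greenKernel_le (fun j hj => (hs.nonneg j hj).le) hs.nonpos t).trans ?_
    calc ∑ j, ‖rootDeriv (leadCoeff P) (fun j => μ j ξ) j‖⁻¹ ≤ ∑ j : Fin 4, (c * P.β)⁻¹ := by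
          refine Finset.sum_le_sum fun j _ => ?_
          exact inv_anti₀ (by positivity) (h.norm_rootDeriv_ge hν hξ.le j)
      _ = 4 / c / P.β := by
          rw [Finset.sum_const, Finset.card_univ, Fintype.card_fin, nsmul_eq_mul]
          field_simp
          norm_num
  continuous := Eventually.of_forall fun ξ _ t ht => continuousAt_greenKernel ht
  decay := by
    filter_upwards [h.ae_signedRoots hc hβ hν] with ξ hs hξ
    exact tendsto_greenKernel (hs hξ.le).nonneg

theorem IsRootFamily.ae_greenHat_eq (h : IsRootFamily P R c C μ) (hc : 0 < c) (hβ : 0 < P.β)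
    (hν : 0 < P.νeff) (hs : Real.sin P.α ≠ 0) :
    ∀ᵐ ξ : Freq, ‖ξ‖ < R → greenHat P ξ = rootKernel P μ ξ := by
  filter_upwards [h.ae_signedRoots hc hβ hν] with ξ h1 hξ
  exact h.greenHat_eq (leadCoeff_ne_zero hν hs) hξ.le (h1 hξ.le)

theorem IsRootFamily.ae_psiHat_eq (h : IsRootFamily P R c C μ) (hc : 0 < c) (hβ : 0 < P.β)
    (hν : 0 < P.νeff) (hs : Real.sin P.α ≠ 0) (hR : BandLimited R v) :
    ∀ᵐ ξ, psiHat P v ξ = kernelConv (rootKernel P μ ξ) (v ξ) := by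
  filter_upwards [h.ae_greenHat_eq hc hβ hν hs, hR] with ξ h1 h2
  have e : psiHat P v ξ = kernelConv (greenHat P ξ) (v ξ) := rfl
  rw [e]
  rcases lt_or_ge ‖ξ‖ R with hξ | hξ
  · rw [h1 hξ]
  · rw [kernelConv_zero (h2 hξ), kernelConv_zero (h2 hξ)]

theorem IsRootFamily.ae_integrableOn_greenHat (h : IsRootFamily P R c C μ) (hc : 0 < c)
    (hβ : 0 < P.β) (hν : 0 < P.νeff) (hs : Real.sin P.α ≠ 0) (hv : MemL2L1 v)
    (hR : BandLimited R v) :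
    ∀ᵐ ξ, ∀ z, IntegrableOn (fun z' => greenHat P ξ (z - z') * v ξ z') (Ioi 0) := by
  filter_upwards [(h.isGoodKernel hc hβ hν).ae_integrableOn hv hR, h.ae_greenHat_eq hc hβ hν hs, hR]
    with ξ h1 h2 h3 z
  rcases lt_or_ge ‖ξ‖ R with hξ | hξ
  · rw [h2 hξ]
    exact h1 z
  · refine (integrable_zero ℝ ℂ _).congr ?_
    filter_upwards [h3 hξ] with z' hz'
    rw [hz', mul_zero]
    rfl

theorem IsRootFamily.fundamental (h : IsRootFamily P R c C μ) (hc : 0 < c) (hβ : 0 < P.β)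
    (hν : 0 < P.νeff) (hs : Real.sin P.α ≠ 0) :
    ∀ᵐ ξ, ‖ξ‖ < R → ∀ s : ℝ → ℂ, IntegrableOn s (Ioi 0) → ∀ θ : testFun, VanishBelow 0 θ →
      ∫ z in Ioi (0 : ℝ), kernelConv (rootKernel P μ ξ) s z * (diffOp (charPoly P ξ) θ : ℝ → ℂ) z
        = ∫ z in Ioi (0 : ℝ), s z * (θ : ℝ → ℂ) z := by
  filter_upwards [h.ae_signedRoots hc hβ hν] with ξ h1 hξ s hi θ hθ
  have h1 := h1 hξ.le
  rw [h.factor ξ hξ.le]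
  exact integral_kernelConv_mul_diffOp (leadCoeff_ne_zero hν hs) (h.injective hξ.le)
    (fun j hj => (h1.nonneg j hj).le) h1.nonpos hi hθ

theorem IsRootFamily.solvesQG (h : IsRootFamily P R c C μ) (hc : 0 < c) (hβ : 0 < P.β)
    (hν : 0 < P.νeff) (hs : Real.sin P.α ≠ 0) (hcos : 0 < Real.cos P.α) (hv : MemL2L1 v)
    (hR : BandLimited R v) {S : E3 → ℂ} (hS : IsTangFourier P.α S v) :
    SolvesQG P (tangInv P.α (psiHat P v)) S := by
  obtain ⟨h1, h2, h3⟩ := (h.isGoodKernel hc hβ hν).solves hcos hv hR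
    (h.ae_psiHat_eq hc hβ hν hs hR) hS (hasSymbol_qgOp P) (h.fundamental hc hβ hν hs)
  exact ⟨h1, h2, fun φ hφ => h3 ⟨φ, hφ⟩⟩

end GreenSolution

/-! ### Decaying solutions -/

section DecayingSolutions

open Polynomial

variable {P : Params} {R c C : ℝ} {μ : Fin 4 → Freq → ℂ} {u v : Freq → ℝ → ℂ}

theorem norm_le_of_ae_of_continuousOn {f : ℝ → ℂ} (hf : ContinuousOn f (Ioi 0)) {M : ℝ}
    (h : ∀ᵐ z ∂(volume.restrict (Ioi (0 : ℝ))), ‖f z‖ ≤ M) : ∀ z, 0 < z → ‖f z‖ ≤ M := by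
  have ho : IsOpen (Ioi (0 : ℝ) ∩ (fun z => ‖f z‖) ⁻¹' Ioi M) :=
    hf.norm.isOpen_inter_preimage isOpen_Ioi isOpen_Ioi
  have h0 : volume (Ioi (0 : ℝ) ∩ (fun z => ‖f z‖) ⁻¹' Ioi M) = 0 := by
    rw [ae_restrict_iff' measurableSet_Ioi, ae_iff] at h
    refine measure_mono_null (fun z hz => ?_) h
    exact fun hcon => absurd (hcon hz.1) (not_le.mpr hz.2)
  have he := ho.eq_empty_of_measure_zero h0
  intro z hz
  by_contra hcon
  have : z ∈ Ioi (0 : ℝ) ∩ (fun z => ‖f z‖) ⁻¹' Ioi M := ⟨hz, not_le.mp hcon⟩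
  rw [he] at this
  exact this

theorem MemL2C0.ae_norm_le (hu : MemL2C0 u) : ∀ᵐ ξ, ∀ z, 0 < z →
    ‖u ξ z‖ₑ ≤ eLpNorm (u ξ) ∞ (volume.restrict (Ioi (0 : ℝ))) := by
  filter_upwards [hu.2.2] with ξ hξ z hz
  by_cases htop : eLpNorm (u ξ) ∞ (volume.restrict (Ioi (0 : ℝ))) = ∞
  · rw [htop]
    exact le_top
  · have h1 := norm_le_of_ae_of_continuousOn hξ.1
      (M := (eLpNorm (u ξ) ∞ (volume.restrict (Ioi (0 : ℝ)))).toReal) ?_ z hz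
    · rw [← ofReal_norm, ← ENNReal.ofReal_toReal htop]
      exact ENNReal.ofReal_le_ofReal h1
    · rw [eLpNorm_exponent_top] at htop ⊢
      filter_upwards [ae_le_eLpNormEssSup (f := u ξ) (μ := volume.restrict (Ioi (0 : ℝ)))] with z hz
      rw [← ofReal_norm, ← ENNReal.ofReal_toReal htop] at hz
      exact (ENNReal.ofReal_le_ofReal_iff ENNReal.toReal_nonneg).mp hz

theorem aestronglyMeasurable_shiftPairing (hu : TangMeas u) (θ : testFun) (q : ℝ) :
    AEStronglyMeasurable fun ξ => shiftPairing (u ξ) θ q := by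
  have h : AEStronglyMeasurable (fun r : Freq × ℝ => u r.1 r.2 * (θ : ℝ → ℂ) (r.2 - q))
      ((volume : Measure Freq).prod (volume.restrict (Ioi (0 : ℝ)))) := by
    refine AEStronglyMeasurable.mul hu ?_
    exact ((testFun_continuous θ).comp (by fun_prop)).aestronglyMeasurable
  exact h.integral_prod_right'

theorem MemL2C0.aestronglyMeasurable_eval (hu : MemL2C0 u) {z : ℝ} (hz : 0 < z) :
    AEStronglyMeasurable fun ξ => u ξ z := by
  refine aestronglyMeasurable_of_tendsto_ae atTop
    (fun n => aestronglyMeasurable_shiftPairing hu.1 (mollifier n) z) ?_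
  filter_upwards [hu.2.2] with ξ hξ
  exact tendsto_shiftPairing_mollifier hξ.1 hz

/-- The supremum over the positive rationals, a measurable substitute of the supremum norm. -/
def ratSup (f : ℝ → ℂ) : ℝ≥0∞ := ⨆ q : {q : ℚ // 0 < q}, ‖f (q : ℚ)‖ₑ

theorem enorm_le_ratSup {f : ℝ → ℂ} (hf : ContinuousOn f (Ioi 0)) {z : ℝ} (hz : 0 < z) :
    ‖f z‖ₑ ≤ ratSup f := by
  by_contra hcon
  have ho : IsOpen (Ioi (0 : ℝ) ∩ (fun z => ‖f z‖ₑ) ⁻¹' Ioi (ratSup f)) :=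
    (continuous_enorm.comp_continuousOn hf).isOpen_inter_preimage isOpen_Ioi isOpen_Ioi
  obtain ⟨q, hq⟩ := Rat.denseRange_cast.exists_mem_open ho ⟨z, hz, not_le.mp hcon⟩
  have hq1 : (0 : ℝ) < q := hq.1
  have hq0 : 0 < q := by exact_mod_cast hq1
  exact absurd (le_iSup (fun q : {q : ℚ // 0 < q} => ‖f (q : ℚ)‖ₑ) ⟨q, hq0⟩) (not_le.mpr hq.2)

/-- The essential supremum in `z` need not be measurable in `ξ`, so its finiteness for almost every
`ξ` is derived through `ratSup`. -/
theorem MemL2C0.ae_bounded (hu : MemL2C0 u) : ∀ᵐ ξ, ∃ M : ℝ, ∀ z, 0 < z → ‖u ξ z‖ ≤ M := by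
  have hm : AEMeasurable fun ξ => ratSup (u ξ) :=
    AEMeasurable.iSup fun q => (hu.aestronglyMeasurable_eval
      (by exact_mod_cast q.2 : (0 : ℝ) < (q : ℚ))).enorm
  have h1 : ∫⁻ ξ, ratSup (u ξ) ^ 2 < ∞ := by
    refine lt_of_le_of_lt (lintegral_mono_ae ?_) (lintegral_sq_of_tangNorm hu.2.1)
    filter_upwards [hu.ae_norm_le] with ξ hξ
    gcongr
    exact iSup_le fun q => hξ _ (by exact_mod_cast q.2)
  filter_upwards [ae_lt_top' (hm.pow_const 2) h1.ne, hu.2.2] with ξ h2 h3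
  rw [ENNReal.pow_lt_top_iff] at h2
  have h2 := h2.resolve_right (by norm_num)
  refine ⟨(ratSup (u ξ)).toReal, fun z hz => ?_⟩
  rw [← ENNReal.ofReal_le_ofReal_iff ENNReal.toReal_nonneg, ENNReal.ofReal_toReal h2.ne, ofReal_norm]
  exact enorm_le_ratSup h3.1 hz

theorem MemL2C0.memLp_eval (hu : MemL2C0 u) {z : ℝ} (hz : 0 < z) : MemLp (fun ξ => u ξ z) 2 := by
  refine ⟨hu.aestronglyMeasurable_eval hz, ?_⟩
  rw [eLpNorm_lt_top_iff_lintegral_rpow_enorm_lt_top (by norm_num) (by norm_num)]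
  refine lt_of_le_of_lt (lintegral_mono_ae ?_) (lintegral_sq_of_tangNorm hu.2.1)
  filter_upwards [hu.ae_norm_le] with ξ hξ
  simp only [ENNReal.toReal_ofNat, ENNReal.rpow_ofNat]
  have := hξ z hz
  gcongr

/-- The coefficient of `exp(-m₁ z)` in a combination of `exp(-m₁ z)` and `exp(-m₂ z)`, computed from
the values at `1` and `1 + h`. -/
def modeCoeff (f : ℝ → ℂ) (h : ℝ) (m₁ m₂ : ℂ) : ℂ :=
  (f (1 + h) - Complex.exp (-m₂ * h) * f 1) * Complex.exp m₁ *
    (Complex.exp (-m₁ * h) - Complex.exp (-m₂ * h))⁻¹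

theorem norm_exp_shift_sub_ge {m₁ m₂ : ℂ} {h M g : ℝ} (h0 : 0 < h) (hM : ‖m₂‖ ≤ M)
    (hg : g ≤ ‖m₁ - m₂‖) (hh : ‖m₁ - m₂‖ * h ≤ 1 / 2) :
    Real.exp (-(M * h)) * (g * h / 2) ≤ ‖Complex.exp (-m₁ * h) - Complex.exp (-m₂ * h)‖ := by
  have hu : ‖(-(m₁ - m₂) * h : ℂ)‖ = ‖m₁ - m₂‖ * h := by
    rw [norm_mul, norm_neg, Complex.norm_real, Real.norm_eq_abs, abs_of_pos h0]
  have h1 := norm_exp_sub_one_ge (hu.le.trans hh)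
  rw [hu] at h1
  have h2 : Complex.exp (-m₁ * h) - Complex.exp (-m₂ * h)
      = Complex.exp (-m₂ * h) * (Complex.exp (-(m₁ - m₂) * h) - 1) := by
    rw [mul_sub, ← Complex.exp_add, mul_one]
    congr 2
    ring
  rw [h2, norm_mul]
  have h3 : Real.exp (-(M * h)) ≤ ‖Complex.exp (-m₂ * h)‖ := by
    rw [Complex.norm_exp, Real.exp_le_exp, neg_mul, Complex.neg_re, Complex.re_mul_ofReal]
    have := (Complex.re_le_norm m₂).trans hM
    nlinarith
  have h4 : g * h / 2 ≤ ‖Complex.exp (-(m₁ - m₂) * h) - 1‖ := by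
    refine le_trans ?_ h1
    gcongr
  calc Real.exp (-(M * h)) * (g * h / 2)
      ≤ Real.exp (-(M * h)) * ‖Complex.exp (-(m₁ - m₂) * h) - 1‖ := by gcongr
    _ ≤ _ := by gcongr

/-- The mode coefficients are square integrable, since the roots are bounded and separated. -/
theorem memLp_modeCoeff {w : Freq → ℝ → ℂ} (hw : ∀ z, 0 < z → MemLp (fun ξ => w ξ z) 2)
    {m₁ m₂ : Freq → ℂ} (hm₁ : Measurable m₁) (hm₂ : Measurable m₂) {h M g : ℝ} (h0 : 0 < h)
    (hg0 : 0 < g)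
    (hM₁ : ∀ ξ, ‖ξ‖ ≤ R → ‖m₁ ξ‖ ≤ M) (hM₂ : ∀ ξ, ‖ξ‖ ≤ R → ‖m₂ ξ‖ ≤ M)
    (hg : ∀ ξ, ‖ξ‖ ≤ R → g ≤ ‖m₁ ξ - m₂ ξ‖) (hh : ∀ ξ, ‖ξ‖ ≤ R → ‖m₁ ξ - m₂ ξ‖ * h ≤ 1 / 2) :
    MemLp ((Metric.ball (0 : Freq) R).indicator fun ξ => modeCoeff (w ξ) h (m₁ ξ) (m₂ ξ)) 2 := by
  set B := Metric.ball (0 : Freq) R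
  have hB : MeasurableSet B := measurableSet_ball
  set D : Freq → ℂ := fun ξ => Complex.exp (m₁ ξ) *
    (Complex.exp (-m₁ ξ * h) - Complex.exp (-m₂ ξ * h))⁻¹ with hD
  set κ := Real.exp M * (Real.exp (-(M * h)) * (g * h / 2))⁻¹ with hκ
  have hDm : Measurable D := by
    refine (Complex.measurable_exp.comp hm₁).mul (Measurable.inv ?_)
    exact (Complex.measurable_exp.comp (hm₁.neg.mul_const _)).sub
      (Complex.measurable_exp.comp (hm₂.neg.mul_const _))
  have hDb : ∀ ξ ∈ B, ‖D ξ‖ ≤ κ := by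
    intro ξ hξ
    have hξ' : ‖ξ‖ ≤ R := (mem_ball_zero_iff.mp hξ).le
    rw [hD, hκ, norm_mul, norm_inv]
    have h1 := norm_exp_shift_sub_ge h0 (hM₂ ξ hξ') (hg ξ hξ') (hh ξ hξ')
    have h2 : ‖Complex.exp (m₁ ξ)‖ ≤ Real.exp M :=
      (Complex.norm_exp_le_exp_norm _).trans (Real.exp_le_exp.mpr (hM₁ ξ hξ'))
    have h3 : 0 < Real.exp (-(M * h)) * (g * h / 2) := by positivity
    exact mul_le_mul h2 (inv_anti₀ h3 h1) (inv_nonneg.mpr (norm_nonneg _)) (Real.exp_pos _).le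
  have h1 : MemLp (B.indicator fun ξ => D ξ * w ξ (1 + h)) 2 := by
    refine (hw (1 + h) (by linarith)).of_le_mul (c := κ) ?_ (Eventually.of_forall fun ξ => ?_)
    · exact (hDm.aestronglyMeasurable.mul (hw (1 + h) (by linarith)).1).indicator hB
    · by_cases hξ : ξ ∈ B
      · rw [indicator_of_mem hξ, norm_mul]
        exact mul_le_mul_of_nonneg_right (hDb ξ hξ) (norm_nonneg _)
      · rw [indicator_of_notMem hξ, norm_zero]
        positivity
  have h2 : MemLp (B.indicator fun ξ => D ξ * Complex.exp (-m₂ ξ * h) * w ξ 1) 2 := by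
    refine (hw 1 one_pos).of_le_mul (c := κ * Real.exp (M * h)) ?_ (Eventually.of_forall fun ξ => ?_)
    · exact ((hDm.mul (Complex.measurable_exp.comp (hm₂.neg.mul_const _))).aestronglyMeasurable.mul
        (hw 1 one_pos).1).indicator hB
    · by_cases hξ : ξ ∈ B
      · rw [indicator_of_mem hξ, norm_mul, norm_mul]
        have h3 : ‖Complex.exp (-m₂ ξ * h)‖ ≤ Real.exp (M * h) := by
          refine (Complex.norm_exp_le_exp_norm _).trans (Real.exp_le_exp.mpr ?_)
          rw [norm_mul, norm_neg, Complex.norm_real, Real.norm_eq_abs, abs_of_pos h0]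
          exact mul_le_mul_of_nonneg_right (hM₂ ξ (mem_ball_zero_iff.mp hξ).le) h0.le
        refine mul_le_mul_of_nonneg_right ?_ (norm_nonneg _)
        exact mul_le_mul (hDb ξ hξ) h3 (norm_nonneg _) (by positivity)
      · rw [indicator_of_notMem hξ, norm_zero]
        positivity
  refine (h1.sub h2).ae_eq (Eventually.of_forall fun ξ => ?_)
  by_cases hξ : ξ ∈ B
  · simp only [Pi.sub_apply, indicator_of_mem hξ, hD, modeCoeff]
    ring
  · simp only [Pi.sub_apply, indicator_of_notMem hξ, sub_zero]

/-- Bounded solutions of the homogeneous equation are combinations of the two decaying modes, with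
square integrable coefficients. -/
theorem IsRootFamily.exists_modes (h : IsRootFamily P R c C μ) (hR : 0 < R) (hc : 0 < c)
    (hβ : 0 < P.β) (hν : 0 < P.νeff) (hs : Real.sin P.α ≠ 0) {w : Freq → ℝ → ℂ}
    (hw : ∀ z, 0 < z → MemLp (fun ξ => w ξ z) 2)
    (hwc : ∀ᵐ ξ, ContinuousOn (w ξ) (Ioi 0)) (hwb : ∀ᵐ ξ, ∃ M : ℝ, ∀ z, 0 < z → ‖w ξ z‖ ≤ M)
    (hwR : BandLimited R w)
    (hweak : ∀ᵐ ξ, ‖ξ‖ < R → ∀ (n : ℕ) (q : ℚ), 1 / ((n : ℝ) + 1) < q →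
      shiftPairing (w ξ) (diffOp (charPoly P ξ) (mollifier n)) q = 0) :
    ∃ d : Fin 2 → Freq → ℂ, (∀ j, MemLp (d j) 2 volume) ∧ ∀ᵐ ξ, ∀ z : ℝ, 0 < z →
      w ξ z = ∑ j : Fin 2, d j ξ * Complex.exp (-rootPos P ξ j * z) := by
  obtain ⟨M, hM⟩ := h.bounded
  obtain ⟨g, hg0, hg⟩ := h.separated
  have hM0 : 0 ≤ M := (norm_nonneg _).trans (hM 0 (by simpa using hR.le) 0)
  -- A sampling step for which the two exponentials have distinct ratios at all frequencies.
  set η : ℝ := 1 / (4 * M + 4) with hη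
  have hη0 : 0 < η := by positivity
  have hclose : ∀ j k ξ, ‖ξ‖ ≤ R → ‖μ j ξ - μ k ξ‖ * η ≤ 1 / 2 := by
    intro j k ξ hξ
    have h1 : ‖μ j ξ - μ k ξ‖ ≤ 2 * M := by
      refine (norm_sub_le _ _).trans ?_
      linarith [hM ξ hξ j, hM ξ hξ k]
    rw [hη, mul_one_div, div_le_iff₀ (by positivity)]
    linarith
  have hmem : ∀ j k, j ≠ k → MemLp ((Metric.ball (0 : Freq) R).indicator
      fun ξ => modeCoeff (w ξ) η (μ j ξ) (μ k ξ)) 2 := fun j k hjk =>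
    memLp_modeCoeff hw (h.measurable j) (h.measurable k) hη0 hg0 (fun ξ hξ => hM ξ hξ j)
      (fun ξ hξ => hM ξ hξ k) (fun ξ hξ => hg ξ hξ j k hjk) (hclose j k)
  set d₁ := (Metric.ball (0 : Freq) R).indicator fun ξ => modeCoeff (w ξ) η (μ 1 ξ) (μ 2 ξ)
  set d₂ := (Metric.ball (0 : Freq) R).indicator fun ξ => modeCoeff (w ξ) η (μ 2 ξ) (μ 1 ξ)
  have hd₁ : MemLp d₁ 2 := hmem 1 2 (by decide)
  have hd₂ : MemLp d₂ 2 := hmem 2 1 (by decide)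
  -- The labelling of the roots `μ₁, μ₂` may differ from the order of `rootPos`, on a measurable set
  -- of frequencies.
  set E : Set Freq := {ξ | PrecedesByRe (μ 1 ξ) (μ 2 ξ)} with hE
  have hEm : MeasurableSet E := measurableSet_precedesByRe (h.measurable 1) (h.measurable 2)
  refine ⟨![E.indicator d₁ + Eᶜ.indicator d₂, E.indicator d₂ + Eᶜ.indicator d₁], ?_, ?_⟩
  · intro j
    fin_cases j
    · exact (hd₁.indicator hEm).add (hd₂.indicator hEm.compl)
    · exact (hd₂.indicator hEm).add (hd₁.indicator hEm.compl)
  · filter_upwards [hwc, hwb, hwR, hweak, h.ae_signedRoots hc hβ hν] with ξ h1 h2 h3 h4 h5 z hz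
    rcases lt_or_ge ‖ξ‖ R with hξ | hξ
    · obtain ⟨M', hM'⟩ := h2
      have hsr := h5 hξ.le
      have ha := leadCoeff_ne_zero hν hs
      have hball : ξ ∈ Metric.ball (0 : Freq) R := mem_ball_zero_iff.mpr hξ
      rw [h.factor ξ hξ.le] at h4
      obtain ⟨c₁, c₂, hc12⟩ := exists_two_exp_of_weak_solution ha (h.injective hξ.le) hsr.zero
        hsr.three h1 hM' (h4 hξ)
      have hne12 : μ 1 ξ ≠ μ 2 ξ := fun he => by
        have := h.injective hξ.le (a₁ := 1) (a₂ := 2) he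
        exact absurd this (by decide)
      have e1 : d₁ ξ = c₁ := by
        have := coeff_of_two_exp (h := η) (hc12 1 one_pos) (hc12 (1 + η) (by linarith))
          (exp_shift_sub_ne_zero hne12 hη0 (hclose 1 2 ξ hξ.le))
        rw [this]
        exact indicator_of_mem hball _
      have e2 : d₂ ξ = c₂ := by
        have hc21 : ∀ z : ℝ, 0 < z → w ξ z
            = c₂ * Complex.exp (-μ 2 ξ * z) + c₁ * Complex.exp (-μ 1 ξ * z) := fun z hz => by
          rw [hc12 z hz, add_comm]
        have := coeff_of_two_exp (h := η) (hc21 1 one_pos) (hc21 (1 + η) (by linarith))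
          (exp_shift_sub_ne_zero hne12.symm hη0 (hclose 2 1 ξ hξ.le))
        rw [this]
        exact indicator_of_mem hball _
      rw [hc12 z hz, Fin.sum_univ_two]
      by_cases hle : ξ ∈ E
      · obtain ⟨r1, r2⟩ := h.rootPos_of_precedes ha hξ.le hsr hle
        have hle' : ξ ∉ Eᶜ := fun hcon => hcon hle
        simp [indicator_of_mem hle, indicator_of_notMem hle', r1, r2, e1, e2]
      · obtain ⟨r1, r2⟩ := h.rootPos_of_not_precedes ha hξ.le hsr hle
        have hle' : ξ ∈ Eᶜ := hle
        simp only [Matrix.cons_val_zero, Matrix.cons_val_one, Pi.add_apply, indicator_of_notMem hle,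
          indicator_of_mem hle', r1, r2, e1, e2, zero_add]
        exact add_comm _ _
    · have hball : ξ ∉ Metric.ball (0 : Freq) R := by
        rw [mem_ball_zero_iff]; exact not_lt.mpr hξ
      have e1 : d₁ ξ = 0 := indicator_of_notMem hball _
      have e2 : d₂ ξ = 0 := indicator_of_notMem hball _
      have hz0 : ‖w ξ z‖ ≤ 0 := norm_le_of_ae_of_continuousOn h1
        (by filter_upwards [h3 hξ] with y hy; rw [hy, norm_zero]) z hz
      rw [norm_le_zero_iff.mp hz0, Fin.sum_univ_two]
      have i1 : ∀ s : Set Freq, s.indicator d₁ ξ = 0 := fun s => by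
        by_cases hm : ξ ∈ s
        · rw [indicator_of_mem hm, e1]
        · exact indicator_of_notMem hm _
      have i2 : ∀ s : Set Freq, s.indicator d₂ ξ = 0 := fun s => by
        by_cases hm : ξ ∈ s
        · rw [indicator_of_mem hm, e2]
        · exact indicator_of_notMem hm _
      simp [i1, i2]

/-- Two solutions with the same source differ by decaying modes. The equation holds at almost
every frequency for each of the countably many rational translates of the mollifiers, hence for
all of them simultaneously. -/
theorem IsRootFamily.ae_decaying_solution (h : IsRootFamily P R c C μ) (hR : 0 < R) (hc : 0 < c)
    (hβ : 0 < P.β) (hν : 0 < P.νeff) (hs : Real.sin P.α ≠ 0) (hcos : 0 < Real.cos P.α)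
    (hv : MemL2L1 v) (hvR : BandLimited R v) {S : E3 → ℂ} (hS : IsTangFourier P.α S v)
    {ψ : E3 → ℂ} (hψu : IsTangFourier P.α ψ u) (hu : MemL2C0 u) (huR : BandLimited R u)
    (hψ : SolvesQG P ψ S) :
    ∃ d : Fin 2 → Freq → ℂ, (∀ j, MemLp (d j) 2 volume) ∧ ∀ᵐ ξ, ∀ z : ℝ, 0 < z →
      u ξ z = psiHat P v ξ z + ∑ j : Fin 2, d j ξ * Complex.exp (-rootPos P ξ j * z) := by
  have hK := h.isGoodKernel hc hβ hν
  have hp := h.ae_psiHat_eq hc hβ hν hs hvR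
  have hpC := hK.memL2C0 hv hvR hp
  have hpR : BandLimited R (psiHat P v) := IsGoodKernel.bandLimited hvR hp
  have hweak : ∀ (n : ℕ) (q : ℚ), ∀ᵐ ξ, 1 / ((n : ℝ) + 1) < q →
      ∫ z in Ioi (0 : ℝ), u ξ z * (diffOp (charPoly P ξ) (testShift q (mollifier n)) : ℝ → ℂ) z
        = ∫ z in Ioi (0 : ℝ), v ξ z * (testShift q (mollifier n) : ℝ → ℂ) z := by
    intro n q
    by_cases hq : 1 / ((n : ℝ) + 1) < q
    · have := ae_weak_equation hcos (hasSymbol_qgOp P) (hu.sliceRegular hψu) (hv.sliceRegular hS)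
        hψ.1 hψ.2.1 hψu.2 hS.2 (fun φ => hψ.2.2 φ φ.2) (tsupport_testShift_mollifier hq)
      filter_upwards [this] with ξ hξ _ using hξ
    · exact Eventually.of_forall fun ξ hcon => absurd hcon hq
  have hweak' := ae_all_iff.mpr fun n => ae_all_iff.mpr (hweak n)
  have hwc : ∀ᵐ ξ, ContinuousOn (fun z => u ξ z - psiHat P v ξ z) (Ioi 0) := by
    filter_upwards [hu.2.2, hpC.2.2] with ξ h1 h2 using h1.1.sub h2.1
  have hwb : ∀ᵐ ξ, ∃ M : ℝ, ∀ z, 0 < z → ‖u ξ z - psiHat P v ξ z‖ ≤ M := by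
    filter_upwards [hu.ae_bounded, hpC.ae_bounded] with ξ ⟨M, hM⟩ ⟨M', hM'⟩
    exact ⟨M + M', fun z hz => (norm_sub_le _ _).trans (add_le_add (hM z hz) (hM' z hz))⟩
  have hwR : BandLimited R fun ξ z => u ξ z - psiHat P v ξ z := by
    filter_upwards [huR, hpR] with ξ h1 h2 hξ
    filter_upwards [h1 hξ, h2 hξ] with z h3 h4
    rw [h3, h4, sub_zero]
  have hwk : ∀ᵐ ξ, ‖ξ‖ < R → ∀ (n : ℕ) (q : ℚ), 1 / ((n : ℝ) + 1) < q →
      shiftPairing (fun z => u ξ z - psiHat P v ξ z) (diffOp (charPoly P ξ) (mollifier n)) q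
        = 0 := by
    filter_upwards [hweak', h.fundamental hc hβ hν hs, hp, hv.ae_integrableOn, hu.2.2, hpC.2.2,
      hu.ae_bounded, hpC.ae_bounded] with ξ h1 h2 h3 h4 h5 h6 ⟨M, hM⟩ ⟨M', hM'⟩ hξ n q hq
    have e1 := h1 n q hq
    have e2 := h2 hξ (v ξ) h4 _ (vanishBelow_testShift_mollifier hq)
    rw [← h3] at e2
    rw [diffOp_testShift] at e1 e2
    simp only [testShift_apply] at e1 e2
    simp only [shiftPairing, sub_mul]
    rw [integral_sub, e1, e2, sub_self]
    · exact integrableOn_shiftPairing (h5.1.aestronglyMeasurable measurableSet_Ioi) hM _ _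
    · exact integrableOn_shiftPairing (h6.1.aestronglyMeasurable measurableSet_Ioi) hM' _ _
  obtain ⟨d, hd, hdu⟩ := h.exists_modes hR hc hβ hν hs (w := fun ξ z => u ξ z - psiHat P v ξ z)
    (fun z hz => (hu.memLp_eval hz).sub (hpC.memLp_eval hz)) hwc hwb hwR hwk
  refine ⟨d, hd, ?_⟩
  filter_upwards [hdu] with ξ hξ z hz
  rw [← hξ z hz]
  ring

end DecayingSolutions

/-! ### The Sverdrup equation -/

section Sverdrup

open Polynomial

variable {P : Params} {R : ℝ} {u v : Freq → ℝ → ℂ}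

/-- The root of the Sverdrup operator, `-i ξ_x cot α`. -/
def sverdrupRoot (α : ℝ) (ξ : Freq) : ℂ := -(Real.cos α * Complex.I * ξ 0) / Real.sin α

/-- The Green kernel of the Sverdrup operator that vanishes for `t > 0`. -/
def sverdrupKernel (P : Params) (ξ : Freq) : ℝ → ℂ :=
  greenKernel ((P.β : ℂ) * Real.sin P.α) (fun _ : Unit => sverdrupRoot P.α ξ) ∅

theorem sverdrupRoot_re (α : ℝ) (ξ : Freq) : (sverdrupRoot α ξ).re = 0 := by
  have : sverdrupRoot α ξ = ((-(Real.cos α * ξ 0) / Real.sin α : ℝ) : ℂ) * Complex.I := by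
    rw [sverdrupRoot]
    push_cast
    ring
  rw [this, Complex.re_ofReal_mul, Complex.I_re, mul_zero]

theorem rootDeriv_unit (a : ℂ) (μ : Unit → ℂ) (j : Unit) : rootDeriv a μ j = a := by
  rw [rootDeriv]
  simp

theorem sverdrupKernel_of_pos {ξ : Freq} {t : ℝ} (ht : 0 < t) : sverdrupKernel P ξ t = 0 := by
  rw [sverdrupKernel, greenKernel, if_pos ht, Finset.sum_empty]

theorem sverdrupKernel_of_nonpos {ξ : Freq} {t : ℝ} (ht : t ≤ 0) : sverdrupKernel P ξ t
    = ((P.β : ℂ) * Real.sin P.α)⁻¹ * Complex.exp (-sverdrupRoot P.α ξ * t) := by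
  rw [sverdrupKernel, greenKernel, if_neg (not_lt.mpr ht), Finset.compl_empty,
    Finset.univ_unique, Finset.sum_singleton, rootDeriv_unit]

theorem sverdrup_symbol_eq (hs : Real.sin P.α ≠ 0) (ξ : Freq) :
    Polynomial.C (P.β : ℂ) * symbolOne P.α ξ
      = Polynomial.C ((P.β : ℂ) * Real.sin P.α) * (X - Polynomial.C (sverdrupRoot P.α ξ)) := by
  have hs' : (Real.sin P.α : ℂ) ≠ 0 := by exact_mod_cast hs
  apply Polynomial.funext
  intro m
  simp only [symbolOne, sverdrupRoot, eval_add, eval_sub, eval_mul, eval_C, eval_X]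
  field_simp
  ring

theorem measurable_sverdrupKernel : Measurable (Function.uncurry (sverdrupKernel P)) := by
  have e : Function.uncurry (sverdrupKernel P) = fun q : Freq × ℝ => if 0 < q.2 then 0 else
      ((P.β : ℂ) * Real.sin P.α)⁻¹ * Complex.exp (-sverdrupRoot P.α q.1 * q.2) := by
    funext q
    split_ifs with h
    · exact sverdrupKernel_of_pos h
    · exact sverdrupKernel_of_nonpos (not_lt.mp h)
  rw [e]
  refine Measurable.ite (measurableSet_lt measurable_const measurable_snd) measurable_const ?_
  unfold sverdrupRoot
  exact Continuous.measurable (by fun_prop)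

theorem isGoodKernel_sverdrupKernel (R : ℝ) :
    IsGoodKernel R (1 / (|P.β| * |Real.sin P.α|)) (sverdrupKernel P) where
  measurable := measurable_sverdrupKernel
  bound := by
    refine Eventually.of_forall fun ξ _ t => ?_
    refine (norm_greenKernel_le (by simp) (fun j _ => (sverdrupRoot_re _ _).le) t).trans ?_
    rw [Finset.univ_unique, Finset.sum_singleton, rootDeriv_unit, norm_mul, Complex.norm_real,
      Complex.norm_real, Real.norm_eq_abs, Real.norm_eq_abs, one_div]
  continuous := Eventually.of_forall fun ξ _ t ht => continuousAt_greenKernel ht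
  decay := Eventually.of_forall fun ξ _ => tendsto_greenKernel (by simp)

theorem sverdrupKernel_fundamental (hβ : 0 < P.β) (hs : Real.sin P.α ≠ 0) (ξ : Freq) {s : ℝ → ℂ}
    (hi : IntegrableOn s (Ioi 0)) {θ : testFun} (hθ : VanishBelow 0 θ) :
    ∫ z in Ioi (0 : ℝ), kernelConv (sverdrupKernel P ξ) s z *
        (diffOp (Polynomial.C (P.β : ℂ) * symbolOne P.α ξ) θ : ℝ → ℂ) z
      = ∫ z in Ioi (0 : ℝ), s z * (θ : ℝ → ℂ) z := by
  have ha : (P.β : ℂ) * Real.sin P.α ≠ 0 :=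
    mul_ne_zero (by exact_mod_cast hβ.ne') (by exact_mod_cast hs)
  have h := integral_kernelConv_mul_diffOp (ι := Unit) (J := ∅) ha
    (μ := fun _ => sverdrupRoot P.α ξ) (Function.injective_of_subsingleton _) (by simp)
    (fun j _ => (sverdrupRoot_re _ _).le) hi hθ
  rw [sverdrup_symbol_eq hs]
  rw [Finset.univ_unique, Finset.prod_singleton] at h
  exact h

/-- The transform of the Sverdrup solution. -/
def sverdrupHat (P : Params) (v : Freq → ℝ → ℂ) (ξ : Freq) : ℝ → ℂ :=
  kernelConv (sverdrupKernel P ξ) (v ξ)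

theorem ae_sverdrupHat_eq :
    ∀ᵐ ξ, sverdrupHat P v ξ = kernelConv (sverdrupKernel P ξ) (v ξ) :=
  Eventually.of_forall fun _ => rfl

/-- Integration from infinity provides a Sverdrup solution. -/
theorem isSverdrup_sverdrupHat (hβ : 0 < P.β) (hs : Real.sin P.α ≠ 0) (hcos : 0 < Real.cos P.α)
    (hv : MemL2L1 v) (hR : BandLimited R v) {S : E3 → ℂ} (hS : IsTangFourier P.α S v) :
    IsSverdrup P S (tangInv P.α (sverdrupHat P v)) (sverdrupHat P v) := by
  have hK := isGoodKernel_sverdrupKernel (P := P) R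
  have hC := hK.memL2C0 hv hR ae_sverdrupHat_eq
  have hBL : BandLimited R (sverdrupHat P v) := IsGoodKernel.bandLimited hR ae_sverdrupHat_eq
  refine ⟨isTangFourier_tangInv (hC.stripIntegrable hBL), hC, ?_⟩
  obtain ⟨h1, h2, h3⟩ := hK.solves hcos hv hR ae_sverdrupHat_eq hS (hasSymbol_sverdrupOp P)
    (Eventually.of_forall fun ξ _ s hi θ hθ => sverdrupKernel_fundamental hβ hs ξ hi hθ)
  exact ⟨h1, h2, fun φ hφ => h3 ⟨φ, hφ⟩⟩

/-- The decaying solution of the Sverdrup equation is unique: the homogeneous solutions are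
multiples of `exp(i ξ_x z cot α)`, which has modulus `1`. -/
theorem IsSverdrup.ae_eq (hβ : 0 < P.β) (hs : Real.sin P.α ≠ 0) (hcos : 0 < Real.cos P.α)
    (hv : MemL2L1 v) (hR : BandLimited R v) {S ψ : E3 → ℂ} (hS : IsTangFourier P.α S v)
    (h : IsSverdrup P S ψ u) : ∀ᵐ ξ, ∀ z, 0 < z → u ξ z = sverdrupHat P v ξ z := by
  obtain ⟨hψu, hu, hψ⟩ := h
  have hK := isGoodKernel_sverdrupKernel (P := P) R
  have hC := hK.memL2C0 hv hR ae_sverdrupHat_eq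
  have hweak : ∀ (n : ℕ) (q : ℚ), ∀ᵐ ξ, 1 / ((n : ℝ) + 1) < q →
      ∫ z in Ioi (0 : ℝ), u ξ z * (diffOp (Polynomial.C (P.β : ℂ) * symbolOne P.α ξ)
          (testShift q (mollifier n)) : ℝ → ℂ) z
        = ∫ z in Ioi (0 : ℝ), v ξ z * (testShift q (mollifier n) : ℝ → ℂ) z := by
    intro n q
    by_cases hq : 1 / ((n : ℝ) + 1) < q
    · have := ae_weak_equation hcos (hasSymbol_sverdrupOp P) (hu.sliceRegular hψu)
        (hv.sliceRegular hS) hψ.1 hψ.2.1 hψu.2 hS.2 (fun φ => hψ.2.2 φ φ.2)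
        (tsupport_testShift_mollifier hq)
      filter_upwards [this] with ξ hξ _ using hξ
    · exact Eventually.of_forall fun ξ hcon => absurd hcon hq
  have hweak' := ae_all_iff.mpr fun n => ae_all_iff.mpr (hweak n)
  filter_upwards [hweak', hv.ae_integrableOn, hu.2.2, hC.2.2, hu.ae_bounded, hC.ae_bounded]
    with ξ h1 h4 h5 h6 ⟨M, hM⟩ ⟨M', hM'⟩ z hz
  have ha : (P.β : ℂ) * Real.sin P.α ≠ 0 :=
    mul_ne_zero (by exact_mod_cast hβ.ne') (by exact_mod_cast hs)
  refine sub_eq_zero.mp (eq_zero_of_weak_solution (v := fun z => u ξ z - sverdrupHat P v ξ z) ha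
    (sverdrupRoot_re P.α ξ).le (h5.1.sub h6.1) (M := M + M')
    (fun z hz => (norm_sub_le _ _).trans (add_le_add (hM z hz) (hM' z hz))) ?_ ?_ z hz)
  · simpa using h5.2.sub h6.2
  · intro n q hq
    have e1 := h1 n q hq
    have e2 := sverdrupKernel_fundamental hβ hs ξ h4 (vanishBelow_testShift_mollifier hq)
    rw [diffOp_testShift] at e1 e2
    simp only [testShift_apply] at e1 e2
    rw [← sverdrup_symbol_eq hs]
    simp only [shiftPairing, sub_mul]
    rw [integral_sub, e1, sub_eq_zero]
    · exact e2.symm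
    · exact integrableOn_shiftPairing (h5.1.aestronglyMeasurable measurableSet_Ioi) hM _ _
    · exact integrableOn_shiftPairing (h6.1.aestronglyMeasurable measurableSet_Ioi) hM' _ _

end Sverdrup

/-! ### Convergence of the kernels -/

section KernelLimit

/-- Concentrating exponentials have small convolutions with a fixed integrable function, uniformly
in the position, by absolute continuity of the integral. -/
theorem eventually_lintegral_exp_le {f : ℝ → ℂ} (hf : IntegrableOn f (Ioi 0)) {lam : ℕ → ℝ}
    (hlam : Tendsto lam atTop atTop) {δ : ℝ≥0∞} (hδ : δ ≠ 0) :
    ∀ᶠ n in atTop, ∀ z : ℝ, ∫⁻ z' in Ioi (0 : ℝ),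
      ENNReal.ofReal (Real.exp (-(lam n * |z - z'|))) * ‖f z'‖ₑ ≤ δ := by
  have hfin : ∫⁻ z' in Ioi (0 : ℝ), ‖f z'‖ₑ ≠ ∞ := hf.2.ne
  have hδ2 : δ / 2 ≠ 0 := (ENNReal.half_pos hδ).ne'
  obtain ⟨η, hη, hsmall⟩ := exists_pos_setLIntegral_lt_of_measure_lt hfin hδ2
  obtain ⟨r, hr0, hrη⟩ := ENNReal.lt_iff_exists_nnreal_btwn.mp hη
  have hr0' : 0 < (r : ℝ) := by exact_mod_cast hr0
  have hlim : Tendsto (fun n => ENNReal.ofReal (Real.exp (-(lam n * (r / 2)))) *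
      ∫⁻ z' in Ioi (0 : ℝ), ‖f z'‖ₑ) atTop (𝓝 0) := by
    have h1 : Tendsto (fun n => Real.exp (-(lam n * (r / 2)))) atTop (𝓝 0) :=
      Real.tendsto_exp_neg_atTop_nhds_zero.comp (hlam.atTop_mul_const (by positivity))
    have h2 := ENNReal.Tendsto.mul_const (ENNReal.tendsto_ofReal h1) (Or.inr hfin)
    simpa using h2
  filter_upwards [hlim.eventually (gt_mem_nhds (ENNReal.half_pos hδ)), hlam.eventually_ge_atTop 0]
    with n hn hn0 z
  calc ∫⁻ z' in Ioi (0 : ℝ), ENNReal.ofReal (Real.exp (-(lam n * |z - z'|))) * ‖f z'‖ₑ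
      ≤ ∫⁻ z' in Ioi (0 : ℝ), ((Metric.ball z (r / 2)).indicator (fun z' => ‖f z'‖ₑ) z'
          + ENNReal.ofReal (Real.exp (-(lam n * (r / 2)))) * ‖f z'‖ₑ) := by
        refine lintegral_mono fun z' => ?_
        by_cases h : z' ∈ Metric.ball z (r / 2)
        · dsimp only
          rw [indicator_of_mem h]
          refine le_trans ?_ le_self_add
          refine mul_le_of_le_one_left (zero_le) ?_
          rw [ENNReal.ofReal_le_one, Real.exp_le_one_iff, neg_nonpos]
          positivity
        · dsimp only
          rw [indicator_of_notMem h, zero_add]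
          gcongr
          rw [Metric.mem_ball, Real.dist_eq, not_lt, abs_sub_comm] at h
          exact h
    _ = (∫⁻ z' in Metric.ball z (r / 2), ‖f z'‖ₑ ∂(volume.restrict (Ioi (0 : ℝ))))
          + ENNReal.ofReal (Real.exp (-(lam n * (r / 2)))) * ∫⁻ z' in Ioi (0 : ℝ), ‖f z'‖ₑ := by
        rw [lintegral_add_right' _ (hf.1.enorm.const_mul _), lintegral_indicator measurableSet_ball,
          lintegral_const_mul' _ _ ENNReal.ofReal_ne_top]
    _ ≤ δ / 2 + δ / 2 := by
        refine add_le_add (hsmall _ ?_).le hn.le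
        refine lt_of_le_of_lt (Measure.restrict_apply_le _ _) ?_
        rw [Real.volume_ball, mul_div_cancel₀ _ (two_ne_zero), ENNReal.ofReal_coe_nnreal]
        exact hrη
    _ = δ := ENNReal.add_halves δ

theorem tendsto_lintegral_min_mul {f : ℝ → ℂ} (hf : IntegrableOn f (Ioi 0)) {η ζ : ℕ → ℝ}
    (hη : Tendsto η atTop (𝓝 0)) (hζ : Tendsto ζ atTop (𝓝 0)) {b : ℝ} (hb : 0 ≤ b) :
    Tendsto (fun n => ∫⁻ z' in Ioi (0 : ℝ),
      ENNReal.ofReal (η n + b * min 2 (ζ n * z')) * ‖f z'‖ₑ) atTop (𝓝 0) := by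
  have h0 : (0 : ℝ≥0∞) = ∫⁻ z' in Ioi (0 : ℝ), 0 := by simp
  rw [h0]
  refine tendsto_lintegral_filter_of_dominated_convergence'
    (fun z' => ENNReal.ofReal (1 + b * 2) * ‖f z'‖ₑ) ?_ ?_ ?_ ?_
  · exact Eventually.of_forall fun n =>
      (Measurable.aemeasurable (by fun_prop)).mul hf.1.enorm
  · filter_upwards [hη.eventually (gt_mem_nhds one_pos)] with n hn
    refine Eventually.of_forall fun z' => ?_
    have hmin : min 2 (ζ n * z') ≤ 2 := min_le_left _ _
    gcongr
  · rw [lintegral_const_mul' _ _ ENNReal.ofReal_ne_top]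
    exact ENNReal.mul_ne_top ENNReal.ofReal_ne_top hf.2.ne
  · refine Eventually.of_forall fun z' => ?_
    have h1 : Tendsto (fun n => η n + b * min 2 (ζ n * z')) atTop (𝓝 (0 + b * min 2 (0 * z'))) :=
      hη.add ((tendsto_const_nhds.min (hζ.mul_const z')).const_mul b)
    have h2 := ENNReal.Tendsto.mul_const (ENNReal.tendsto_ofReal h1)
      (Or.inr (enorm_ne_top : ‖f z'‖ₑ ≠ ∞))
    simpa using h2

/-- Kernels that concentrate at `t = 0`, up to an error that is small at bounded `t`, have small
convolutions with a fixed integrable source, uniformly on the half-line. -/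
theorem eventually_kernelConv_le {f : ℝ → ℂ} (hf : IntegrableOn f (Ioi 0)) {E : ℕ → ℝ → ℂ}
    {lam η ζ : ℕ → ℝ} {a b : ℝ} (ha : 0 ≤ a) (hb : 0 ≤ b)
    (hlam : Tendsto lam atTop atTop)
    (hη : Tendsto η atTop (𝓝 0)) (hζ : Tendsto ζ atTop (𝓝 0))
    (hE : ∀ n t s, 0 ≤ s → -s ≤ t →
      ‖E n t‖ ≤ a * Real.exp (-(lam n * |t|)) + (η n + b * min 2 (ζ n * s)))
    {δ : ℝ≥0∞} (hδ : δ ≠ 0) :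
    ∀ᶠ n in atTop, ∀ z : ℝ, 0 < z → ‖kernelConv (E n) f z‖ₑ ≤ δ := by
  obtain ⟨δ', hδ', hδ'a⟩ : ∃ δ' : ℝ≥0∞, δ' ≠ 0 ∧ ENNReal.ofReal a * δ' ≤ δ / 2 := by
    rcases eq_or_ne (ENNReal.ofReal a) 0 with h0 | h0
    · exact ⟨1, one_ne_zero, by simp [h0]⟩
    · refine ⟨δ / 2 / ENNReal.ofReal a, ?_, ENNReal.mul_div_le⟩
      exact ENNReal.div_ne_zero.mpr ⟨(ENNReal.half_pos hδ).ne', ENNReal.ofReal_ne_top⟩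
  filter_upwards [eventually_lintegral_exp_le hf hlam hδ',
    (tendsto_lintegral_min_mul hf hη hζ hb).eventually (gt_mem_nhds (ENNReal.half_pos hδ))]
    with n h1 h2 z hz
  calc ‖kernelConv (E n) f z‖ₑ ≤ ∫⁻ z' in Ioi (0 : ℝ), ‖E n (z - z') * f z'‖ₑ :=
        enorm_integral_le_lintegral_enorm _
    _ ≤ ∫⁻ z' in Ioi (0 : ℝ), (ENNReal.ofReal a *
          (ENNReal.ofReal (Real.exp (-(lam n * |z - z'|))) * ‖f z'‖ₑ)
          + ENNReal.ofReal (η n + b * min 2 (ζ n * z')) * ‖f z'‖ₑ) := by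
        refine lintegral_mono_ae ?_
        filter_upwards [ae_restrict_mem measurableSet_Ioi] with z' hz'
        rw [enorm_mul, ← mul_assoc, ← add_mul, ← ENNReal.ofReal_mul ha]
        gcongr
        have hz'' : (0 : ℝ) < z' := hz'
        refine le_trans ?_ ENNReal.ofReal_add_le
        rw [← ofReal_norm]
        exact ENNReal.ofReal_le_ofReal (hE n (z - z') z' hz''.le (by linarith))
    _ = ENNReal.ofReal a * (∫⁻ z' in Ioi (0 : ℝ),
          ENNReal.ofReal (Real.exp (-(lam n * |z - z'|))) * ‖f z'‖ₑ)
          + ∫⁻ z' in Ioi (0 : ℝ), ENNReal.ofReal (η n + b * min 2 (ζ n * z')) * ‖f z'‖ₑ := by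
        have hm : AEMeasurable (fun z' => ENNReal.ofReal (η n + b * min 2 (ζ n * z')) * ‖f z'‖ₑ)
            (volume.restrict (Ioi (0 : ℝ))) :=
          (Measurable.aemeasurable (by fun_prop)).mul hf.1.enorm
        rw [lintegral_add_right' _ hm, lintegral_const_mul' _ _ ENNReal.ofReal_ne_top]
    _ ≤ ENNReal.ofReal a * δ' + δ / 2 := by
        gcongr
        exact h1 z
    _ ≤ δ / 2 + δ / 2 := by gcongr
    _ = δ := ENNReal.add_halves δ

theorem norm_exp_sub_exp_le {m m' : ℂ} {t : ℝ} (h : 0 ≤ m.re * t) (h' : 0 ≤ m'.re * t) :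
    ‖Complex.exp (-m * t) - Complex.exp (-m' * t)‖ ≤ min 2 (‖m - m'‖ * |t|) := by
  refine le_min ?_ ?_
  · refine (norm_sub_le _ _).trans ?_
    linarith [norm_exp_neg_mul_le_one h, norm_exp_neg_mul_le_one h']
  · have hconv : Convex ℝ {w : ℂ | w.re ≤ 0} := convex_halfSpace_re_le 0
    have h1 := hconv.norm_image_sub_le_of_norm_hasDerivWithin_le (𝕜 := ℂ) (f := Complex.exp)
      (f' := Complex.exp) (C := 1) (fun w _ => (Complex.hasDerivAt_exp w).hasDerivWithinAt)
      (fun w hw => by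
        rw [Complex.norm_exp, Real.exp_le_one_iff]; exact hw)
      (x := -m' * t) (y := -m * t) ?_ ?_
    · refine h1.trans_eq ?_
      rw [one_mul, ← sub_mul, norm_mul, Complex.norm_real, Real.norm_eq_abs]
      congr 1
      rw [← norm_neg]
      congr 1
      ring
    · change (-m' * t).re ≤ 0
      rw [neg_mul, Complex.neg_re, Complex.re_mul_ofReal]
      linarith
    · change (-m * t).re ≤ 0
      rw [neg_mul, Complex.neg_re, Complex.re_mul_ofReal]
      linarith

end KernelLimit

/-! ### Convergence to the Sverdrup solution -/

section SverdrupLimit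

open Polynomial

variable {P : Params} {R c C : ℝ} {μ : Fin 4 → Freq → ℂ} {u v : Freq → ℝ → ℂ}

/-- The decay rate of the boundary layers. -/
def layerRate (P : Params) (c : ℝ) : ℝ := c * layerScale P / freqWeight P ^ 4

/-- The relative error on the amplitude of the slow mode. -/
def amplitudeError (P : Params) (R c C : ℝ) : ℝ :=
  C * freqWeight P * (R / layerScale P) / (c * |Real.sin P.α|)

/-- The distance between the slow root and the root of the Sverdrup operator. -/
def rootError (P : Params) (R C : ℝ) : ℝ :=
  C * freqWeight P * R ^ 2 / layerScale P / |Real.sin P.α|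

theorem norm_mode_le {d m : ℂ} {b lam t : ℝ} (hb : 0 < b) (hd : b ≤ ‖d‖)
    (hm : lam * |t| ≤ m.re * t) : ‖d⁻¹ * Complex.exp (-m * t)‖ ≤ b⁻¹ * Real.exp (-(lam * |t|)) := by
  rw [norm_mul, norm_inv, Complex.norm_exp, neg_mul, Complex.neg_re, Complex.re_mul_ofReal]
  exact mul_le_mul (inv_anti₀ hb hd) (Real.exp_le_exp.mpr (neg_le_neg hm)) (Real.exp_pos _).le
    (inv_nonneg.mpr hb.le)

/-- The Green kernel is a perturbation of the Sverdrup kernel. The modes `μ₁`, `μ₂` (for `t > 0`)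
and `μ₃` (for `t ≤ 0`) are boundary layers, and the slow mode `μ₀` is compared with the Sverdrup
mode through its amplitude and its root. The bound `-s ≤ t` is the one satisfied by `t = z - z'`
for `s = z'`. -/
theorem IsRootFamily.norm_kernel_sub_le (h : IsRootFamily P R c C μ) (hc : 0 < c)
    (hβ : 0 < P.β) (hν : 0 < P.νeff) (hs : Real.sin P.α ≠ 0) {ξ : Freq} (hξ : ‖ξ‖ ≤ R)
    (hsr : SignedRoots fun j => μ j ξ) {t s : ℝ} (hs0 : 0 ≤ s) (hst : -s ≤ t)
    (hη : 0 ≤ amplitudeError P R c C) (hζ : 0 ≤ rootError P R C) :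
    ‖(P.β : ℂ) * (rootKernel P μ ξ t - sverdrupKernel P ξ t)‖
      ≤ 2 / c * Real.exp (-(layerRate P c * |t|)) +
        (amplitudeError P R c C + 1 / |Real.sin P.α| * min 2 (rootError P R C * s)) := by
  have hsa : 0 < |Real.sin P.α| := abs_pos.mpr hs
  have hβc : (P.β : ℂ) ≠ 0 := by exact_mod_cast hβ.ne'
  have hsc : (Real.sin P.α : ℂ) ≠ 0 := by exact_mod_cast hs
  have hβn : ‖(P.β : ℂ)‖ = P.β := by
    rw [Complex.norm_real, Real.norm_eq_abs, abs_of_pos hβ]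
  have hsn : ‖(Real.sin P.α : ℂ)‖ = |Real.sin P.α| := by
    rw [Complex.norm_real, Real.norm_eq_abs]
  have hcb : 0 < c * P.β := by positivity
  have hmin : 0 ≤ min 2 (rootError P R C * s) := le_min (by norm_num) (by positivity)
  have hrest : 0 ≤ amplitudeError P R c C + 1 / |Real.sin P.α| * min 2 (rootError P R C * s) := by
    positivity
  set r := fun j => rootDeriv (leadCoeff P) (fun j => μ j ξ) j with hr
  have hrn : ∀ j, c * P.β ≤ ‖r j‖ := h.norm_rootDeriv_ge hν hξ
  have hmode : ∀ j, layerRate P c * |t| ≤ (μ j ξ).re * t →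
      ‖(P.β : ℂ) * ((r j)⁻¹ * Complex.exp (-μ j ξ * t))‖
        ≤ 1 / c * Real.exp (-(layerRate P c * |t|)) := by
    intro j hj
    rw [norm_mul, hβn]
    calc P.β * ‖(r j)⁻¹ * Complex.exp (-μ j ξ * t)‖
        ≤ P.β * ((c * P.β)⁻¹ * Real.exp (-(layerRate P c * |t|))) := by
          gcongr
          exact norm_mode_le hcb (hrn j) hj
      _ = 1 / c * Real.exp (-(layerRate P c * |t|)) := by field_simp
  rcases lt_or_ge 0 t with ht | ht
  · have e : (P.β : ℂ) * (rootKernel P μ ξ t - sverdrupKernel P ξ t)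
        = -((P.β : ℂ) * ((r 1)⁻¹ * Complex.exp (-μ 1 ξ * t)))
          - (P.β : ℂ) * ((r 2)⁻¹ * Complex.exp (-μ 2 ξ * t)) := by
      rw [sverdrupKernel_of_pos ht, rootKernel, greenKernel, if_pos ht,
        Finset.sum_pair (by decide)]
      ring
    have h1 : layerRate P c * |t| ≤ (μ 1 ξ).re * t := by
      rw [abs_of_pos ht]
      exact mul_le_mul_of_nonneg_right (h.re_one ξ hξ) ht.le
    have h2 : layerRate P c * |t| ≤ (μ 2 ξ).re * t := by
      rw [abs_of_pos ht]
      exact mul_le_mul_of_nonneg_right (h.re_two ξ hξ) ht.le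
    rw [e]
    refine (norm_sub_le _ _).trans ?_
    rw [norm_neg]
    have e2 : 2 / c * Real.exp (-(layerRate P c * |t|))
        = 1 / c * Real.exp (-(layerRate P c * |t|)) + 1 / c * Real.exp (-(layerRate P c * |t|)) := by
      ring
    linarith [hmode 1 h1, hmode 2 h2]
  · have hcompl : ({1, 2} : Finset (Fin 4))ᶜ = {0, 3} := by decide
    set m := sverdrupRoot P.α ξ with hm
    have e : (P.β : ℂ) * (rootKernel P μ ξ t - sverdrupKernel P ξ t)
        = (P.β : ℂ) * ((r 3)⁻¹ * Complex.exp (-μ 3 ξ * t))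
          + (((P.β : ℂ) * (r 0)⁻¹ - (Real.sin P.α : ℂ)⁻¹) * Complex.exp (-μ 0 ξ * t)
          + (Real.sin P.α : ℂ)⁻¹ * (Complex.exp (-μ 0 ξ * t) - Complex.exp (-m * t))) := by
      rw [sverdrupKernel_of_nonpos ht, rootKernel, greenKernel, if_neg (not_lt.mpr ht), hcompl,
        Finset.sum_pair (by decide)]
      field_simp
      ring
    have h3 : layerRate P c * |t| ≤ (μ 3 ξ).re * t := by
      rw [abs_of_nonpos ht]
      have := mul_le_mul_of_nonpos_right (h.re_three ξ hξ) ht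
      rw [layerRate]
      linarith
    have hr0 : r 0 ≠ 0 := norm_pos_iff.mp (lt_of_lt_of_le hcb (hrn 0))
    have hamp : ‖(P.β : ℂ) * (r 0)⁻¹ - (Real.sin P.α : ℂ)⁻¹‖ ≤ amplitudeError P R c C := by
      have e1 : (P.β : ℂ) * (r 0)⁻¹ - (Real.sin P.α : ℂ)⁻¹
          = -(r 0 - P.β * Real.sin P.α) * ((r 0)⁻¹ * (Real.sin P.α : ℂ)⁻¹) := by
        field_simp
        ring
      have e2 : r 0 = -((P.νeff : ℂ) * (Real.sin P.α : ℂ) ^ 2) *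
          ((μ 0 ξ - μ 1 ξ) * (μ 0 ξ - μ 2 ξ) * (μ 0 ξ - μ 3 ξ)) := by
        have he : (Finset.univ : Finset (Fin 4)).erase 0 = {1, 2, 3} := by decide
        rw [hr]
        dsimp only
        rw [rootDeriv, he, Finset.prod_insert (by decide), Finset.prod_pair (by decide), leadCoeff]
        ring
      rw [e1, norm_mul, norm_neg, norm_mul, norm_inv, norm_inv, hsn]
      have h4 := h.deriv_zero_near ξ hξ
      rw [← e2] at h4
      calc ‖r 0 - P.β * Real.sin P.α‖ * (‖r 0‖⁻¹ * |Real.sin P.α|⁻¹)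
          ≤ (P.β * (C * freqWeight P * (R / layerScale P))) *
            ((c * P.β)⁻¹ * |Real.sin P.α|⁻¹) := by
            refine mul_le_mul h4 ?_ (by positivity) ((norm_nonneg _).trans h4)
            gcongr
            exact hrn 0
        _ = amplitudeError P R c C := by
            rw [amplitudeError]
            field_simp
    have hroot : ‖μ 0 ξ - m‖ ≤ rootError P R C := by
      have e1 : μ 0 ξ - m = (Real.cos P.α * Complex.I * ξ 0 + Real.sin P.α * μ 0 ξ : ℂ) *
          (Real.sin P.α : ℂ)⁻¹ := by
        rw [hm, sverdrupRoot]
        field_simp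
        ring
      rw [e1, norm_mul, norm_inv, hsn, rootError, ← div_eq_mul_inv]
      gcongr
      exact h.zero_near ξ hξ
    have h0 : 0 ≤ (μ 0 ξ).re * t := mul_nonneg_of_nonpos_of_nonpos hsr.zero.le ht
    have hm0 : 0 ≤ m.re * t := by
      rw [hm, sverdrupRoot_re, zero_mul]
    rw [e]
    refine (norm_add_le _ _).trans ?_
    refine add_le_add ((hmode 3 h3).trans ?_) ((norm_add_le _ _).trans (add_le_add ?_ ?_))
    · gcongr
      norm_num
    · rw [norm_mul]
      exact (mul_le_of_le_one_right (norm_nonneg _) (norm_exp_neg_mul_le_one h0)).trans hamp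
    · rw [norm_mul, norm_inv, hsn, one_div]
      gcongr
      refine (norm_exp_sub_exp_le h0 hm0).trans (min_le_min le_rfl ?_)
      rw [abs_of_nonpos ht]
      exact mul_le_mul hroot (by linarith) (by linarith) ((norm_nonneg _).trans hroot)

/-- Convergence along a sequence of parameters for which the boundary layers become thin. At each
frequency the convolutions converge uniformly in `z`, and the bounds on both solutions allow
dominated convergence in `ξ`. -/
theorem tendsto_tangNorm_sub_sverdrup {α : ℝ} (hsα : Real.sin α ≠ 0) (hcos : 0 < Real.cos α)
    {P : ℕ → Params} (hα : ∀ n, (P n).α = α) (hβ : ∀ n, 0 < (P n).β) (hν : ∀ n, 0 < (P n).νeff)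
    {R c C : ℝ} (hR : 0 < R) (hc : 0 < c) (hC : 0 < C)
    (hroots : ∀ n, ∃ μ, IsRootFamily (P n) R c C μ)
    (hlam : Tendsto (fun n => layerRate (P n) c) atTop atTop)
    (hη : Tendsto (fun n => amplitudeError (P n) R c C) atTop (𝓝 0))
    (hζ : Tendsto (fun n => rootError (P n) R C) atTop (𝓝 0))
    {v : Freq → ℝ → ℂ} (hv : MemL2L1 v) (hvR : BandLimited R v) {S : E3 → ℂ}
    (hS : IsTangFourier α S v) {ψ : ℕ → E3 → ℂ} {u : ℕ → Freq → ℝ → ℂ}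
    (hu : ∀ n, IsSverdrup (P n) S (ψ n) (u n)) {σ : ℝ} (hσ : 0 ≤ σ) :
    Tendsto (fun n => tangNorm σ ∞ fun ξ z => ((P n).β : ℂ) * (psiHat (P n) v ξ z - u n ξ z))
      atTop (𝓝 0) := by
  choose μ hμ using hroots
  set D : ℕ → Freq → ℝ → ℂ := fun n ξ z => ((P n).β : ℂ) * (psiHat (P n) v ξ z - u n ξ z) with hD
  have hs : ∀ n, Real.sin (P n).α ≠ 0 := fun n => by rw [hα]; exact hsα
  have hcos' : ∀ n, 0 < Real.cos (P n).α := fun n => by rw [hα]; exact hcos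
  have hS' : ∀ n, IsTangFourier (P n).α S v := fun n => by rw [hα]; exact hS
  have hK := fun n => (hμ n).isGoodKernel hc (hβ n) (hν n)
  have hp := fun n => (hμ n).ae_psiHat_eq hc (hβ n) (hν n) (hs n) hvR
  have hpC := fun n => (hK n).memL2C0 hv hvR (hp n)
  have hKs := fun n => isGoodKernel_sverdrupKernel (P := P n) R
  have hueq := fun n => (hu n).ae_eq (hβ n) (hs n) (hcos' n) hv hvR (hS' n)
  have hη0 : ∀ n, 0 ≤ amplitudeError (P n) R c C := fun n => by
    have := layerScale_pos (hβ n) (hν n)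
    have := hβ n
    unfold amplitudeError freqWeight
    positivity
  have hζ0 : ∀ n, 0 ≤ rootError (P n) R C := fun n => by
    have := layerScale_pos (hβ n) (hν n)
    have := hβ n
    unfold rootError freqWeight
    positivity
  -- The difference is the convolution of `v` with the difference of the kernels.
  have hrep : ∀ n, ∀ᵐ ξ, ∀ z, 0 < z → D n ξ z = kernelConv
      (fun t => ((P n).β : ℂ) * (rootKernel (P n) (μ n) ξ t - sverdrupKernel (P n) ξ t)) (v ξ) z := by
    intro n
    filter_upwards [hp n, hueq n, (hK n).ae_integrableOn hv hvR, (hKs n).ae_integrableOn hv hvR]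
      with ξ h1 h2 h3 h4 z hz
    simp only [hD]
    rw [h1, h2 z hz, sverdrupHat, kernelConv, kernelConv, ← integral_sub (h3 z) (h4 z),
      ← integral_const_mul, kernelConv]
    refine integral_congr_ae (Eventually.of_forall fun z' => ?_)
    dsimp only
    ring
  -- `ratSup` replaces the essential supremum, whose measurability in `ξ` is not clear.
  have hpt : ∀ᵐ ξ, Tendsto (fun n => ratSup (D n ξ)) atTop (𝓝 0) := by
    have hsr := fun n => (hμ n).ae_signedRoots hc (hβ n) (hν n)
    filter_upwards [ae_all_iff.mpr hrep, ae_all_iff.mpr hsr, hv.ae_integrableOn, hvR]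
      with ξ h1 h2 h3 h4
    rw [ENNReal.tendsto_nhds_zero]
    intro δ hδ
    rcases lt_or_ge ‖ξ‖ R with hξ | hξ
    · have hE := eventually_kernelConv_le h3 (E := fun n t => ((P n).β : ℂ) *
        (rootKernel (P n) (μ n) ξ t - sverdrupKernel (P n) ξ t)) (a := 2 / c)
        (b := 1 / |Real.sin α|) (by positivity) (by positivity) hlam hη hζ (fun n t s hs0 hst => by
          have := (hμ n).norm_kernel_sub_le hc (hβ n) (hν n) (hs n) hξ.le (h2 n hξ.le) hs0 hst
            (hη0 n) (hζ0 n)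
          rwa [hα n] at this) hδ.ne'
      filter_upwards [hE] with n hn
      refine iSup_le fun q => ?_
      have hq : (0 : ℝ) < (q : ℚ) := by exact_mod_cast q.2
      rw [h1 n _ hq]
      exact hn _ hq
    · refine Eventually.of_forall fun n => iSup_le fun q => ?_
      have hq : (0 : ℝ) < (q : ℚ) := by exact_mod_cast q.2
      rw [h1 n _ hq, kernelConv_zero (h4 hξ)]
      simp
  set B : ℝ≥0∞ := ENNReal.ofReal (4 / c) + ENNReal.ofReal (1 / |Real.sin α|) with hB
  have hbound : ∀ n, ∀ᵐ ξ, ratSup (D n ξ)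
      ≤ B * eLpNorm (v ξ) 1 (volume.restrict (Ioi (0 : ℝ))) := by
    intro n
    filter_upwards [(hK n).ae_enorm_le hv hvR (hp n),
      (hKs n).ae_enorm_le hv hvR ae_sverdrupHat_eq, hueq n] with ξ h1 h2 h3
    refine iSup_le fun q => ?_
    have hq : (0 : ℝ) < (q : ℚ) := by exact_mod_cast q.2
    simp only [hD]
    rw [enorm_mul, h3 _ hq]
    have hβe : ‖((P n).β : ℂ)‖ₑ = ENNReal.ofReal (P n).β := by
      rw [← ofReal_norm, Complex.norm_real, Real.norm_eq_abs, abs_of_pos (hβ n)]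
    have hβn := hβ n
    have hsa : 0 < |Real.sin α| := abs_pos.mpr hsα
    have e1 : ENNReal.ofReal (P n).β * ENNReal.ofReal (4 / c / (P n).β) = ENNReal.ofReal (4 / c) := by
      rw [← ENNReal.ofReal_mul hβn.le]
      congr 1
      field_simp
    have e2 : ENNReal.ofReal (P n).β * ENNReal.ofReal (1 / (|(P n).β| * |Real.sin (P n).α|))
        = ENNReal.ofReal (1 / |Real.sin α|) := by
      rw [← ENNReal.ofReal_mul hβn.le, hα n, abs_of_pos hβn]
      congr 1
      field_simp
    calc ‖((P n).β : ℂ)‖ₑ * ‖psiHat (P n) v ξ (q : ℚ) - sverdrupHat (P n) v ξ (q : ℚ)‖ₑ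
        ≤ ENNReal.ofReal (P n).β * (ENNReal.ofReal (4 / c / (P n).β) *
              eLpNorm (v ξ) 1 (volume.restrict (Ioi (0 : ℝ)))
            + ENNReal.ofReal (1 / (|(P n).β| * |Real.sin (P n).α|)) *
              eLpNorm (v ξ) 1 (volume.restrict (Ioi (0 : ℝ)))) := by
          rw [hβe]
          gcongr
          exact enorm_sub_le.trans (add_le_add (h1 _) (h2 _))
      _ = B * eLpNorm (v ξ) 1 (volume.restrict (Ioi (0 : ℝ))) := by
          rw [mul_add, ← mul_assoc, ← mul_assoc, e1, e2, ← add_mul]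
  have hmeas : ∀ n, AEMeasurable fun ξ => ratSup (D n ξ) := fun n =>
    AEMeasurable.iSup fun q => by
      have hq : (0 : ℝ) < (q : ℚ) := by exact_mod_cast q.2
      exact ((((hpC n).aestronglyMeasurable_eval hq).sub
        ((hu n).2.1.aestronglyMeasurable_eval hq)).const_mul _).enorm
  have hzero : ∀ᵐ ξ, R ≤ ‖ξ‖ → eLpNorm (v ξ) 1 (volume.restrict (Ioi (0 : ℝ))) = 0 := by
    filter_upwards [hvR] with ξ hξ h
    rw [eLpNorm_congr_ae (g := 0) (hξ h), eLpNorm_zero]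
  have hlim : Tendsto (fun n => ∫⁻ ξ : Freq, ENNReal.ofReal ((1 + ‖ξ‖ ^ 2) ^ σ) *
      ratSup (D n ξ) ^ 2) atTop (𝓝 (∫⁻ ξ : Freq, 0)) := by
    refine tendsto_lintegral_of_dominated_convergence' (fun ξ =>
      ENNReal.ofReal ((1 + R ^ 2) ^ σ) * B ^ 2 *
        eLpNorm (v ξ) 1 (volume.restrict (Ioi (0 : ℝ))) ^ 2) (fun n => ?_) (fun n => ?_) ?_ ?_
    · refine AEMeasurable.mul (Measurable.aemeasurable ?_) ((hmeas n).pow_const 2)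
      exact ENNReal.measurable_ofReal.comp
        ((Measurable.pow_const (by fun_prop) σ))
    · filter_upwards [hbound n, hzero] with ξ h1 h2
      rw [mul_assoc, ← mul_pow]
      rcases lt_or_ge ‖ξ‖ R with hξ | hξ
      · gcongr
      · rw [h2 hξ, mul_zero] at h1
        rw [nonpos_iff_eq_zero.mp h1]
        simp
    · have hBt : B ≠ ∞ := ENNReal.add_ne_top.mpr ⟨ENNReal.ofReal_ne_top, ENNReal.ofReal_ne_top⟩
      have hct : ENNReal.ofReal ((1 + R ^ 2) ^ σ) * B ^ 2 ≠ ∞ :=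
        ENNReal.mul_ne_top ENNReal.ofReal_ne_top (ENNReal.pow_ne_top hBt)
      rw [lintegral_const_mul' _ _ hct]
      exact ENNReal.mul_ne_top hct (lintegral_sq_of_tangNorm hv.2).ne
    · filter_upwards [hpt] with ξ hξ
      have h1 := ENNReal.Tendsto.const_mul (a := ENNReal.ofReal ((1 + ‖ξ‖ ^ 2) ^ σ))
        (ENNReal.Tendsto.pow (n := 2) hξ) (Or.inr ENNReal.ofReal_ne_top)
      simpa using h1
  rw [lintegral_zero] at hlim
  have hlim2 := hlim.ennrpow_const (1 / 2 : ℝ)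
  rw [ENNReal.zero_rpow_of_pos (by norm_num)] at hlim2
  refine tendsto_of_tendsto_of_tendsto_of_le_of_le tendsto_const_nhds hlim2
    (fun n => zero_le) fun n => ?_
  refine ENNReal.rpow_le_rpow (lintegral_mono_ae ?_) (by norm_num)
  filter_upwards [(hpC n).2.2, (hu n).2.1.2.2] with ξ h1 h2
  gcongr
  rw [eLpNorm_exponent_top]
  refine essSup_le_of_ae_le _ ?_
  filter_upwards [ae_restrict_mem measurableSet_Ioi] with z hz
  exact enorm_le_ratSup ((h1.1.sub h2.1).const_smul ((P n).β : ℂ)) hz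

end SverdrupLimit

/-! ### Power laws for the parameters -/

section PowerLaws

variable {α a b d e ε : ℝ}

theorem νeff_powerParams_le (hε : 0 < ε) (hε1 : ε ≤ 1) (hde : d ≤ e) :
    (powerParams α a b d e ε).νeff ≤ ε ^ d := by
  have h := Real.rpow_le_rpow_of_exponent_ge hε hε1 hde
  have h2 := Real.sin_sq_add_cos_sq α
  calc (powerParams α a b d e ε).νeff = ε ^ d * Real.sin α ^ 2 + ε ^ e * Real.cos α ^ 2 := rfl
    _ ≤ ε ^ d * Real.sin α ^ 2 + ε ^ d * Real.cos α ^ 2 := by gcongr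
    _ = ε ^ d := by rw [← mul_add, h2, mul_one]

theorem le_νeff_powerParams (hε : 0 < ε) :
    ε ^ d * Real.sin α ^ 2 ≤ (powerParams α a b d e ε).νeff :=
  le_add_of_nonneg_right (mul_nonneg (Real.rpow_pos_of_pos hε _).le (sq_nonneg _))

theorem νeff_powerParams_pos (hε : 0 < ε) : 0 < (powerParams α a b d e ε).νeff :=
  νeff_pos (Real.rpow_pos_of_pos hε _) (Real.rpow_pos_of_pos hε _)

theorem tendsto_layerScale_powerParams (ha : 0 < a) (hd : 0 ≤ d) (hde : d ≤ e) :
    Tendsto (fun ε => layerScale (powerParams α a b d e ε)) (𝓝[>] 0) atTop := by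
  have h1 : Tendsto (fun ε : ℝ => (ε ^ (-a)) ^ (1 / 3 : ℝ)) (𝓝[>] 0) atTop :=
    (tendsto_rpow_atTop (by norm_num)).comp (tendsto_rpow_neg_nhdsGT_zero (neg_lt_zero.mpr ha))
  refine tendsto_atTop_mono' _ ?_ h1
  filter_upwards [Ioc_mem_nhdsGT (zero_lt_one' ℝ)] with ε hε
  have hν := νeff_powerParams_pos (α := α) (a := a) (b := b) (d := d) (e := e) hε.1
  have hν1 : (powerParams α a b d e ε).νeff ≤ 1 :=
    (νeff_powerParams_le hε.1 hε.2 hde).trans (Real.rpow_le_one hε.1.le hε.2 hd)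
  have hb : 0 < ε ^ (-a) := Real.rpow_pos_of_pos hε.1 _
  exact Real.rpow_le_rpow hb.le ((le_div_iff₀ hν).mpr (mul_le_of_le_one_right hb.le hν1))
    (by norm_num)

/-- Under the constraint on `b`, the forcing frequency does not dominate the boundary layers. -/
theorem freqWeight_powerParams_le (hs : Real.sin α ≠ 0) (hb : b ≤ (2 * a - d) / 3)
    (hε : 0 < ε) (hε1 : ε ≤ 1) :
    freqWeight (powerParams α a b d e ε) ≤ 1 + 1 / Real.sin α ^ 2 := by
  set P := powerParams α a b d e ε with hP
  have hs2 : 0 < Real.sin α ^ 2 := by positivity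
  have hβ : 0 < P.β := Real.rpow_pos_of_pos hε _
  have hω : 0 < P.ω := Real.rpow_pos_of_pos hε _
  have hν : 0 < P.νeff := νeff_powerParams_pos hε
  have hM : 1 ≤ 1 / Real.sin α ^ 2 := (one_le_div hs2).mpr (Real.sin_sq_le_one α)
  have hL := layerScale_pos hβ hν
  have hpow : P.ω ^ 3 ≤ ε ^ d * P.β ^ 2 := by
    have e1 : P.ω ^ 3 = ε ^ (-b * 3) := by
      rw [Real.rpow_mul hε.le]
      exact (Real.rpow_ofNat _ 3).symm
    have e2 : P.β ^ 2 = ε ^ (-a * 2) := by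
      rw [Real.rpow_mul hε.le]
      exact (Real.rpow_ofNat _ 2).symm
    rw [e1, e2, ← Real.rpow_add hε]
    exact Real.rpow_le_rpow_of_exponent_ge hε hε1 (by linarith)
  have hcube : (P.ω * layerScale P / P.β) ^ 3 ≤ (1 / Real.sin α ^ 2) ^ 3 := by
    have e1 : (P.ω * layerScale P / P.β) ^ 3 = P.ω ^ 3 / (P.νeff * P.β ^ 2) := by
      have h3 : layerScale P ^ 3 = P.β / P.νeff := by
        rw [eq_div_iff hν.ne', mul_comm]
        exact layerScale_pow_three hβ hν
      rw [div_pow, mul_pow, h3]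
      field_simp
    rw [e1]
    refine le_trans ?_ (le_self_pow₀ hM (by norm_num))
    rw [div_le_div_iff₀ (by positivity) hs2, one_mul]
    calc P.ω ^ 3 * Real.sin α ^ 2 ≤ ε ^ d * P.β ^ 2 * Real.sin α ^ 2 := by gcongr
      _ = ε ^ d * Real.sin α ^ 2 * P.β ^ 2 := by ring
      _ ≤ P.νeff * P.β ^ 2 := by
          gcongr
          exact le_νeff_powerParams hε
  have hw : P.ω * layerScale P / P.β ≤ 1 / Real.sin α ^ 2 :=
    le_of_pow_le_pow_left₀ (by norm_num) (by positivity) hcube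
  rw [freqWeight, abs_of_pos hω]
  linarith

theorem one_le_freqWeight {P : Params} (hβ : 0 < P.β) (hν : 0 < P.νeff) : 1 ≤ freqWeight P := by
  have := layerScale_pos hβ hν
  rw [freqWeight]
  exact le_add_of_nonneg_right (by positivity)

/-- The layer scale tends to infinity while the normalized forcing frequency stays bounded, so that
the roots are localized for small `ε` and all the errors tend to zero. -/
theorem tendsto_tangNorm_sub_sverdrup_powerParams (hα : α ∈ Ioo (-(Real.pi / 2)) 0) (ha : 0 < a)
    (hd : 0 ≤ d) (hde : d ≤ e) (hb : b ≤ (2 * a - d) / 3) {R : ℝ} (hR : 0 < R)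
    {v : Freq → ℝ → ℂ} (hv : MemL2L1 v) (hvR : BandLimited R v) {S : E3 → ℂ}
    (hS : IsTangFourier α S v) {ψ : ℝ → E3 → ℂ} {u : ℝ → Freq → ℝ → ℂ}
    (hu : ∀ ε : ℝ, 0 < ε → IsSverdrup (powerParams α a b d e ε) S (ψ ε) (u ε)) {σ : ℝ}
    (hσ : 0 ≤ σ) :
    Tendsto (fun ε : ℝ => tangNorm σ ∞ fun ξ z => ((powerParams α a b d e ε).β : ℂ) *
      (psiHat (powerParams α a b d e ε) v ξ z - u ε ξ z)) (𝓝[>] 0) (𝓝 0) := by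
  have hs : Real.sin α ≠ 0 :=
    (Real.sin_neg_of_neg_of_neg_pi_lt hα.2 (by linarith [hα.1, Real.pi_pos])).ne
  have hcos : 0 < Real.cos α := Real.cos_pos_of_mem_Ioo ⟨hα.1, by linarith [hα.2, Real.pi_pos]⟩
  have hsa : 0 < |Real.sin α| := abs_pos.mpr hs
  obtain ⟨κ, C, c, hκ, hC, hc, hroots⟩ := exists_isRootFamily hα
  set P : ℝ → Params := powerParams α a b d e with hP
  set M : ℝ := 1 + 1 / Real.sin α ^ 2 with hM
  have hM0 : 0 < M := by positivity
  have hβ : ∀ ε, 0 < ε → 0 < (P ε).β := fun ε hε => Real.rpow_pos_of_pos hε _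
  have hν : ∀ ε, 0 < ε → 0 < (P ε).νeff := fun ε hε => νeff_powerParams_pos hε
  have hL : Tendsto (fun ε => layerScale (P ε)) (𝓝[>] 0) atTop :=
    tendsto_layerScale_powerParams ha hd hde
  have hsmall : ∀ᶠ ε in 𝓝[>] (0 : ℝ), 0 < ε ∧ ε ≤ 1 ∧ R * M ^ 4 / κ ≤ layerScale (P ε) := by
    filter_upwards [Ioc_mem_nhdsGT (zero_lt_one' ℝ), hL.eventually_ge_atTop (R * M ^ 4 / κ)]
      with ε h1 h2 using ⟨h1.1, h1.2, h2⟩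
  -- Dominated convergence works along sequences; discarding finitely many terms, every parameter in
  -- the sequence is admissible.
  refine tendsto_of_seq_tendsto fun x hx => ?_
  obtain ⟨N, hN⟩ := eventually_atTop.mp (hx.eventually hsmall)
  rw [← tendsto_add_atTop_iff_nat N]
  have hx' : ∀ n, 0 < x (n + N) ∧ x (n + N) ≤ 1 ∧ R * M ^ 4 / κ ≤ layerScale (P (x (n + N))) :=
    fun n => hN _ (Nat.le_add_left N n)
  have hW : ∀ n, freqWeight (P (x (n + N))) ≤ M := fun n =>
    freqWeight_powerParams_le hs hb (hx' n).1 (hx' n).2.1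
  have hW1 : ∀ n, 1 ≤ freqWeight (P (x (n + N))) := fun n =>
    one_le_freqWeight (hβ _ (hx' n).1) (hν _ (hx' n).1)
  have hL0 : ∀ n, 0 < layerScale (P (x (n + N))) := fun n =>
    layerScale_pos (hβ _ (hx' n).1) (hν _ (hx' n).1)
  have hLn : Tendsto (fun n => layerScale (P (x (n + N)))) atTop atTop :=
    hL.comp ((tendsto_add_atTop_iff_nat N).mpr hx)
  refine tendsto_tangNorm_sub_sverdrup (P := fun n => P (x (n + N))) hs hcos (fun n => rfl)
    (fun n => hβ _ (hx' n).1) (fun n => hν _ (hx' n).1) hR hc hC (fun n => ?_) ?_ ?_ ?_ hv hvR hS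
    (fun n => hu _ (hx' n).1) hσ
  · refine hroots _ rfl (hβ _ (hx' n).1) (Real.rpow_pos_of_pos (hx' n).1 _)
      (Real.rpow_pos_of_pos (hx' n).1 _) R hR ?_
    have h3 := (hx' n).2.2
    rw [div_le_iff₀ hκ] at h3
    rw [div_mul_eq_mul_div, div_le_iff₀ (hL0 n), mul_comm κ]
    refine le_trans ?_ h3
    have := hW n
    have := hW1 n
    gcongr
  · refine tendsto_atTop_mono (fun n => ?_) (hLn.const_mul_atTop (show 0 < c / M ^ 4 by positivity))
    have := hW n
    have := hW1 n
    have := hL0 n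
    rw [layerRate, div_mul_eq_mul_div]
    gcongr
  · have h0 : Tendsto (fun n => C * M * R / (c * |Real.sin α|) * (layerScale (P (x (n + N))))⁻¹)
        atTop (𝓝 0) := by
      simpa using (tendsto_inv_atTop_zero.comp hLn).const_mul (C * M * R / (c * |Real.sin α|))
    refine squeeze_zero (fun n => ?_) (fun n => ?_) h0
    · have := hW1 n
      have := hL0 n
      rw [amplitudeError]
      positivity
    · have := hW n
      have := hL0 n
      calc amplitudeError (P (x (n + N))) R c C
          = C * freqWeight (P (x (n + N))) * R / (c * |Real.sin α|) *
              (layerScale (P (x (n + N))))⁻¹ := by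
            rw [amplitudeError]
            change _ / (c * |Real.sin α|) = _
            ring
        _ ≤ _ := by gcongr
  · have h0 : Tendsto (fun n => C * M * R ^ 2 / |Real.sin α| * (layerScale (P (x (n + N))))⁻¹)
        atTop (𝓝 0) := by
      simpa using (tendsto_inv_atTop_zero.comp hLn).const_mul (C * M * R ^ 2 / |Real.sin α|)
    refine squeeze_zero (fun n => ?_) (fun n => ?_) h0
    · have := hW1 n
      have := hL0 n
      rw [rootError]
      positivity
    · have := hW n
      have := hL0 n
      calc rootError (P (x (n + N))) R C
          = C * freqWeight (P (x (n + N))) * R ^ 2 / |Real.sin α| *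
              (layerScale (P (x (n + N))))⁻¹ := by
            rw [rootError]
            change _ / |Real.sin α| = _
            ring
        _ ≤ _ := by gcongr

end PowerLaws

end

end QG3D

theorem proposition3p3 (α : ℝ) (hα : α ∈ Ioo (-(Real.pi / 2)) 0) :
    -- Green function solution, estimates, and decaying solutions
    (∀ K : ℝ, 0 < K → ∃ κ : ℝ, 0 < κ ∧ ∃ C : ℝ, 0 < C ∧
      ∀ (P : QG3D.Params) (R : ℝ), P.α = α → 0 < P.β → 0 < P.νh → 0 < P.ν3 → 0 < R →
        QG3D.Regime K κ P R →
      ∀ (S : QG3D.E3 → ℂ) (Shat : QG3D.Freq → ℝ → ℂ),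
        QG3D.IsTangFourier α S Shat → QG3D.MemL2L1 Shat → QG3D.BandLimited R Shat →
        (∀ᵐ ξ : QG3D.Freq, ∀ z : ℝ, 0 ≤ z →
          IntegrableOn (fun z' => QG3D.greenHat P ξ (z - z') * Shat ξ z') (Ioi 0)) ∧
        QG3D.MemL2C0 (QG3D.psiHat P Shat) ∧
        (∀ᵐ ξ : QG3D.Freq, ContinuousOn (QG3D.psiHat P Shat ξ) (Ici 0)) ∧
        QG3D.SolvesQG P (QG3D.tangInv α (QG3D.psiHat P Shat)) S ∧
        (∀ σ : ℝ, 0 ≤ σ →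
          QG3D.tangNorm σ ∞ (QG3D.psiHat P Shat) ≤
            ENNReal.ofReal (C / P.β) * QG3D.tangNorm σ 1 Shat) ∧
        (∀ (ψ : QG3D.E3 → ℂ) (ψhat : QG3D.Freq → ℝ → ℂ),
          QG3D.IsTangFourier α ψ ψhat → QG3D.MemL2C10 ψhat → QG3D.BandLimited R ψhat →
          QG3D.SolvesQG P ψ S →
          ∃ c : Fin 2 → QG3D.Freq → ℂ, (∀ j, MemLp (c j) 2 volume) ∧
            ∀ᵐ ξ : QG3D.Freq, ∀ z : ℝ, 0 < z →
              ψhat ξ z = QG3D.psiHat P Shat ξ z +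
                ∑ j : Fin 2, c j ξ * Complex.exp (-QG3D.rootPos P ξ j * z))) ∧
    -- convergence to the Sverdrup solution
    (∀ a b d e : ℝ, 0 < a → a < 1 → 0 ≤ d → d ≤ e → b ≤ (2 * a - d) / 3 →
      ∀ (R : ℝ), 0 < R → ∀ (S : QG3D.E3 → ℂ) (Shat : QG3D.Freq → ℝ → ℂ),
        QG3D.IsTangFourier α S Shat → QG3D.MemL2L1 Shat → QG3D.BandLimited R Shat →
        (∀ ε : ℝ, 0 < ε → ∃ (ψ : QG3D.E3 → ℂ) (ψhat : QG3D.Freq → ℝ → ℂ),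
          QG3D.IsSverdrup (QG3D.powerParams α a b d e ε) S ψ ψhat) ∧
        ∀ (ψbar : ℝ → QG3D.E3 → ℂ) (ψbarhat : ℝ → QG3D.Freq → ℝ → ℂ),
          (∀ ε : ℝ, 0 < ε →
            QG3D.IsSverdrup (QG3D.powerParams α a b d e ε) S (ψbar ε) (ψbarhat ε)) →
          ∀ σ : ℝ, 0 ≤ σ →
            Tendsto (fun ε : ℝ => QG3D.tangNorm σ ∞ (fun ξ z =>
                ((QG3D.powerParams α a b d e ε).β : ℂ) *
                  (QG3D.psiHat (QG3D.powerParams α a b d e ε) Shat ξ z - ψbarhat ε ξ z)))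
              (𝓝[>] 0) (𝓝 0)) := by
  have hs : Real.sin α ≠ 0 :=
    (Real.sin_neg_of_neg_of_neg_pi_lt hα.2 (by linarith [hα.1, Real.pi_pos])).ne
  have hcos : 0 < Real.cos α := Real.cos_pos_of_mem_Ioo ⟨hα.1, by linarith [hα.2, Real.pi_pos]⟩
  refine ⟨fun K hK => ?_, fun a b d e ha _ hd hde hb R hR S Shat hS hv hvR => ⟨fun ε hε => ?_, ?_⟩⟩
  · obtain ⟨κ', C, c, hκ', -, hc, hroots⟩ := QG3D.exists_isRootFamily hα
    obtain ⟨κ, hκ, hscale⟩ := QG3D.exists_scale_le_of_regime hK hκ'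
    refine ⟨κ, hκ, 4 / c, by positivity, ?_⟩
    rintro P R rfl hβ hh h3 hR hreg S Shat hS hv hvR
    have hν := QG3D.νeff_pos hh h3
    obtain ⟨μ, hμ⟩ := hroots P rfl hβ hh h3 R hR (hscale P R hβ hν hR hreg)
    have hK' := hμ.isGoodKernel hc hβ hν
    have hp := hμ.ae_psiHat_eq hc hβ hν hs hvR
    refine ⟨?_, hK'.memL2C0 hv hvR hp, ?_, hμ.solvesQG hc hβ hν hs hcos hv hvR hS,
      fun σ _ => hK'.tangNorm_le hv hvR hp σ, fun ψ ψhat hψ hu huR hsol =>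
        hμ.ae_decaying_solution hR hc hβ hν hs hcos hv hvR hS hψ hu.1 huR hsol⟩
    · filter_upwards [hμ.ae_integrableOn_greenHat hc hβ hν hs hv hvR] with ξ hξ z _ using hξ z
    · filter_upwards [hK'.ae_continuous hv hvR hp] with ξ hξ using hξ.1.continuousOn
  · exact ⟨_, _, QG3D.isSverdrup_sverdrupHat (P := QG3D.powerParams α a b d e ε)
      (Real.rpow_pos_of_pos hε _) hs hcos hv hvR hS⟩
  · intro ψbar ψbarhat hu σ hσ
    exact QG3D.tendsto_tangNorm_sub_sverdrup_powerParams hα ha hd hde hb hR hv hvR hS hu hσ
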